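/- **Conventions.** For a quasi-coherent module $\mathcal F$ on a scheme $T$ put $\mathbb V(\mathcal F)=\mathrm{Spec}(\mathrm{Sym}\,\mathcal F)$, the $T$-group scheme representing $T'\mapsto \mathrm{Hom}_{\mathcal O_T}(\mathcal F,t_*\mathcal O_{T'})$ for $t\colon T'\to T$, with its addition. For a closed immersion $i\colon Z\hookrightarrow X$ with ideal sheaf $\mathcal I$, $\mathcal C_{Z/X}=i^*\mathcal I=\mathcal I/\mathcal I^2$ is the conormal sheaf; $i$ is *regular* if $\mathcal I$ is locally generated by a regular sequence. A sequence $1\to A\to B\to C\to 1$ of group schemes is *exact* if $A\to B$ is the kernel of $B\to C$ and $B\to C$ is faithfully flat and locally of finite presentation. For closed subschemes $Z=V(\mathcal I)\subset D=V(\mathcal J)\subset X$ with $\mathcal J$ locally principal, the *dilatation* of $X$ in $Z$ along $D$ is the relative spectrum over $X$ of the affine blowup algebra, which over an affine open $\mathrm{Spec}\,B$ with $I=\mathcal I(\mathrm{Spec}\,B)$ and $\mathcal J(\mathrm{Spec}\,B)=(b)$ is the $B$-subalgebra $B[I/b]$ of $B[b^{-1}]$ generated by the fractions $x/b$, $x\in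 I$. **Setting.** Let $S$ be a scheme, $j\colon S_0\hookrightarrow S$ an effective Cartier divisor (a closed subscheme locally defined by one non-zero-divisor), $G\to S$ a group scheme and $G_0=G\times_S S_0$. For a closed $S_0$-subgroup scheme $H\subset G_0$ let $\pi\colon\mathcal G\to G$ be the dilatation of $G$ in $H$ along $G_0$, and $\mathcal G_0=\mathcal G\times_S S_0$. Let $\mathcal J$ be the ideal sheaf of $G_0$ in $G$, $\mathcal J_H$ its pullback to $H$, and $e_0\colon S_0\to H$ the unit section. **Theorem.** Assume that $G\to S$ is flat and locally of finite presentation, that $H\to S_0$ is flat and that $H\hookrightarrow G_0$ is a regular immersion. The dilatation exists, and $\mathcal G\to S$ carries a unique structure of $S$-group scheme for which $\pi$ is a homomorphism. The morphism $\mathcal G_0\to G_0$ factors through a homomorphism $q\colon \mathcal G_0\to H$. Let $V=\mathbb V\big(e_0^*(\mathcal C_{H/G_0}\otimes\mathcal J_H^{-1})\big)$, the restriction along $e_0$ of the vector bundle $\mathbb V(\mathcal C_{H/G_0}\otimes\mathcal J_H^{-1})\to H$. 1. Locally over $S_0$ there is an exact sequence of group schemes $1\to V\to\mathcal G_0\xrightarrow{\,q\,}H\to1$;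 that is, $S_0$ has an open cover by sets $U$ over which there is a homomorphism $V|_U\to\mathcal G_0|_U$ making $1\to V|_U\to\mathcal G_0|_U\to H|_U\to1$ exact. 2. Suppose that $H$ lifts to a flat $S$-subgroup scheme of $G$, i.e. that there is an $S$-group scheme $H'$, flat over $S$, with a homomorphism $h\colon H'\to G$ that is an immersion and with $H'\times_S S_0= H$ as subschemes of $G_0$. Then there is globally over $S_0$ an exact sequence $1\to V\to\mathcal G_0\xrightarrow{\,q\,}H\to1$, canonically split. Here $V\to\mathcal G_0$ is the canonical inclusion: if $x$ is a local function on $G$ vanishing on $H'$ and $\beta$ is a local section of $\mathcal J$ generating $\mathcal J_H$, then the function $x/\beta$ on $\mathcal G$ pulls back to the linear function $e_0^*([x]\otimes\beta^{-1})$ on $V$. The splitting is the restriction $H\to\mathcal G_0$ to $S_0$ of the unique morphism $\sigma\colon H'\to\mathcal G$ with $\pi\circ\sigma=h$, and $\sigma$ is a homomorphism. 3. Assume now only that $G\to S$ is smooth and separated, and take for $H$ the unit section of $G_0$, so that $\mathcal G\to G$ is the dilatation of the unit section. Again $\mathcal G$ exists and has a unique $S$-group scheme structure for which $\pi$ is a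 homomorphism. Let $\mathrm{Lie}(G_0/S_0)=\mathbb V(e_0^*\Omega^1_{G_0/S_0})$, where $e_0$ is now the unit section of $G_0$, and let $\mathcal N_{S_0/S}$ be the normal bundle of $S_0$ in $S$, so that $\mathrm{Lie}(G_0/S_0)\otimes\mathcal N_{S_0/S}^{-1}=\mathbb V\big(e_0^*\Omega^1_{G_0/S_0}\otimes\mathcal C_{S_0/S}^{-1}\big)$. There is a canonical isomorphism of smooth $S_0$-group schemes $$\mathcal G_0\;\cong\;\mathrm{Lie}(G_0/S_0)\otimes\mathcal N_{S_0/S}^{-1}.$$ Under it, for a local function $x$ on $G$ vanishing on the unit section of $G$ and a local generator $\beta$ of the ideal of $S_0$ in $S$, the linear function $e_0^*(dx)\otimes\beta^{-1}$ corresponds to the restriction of $x/\beta$ to $\mathcal G_0$. -/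

import Mathlib

open CategoryTheory Limits AlgebraicGeometry TopologicalSpace MonoidalCategory
open CartesianMonoidalCategory
open scoped MonObj Obj

universe u

namespace NeronBlowup

noncomputable section

variable {X Y Z : Scheme.{u}}

/-! ### Affine blowup algebras and dilatations -/

/-- The affine blowup algebra `B[I/b]`: the `B`-subalgebra of `B[b⁻¹]` generated by the
fractions `x/b` with `x ∈ I`. -/
def affineBlowupAlgebra {B : Type u} [CommRing B] (I : Ideal B) (b : B) :
    Subalgebra B (Localization.Away b) :=
  Algebra.adjoin B {y | ∃ x ∈ I, algebraMap B (Localization.Away b) x = b • y}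

/-- `π : X' ⟶ X` is the dilatation (affine blowup) of `X` with centre the closed subschemes
`V(I) ⊆ V(J)` with `V(J)` locally principal, i.e. the relative spectrum of the sheaf of affine
blowup algebras: `π` is affine, and over every affine open `U` on which `J` is generated by one
element `b`, the `Γ(X, U)`-algebra of functions on `X'` is `Γ(X, U)[I(U)/b]`.
(Such an isomorphism of `Γ(X, U)`-algebras is unique, so these isomorphisms glue.) -/
structure IsDilatation {X' : Scheme.{u}} (π : X' ⟶ X) (I J : X.IdealSheafData) : Prop where
  isAffineHom : IsAffineHom π
  exists_ringEquiv : ∀ (U : X.affineOpens) (b : Γ(X, U.1)), J.ideal U = Ideal.span {b} →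
    ∃ e : Γ(X', π ⁻¹ᵁ U.1) ≃+* affineBlowupAlgebra (I.ideal U) b,
      ∀ a : Γ(X, U.1), e ((π.app U.1).hom a) = algebraMap _ (affineBlowupAlgebra (I.ideal U) b) a

/-! ### Regular immersions and effective Cartier divisors -/

/-- A closed immersion is an effective Cartier divisor if locally its ideal is generated by
a non-zero-divisor. -/
def IsEffectiveCartier (i : Z ⟶ X) : Prop :=
  ∀ x : X, ∃ U : X.affineOpens, x ∈ U.1 ∧
    ∃ b ∈ nonZeroDivisors Γ(X, U.1), i.ker.ideal U = Ideal.span {b}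

/-- A closed immersion is regular if, around every point of its image, its ideal is generated
by a regular sequence. -/
def IsRegularImmersion (i : Z ⟶ X) : Prop :=
  ∀ z : Z, ∃ U : X.affineOpens, i z ∈ U.1 ∧ ∃ rs : List Γ(X, U.1),
    RingTheory.Sequence.IsRegular Γ(X, U.1) rs ∧ i.ker.ideal U = Ideal.ofList rs

/-! ### Sheaves of modules: ideal sheaves, conormal sheaves, differentials -/

/-- The structure sheaf `𝒪_X`, as an `𝒪_X`-module. -/
def structureSheaf (X : Scheme.{u}) : X.Modules := SheafOfModules.unit X.ringCatSheaf

/-- The comorphism `𝒪_Y ⟶ f_* 𝒪_X` of `f`, as a morphism of `𝒪_Y`-modules. -/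
def sharp (f : X ⟶ Y) :
    structureSheaf Y ⟶ (Scheme.Modules.pushforward f).obj (structureSheaf X) :=
  SheafOfModules.unitToPushforwardObjUnit f.toRingCatSheafHom

/-- The ideal sheaf of a closed immersion, as an `𝒪_X`-module. -/
def idealSheaf (i : Z ⟶ X) : X.Modules := kernel (sharp i)

/-- The function on `U` underlying a section of the ideal sheaf. -/
def toFunction {i : Z ⟶ X} {U : X.Opens} (ξ : Γ(idealSheaf i, U)) : Γ(X, U) :=
  ((kernel.ι (sharp i)).app U).hom ξ

/-- The restriction of a section of a sheaf of modules to a smaller open subset. -/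
def res {M : X.Modules} {U V : X.Opens} (h : V ≤ U) (m : Γ(M, U)) : Γ(M, V) :=
  (M.presheaf.map (homOfLE h).op).hom m

/-- The pullback `f^* m` of a section `m` of a sheaf of modules. -/
def pullbackSection (f : X ⟶ Y) {M : Y.Modules} {U : Y.Opens} (m : Γ(M, U)) :
    Γ((Scheme.Modules.pullback f).obj M, f ⁻¹ᵁ U) :=
  (((Scheme.Modules.pullbackPushforwardAdjunction f).unit.app M).app U).hom m

/-- The conormal sheaf `i^* ℐ = ℐ/ℐ²` of a closed immersion `i` with ideal sheaf `ℐ`. -/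
def conormal (i : Z ⟶ X) : Z.Modules := (Scheme.Modules.pullback i).obj (idealSheaf i)

/-- The sheaf of relative differentials `Ω¹_{X/Y}` of a separated morphism `X ⟶ Y`: the conormal
sheaf of the diagonal. -/
def differentials (f : X ⟶ Y) : X.Modules := conormal (pullback.diagonal f)

/-- `ω = dx`, i.e. `ω` is the class of the function `1 ⊗ x - x ⊗ 1` vanishing on the diagonal. -/
def IsDifferential (f : X ⟶ Y) {W : X.Opens} (x : Γ(X, W)) (ω : Γ(differentials f, W)) : Prop :=
  ∃ (ξ : Γ(idealSheaf (pullback.diagonal f),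
      pullback.fst f f ⁻¹ᵁ W ⊓ pullback.snd f f ⁻¹ᵁ W))
    (h : W ≤ pullback.diagonal f ⁻¹ᵁ (pullback.fst f f ⁻¹ᵁ W ⊓ pullback.snd f f ⁻¹ᵁ W)),
    toFunction ξ = ((pullback.snd f f).appLE W _ inf_le_right).hom x -
      ((pullback.fst f f).appLE W _ inf_le_left).hom x ∧
    ω = res h (pullbackSection (pullback.diagonal f) ξ)

/-! ### Twisting by the dual of a module -/

/-- The sections over `U` of the dual `ℒ^∨ = ℋom(ℒ, 𝒪_X)`: families of linear forms
`ℒ(V) → 𝒪_X(V)`, for `V ⊆ U` open, compatible with restriction. -/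
def dualSections (L : X.Modules) (U : X.Opens) :
    AddSubgroup (∀ V : {V : X.Opens // V ≤ U}, Γ(L, V.1) →ₗ[Γ(X, V.1)] Γ(X, V.1)) where
  carrier := {φ | ∀ (V W : {V : X.Opens // V ≤ U}) (h : W.1 ≤ V.1) (s : Γ(L, V.1)),
    φ W (L.presheaf.map (homOfLE h).op s) = X.presheaf.map (homOfLE h).op (φ V s)}
  zero_mem' := by
    intro V W h s
    simp
  add_mem' := by
    intro φ ψ hφ hψ V W h s
    simp [hφ V W h s, hψ V W h s]
  neg_mem' := by
    intro φ hφ V W h s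
    simp [hφ V W h s]

/-- The pairing of a section of `ℒ^∨` with a section of `ℒ`. -/
def pair {L : X.Modules} {U : X.Opens} (δ : dualSections L U) (s : Γ(L, U)) : Γ(X, U) :=
  δ.1 ⟨U, le_rfl⟩ s

lemma presheaf_map_map {U V W : X.Opens} (h : V ≤ U) (h' : W ≤ V) (r : Γ(X, U)) :
    X.presheaf.map (homOfLE h').op (X.presheaf.map (homOfLE h).op r) =
      X.presheaf.map (homOfLE (h'.trans h)).op r := by
  rw [← ConcreteCategory.comp_apply, ← X.presheaf.map_comp]
  rfl

instance dualSections.module (L : X.Modules) (U : X.Opens) :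
    Module Γ(X, U) (dualSections L U) where
  smul r φ := ⟨fun V ↦ X.presheaf.map (homOfLE V.2).op r • φ.1 V, by
    intro V W h s
    simp [φ.2 V W h s, presheaf_map_map]⟩
  one_smul φ := by
    apply Subtype.ext; funext V
    change X.presheaf.map (homOfLE V.2).op 1 • φ.1 V = φ.1 V
    simp
  mul_smul r s φ := by
    apply Subtype.ext; funext V
    change X.presheaf.map (homOfLE V.2).op (r * s) • φ.1 V =
      X.presheaf.map (homOfLE V.2).op r • X.presheaf.map (homOfLE V.2).op s • φ.1 V
    rw [map_mul, mul_smul]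
  smul_zero r := by
    apply Subtype.ext; funext V
    exact smul_zero _
  smul_add r φ ψ := by
    apply Subtype.ext; funext V
    exact smul_add _ _ _
  add_smul r s φ := by
    apply Subtype.ext; funext V
    change X.presheaf.map (homOfLE V.2).op (r + s) • φ.1 V =
      X.presheaf.map (homOfLE V.2).op r • φ.1 V + X.presheaf.map (homOfLE V.2).op s • φ.1 V
    rw [map_add, add_smul]
  zero_smul φ := by
    apply Subtype.ext; funext V
    change X.presheaf.map (homOfLE V.2).op 0 • φ.1 V = 0
    rw [map_zero, zero_smul]

/-- Restriction of sections of `ℒ^∨`. -/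
def dualSections.restrict (L : X.Modules) {U V : X.Opens} (h : V ≤ U) :
    dualSections L U →+ dualSections L V where
  toFun φ := ⟨fun W ↦ φ.1 ⟨W.1, W.2.trans h⟩, fun W W' h' s ↦ φ.2 ⟨W.1, _⟩ ⟨W'.1, _⟩ h' s⟩
  map_zero' := rfl
  map_add' _ _ := rfl

lemma dualSections.restrict_smul (L : X.Modules) {U V : X.Opens} (h : V ≤ U) (r : Γ(X, U))
    (φ : dualSections L U) :
    restrict L h (r • φ) = X.presheaf.map (homOfLE h).op r • restrict L h φ := by
  apply Subtype.ext; funext W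
  change X.presheaf.map (homOfLE (W.2.trans h)).op r • φ.1 ⟨W.1, _⟩ =
    X.presheaf.map (homOfLE W.2).op (X.presheaf.map (homOfLE h).op r) • φ.1 ⟨W.1, _⟩
  rw [presheaf_map_map]

/-- The dual `ℒ^∨`. -/
def dualPresheaf (L : X.Modules) :
    PresheafOfModules.{u} (X.presheaf ⋙ forget₂ CommRingCat RingCat) where
  obj U := ModuleCat.of Γ(X, U.unop) (dualSections L U.unop)
  map {_ V} f := ModuleCat.ofHom
    (Y := (ModuleCat.restrictScalars (X.presheaf.map f).hom).obj
      (ModuleCat.of Γ(X, V.unop) (dualSections L V.unop)))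
    { toFun := dualSections.restrict L f.unop.le
      map_add' := map_add _
      map_smul' := fun r φ ↦ dualSections.restrict_smul L f.unop.le r φ }
  map_id _ := rfl
  map_comp _ _ := rfl

/-- The presheaf `U ↦ ℳ(U) ⊗ ℒ^∨(U)`. -/
def tensorDualPresheaf (M L : X.Modules) :
    PresheafOfModules.{u} (X.presheaf ⋙ forget₂ CommRingCat RingCat) :=
  PresheafOfModules.Monoidal.tensorObj (R := X.presheaf) M.val (dualPresheaf L)

/-- The `𝒪_X`-module `ℳ ⊗ ℒ^∨`, the sheaf associated with `U ↦ ℳ(U) ⊗ ℒ^∨(U)`. For an invertible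
module `ℒ` this is the twist `ℳ ⊗ ℒ⁻¹`. -/
def tensorDual (M L : X.Modules) : X.Modules :=
  (PresheafOfModules.sheafification (𝟙 X.ringCatSheaf.obj)).obj (tensorDualPresheaf M L)

/-- The section `m ⊗ δ` of `ℳ ⊗ ℒ^∨`. -/
def tmul {M L : X.Modules} {U : X.Opens} (m : Γ(M, U)) (δ : dualSections L U) :
    Γ(tensorDual M L, U) :=
  ((CategoryTheory.toSheafify (Opens.grothendieckTopology X)
    (tensorDualPresheaf M L).presheaf).app (.op U)).hom
      (show (tensorDualPresheaf M L).presheaf.obj (.op U) from TensorProduct.tmul Γ(X, U) m δ)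

/-! ### The group schemes `𝕍(ℱ)` -/

variable {S : Scheme.{u}}

/-- For an `S`-morphism `f : T ⟶ V`, the `𝒪_S`-linear map `v_* 𝒪_V ⟶ t_* 𝒪_T`, `a ↦ a ∘ f`, where
`v`, `t` are the structure morphisms. -/
def pushStructure {T V : Over S} (f : T ⟶ V) :
    (Scheme.Modules.pushforward V.hom).obj (structureSheaf V.left) ⟶
      (Scheme.Modules.pushforward T.hom).obj (structureSheaf T.left) :=
  (Scheme.Modules.pushforward V.hom).map (sharp f.left) ≫
    (Scheme.Modules.pushforwardComp f.left V.hom).hom.app _ ≫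
      (Scheme.Modules.pushforwardCongr (Over.w f)).hom.app _

/-- The `S`-group scheme `V` is `𝕍(ℱ) = Spec Sym ℱ`, with universal linear map
`u : ℱ ⟶ v_* 𝒪_V`: it represents the functor `T ↦ Hom_{𝒪_S}(ℱ, t_* 𝒪_T)` with its addition. -/
structure IsVectorGroup (F : S.Modules) (V : Over S) [GrpObj V]
    (u : F ⟶ (Scheme.Modules.pushforward V.hom).obj (structureSheaf V.left)) : Prop where
  bijective : ∀ T : Over S, Function.Bijective fun f : T ⟶ V ↦ u ≫ pushStructure f
  add : ∀ (T : Over S) (f g : T ⟶ V),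
    u ≫ pushStructure (f * g) = u ≫ pushStructure f + u ≫ pushStructure g

/-- `1 ⟶ A ⟶ B ⟶ C ⟶ 1` is an exact sequence of `S`-group schemes: `f` is the kernel of `g`, and
`g` is faithfully flat and locally of finite presentation (an fppf covering). -/
structure IsShortExact {A B C : Over S} [GrpObj A] [GrpObj B] [GrpObj C]
    (f : A ⟶ B) (g : B ⟶ C) : Prop where
  isMonHom_left : IsMonHom f
  isMonHom_right : IsMonHom g
  isPullback : IsPullback f (toUnit A) g η[C]
  flat : Flat g.left
  surjective : Surjective g.left
  locallyOfFinitePresentation : LocallyOfFinitePresentation g.left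

/-! ### Néron blowups -/

section Neron

variable {S₀ : Scheme.{u}} (j : S₀ ⟶ S) (G : Over S)

/-- The restriction `G₀ = G ×_S S₀`. -/
abbrev special : Over S₀ := (Over.pullback j).obj G

/-- The projection `G₀ ⟶ G`. -/
abbrev proj : (special j G).left ⟶ G.left := pullback.fst G.hom j

variable {G} {H : Over S₀} (i : H ⟶ special j G)

/-- `π : 𝒢 ⟶ G` is the Néron blowup of `G` in `H ⊆ G₀` along `S₀`: the dilatation of `G` with
centre `H ⊆ G₀`. -/
def IsNeronBlowup {G' : Scheme.{u}} (π : G' ⟶ G.left) : Prop :=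
  IsDilatation π (i.left ≫ proj j G).ker (proj j G).ker

/-- The restriction `𝒥_H` to `H` of the ideal sheaf `𝒥` of `G₀` in `G`. -/
def restrictedIdeal : H.left.Modules :=
  (Scheme.Modules.pullback (i.left ≫ proj j G)).obj (idealSheaf (proj j G))

/-- The `𝒪_{S₀}`-module `e₀^*(𝒞_{H/G₀} ⊗ 𝒥_H⁻¹)`, where `e₀` is the unit section of `H`. -/
def twistedConormal [GrpObj H] : S₀.Modules :=
  (Scheme.Modules.pullback η[H].left).obj (tensorDual (conormal i.left) (restrictedIdeal j i))

/-- Let `H' ⟶ G` be a lift of `H` and `V = 𝕍(e₀^*(𝒞_{H/G₀} ⊗ 𝒥_H⁻¹))`, with universal linear map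
`u`. The morphism `f : V ⟶ 𝒢₀` is the canonical one: if `x` is a function on an open `W ⊆ G`
vanishing on `H'`, if `β` is a section of `𝒥` over `W` whose restriction to `H` has a dual
generator `δ`, and if `y = x/β` on `𝒢`, then `y` pulls back to `V` as the linear function
`e₀^*([x] ⊗ δ)`. -/
def IsCanonicalInclusion [GrpObj H] {G' : Scheme.{u}} (π : G' ⟶ G.left) {V : Over S₀}
    (u : twistedConormal j i ⟶ (Scheme.Modules.pushforward V.hom).obj (structureSheaf V.left))
    (f : V ⟶ special j (Over.mk (π ≫ G.hom))) {H' : Over S} (h : H' ⟶ G) : Prop :=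
  ∀ (W : G.left.Opens) (x : Γ(G.left, W)), (h.left.app W).hom x = 0 →
  ∀ ξ : Γ(idealSheaf i.left, proj j G ⁻¹ᵁ W), toFunction ξ = ((proj j G).app W).hom x →
  ∀ (β : Γ(idealSheaf (proj j G), W))
    (δ : dualSections (restrictedIdeal j i) (i.left ⁻¹ᵁ (proj j G ⁻¹ᵁ W))),
    pair δ (pullbackSection (i.left ≫ proj j G) β) = 1 →
  ∀ y : Γ(G', π ⁻¹ᵁ W), (π.app W).hom x = (π.app W).hom (toFunction β) * y →
  ∀ (O : V.left.Opens)
    (h₁ : O ≤ (f.left ≫ proj j (Over.mk (π ≫ G.hom))) ⁻¹ᵁ (π ⁻¹ᵁ W))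
    (h₂ : O ≤ V.hom ⁻¹ᵁ (η[H].left ⁻¹ᵁ (i.left ⁻¹ᵁ (proj j G ⁻¹ᵁ W)))),
    ((f.left ≫ proj j (Over.mk (π ≫ G.hom))).appLE (π ⁻¹ᵁ W) O h₁).hom y =
      res (M := structureSheaf V.left) h₂ ((u.app _).hom
        (pullbackSection η[H].left (tmul (pullbackSection i.left ξ) δ)))

variable (G) in
/-- The `𝒪_{S₀}`-module `e₀^* Ω¹_{G₀/S₀} ⊗ 𝒞_{S₀/S}⁻¹`, where `e₀` is the unit section of `G₀`;
the associated vector bundle is `Lie(G₀/S₀) ⊗ 𝒩_{S₀/S}⁻¹`. -/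
def twistedCotangent [GrpObj G] : S₀.Modules :=
  tensorDual ((Scheme.Modules.pullback η[special j G].left).obj
    (differentials (special j G).hom)) (conormal j)

/-- Let `π : 𝒢 ⟶ G` be the dilatation of the unit section. The linear map
`w : e₀^* Ω¹_{G₀/S₀} ⊗ 𝒞_{S₀/S}⁻¹ ⟶ p_* 𝒪_{𝒢₀}`, with `p : 𝒢₀ ⟶ S₀`, is the canonical one: if `x`
is a function on an open `W ⊆ G` vanishing on the unit section, if `β` is a section of the ideal
sheaf of `S₀ ⊆ S` whose class has a dual generator `δ`, and if `y = x/β` on `𝒢`, then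
`w(e₀^*(dx) ⊗ δ)` is the restriction of `y`. -/
def IsCanonicalLieMap [GrpObj G] {G' : Scheme.{u}} (π : G' ⟶ G.left)
    (w : twistedCotangent j G ⟶
      (Scheme.Modules.pushforward (special j (Over.mk (π ≫ G.hom))).hom).obj
        (structureSheaf (special j (Over.mk (π ≫ G.hom))).left)) : Prop :=
  ∀ (W : G.left.Opens) (x : Γ(G.left, W)), (η[G].left.app W).hom x = 0 →
  ∀ ω : Γ(differentials (special j G).hom, proj j G ⁻¹ᵁ W),
    IsDifferential (special j G).hom (((proj j G).app W).hom x) ω →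
  ∀ (U : S.Opens) (β : Γ(idealSheaf j, U)) (U₀ : S₀.Opens) (h : U₀ ≤ j ⁻¹ᵁ U)
    (h' : U₀ ≤ η[special j G].left ⁻¹ᵁ (proj j G ⁻¹ᵁ W)) (δ : dualSections (conormal j) U₀),
    pair δ (res h (pullbackSection j β)) = 1 →
  ∀ (hW : W ≤ G.hom ⁻¹ᵁ U) (y : Γ(G', π ⁻¹ᵁ W)),
    (π.app W).hom x = (π.app W).hom ((G.hom.appLE U W hW).hom (toFunction β)) * y →
  ∀ (O : (special j (Over.mk (π ≫ G.hom))).left.Opens)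
    (h₁ : O ≤ proj j (Over.mk (π ≫ G.hom)) ⁻¹ᵁ (π ⁻¹ᵁ W))
    (h₂ : O ≤ (special j (Over.mk (π ≫ G.hom))).hom ⁻¹ᵁ U₀),
    ((proj j (Over.mk (π ≫ G.hom))).appLE (π ⁻¹ᵁ W) O h₁).hom y =
      res (M := structureSheaf _) h₂ ((w.app U₀).hom
        (tmul (res h' (pullbackSection η[special j G].left ω)) δ))

end Neron

end

end NeronBlowup

namespace NeronBlowup

noncomputable section

/-! ### A local criterion of flatness along a non-zero-divisor -/

/-! Let `b` be a local equation of `S₀`. Near a point of `H`, a regular sequence cutting out `H` in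
`G₀` lifts to functions `g₁, …, gₙ` on `G` that are regular modulo `b`, and the centre has ideal `I
= (b, g₁, …, gₙ)`. Then `B[I/b] = B[X₁, …, Xₙ]/(bXₖ - gₖ)`: modulo `b` the relations become `-gₖ`,
so `b` is a non-zero-divisor modulo the relations (`mem_blowupRelations_of_mul_mem`) and inverting
it loses nothing. Reducing modulo `b` gives `B[I/b]/b = (B/I)[X₁, …, Xₙ]`
(`IsBlowup.bijective_eval₂Hom`), so `q : 𝒢₀ → H` is locally the projection of an affine space; in
particular it is flat, surjective and of finite presentation. As `𝒢₀` is flat over `H`, hence over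
`S₀`, and `𝒢` agrees with `G` where `b` is invertible, a local criterion along `b` shows that `𝒢` is
flat over `S`.

On a flat `S`-scheme `b` stays a non-zero-divisor, so morphisms to `𝒢` are the morphisms to `G`
whose restriction to `S₀` factors through `H` (`IsDilatation.hom_ext`, `IsDilatation.exists_lift`).
Since `𝒢` and its powers are flat over `S`, the group law of `G` lifts uniquely, and so does a flat
subgroup scheme `H'` lifting `H`.

A point of the kernel of `q` over `T → S₀` is a point `κ` of `𝒢` over the unit section of `G`. Let
`κ₀` be the unit point. For `x ∈ I` the difference `κ(x/b) - κ₀(x/b)` is linear in `x`, vanishes on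
the multiples of `b` (for which `x/b` is a function on `G`) and is divided by `u` when `b` is
multiplied by a unit `u`. It is therefore a linear form on `e₀^*(𝒞 ⊗ 𝒥_H⁻¹)`, and by the
presentation above every such form comes from exactly one `κ` (`TwistedForm.ofPair_injective`,
`TwistedForm.exists_ofPair_eq`). The bijection is additive: as `H` is a subgroup, `μ^*I ⊆ pr₁^*I +
pr₂^*I` (`comap_mul_le`), so `μ^*x/b` is a combination of quotients `pr₁^*ξ/b` and `pr₂^*ξ/b` with
coefficients from `G × G`. Such a function `F` satisfies `F(κ, λ) + F(1, 1) = F(κ, 1) + F(1, λ)` on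
points above `(1, 1)` (`quot_additive`).

Comparison with the unit point needs no choice of coordinates, so the kernel is `V` over all of `S₀`
and the exact sequence exists globally without a lift of `H`; the local statement is its
restriction. A lift `H'` contributes the splitting, and the vanishing of `κ₀(x/b)` for `x` vanishing
on `H'`, whence the formula for the inclusion in terms of `x/β` alone.

For the unit section of a smooth separated group, the centre is a regular immersion
(`isRegularImmersion_of_section`) and a trivial group, so the kernel is all of `𝒢₀`. Forms on
`e₀^*Ω¹` are identified with forms on the functions vanishing on the unit section by `x ↦ 1 ⊗ x - x
⊗ 1` (`LinForm.diff_injective`, `LinForm.diff_surjective`).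

Modules enter only through their linear forms with values in functions (`LinForm`). A form on `M ⊗
L^∨` is an `L^∨`-linear family of forms on `M` (`DualFamily`); `TwistedForm` is its description on
charts. `FormModel` abstracts the passage from a module to such families, so that the kernel is
computed once for both the conormal and the cotangent module. -/

/-- The equational criterion of flatness, for systems of equations. -/
lemma exists_factorization_of_sum_smul_eq_zero {A M : Type*} [CommRing A] [AddCommGroup M]
    [Module A M] [Module.Flat A M] {l k : ℕ} (v : Fin l → Fin k → A) (p : Fin k → M)
    (h : ∀ i, ∑ j, v i j • p j = 0) :
    ∃ (n : ℕ) (w : Fin k → Fin n → A) (q : Fin n → M),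
      (∀ j, p j = ∑ t, w j t • q t) ∧ ∀ i t, ∑ j, v i j * w j t = 0 := by
  obtain ⟨n, a, y, hy, ha⟩ := Module.Flat.exists_factorization_of_comp_eq_zero_of_free
    (f := Fintype.linearCombination A v) (x := Fintype.linearCombination A p) (by
      ext i
      simpa [Fintype.linearCombination_apply] using h i)
  refine ⟨n, fun j t ↦ a (Pi.single j 1) t, fun t ↦ y (Finsupp.single t 1), fun j ↦ ?_,
    fun i t ↦ ?_⟩
  · have := LinearMap.congr_fun hy (Pi.single j 1)
    simp only [Fintype.linearCombination_apply_single, one_smul, LinearMap.comp_apply] at this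
    rw [this]
    conv_lhs => rw [← Finsupp.univ_sum_single (a (Pi.single j 1))]
    rw [map_sum]
    refine Finset.sum_congr rfl fun t _ ↦ ?_
    rw [← map_smul, Finsupp.smul_single, smul_eq_mul, mul_one]
  · have := LinearMap.congr_fun ha (Pi.single i 1)
    simp only [LinearMap.comp_apply, Fintype.linearCombination_apply_single, one_smul,
      LinearMap.zero_apply] at this
    have h2 : v i = ∑ j, v i j • (Pi.single j 1 : Fin k → A) := by
      ext j; simp [Finset.sum_apply, Pi.single_apply]
    rw [h2, map_sum] at this
    have := DFunLike.congr_fun this t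
    simpa [Finsupp.finsetSum_apply] using this

/-- A module is flat if it is flat modulo a non-zero-divisor `b` and after inverting `b`. -/
theorem flat_of_flat_mod_of_flat_localization {A A₀ M M₀ N : Type*} [CommRing A] [CommRing A₀]
    [AddCommGroup M] [Module A M] [AddCommGroup M₀] [Module A₀ M₀] [AddCommGroup N] [Module A N]
    [Module.Flat A₀ M₀] [Module.Flat A N] {b : A} (hb : ∀ a, b * a = 0 → a = 0)
    (hbM : ∀ m : M, b • m = 0 → m = 0)
    (πA : A →+* A₀) (hπA : Function.Surjective πA) (hkA : ∀ a, πA a = 0 ↔ b ∣ a)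
    (πM : M →+ M₀) (hπM : Function.Surjective πM) (hs : ∀ a m, πM (a • m) = πA a • πM m)
    (hkM : ∀ m, πM m = 0 → ∃ m', m = b • m')
    (f : M →ₗ[A] N) (hf : Function.Injective f) (hfN : ∀ n, ∃ (k : ℕ) (m : M), b ^ k • n = f m) :
    Module.Flat A M := by
  refine Module.Flat.of_forall_isTrivialRelation fun {l a x} hx ↦ ?_
  -- `T m` says that the relation `∑ aᵢ mᵢ = 0` is trivial. Flatness of `N` gives `T (b ^ k • x)`
  -- for some `k`; the claim `key` cancels one factor `b` at a time.
  set T : (Fin l → M) → Prop := fun m ↦ ∃ (k : ℕ) (v : Fin l → Fin k → A) (p : Fin k → M),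
    (∀ i, m i = ∑ j, v i j • p j) ∧ ∀ j, ∑ i, a i * v i j = 0 with hT
  have key : ∀ m, T (b • m) → T m := by
    rintro m ⟨k, v, p, hm, hv⟩
    -- Modulo `b` the vectors `∑ⱼ vᵢⱼ pⱼ = b mᵢ` vanish. Flatness modulo `b` gives `p = w q + b r`
    -- with `v w = b c`, and division by `b` yields `m = c q + v r`, where `c` and `v` are both
    -- annihilated by `a`.
    obtain ⟨n, w, q, hp, hw⟩ := exists_factorization_of_sum_smul_eq_zero
      (fun i j ↦ πA (v i j)) (fun j ↦ πM (p j)) (fun i ↦ by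
        have := congrArg πM (hm i)
        rw [map_sum, Pi.smul_apply, hs, (hkA b).2 dvd_rfl, zero_smul] at this
        simpa [hs] using this.symm)
    choose w' hw' using fun j t ↦ hπA (w j t)
    choose q' hq' using fun t ↦ hπM (q t)
    have h1 : ∀ j, ∃ r, p j = ∑ t, w' j t • q' t + b • r := fun j ↦ by
      obtain ⟨r, hr⟩ := hkM (p j - ∑ t, w' j t • q' t) (by
        rw [map_sub, map_sum, sub_eq_zero, hp j]
        exact Finset.sum_congr rfl fun t _ ↦ by rw [hs, hw', hq'])
      exact ⟨r, by rw [← hr]; abel⟩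
    choose r hr using h1
    have h2 : ∀ i t, ∃ c, ∑ j, v i j * w' j t = b * c := fun i t ↦ by
      refine (hkA _).1 ?_
      rw [map_sum, ← hw i t]
      exact Finset.sum_congr rfl fun j _ ↦ by rw [map_mul, hw']
    choose c hc using h2
    refine ⟨n + k, fun i ↦ Fin.append (c i) (v i), Fin.append q' r, fun i ↦ ?_, fun j ↦ ?_⟩
    · rw [← sub_eq_zero]
      refine hbM _ ?_
      rw [smul_sub, sub_eq_zero, ← Pi.smul_apply, hm i, Fin.sum_univ_add]
      simp only [Fin.append_left, Fin.append_right]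
      simp_rw [smul_add, Finset.smul_sum, smul_smul, ← hc, Finset.sum_smul]
      rw [Finset.sum_comm, ← Finset.sum_add_distrib]
      refine Finset.sum_congr rfl fun j _ ↦ ?_
      rw [hr j, smul_add, Finset.smul_sum, smul_smul, mul_comm b]
      simp_rw [smul_smul]
    · induction j using Fin.addCases with
      | left t =>
        simp only [Fin.append_left]
        refine hb _ ?_
        rw [Finset.mul_sum]
        calc _ = ∑ i, ∑ j, a i * v i j * w' j t := Finset.sum_congr rfl fun i _ ↦ by
              rw [mul_left_comm, ← hc, Finset.mul_sum]
              exact Finset.sum_congr rfl fun j _ ↦ by ring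
          _ = 0 := by
              rw [Finset.sum_comm]
              simp_rw [← Finset.sum_mul, hv]
              simp
      | right j => simpa only [Fin.append_right] using hv j
  have key' : ∀ (k : ℕ) m, T (b ^ k • m) → T m := by
    intro k
    induction k with
    | zero => intro m h; simpa using h
    | succ k ih => intro m h; exact ih m (key _ (by rwa [smul_smul, ← pow_succ']))
  suffices T x by
    obtain ⟨k, v, p, h1, h2⟩ := this
    exact ⟨k, v, p, h1, h2⟩
  have hx' : ∑ i, a i • f (x i) = 0 := by
    have := congrArg f hx
    simpa using this
  obtain ⟨k, v, n, hn, hv⟩ := Module.Flat.isTrivialRelation_of_sum_smul_eq_zero hx'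
  choose e m hm using fun j ↦ hfN (n j)
  -- The elements `nⱼ` of `N` come from `M` only after multiplication by `b ^ eⱼ`; the exponent `∑
  -- eⱼ` clears all of them at once.
  refine key' (∑ j, e j) x ⟨_, fun i j ↦ b ^ ((∑ j, e j) - e j) * v i j, m, fun i ↦ hf ?_,
    fun j ↦ ?_⟩
  · rw [Pi.smul_apply, map_smul, show f (x i) = _ from hn i, map_sum, Finset.smul_sum]
    refine Finset.sum_congr rfl fun j _ ↦ ?_
    rw [map_smul, ← hm j, smul_smul, smul_smul, mul_right_comm, ← pow_add,
      Nat.sub_add_cancel (Finset.single_le_sum (f := e) (fun _ _ ↦ Nat.zero_le _)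
        (Finset.mem_univ j))]
  · simp_rw [mul_left_comm (a _), ← Finset.mul_sum]
    rw [hv, mul_zero]

/-! ### Regular sequences modulo an ideal and affine blowup algebras -/

/-- The list `gs` is a weakly regular sequence modulo the ideal `K`. -/
def RegularMod {R : Type*} [CommRing R] : Ideal R → List R → Prop
  | _, [] => True
  | K, g :: gs => (∀ a, g * a ∈ K → a ∈ K) ∧ RegularMod (K ⊔ Ideal.span {g}) gs

/-- Half of a permutation of a regular sequence, valid in any ring. If `ba = l + cg` with `l ∈ L`,
then `c = l' + db` because `g` is regular modulo `L + (b)`; hence `b(a - dg) ∈ L` and `a ∈ L + (g)`.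
Iterate over the sequence. -/
lemma mem_of_mul_mem_of_regularMod {R : Type*} [CommRing R] {b : R} (gs : List R) :
    ∀ L : Ideal R, (∀ a, b * a ∈ L → a ∈ L) → RegularMod (L ⊔ Ideal.span {b}) gs →
      ∀ a, b * a ∈ L ⊔ Ideal.ofList gs → a ∈ L ⊔ Ideal.ofList gs := by
  induction gs with
  | nil => intro L hL _ a ha; simpa using hL a (by simpa using ha)
  | cons g gs ih =>
    intro L hL h a ha
    rw [Ideal.ofList_cons, ← sup_assoc] at ha ⊢
    refine ih _ (fun a ha ↦ ?_) ?_ a ha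
    · obtain ⟨l, hl, _, hc, e⟩ := Submodule.mem_sup.1 ha
      obtain ⟨c, rfl⟩ := Ideal.mem_span_singleton'.1 hc
      obtain ⟨l', hl', _, hd, e'⟩ := Submodule.mem_sup.1 (h.1 c (by
        refine Submodule.mem_sup.2 ⟨-l, neg_mem hl, b * a, ?_, by rw [← e]; ring⟩
        exact Ideal.mul_mem_right _ _ (Ideal.mem_span_singleton_self b)))
      obtain ⟨d, rfl⟩ := Ideal.mem_span_singleton'.1 hd
      refine Submodule.mem_sup.2 ⟨a - d * g, hL _ ?_, d * g,
        Ideal.mul_mem_left _ _ (Ideal.mem_span_singleton_self g), by ring⟩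
      have : b * (a - d * g) = l + l' * g := by rw [mul_sub, ← e, ← e']; ring
      rw [this]
      exact add_mem hl (Ideal.mul_mem_right _ _ hl')
    · have := h.2
      rwa [sup_right_comm] at this

/-- Each `f` is `-g` modulo `b ∈ K`, and signs do not affect regularity. It is applied to `f = bXₖ -
gₖ`. -/
lemma RegularMod.congr {R : Type*} [CommRing R] {b : R} {gs fs : List R}
    (hF : List.Forall₂ (fun g f ↦ b ∣ f + g) gs fs) :
    ∀ K : Ideal R, b ∈ K → RegularMod K gs → RegularMod K fs := by
  induction hF with
  | nil => intros; trivial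
  | @cons g f gs fs hgf _ ih =>
    intro K hb h
    obtain ⟨c, hc⟩ := hgf
    have hF' : f = b * c - g := by rw [← hc]; ring
    have hbc : b * c ∈ K := Ideal.mul_mem_right _ _ hb
    refine ⟨fun a ha ↦ h.1 a ?_, ?_⟩
    · rw [hF', sub_mul] at ha
      exact (Submodule.sub_mem_iff_right _ (Ideal.mul_mem_right _ _ hbc)).1 ha
    · have : K ⊔ Ideal.span {f} = K ⊔ Ideal.span {g} := by
        refine le_antisymm (sup_le le_sup_left ?_) (sup_le le_sup_left ?_) <;>
          rw [Ideal.span_singleton_le_iff_mem]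
        · rw [hF']
          exact sub_mem (Ideal.mem_sup_left hbc)
            (Ideal.mem_sup_right (Ideal.mem_span_singleton_self g))
        · obtain rfl : g = b * c - f := by rw [hF']; ring
          exact sub_mem (Ideal.mem_sup_left hbc)
            (Ideal.mem_sup_right (Ideal.mem_span_singleton_self _))
      rw [this]
      exact ih _ (Ideal.mem_sup_left hb) h.2

lemma RegularMod.mvPolynomial {R σ : Type*} [CommRing R] (gs : List R) :
    ∀ K : Ideal R, RegularMod K gs →
      RegularMod (K.map (MvPolynomial.C (σ := σ))) (gs.map MvPolynomial.C) := by
  induction gs with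
  | nil => intros; trivial
  | cons g gs ih =>
    intro K h
    refine ⟨fun a ha ↦ ?_, ?_⟩
    · rw [MvPolynomial.mem_map_C_iff] at ha ⊢
      exact fun m ↦ h.1 _ (by simpa [MvPolynomial.coeff_C_mul] using ha m)
    · have := ih _ h.2
      rwa [Ideal.map_sup, Ideal.map_span, Set.image_singleton] at this

section Presentation

variable {B : Type u} [CommRing B] {b : B} {I : Ideal B} {n : ℕ} {g : Fin n → B}

/-- The generators of the ideal of relations of `B[I/b]`, for `I = (b, g₁, …, gₙ)`. -/
def blowupRelations (b : B) (g : Fin n → B) : Ideal (MvPolynomial (Fin n) B) :=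
  Ideal.ofList (List.ofFn fun k ↦ MvPolynomial.C b * MvPolynomial.X k - MvPolynomial.C (g k))

/-- Modulo `b` the relations `bXₖ - gₖ` become the sequence `-gₖ`, which stays regular over the
polynomial ring; so `b` may be moved behind them. -/
lemma mem_blowupRelations_of_mul_mem (hb : b ∈ nonZeroDivisors B)
    (hg : RegularMod (Ideal.span {b}) (List.ofFn g)) (P : MvPolynomial (Fin n) B)
    (hP : MvPolynomial.C b * P ∈ blowupRelations b g) : P ∈ blowupRelations b g := by
  have h1 := hg.mvPolynomial (σ := Fin n)
  rw [Ideal.map_span, Set.image_singleton, List.map_ofFn] at h1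
  have := mem_of_mul_mem_of_regularMod (b := MvPolynomial.C b)
    (List.ofFn fun k ↦ MvPolynomial.C b * MvPolynomial.X k - MvPolynomial.C (g k)) ⊥
    (fun a ha ↦ ?_) ?_ P (by simpa [blowupRelations] using hP)
  · simpa [blowupRelations] using this
  · rw [Ideal.mem_bot] at ha ⊢
    ext m
    have := congrArg (MvPolynomial.coeff m) ha
    rw [MvPolynomial.coeff_C_mul, MvPolynomial.coeff_zero] at this
    exact (mul_right_mem_nonZeroDivisors_eq_zero_iff hb).1 (by rwa [mul_comm])
  · rw [bot_sup_eq]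
    refine h1.congr ?_ _ (Ideal.mem_span_singleton_self _)
    rw [List.forall₂_iff_get]
    refine ⟨by simp, fun i h h' ↦ ?_⟩
    simp

/-- The relations replace `bXₖ` by `gₖ`, so a power of `b` turns any polynomial into a constant. -/
lemma exists_C_mul_sub_C_mem_blowupRelations (b : B) (g : Fin n → B)
    (P : MvPolynomial (Fin n) B) :
    ∃ (N : ℕ) (c : B), MvPolynomial.C (b ^ N) * P - MvPolynomial.C c ∈ blowupRelations b g := by
  induction P using MvPolynomial.induction_on with
  | C a => exact ⟨0, a, by simp⟩
  | add P Q hP hQ =>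
    obtain ⟨N, c, h⟩ := hP
    obtain ⟨M, d, h'⟩ := hQ
    refine ⟨N + M, b ^ M * c + b ^ N * d, ?_⟩
    have := add_mem (Ideal.mul_mem_left _ (MvPolynomial.C (b ^ M)) h)
      (Ideal.mul_mem_left _ (MvPolynomial.C (b ^ N)) h')
    convert this using 1
    simp only [pow_add, map_mul, map_add]
    ring
  | mul_X P k hP =>
    obtain ⟨N, c, h⟩ := hP
    refine ⟨N + 1, c * g k, ?_⟩
    have h2 : MvPolynomial.C b * MvPolynomial.X k - MvPolynomial.C (g k) ∈
        blowupRelations b g := Ideal.subset_span (by simp)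
    have := add_mem (Ideal.mul_mem_left _ (MvPolynomial.C b * MvPolynomial.X k) h)
      (Ideal.mul_mem_left _ (MvPolynomial.C c) h2)
    convert this using 1
    simp only [pow_succ, map_mul]
    ring

lemma isUnit_algebraMap_away (b : B) : IsUnit (algebraMap B (Localization.Away b) b) :=
  IsLocalization.Away.algebraMap_isUnit b

lemma affineBlowupAlgebra.exists_smul_eq {x : B} (hx : x ∈ I) :
    ∃ y : affineBlowupAlgebra I b, b • y = algebraMap B _ x := by
  obtain ⟨u, hu⟩ := isUnit_algebraMap_away b
  refine ⟨⟨↑u⁻¹ * algebraMap B _ x, Algebra.subset_adjoin ⟨x, hx, ?_⟩⟩, ?_⟩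
  · rw [Algebra.smul_def, ← hu, Units.mul_inv_cancel_left]
  · ext
    change b • ((↑u⁻¹ : Localization.Away b) * algebraMap B _ x) = algebraMap B _ x
    rw [Algebra.smul_def, ← hu, Units.mul_inv_cancel_left]

lemma affineBlowupAlgebra.smul_injective {y z : affineBlowupAlgebra I b} (h : b • y = b • z) :
    y = z := by
  have := congrArg Subtype.val h
  change b • y.1 = b • z.1 at this
  rw [Algebra.smul_def, Algebra.smul_def] at this
  exact Subtype.ext ((isUnit_algebraMap_away b).mul_left_cancel this)

lemma affineBlowupAlgebra.induction {p : affineBlowupAlgebra I b → Prop}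
    (h1 : ∀ a, p (algebraMap B _ a)) (h2 : ∀ x ∈ I, ∀ y, b • y = algebraMap B _ x → p y)
    (h3 : ∀ y z, p y → p z → p (y + z)) (h4 : ∀ y z, p y → p z → p (y * z)) (y) : p y := by
  obtain ⟨y, hy⟩ := y
  induction hy using Algebra.adjoin_induction with
  | mem y hy =>
    obtain ⟨x, hx, e⟩ := hy
    exact h2 x hx _ (Subtype.ext e.symm)
  | algebraMap r => exact h1 r
  | add y z hy hz ihy ihz => exact h3 _ _ ihy ihz
  | mul y z hy hz ihy ihz => exact h4 _ _ ihy ihz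

variable {C : Type*} [CommRing C]

/-- As `φ b` is a non-zero-divisor, `C` embeds in its localization at `φ b`, and the induced map of
localizations sends every `x/b` into the image of `C`. -/
lemma affineBlowupAlgebra.exists_lift (φ : B →+* C) (hφ : ∀ c, φ b * c = 0 → c = 0)
    (h : ∀ x ∈ I, φ b ∣ φ x) :
    ∃ ψ : affineBlowupAlgebra I b →+* C, ∀ a, ψ (algebraMap B _ a) = φ a := by
  have hinj : Function.Injective (algebraMap C (Localization.Away (φ b))) := by
    refine IsLocalization.injective _ (M := Submonoid.powers (φ b)) ?_
    rw [Submonoid.powers_le, mem_nonZeroDivisors_iff_right]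
    exact fun c hc ↦ hφ c (by rwa [mul_comm])
  let F : Localization.Away b →+* Localization.Away (φ b) := IsLocalization.Away.lift b
    (g := (algebraMap C (Localization.Away (φ b))).comp φ) (isUnit_algebraMap_away (φ b))
  have hF : ∀ a, F (algebraMap B _ a) = algebraMap C _ (φ a) := fun a ↦
    IsLocalization.Away.lift_eq _ _ _
  have hr : ∀ y : affineBlowupAlgebra I b,
      F y.1 ∈ (algebraMap C (Localization.Away (φ b))).range := by
    intro y
    induction y using affineBlowupAlgebra.induction with
    | h1 a => exact ⟨φ a, (hF a).symm⟩
    | h2 x hx y hy =>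
      obtain ⟨c, hc⟩ := h x hx
      refine ⟨c, (isUnit_algebraMap_away (φ b)).mul_left_cancel ?_⟩
      rw [← map_mul, ← hc, ← hF, ← hF, ← map_mul]
      have := congrArg Subtype.val hy
      change b • y.1 = algebraMap B _ x at this
      rw [← this, Algebra.smul_def]
    | h3 y z hy hz => exact map_add F y.1 z.1 ▸ add_mem hy hz
    | h4 y z hy hz => exact map_mul F y.1 z.1 ▸ mul_mem hy hz
  let e := RingEquiv.ofBijective (algebraMap C (Localization.Away (φ b))).rangeRestrict
    ⟨fun x y h ↦ hinj (congrArg Subtype.val h), RingHom.rangeRestrict_surjective _⟩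
  refine ⟨e.symm.toRingHom.comp
    ((F.comp (affineBlowupAlgebra I b).val.toRingHom).codRestrict _ hr), fun a ↦ ?_⟩
  change e.symm _ = φ a
  rw [RingEquiv.symm_apply_eq]
  exact Subtype.ext (hF a)

lemma affineBlowupAlgebra.exists_aeval_eq
    (hI : I = Ideal.span {b} ⊔ Ideal.ofList (List.ofFn g))
    (y : Fin n → affineBlowupAlgebra I b) (hy : ∀ k, b • y k = algebraMap B _ (g k)) (z) :
    ∃ P : MvPolynomial (Fin n) B, MvPolynomial.aeval y P = z := by
  change z ∈ (MvPolynomial.aeval y).range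
  induction z using affineBlowupAlgebra.induction with
  | h1 a => exact ⟨MvPolynomial.C a, by simp⟩
  | h3 y z hy hz => exact add_mem hy hz
  | h4 y z hy hz => exact mul_mem hy hz
  | h2 x hx z hz =>
    subst hI
    obtain ⟨_, hc, x', hx', rfl⟩ := Submodule.mem_sup.1 hx
    obtain ⟨c, rfl⟩ := Ideal.mem_span_singleton'.1 hc
    have : ∃ w ∈ (MvPolynomial.aeval (R := B) y).range, b • w = algebraMap B _ x' := by
      clear hz hx
      induction hx' using Submodule.span_induction with
      | mem x h =>
        obtain ⟨k, rfl⟩ := List.mem_ofFn.1 h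
        exact ⟨y k, ⟨MvPolynomial.X k, by simp⟩, hy k⟩
      | zero => exact ⟨0, zero_mem _, by simp⟩
      | add x z _ _ hx hz =>
        obtain ⟨w, hw, e⟩ := hx
        obtain ⟨w', hw', e'⟩ := hz
        exact ⟨w + w', add_mem hw hw', by rw [smul_add, e, e', map_add]⟩
      | smul a x _ hx =>
        obtain ⟨w, hw, e⟩ := hx
        exact ⟨a • w, Subalgebra.smul_mem _ hw a, by
          rw [smul_comm, e, smul_eq_mul, map_mul, Algebra.smul_def]⟩
    obtain ⟨w, hw, e⟩ := this
    have : z = algebraMap B _ c + w := by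
      apply affineBlowupAlgebra.smul_injective
      rw [hz, smul_add, e, map_add, Algebra.smul_def, map_mul, mul_comm]
    rw [this]
    exact add_mem (Subalgebra.algebraMap_mem _ c) hw

/-- The presentation `B[X]/(bXₖ - gₖ) = B[I/b]`, used as a mapping property. Unlike
`affineBlowupAlgebra.exists_lift`, it allows `φ b` to be a zero-divisor, in particular zero. -/
lemma affineBlowupAlgebra.exists_lift_of_regularMod (hb : b ∈ nonZeroDivisors B)
    (hg : RegularMod (Ideal.span {b}) (List.ofFn g))
    (hI : I = Ideal.span {b} ⊔ Ideal.ofList (List.ofFn g))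
    (y : Fin n → affineBlowupAlgebra I b) (hy : ∀ k, b • y k = algebraMap B _ (g k))
    (φ : B →+* C) (c : Fin n → C) (hc : ∀ k, φ b * c k = φ (g k)) :
    ∃ ψ : affineBlowupAlgebra I b →+* C, (∀ a, ψ (algebraMap B _ a) = φ a) ∧
      ∀ k, ψ (y k) = c k := by
  have hsurj := affineBlowupAlgebra.exists_aeval_eq hI y hy
  have h0 : blowupRelations b g ≤ RingHom.ker (MvPolynomial.aeval (R := B) y).toRingHom := by
    refine Ideal.span_le.2 fun f hf ↦ ?_
    obtain ⟨k, rfl⟩ := List.mem_ofFn.1 hf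
    change MvPolynomial.aeval y _ = 0
    rw [map_sub, map_mul, MvPolynomial.aeval_X, MvPolynomial.aeval_C, MvPolynomial.aeval_C,
      ← Algebra.smul_def, hy, sub_self]
  have hpow : ∀ (N : ℕ) P, MvPolynomial.C (b ^ N) * P ∈ blowupRelations b g →
      P ∈ blowupRelations b g := by
    intro N
    induction N with
    | zero => intro P h; simpa using h
    | succ N ih =>
      intro P h
      refine ih _ (mem_blowupRelations_of_mul_mem hb hg _ ?_)
      rwa [← mul_assoc, ← map_mul, ← pow_succ']
  -- If `P` maps to zero and `b ^ N * P` is congruent to a constant `c`, then `c` dies in `B[b⁻¹]`,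
  -- so `c = 0`; now cancel `b ^ N` modulo the relations.
  have hker : RingHom.ker (MvPolynomial.aeval (R := B) y).toRingHom = blowupRelations b g := by
    refine le_antisymm (fun P hP ↦ ?_) h0
    obtain ⟨N, c, h⟩ := exists_C_mul_sub_C_mem_blowupRelations b g P
    refine hpow N P ?_
    have h1 : algebraMap B (affineBlowupAlgebra I b) c = 0 := by
      have h2 : MvPolynomial.aeval y P = 0 := hP
      have h3 : MvPolynomial.aeval y (MvPolynomial.C (b ^ N) * P - MvPolynomial.C c) = 0 := h0 h
      rw [map_sub, map_mul, h2, mul_zero, MvPolynomial.aeval_C, zero_sub, neg_eq_zero] at h3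
      exact h3
    have h4 : c = 0 := by
      have : algebraMap B (Localization.Away b) c = 0 := congrArg Subtype.val h1
      refine IsLocalization.injective (Localization.Away b) (M := Submonoid.powers b) ?_
        (by rw [this, map_zero])
      rwa [Submonoid.powers_le]
    simpa [h4] using h
  let F : MvPolynomial (Fin n) B →+* C := MvPolynomial.eval₂Hom φ c
  have hF : RingHom.ker (MvPolynomial.aeval (R := B) y).toRingHom ≤ RingHom.ker F := by
    rw [hker]
    refine Ideal.span_le.2 fun f hf ↦ ?_
    obtain ⟨k, rfl⟩ := List.mem_ofFn.1 hf
    change F _ = 0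
    simp [F, hc]
  have hs : Function.Surjective (MvPolynomial.aeval (R := B) y).toRingHom := hsurj
  refine ⟨RingHom.liftOfSurjective _ hs ⟨F, hF⟩, fun a ↦ ?_, fun k ↦ ?_⟩
  · have := RingHom.liftOfSurjective_comp_apply _ hs ⟨F, hF⟩ (MvPolynomial.C a)
    simpa [F] using this
  · have := RingHom.liftOfSurjective_comp_apply _ hs ⟨F, hF⟩ (MvPolynomial.X k)
    simpa [F] using this

end Presentation

/-! ### Inverse images of ideal sheaves -/

section Comap

variable {X Y : Scheme.{u}}

lemma ideal_comap_of_isOpenImmersion' (I : Y.IdealSheafData) (f : X ⟶ Y) [IsOpenImmersion f]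
    (U : X.affineOpens) (A : Y.affineOpens) (h : U.1 ≤ f ⁻¹ᵁ A.1) :
    (I.comap f).ideal U = (I.ideal A).map (f.appLE A.1 U.1 h).hom := by
  have h' : f ''ᵁ U.1 ≤ A.1 := by
    rintro _ ⟨x, hx, rfl⟩
    exact h hx
  rw [Scheme.IdealSheafData.ideal_comap_of_isOpenImmersion,
    ← I.map_ideal (U := ⟨f ''ᵁ U.1, U.2.image_of_isOpenImmersion f⟩) (V := A) h']
  have : f.appLE A.1 U.1 h = Y.presheaf.map (homOfLE h').op ≫ (f.appIso U.1).hom := by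
    simp [Scheme.Hom.appIso_hom', Scheme.Hom.map_appLE]
  rw [this, CommRingCat.hom_comp, ← Ideal.map_map]
  exact (Ideal.map_symm (f.appIso U.1).commRingCatIsoToRingEquiv.symm).symm

lemma bijective_ι_appLE_top (W : X.Opens) :
    Function.Bijective (W.ι.appLE W ⊤ (by simp)).hom := by
  have : IsIso (W.ι.appLE W ⊤ (by simp)) := by
    rw [Scheme.Hom.appLE]
    have : IsIso (W.ι.app W) := Scheme.Hom.isIso_app _ _ (by simp)
    have e : W.ι ⁻¹ᵁ W = ⊤ := by simp
    have : IsIso (homOfLE e.ge).op := by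
      have : homOfLE e.ge = eqToHom e.symm := Subsingleton.elim _ _
      rw [this]; infer_instance
    infer_instance
  exact ConcreteCategory.bijective_of_isIso _

/-- By adjunction of inverse and direct image, it is enough to test both sides on global sections.
-/
lemma ideal_comap_top_of_isAffine [IsAffine X] [IsAffine Y] (I : Y.IdealSheafData) (f : X ⟶ Y) :
    (I.comap f).ideal ⟨⊤, isAffineOpen_top X⟩ =
      (I.ideal ⟨⊤, isAffineOpen_top Y⟩).map f.appTop.hom := by
  apply le_antisymm
  · have : I.comap f ≤ .ofIdealTop ((I.ideal ⟨⊤, isAffineOpen_top Y⟩).map f.appTop.hom) := by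
      rw [← Scheme.IdealSheafData.le_map_iff_comap_le]
      apply Scheme.IdealSheafData.le_of_isAffine
      rw [Scheme.IdealSheafData.ideal_map _ _ _ (isAffineOpen_top X)]
      refine Ideal.map_le_iff_le_comap.1 (le_of_le_of_eq le_rfl ?_)
      exact (Scheme.IdealSheafData.equivOfIsAffine.right_inv _).symm
    simpa using this ⟨⊤, isAffineOpen_top X⟩
  · rw [Ideal.map_le_iff_le_comap]
    have := I.le_map_comap f ⟨⊤, isAffineOpen_top Y⟩
    rwa [Scheme.IdealSheafData.ideal_map _ _ _ (isAffineOpen_top X)] at this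

/-- The inverse image of an ideal sheaf is locally the extended ideal. -/
lemma ideal_comap (I : Y.IdealSheafData) (f : X ⟶ Y) (A : Y.affineOpens) (W : X.affineOpens)
    (h : W.1 ≤ f ⁻¹ᵁ A.1) :
    (I.comap f).ideal W = (I.ideal A).map (f.appLE A.1 W.1 h).hom := by
  have e : f.resLE A.1 W.1 h ≫ A.1.ι = W.1.ι ≫ f := by simp
  have h1 := congrArg (fun J ↦ J.ideal ⟨⊤, isAffineOpen_top _⟩) (congrArg (I.comap) e)
  simp only [Scheme.IdealSheafData.comap_comp] at h1
  have : IsAffine W.1 := W.2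
  have : IsAffine A.1 := A.2
  rw [ideal_comap_top_of_isAffine, ideal_comap_of_isOpenImmersion' I A.1.ι _ A (by simp),
    ideal_comap_of_isOpenImmersion' (I.comap f) W.1.ι _ W (by simp), Ideal.map_map,
    ← CommRingCat.hom_comp] at h1
  apply_fun Ideal.comap (W.1.ι.appLE W.1 ⊤ (by simp)).hom at h1
  rw [Ideal.comap_map_of_bijective _ (bijective_ι_appLE_top _)] at h1
  rw [← h1]
  have h2 : A.1.ι.appLE A.1 ⊤ (by simp) ≫ (f.resLE A.1 W.1 h).appTop =
      f.appLE A.1 W.1 h ≫ W.1.ι.appLE W.1 ⊤ (by simp) := by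
    have h4 : (⊤ : (W.1 : Scheme).Opens) ≤ f.resLE A.1 W.1 h ⁻¹ᵁ ⊤ := fun _ _ ↦ trivial
    have h3 : (f.resLE A.1 W.1 h).appTop = (f.resLE A.1 W.1 h).appLE ⊤ ⊤ h4 :=
      Scheme.Hom.app_eq_appLE _
    rw [Scheme.Hom.appLE_comp_appLE, h3, Scheme.Hom.appLE_comp_appLE]
    congr 1
  rw [h2, CommRingCat.hom_comp, ← Ideal.map_map,
    Ideal.comap_map_of_bijective _ (bijective_ι_appLE_top _)]

end Comap

/-! ### Existence of dilatations -/

section BlowupSubring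

variable {B C B' C' : Type*} [CommRing B] [CommRing C] [CommRing B'] [CommRing C']

/-- The subring of fractions `s` with `Jⁿ s ⊆ Iⁿ` for some `n`. -/
def blowupSubring (φ : B →+* C) {I J : Ideal B} (h : J ≤ I) : Subring C where
  -- No generator of `J` is chosen. For `J = (b)` the condition says `s ∈ Iⁿ/bⁿ`, and the union of
  -- these sets is `B[I/b]`.
  carrier := {s | ∃ n : ℕ, ∀ x ∈ J ^ n, ∃ i ∈ I ^ n, φ x * s = φ i}
  mul_mem' := by
    rintro s t ⟨n, hn⟩ ⟨m, hm⟩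
    refine ⟨n + m, fun x hx ↦ ?_⟩
    rw [pow_add] at hx ⊢
    induction hx using Submodule.mul_induction_on' with
    | mem_mul_mem x hx y hy =>
      obtain ⟨i, hi, e⟩ := hn x hx
      obtain ⟨i', hi', e'⟩ := hm y hy
      refine ⟨i * i', Ideal.mul_mem_mul hi hi', ?_⟩
      rw [map_mul, map_mul, ← e, ← e']
      ring
    | add x _ y _ hx hy =>
      obtain ⟨i, hi, e⟩ := hx
      obtain ⟨i', hi', e'⟩ := hy
      exact ⟨i + i', add_mem hi hi', by rw [map_add, add_mul, e, e', map_add]⟩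
  one_mem' := ⟨0, fun x hx ↦ ⟨x, hx, mul_one _⟩⟩
  add_mem' := by
    have key : ∀ (n m : ℕ) (s : C), (∀ x ∈ J ^ n, ∃ i ∈ I ^ n, φ x * s = φ i) →
        ∀ x ∈ J ^ (n + m), ∃ i ∈ I ^ (n + m), φ x * s = φ i := by
      intro n m s hn x hx
      rw [pow_add] at hx ⊢
      induction hx using Submodule.mul_induction_on' with
      | mem_mul_mem x hx y hy =>
        obtain ⟨i, hi, e⟩ := hn x hx
        refine ⟨i * y, Ideal.mul_mem_mul hi (Ideal.pow_right_mono h m hy), ?_⟩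
        rw [map_mul, map_mul, ← e]
        ring
      | add x _ y _ hx hy =>
        obtain ⟨i, hi, e⟩ := hx
        obtain ⟨i', hi', e'⟩ := hy
        exact ⟨i + i', add_mem hi hi', by rw [map_add, add_mul, e, e', map_add]⟩
    rintro s t ⟨n, hn⟩ ⟨m, hm⟩
    refine ⟨n + m, fun x hx ↦ ?_⟩
    obtain ⟨i, hi, e⟩ := key n m s hn x hx
    obtain ⟨i', hi', e'⟩ := key m n t hm x (by rwa [add_comm])
    exact ⟨i + i', add_mem hi (by rwa [add_comm]), by rw [mul_add, e, e', map_add]⟩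
  zero_mem' := ⟨0, fun x hx ↦ ⟨0, zero_mem _, by simp⟩⟩
  neg_mem' := by
    rintro s ⟨n, hn⟩
    refine ⟨n, fun x hx ↦ ?_⟩
    obtain ⟨i, hi, e⟩ := hn x hx
    exact ⟨-i, neg_mem hi, by rw [mul_neg, e, map_neg]⟩

lemma map_mem_blowupSubring (φ : B →+* C) {I J : Ideal B} (h : J ≤ I) (a : B) :
    φ a ∈ blowupSubring φ h :=
  ⟨0, fun x _ ↦ ⟨x * a, by simp, by rw [map_mul]⟩⟩

lemma mem_blowupSubring_of_span (φ : B →+* C) {I J : Ideal B} (h : J ≤ I) (n : ℕ) (T : Set B)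
    (hT : J ^ n ≤ Ideal.span T) (s : C) (hs : ∀ x ∈ T, ∃ i ∈ I ^ n, φ x * s = φ i) :
    s ∈ blowupSubring φ h := by
  refine ⟨n, fun x hx ↦ ?_⟩
  have hx' := hT hx
  clear hx
  induction hx' using Submodule.span_induction with
  | mem x hx => exact hs x hx
  | zero => exact ⟨0, zero_mem _, by simp⟩
  | add x y _ _ hx hy =>
    obtain ⟨i, hi, e⟩ := hx
    obtain ⟨i', hi', e'⟩ := hy
    exact ⟨i + i', add_mem hi hi', by rw [map_add, add_mul, e, e', map_add]⟩
  | smul a x _ hx =>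
    obtain ⟨i, hi, e⟩ := hx
    exact ⟨a * i, Ideal.mul_mem_left _ _ hi, by rw [smul_eq_mul, map_mul, map_mul, mul_assoc, e]⟩

lemma map_mem_blowupSubring_map {φ : B →+* C} {φ' : B' →+* C'} {β : B →+* B'} {ψ : C →+* C'}
    (hc : ∀ x, ψ (φ x) = φ' (β x)) {I J : Ideal B} (h : J ≤ I) {I' J' : Ideal B'} (h' : J' ≤ I')
    (hI : I.map β = I') (hJ : J.map β = J') {s : C} (hs : s ∈ blowupSubring φ h) :
    ψ s ∈ blowupSubring φ' h' := by
  subst hI hJ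
  obtain ⟨n, hn⟩ := hs
  refine mem_blowupSubring_of_span φ' h' n (β '' (J ^ n : Ideal B)) ?_ _ ?_
  · rw [← Ideal.map_pow]; exact le_rfl
  · rintro _ ⟨x, hx, rfl⟩
    obtain ⟨i, hi, e⟩ := hn x hx
    exact ⟨β i, by rw [← Ideal.map_pow]; exact Ideal.mem_map_of_mem _ hi, by
      rw [← hc, ← map_mul, e, hc]⟩

/-- Compatibility with localization is what allows these rings to be glued. It requires that the
denominators be cleared simultaneously for all elements of `Jⁿ`, hence finite generation of `J`. -/
lemma isLocalization_blowupSubring [Algebra B B'] [Algebra C C'] (f : B)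
    [IsLocalization.Away f B'] {φ : B →+* C} {φ' : B' →+* C'} [IsLocalization.Away (φ f) C']
    (hc : ∀ x, algebraMap C C' (φ x) = φ' (algebraMap B B' x)) {I J : Ideal B} (h : J ≤ I)
    {I' J' : Ideal B'} (h' : J' ≤ I') (hI : I.map (algebraMap B B') = I')
    (hJ : J.map (algebraMap B B') = J') (hfg : J.FG)
    [Algebra (blowupSubring φ h) (blowupSubring φ' h')]
    (ha : ∀ s : blowupSubring φ h, (algebraMap (blowupSubring φ h) (blowupSubring φ' h') s).1 =
      algebraMap C C' s.1) :
    IsLocalization.Away (⟨φ f, map_mem_blowupSubring φ h f⟩ : blowupSubring φ h)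
      (blowupSubring φ' h') := by
  set f' : blowupSubring φ h := ⟨φ f, map_mem_blowupSubring φ h f⟩ with hf'
  have hpow : ∀ n : ℕ, (algebraMap (blowupSubring φ h) (blowupSubring φ' h') (f' ^ n)).1 =
      φ' (algebraMap B B' f) ^ n := fun n ↦ by
    rw [ha]
    simp [hf', hc]
  refine ⟨⟨?_, ?_, ?_⟩⟩
  · rintro ⟨_, n, rfl⟩
    refine IsUnit.of_mul_eq_one
      ⟨φ' (IsLocalization.Away.invSelf f) ^ n, pow_mem (map_mem_blowupSubring φ' h' _) n⟩ ?_
    ext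
    change (algebraMap (blowupSubring φ h) (blowupSubring φ' h') (f' ^ n)).1 * _ = 1
    rw [hpow, ← mul_pow, ← map_mul, IsLocalization.Away.mul_invSelf, map_one, one_pow]
  · rintro ⟨z, n, hz⟩
    obtain ⟨t, ht⟩ := hfg.pow (n := n)
    obtain ⟨⟨s, _, k, rfl⟩, hs⟩ := IsLocalization.surj (M := Submonoid.powers (φ f)) z
    have h1 : ∀ x ∈ t, ∃ (K : ℕ) (i : B), i ∈ I ^ n ∧ φ x * (φ f ^ K * s) = φ i := by
      intro x hx
      obtain ⟨i', hi', e⟩ := hz (algebraMap B B' x) (by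
        rw [← hJ, ← Ideal.map_pow]
        exact Ideal.mem_map_of_mem _ (ht ▸ Ideal.subset_span hx))
      rw [← hI, ← Ideal.map_pow] at hi'
      obtain ⟨⟨⟨i, hi⟩, ⟨_, m, rfl⟩⟩, e'⟩ :=
        (IsLocalization.mem_map_algebraMap_iff (Submonoid.powers f) _).1 hi'
      have h2 : algebraMap C C' (φ x * φ f ^ m * s) = algebraMap C C' (φ f ^ k * φ i) := by
        have e'' := congrArg φ' e'
        simp only [map_mul, map_pow] at e'' hs ⊢
        rw [← hs]
        simp only [hc]
        rw [← e'', ← e]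
        ring
      obtain ⟨⟨_, c, rfl⟩, h3⟩ :=
        (IsLocalization.eq_iff_exists (Submonoid.powers (φ f)) C').1 h2
      refine ⟨c + m, f ^ (c + k) * i, Ideal.mul_mem_left _ _ hi, ?_⟩
      simp only [map_mul, map_pow, pow_add] at h3 ⊢
      linear_combination h3
    choose! K i hi e using h1
    -- One exponent for all the generators of `Jⁿ`.
    set N := ∑ x ∈ t, K x with hN
    have hs' : φ f ^ N * s ∈ blowupSubring φ h := by
      refine mem_blowupSubring_of_span φ h n (t : Set B) ht.ge _ fun x hx ↦ ?_
      refine ⟨f ^ (N - K x) * i x, Ideal.mul_mem_left _ _ (hi x hx), ?_⟩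
      rw [map_mul, ← e x hx, map_pow]
      have : N = (N - K x) + K x := (Nat.sub_add_cancel
        (Finset.single_le_sum (f := K) (fun _ _ ↦ Nat.zero_le _) hx)).symm
      conv_lhs => rw [this, pow_add]
      ring
    refine ⟨⟨⟨_, hs'⟩, ⟨f' ^ (N + k), N + k, rfl⟩⟩, ?_⟩
    ext
    change z * (algebraMap (blowupSubring φ h) (blowupSubring φ' h') (f' ^ (N + k))).1 =
      (algebraMap (blowupSubring φ h) (blowupSubring φ' h') ⟨_, hs'⟩).1
    rw [hpow, ha]
    simp only [map_mul, map_pow, hc] at hs ⊢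
    rw [← hs]
    ring
  · intro s t hst
    have := congrArg Subtype.val hst
    rw [ha, ha] at this
    obtain ⟨⟨_, c, rfl⟩, h3⟩ :=
      (IsLocalization.eq_iff_exists (Submonoid.powers (φ f)) C').1 this
    exact ⟨⟨f' ^ c, c, rfl⟩, Subtype.ext h3⟩

end BlowupSubring

/-- Every element of `Iⁿ` is `bⁿ` times an element of `B[I/b]`, so the intrinsic condition cuts out
`B[I/b]` in the localization. Conversely the generators `x/b` satisfy it with `n = 1`. -/
lemma nonempty_ringEquiv_blowupSubring {B : Type u} {C : Type*} [CommRing B] [CommRing C]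
    (φ : B →+* C) {I J : Ideal B} (h : J ≤ I) (b : B) (hJ : J = Ideal.span {b})
    (hφ : let _ := φ.toAlgebra; IsLocalization.Away b C) :
    ∃ e : blowupSubring φ h ≃+* affineBlowupAlgebra I b,
      ∀ a, e ⟨φ a, map_mem_blowupSubring φ h a⟩ = algebraMap _ _ a := by
  let _ := φ.toAlgebra
  let ε : C ≃ₐ[B] Localization.Away b :=
    IsLocalization.algEquiv (Submonoid.powers b) C (Localization.Away b)
  have hu := isUnit_algebraMap_away b
  have h1 : ∀ (n : ℕ), ∀ i ∈ I ^ n,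
      ∃ y ∈ affineBlowupAlgebra I b, algebraMap B (Localization.Away b) i =
        algebraMap B (Localization.Away b) b ^ n * y := by
    intro n
    induction n with
    | zero => exact fun i _ ↦ ⟨algebraMap B _ i, Subalgebra.algebraMap_mem _ i, by simp⟩
    | succ n ih =>
      intro i hi
      rw [pow_succ] at hi
      induction hi using Submodule.mul_induction_on' with
      | mem_mul_mem i hi x hx =>
        obtain ⟨y, hy, e⟩ := ih i hi
        obtain ⟨z, hz⟩ := affineBlowupAlgebra.exists_smul_eq (b := b) hx
        refine ⟨y * z.1, mul_mem hy z.2, ?_⟩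
        have := congrArg Subtype.val hz
        change b • z.1 = algebraMap B _ x at this
        rw [map_mul, e, ← this, Algebra.smul_def]
        ring
      | add i _ j _ hi hj =>
        obtain ⟨y, hy, e⟩ := hi
        obtain ⟨z, hz, e'⟩ := hj
        exact ⟨y + z, add_mem hy hz, by rw [map_add, e, e', mul_add]⟩
  have h2 : (blowupSubring φ h).map ε.toRingEquiv.toRingHom =
      (affineBlowupAlgebra I b).toSubring := by
    ext z
    constructor
    · rintro ⟨s, ⟨n, hn⟩, rfl⟩
      obtain ⟨i, hi, e⟩ := hn (b ^ n) (hJ ▸ Ideal.pow_mem_pow (Ideal.mem_span_singleton_self b) n)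
      obtain ⟨y, hy, e'⟩ := h1 n i hi
      have : ε s = y := by
        refine (hu.pow n).mul_left_cancel ?_
        rw [← e', ← map_pow, ← ε.commutes, ← ε.commutes, ← map_mul]
        exact congrArg ε e
      change ε s ∈ affineBlowupAlgebra I b
      rwa [this]
    · intro hz
      change z ∈ affineBlowupAlgebra I b at hz
      have key : ∀ z : affineBlowupAlgebra I b,
          z.1 ∈ (blowupSubring φ h).map ε.toRingEquiv.toRingHom := by
        intro z
        induction z using affineBlowupAlgebra.induction with
        | h1 a => exact ⟨φ a, map_mem_blowupSubring φ h a, ε.commutes a⟩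
        | h3 y z hy hz => exact add_mem hy hz
        | h4 y z hy hz => exact mul_mem hy hz
        | h2 x hx y hy =>
          refine ⟨ε.symm y.1, mem_blowupSubring_of_span φ h 1 {b} (by rw [hJ, pow_one]) _ ?_,
            ε.apply_symm_apply _⟩
          rintro _ rfl
          refine ⟨x, by rwa [pow_one], ?_⟩
          have := congrArg (fun w ↦ ε.symm w.1) hy
          change ε.symm (_ • y.1) = ε.symm (algebraMap B _ x) at this
          rwa [map_smul, AlgEquiv.commutes, Algebra.smul_def] at this
      exact key ⟨z, hz⟩
  let e1 : blowupSubring φ h ≃+* (blowupSubring φ h).map ε.toRingEquiv.toRingHom :=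
    (blowupSubring φ h).equivMapOfInjective _ ε.injective
  refine ⟨e1.trans (RingEquiv.subringCongr h2), fun a ↦ Subtype.ext ?_⟩
  exact ε.commutes a

lemma appLE_fromSpec_top {X : Scheme.{u}} {U : X.Opens} (hU : IsAffineOpen U)
    (h : (⊤ : (Spec Γ(X, U)).Opens) ≤ hU.fromSpec ⁻¹ᵁ U) :
    hU.fromSpec.appLE U ⊤ h = (Scheme.ΓSpecIso _).inv := by
  rw [Scheme.Hom.appLE, IsAffineOpen.fromSpec_app_self, Category.assoc, ← Functor.map_comp]
  have := (Spec Γ(X, U)).presheaf.map_id (.op ⊤)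
  exact (congrArg _ this).trans (Category.comp_id _)

lemma exists_ringEquiv_of_opensRange_eq {X X' : Scheme.{u}} {U : X.Opens} (hU : IsAffineOpen U)
    {R : CommRingCat.{u}} (α : Γ(X, U) ⟶ R) (π : X' ⟶ X) (i : Spec R ⟶ X') [IsOpenImmersion i]
    (hr : π ⁻¹ᵁ U = i.opensRange) (hw : i ≫ π = Spec.map α ≫ hU.fromSpec) :
    ∃ e : Γ(X', π ⁻¹ᵁ U) ≃+* R, ∀ a : Γ(X, U), e ((π.app U).hom a) = α.hom a := by
  have htop : (⊤ : (Spec R).Opens) ≤ i ⁻¹ᵁ (π ⁻¹ᵁ U) := by rw [hr]; simp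
  have : IsIso (i.appLE (π ⁻¹ᵁ U) ⊤ htop) := by
    rw [Scheme.Hom.appLE]
    have : IsIso (i.app (π ⁻¹ᵁ U)) := Scheme.Hom.isIso_app _ _ hr.le
    have e : (homOfLE htop) = eqToHom (top_le_iff.1 htop).symm := Subsingleton.elim _ _
    have : IsIso (homOfLE htop).op := by rw [e]; infer_instance
    infer_instance
  let ε : Γ(X', π ⁻¹ᵁ U) ⟶ R := i.appLE (π ⁻¹ᵁ U) ⊤ htop ≫ (Scheme.ΓSpecIso _).hom
  have hε : π.app U ≫ ε = α := by
    have h1 : π.app U = π.appLE U _ le_rfl := Scheme.Hom.app_eq_appLE _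
    have h2 : ∀ (f : Spec R ⟶ X) (_ : f = Spec.map α ≫ hU.fromSpec) (h : ⊤ ≤ f ⁻¹ᵁ U),
        f.appLE U ⊤ h = α ≫ (Scheme.ΓSpecIso _).inv := by
      rintro _ rfl h
      have h3 : (⊤ : (Spec Γ(X, U)).Opens) ≤ hU.fromSpec ⁻¹ᵁ U := by simp
      rw [← Scheme.Hom.appLE_comp_appLE _ _ U ⊤ ⊤ h3 (fun _ _ ↦ trivial), appLE_fromSpec_top]
      exact ((Scheme.ΓSpecIso_inv_naturality α).trans
        (congrArg _ (Scheme.Hom.app_eq_appLE _))).symm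
    rw [h1, ← Category.assoc, Scheme.Hom.appLE_comp_appLE, h2 _ hw, Category.assoc,
      Iso.inv_hom_id, Category.comp_id]
  exact ⟨(asIso ε).commRingCatIsoToRingEquiv, fun a ↦ congrArg (fun f ↦ f.hom a) hε⟩

/-- A relative spectrum: an algebra given on affine opens and compatible with localization glues to
an affine scheme over `X`. -/
lemma exists_isAffineHom_of_coequifibered {X : Scheme.{u}}
    {F : X.AffineZariskiSiteᵒᵖ ⥤ CommRingCat.{u}}
    {α : (Scheme.AffineZariskiSite.toOpensFunctor X).op ⋙ X.presheaf ⟶ F}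
    (H : ∀ (U : X.AffineZariskiSite) (f : Γ(X, U.1)),
      let _ := (F.map (homOfLE (U.basicOpen_le f)).op).hom.toAlgebra
      IsLocalization.Away (α.app (.op U) f) (F.obj (.op (U.basicOpen f)))) :
    ∃ (X' : Scheme.{u}) (π : X' ⟶ X), IsAffineHom π ∧ ∀ U : X.AffineZariskiSite,
      ∃ e : Γ(X', π ⁻¹ᵁ U.1) ≃+* F.obj (.op U),
        ∀ a : Γ(X, U.1), e ((π.app U.1).hom a) = (α.app (.op U)).hom a := by
  have H' : α.Coequifibered :=
    Scheme.AffineZariskiSite.coequifibered_iff_forall_isLocalizationAway.2 H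
  let d := Scheme.AffineZariskiSite.relativeGluingData H'
  have : (d.functor ⋙ Scheme.forget).IsLocallyDirected :=
    Scheme.Cover.RelativeGluingData.instIsLocallyDirectedI₀CompFunctorForgetOfIsThin ..
  let i (U : X.AffineZariskiSite) : Spec (F.obj (.op U)) ⟶ d.glued := d.cover.f U
  have hi (U : X.AffineZariskiSite) : IsOpenImmersion (i U) := d.cover.map_prop U
  have hr (U : X.AffineZariskiSite) : d.toBase ⁻¹ᵁ U.1 = (i U).opensRange :=
    (congrArg _ (Scheme.Opens.opensRange_ι U.1).symm).trans (d.toBase_preimage_eq_opensRange_ι U)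
  refine ⟨d.glued, d.toBase, ⟨fun U hU ↦ ?_⟩, fun U ↦ ?_⟩
  · have := hi ⟨U, hU⟩
    rw [hr ⟨U, hU⟩]
    exact isAffineOpen_opensRange _
  · have := hi U
    exact exists_ringEquiv_of_opensRange_eq U.2 (α.app (.op U)) d.toBase (i U) (hr U)
      ((d.ι_toBase U).trans (Category.assoc _ _ _))

/-- An ideal sheaf is locally principal. -/
def IsLocallyPrincipal {X : Scheme.{u}} (J : X.IdealSheafData) : Prop :=
  ∀ x : X, ∃ U : X.affineOpens, x ∈ U.1 ∧ ∃ b, J.ideal U = Ideal.span {b}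

lemma map_homOfLE_app_apply {X Y : Scheme.{u}} (f : X ⟶ Y) {U V : Y.Opens} (h : V ≤ U)
    (x : Γ(Y, U)) : (X.presheaf.map (homOfLE (f.preimage_mono h)).op).hom ((f.app U).hom x) =
      (f.app V).hom ((Y.presheaf.map (homOfLE h).op).hom x) :=
  (congrArg (fun g ↦ g.hom x) (f.naturality (homOfLE h).op)).symm

section Existence

variable {X : Scheme.{u}} {I J : X.IdealSheafData}

/-- A generator is available only near each point; finite generation then spreads to all affine
opens by the affine communication lemma. -/
lemma IsLocallyPrincipal.fg (hJ : IsLocallyPrincipal J) (U : X.affineOpens) :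
    (J.ideal U).FG := by
  choose V hV b hb using hJ
  refine of_affine_open_cover (P := fun U ↦ (J.ideal U).FG) V ?_ U ?_ ?_ ?_
  · refine top_le_iff.1 fun x _ ↦ ?_
    simp only [Opens.iSup_mk]
    exact Set.mem_iUnion.2 ⟨x, hV x⟩
  · intro U f h
    rw [← J.map_ideal_basicOpen]
    exact h.map _
  · intro U s hs h
    refine Ideal.fg_of_localizationSpan (s : Set _) hs fun f ↦ ?_
    let _ := (X.presheaf.map (homOfLE (X.basicOpen_le f.1)).op).hom.toAlgebra
    have : IsLocalization.Away f.1 Γ(X, X.basicOpen f.1) := U.2.isLocalization_basicOpen f.1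
    let e := IsLocalization.algEquiv (Submonoid.powers f.1) Γ(X, X.basicOpen f.1)
      (Localization.Away f.1)
    have h0 : ((J.ideal U).map (algebraMap _ Γ(X, X.basicOpen f.1))).FG := by
      have := h f
      rwa [← J.map_ideal_basicOpen] at this
    have h1 := h0.map e.toRingEquiv.toRingHom
    rw [Ideal.map_map] at h1
    convert h1
    exact RingHom.ext fun a ↦ (e.commutes a).symm
  · intro x
    rw [hb]
    exact ⟨{b x}, by simp⟩

/-- The open complement of the support of an ideal sheaf. -/
def complSupport (J : X.IdealSheafData) : X.Opens := J.support.compl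

lemma complSupport_inf_eq_basicOpen (J : X.IdealSheafData) (U : X.affineOpens) (b : Γ(X, U.1))
    (hb : J.ideal U = Ideal.span {b}) :
    complSupport J ⊓ U.1 = X.basicOpen b := by
  have h := J.coe_support_inter U
  rw [hb, Scheme.zeroLocus_span, Scheme.zeroLocus_singleton] at h
  ext x
  have hx := Set.ext_iff.1 h x
  simp only [Set.mem_inter_iff, Set.mem_compl_iff, SetLike.mem_coe] at hx
  have hle : x ∈ X.basicOpen b → x ∈ U.1 := fun h ↦ X.basicOpen_le b h
  change (x ∉ (J.support : Set X) ∧ x ∈ U.1) ↔ x ∈ X.basicOpen b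
  tauto

lemma ι_image_preimage_complSupport (U : X.affineOpens) (b : Γ(X, U.1))
    (hb : J.ideal U = Ideal.span {b}) :
    (complSupport J).ι ''ᵁ ((complSupport J).ι ⁻¹ᵁ U.1) = X.basicOpen b := by
  rw [Scheme.Hom.image_preimage_eq_opensRange_inf, Scheme.Opens.opensRange_ι,
    complSupport_inf_eq_basicOpen J U b hb]

lemma IsLocallyPrincipal.isAffineHom_ι (hJ : IsLocallyPrincipal J) :
    IsAffineHom (complSupport J).ι := by
  refine isAffineHom_of_forall_exists_isAffineOpen _ fun x ↦ ?_
  obtain ⟨U, hx, b, hb⟩ := hJ x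
  refine ⟨U.1, hx, U.2, ?_⟩
  rw [← Scheme.Hom.isAffineOpen_iff_of_isOpenImmersion (complSupport J).ι,
    ι_image_preimage_complSupport U b hb]
  exact U.2.basicOpen b

/-- The presheaf of blowup algebras, as subrings of the functions away from `V(J)`. -/
def blowupPresheaf (h : J ≤ I) : X.AffineZariskiSiteᵒᵖ ⥤ CommRingCat.{u} where
  obj U := .of (blowupSubring ((complSupport J).ι.app U.unop.1).hom (h U.unop))
  map {U V} f := CommRingCat.ofHom
    (RingHom.restrict ((complSupport J : Scheme).presheaf.map (homOfLE
      ((complSupport J).ι.preimage_mono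
        (Scheme.AffineZariskiSite.toOpens_mono f.unop.le))).op).hom _ _ fun s hs ↦
      map_mem_blowupSubring_map (β := (X.presheaf.map (homOfLE
        (Scheme.AffineZariskiSite.toOpens_mono f.unop.le)).op).hom)
        (map_homOfLE_app_apply (complSupport J).ι _)
        (h U.unop) (h V.unop) (I.map_ideal _) (J.map_ideal _) hs)
  map_id U := by
    ext x
    exact congrArg (fun g ↦ g.hom x.1) ((complSupport J : Scheme).presheaf.map_id _)
  map_comp f g := by
    ext x
    exact congrArg (fun g ↦ g.hom x.1) ((complSupport J : Scheme).presheaf.map_comp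
      (homOfLE ((complSupport J).ι.preimage_mono
        (Scheme.AffineZariskiSite.toOpens_mono f.unop.le))).op
      (homOfLE ((complSupport J).ι.preimage_mono
        (Scheme.AffineZariskiSite.toOpens_mono g.unop.le))).op)

/-- The structure map of the presheaf of blowup algebras. -/
def toBlowupPresheaf (h : J ≤ I) :
    (Scheme.AffineZariskiSite.toOpensFunctor X).op ⋙ X.presheaf ⟶ blowupPresheaf h where
  app U := CommRingCat.ofHom (RingHom.codRestrict ((complSupport J).ι.app U.unop.1).hom _
    (map_mem_blowupSubring _ (h U.unop)))
  naturality {U V} f := by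
    ext x
    apply Subtype.ext
    exact (map_homOfLE_app_apply (complSupport J).ι
      (Scheme.AffineZariskiSite.toOpens_mono f.unop.le) x).symm

lemma IsLocallyPrincipal.isLocalization_blowupPresheaf (hJ : IsLocallyPrincipal J) (h : J ≤ I)
    (U : X.AffineZariskiSite) (f : Γ(X, U.1)) :
    let _ := ((blowupPresheaf h).map (homOfLE (U.basicOpen_le f)).op).hom.toAlgebra
    IsLocalization.Away ((toBlowupPresheaf h).app (.op U) f)
      ((blowupPresheaf h).obj (.op (U.basicOpen f))) := by
  have haff := hJ.isAffineHom_ι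
  let D : Scheme := complSupport J
  let k : D ⟶ X := (complSupport J).ι
  let _ : Algebra Γ(X, U.1) Γ(X, X.basicOpen f) :=
    (X.presheaf.map (homOfLE (X.basicOpen_le f)).op).hom.toAlgebra
  have : IsLocalization.Away f Γ(X, X.basicOpen f) :=
    IsAffineOpen.isLocalization_basicOpen U.2 f
  let _ : Algebra Γ(D, k ⁻¹ᵁ U.1) Γ(D, k ⁻¹ᵁ X.basicOpen f) :=
    (D.presheaf.map (homOfLE (k.preimage_mono (X.basicOpen_le f))).op).hom.toAlgebra
  have : IsLocalization.Away ((k.app U.1).hom f) Γ(D, k ⁻¹ᵁ X.basicOpen f) :=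
    IsAffineOpen.isLocalization_of_eq_basicOpen (IsAffineHom.isAffine_preimage U.1 U.2) _
      (homOfLE (k.preimage_mono (X.basicOpen_le f))) (Scheme.preimage_basicOpen _ _)
  let _ : Algebra (blowupSubring (k.app U.1).hom (h U))
      (blowupSubring (k.app (X.basicOpen f)).hom (h (U.basicOpen f))) :=
    ((blowupPresheaf h).map (homOfLE (U.basicOpen_le f)).op).hom.toAlgebra
  exact isLocalization_blowupSubring (φ := (k.app U.1).hom) (φ' := (k.app (X.basicOpen f)).hom) f
    (map_homOfLE_app_apply k _) (h U) (h (U.basicOpen f))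
    (I.map_ideal (X.affineBasicOpen_le (V := U) f)) (J.map_ideal (X.affineBasicOpen_le (V := U) f))
    (hJ.fg U) (fun s ↦ rfl)

/-- Dilatations along locally principal closed subschemes exist. -/
theorem IsLocallyPrincipal.exists_isDilatation (hJ : IsLocallyPrincipal J) (h : J ≤ I) :
    ∃ (X' : Scheme.{u}) (π : X' ⟶ X), IsDilatation π I J := by
  obtain ⟨X', π, hπ, H⟩ := exists_isAffineHom_of_coequifibered (α := toBlowupPresheaf h)
    (hJ.isLocalization_blowupPresheaf h)
  refine ⟨X', π, hπ, fun U b hb ↦ ?_⟩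
  obtain ⟨e, he⟩ := H U
  obtain ⟨e', he'⟩ := nonempty_ringEquiv_blowupSubring ((complSupport J).ι.app U.1).hom (h U) b hb
    (IsAffineOpen.isLocalization_of_eq_basicOpen U.2 b
      (homOfLE (Set.image_preimage_subset _ _)) (ι_image_preimage_complSupport U b hb))
  exact ⟨e.trans e', fun a ↦ (congrArg e' (he a)).trans (he' a)⟩

end Existence

/-! ### Algebra maps isomorphic to affine blowup algebras -/

section IsBlowup

variable {B : Type u} {B' : Type*} [CommRing B] [CommRing B']

/-- The ring homomorphism `ρ : B → B'` is isomorphic to `B → B[I/b]`. -/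
def IsBlowup (I : Ideal B) (b : B) (ρ : B →+* B') : Prop :=
  ∃ e : B' ≃+* affineBlowupAlgebra I b, ∀ a, e (ρ a) = algebraMap _ _ a

namespace IsBlowup

variable {I : Ideal B} {b : B} {ρ : B →+* B'}

lemma eq_zero_of_mul_eq_zero (h : IsBlowup I b ρ) {c : B'} (hc : ρ b * c = 0) : c = 0 := by
  obtain ⟨e, he⟩ := h
  refine e.injective (affineBlowupAlgebra.smul_injective ?_)
  rw [Algebra.smul_def, ← he, ← map_mul, hc, map_zero]
  exact (smul_zero b).symm

lemma exists_mul_eq (h : IsBlowup I b ρ) {x : B} (hx : x ∈ I) : ∃ y, ρ b * y = ρ x := by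
  obtain ⟨e, he⟩ := h
  obtain ⟨y, hy⟩ := affineBlowupAlgebra.exists_smul_eq (b := b) hx
  refine ⟨e.symm y, e.injective ?_⟩
  rw [map_mul, he, he, e.apply_symm_apply, ← hy, Algebra.smul_def]

lemma exists_pow_mul_eq (h : IsBlowup I b ρ) (z : B') : ∃ (n : ℕ) (x : B), ρ b ^ n * z = ρ x := by
  obtain ⟨e, he⟩ := h
  obtain ⟨⟨x, _, n, rfl⟩, hx⟩ := IsLocalization.surj (M := Submonoid.powers b) (e z).1
  refine ⟨n, x, e.injective (Subtype.ext ?_)⟩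
  rw [map_mul, map_pow, he, he]
  exact (mul_comm _ _).trans ((congrArg ((e z).1 * ·) (map_pow _ _ _).symm).trans hx)

lemma exists_lift {C : Type*} [CommRing C] (h : IsBlowup I b ρ) (φ : B →+* C)
    (hφ : ∀ c, φ b * c = 0 → c = 0) (hI : ∀ x ∈ I, φ b ∣ φ x) :
    ∃ ψ : B' →+* C, ∀ a, ψ (ρ a) = φ a := by
  obtain ⟨e, he⟩ := h
  obtain ⟨ψ, hψ⟩ := affineBlowupAlgebra.exists_lift φ hφ hI
  exact ⟨ψ.comp e.toRingHom, fun a ↦ by simp [he, hψ]⟩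

/-- Every element of `B'` comes from `B` after multiplication by a power of `b`, and `b` can be
cancelled in `C`. -/
lemma hom_ext {C : Type*} [CommRing C] (h : IsBlowup I b ρ) {ψ ψ' : B' →+* C}
    (hψ : ∀ a, ψ (ρ a) = ψ' (ρ a)) (hb : ∀ c, ψ (ρ b) * c = 0 → c = 0) : ψ = ψ' := by
  ext z
  obtain ⟨n, x, hx⟩ := h.exists_pow_mul_eq z
  have h1 : ψ (ρ b) ^ n * (ψ z - ψ' z) = 0 := by
    rw [mul_sub, ← map_pow, ← map_mul, hx, map_pow, hψ b, ← map_pow, ← map_mul, hx, hψ, sub_self]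
  have h2 : ∀ (n : ℕ) c, ψ (ρ b) ^ n * c = 0 → c = 0 := by
    intro n
    induction n with
    | zero => intro c hc; simpa using hc
    | succ n ih => intro c hc; exact hb c (ih _ (by rwa [pow_succ, mul_assoc] at hc))
  exact sub_eq_zero.1 (h2 n _ h1)

variable {n : ℕ} {g : Fin n → B}

/-- The counterpart of `hom_ext` when `b` cannot be cancelled in `C`, as over the divisor: the
coordinates `yₖ = gₖ/b` generate `B'` over `B`. -/
lemma hom_ext_of_eq_ofList {C : Type*} [CommRing C] (h : IsBlowup I b ρ)
    (hI : I = Ideal.span {b} ⊔ Ideal.ofList (List.ofFn g)) (y : Fin n → B')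
    (hy : ∀ k, ρ b * y k = ρ (g k)) {ψ ψ' : B' →+* C} (hψ : ∀ a, ψ (ρ a) = ψ' (ρ a))
    (hψy : ∀ k, ψ (y k) = ψ' (y k)) : ψ = ψ' := by
  obtain ⟨e, he⟩ := h
  ext z
  obtain ⟨P, hP⟩ := affineBlowupAlgebra.exists_aeval_eq hI (fun k ↦ e (y k))
    (fun k ↦ by rw [Algebra.smul_def, ← he, ← map_mul, hy, he]) (e z)
  obtain rfl : z = e.symm (MvPolynomial.aeval (fun k ↦ e (y k)) P) := by rw [hP]; simp
  induction P using MvPolynomial.induction_on with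
  | C a =>
    rw [MvPolynomial.aeval_C, ← he, e.symm_apply_apply, hψ]
  | add p q hp hq =>
    simp only [map_add] at hp hq ⊢
    rw [hp (by simp), hq (by simp)]
  | mul_X p i hp =>
    simp only [map_mul, MvPolynomial.aeval_X, e.symm_apply_apply] at hp ⊢
    rw [hp (by simp), hψy]

lemma exists_lift_of_regularMod {C : Type*} [CommRing C] (h : IsBlowup I b ρ)
    (hb : b ∈ nonZeroDivisors B) (hg : RegularMod (Ideal.span {b}) (List.ofFn g))
    (hI : I = Ideal.span {b} ⊔ Ideal.ofList (List.ofFn g)) (y : Fin n → B')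
    (hy : ∀ k, ρ b * y k = ρ (g k)) (φ : B →+* C) (c : Fin n → C)
    (hc : ∀ k, φ b * c k = φ (g k)) :
    ∃ ψ : B' →+* C, (∀ a, ψ (ρ a) = φ a) ∧ ∀ k, ψ (y k) = c k := by
  obtain ⟨e, he⟩ := h
  obtain ⟨ψ, hψ, hψy⟩ := affineBlowupAlgebra.exists_lift_of_regularMod hb hg hI (fun k ↦ e (y k))
    (fun k ↦ by rw [Algebra.smul_def, ← he, ← map_mul, hy, he]) φ c hc
  exact ⟨ψ.comp e.toRingHom, fun a ↦ by simp [he, hψ], fun k ↦ hψy k⟩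

/-- A blowup algebra of a flat algebra along a non-zero-divisor `a` of the base is flat if its
reduction modulo `a` is flat. -/
lemma flat {A : Type*} {A₀ M₀ : Type*} [CommRing A] [CommRing A₀] [CommRing M₀] (h : IsBlowup I b ρ)
    (α : A →+* B) (hα : α.Flat) (a : A) (hb : α a = b) (ha : a ∈ nonZeroDivisors A)
    (πA : A →+* A₀) (hπA : Function.Surjective πA) (hkA : RingHom.ker πA = Ideal.span {a})
    (πM : B' →+* M₀) (hπM : Function.Surjective πM) (hkM : RingHom.ker πM = Ideal.span {ρ b})
    (s : A₀ →+* M₀) (hs : s.Flat) (hc : ∀ x, s (πA x) = πM (ρ (α x))) :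
    (ρ.comp α).Flat := by
  algebraize [α, s, ρ.comp α]
  let loc := algebraMap B (Localization.Away b)
  have : IsScalarTower A B (Localization.Away b) := .of_algebraMap_eq' rfl
  have : Module.Flat B (Localization.Away b) := IsLocalization.flat _ (Submonoid.powers b)
  have : Module.Flat A (Localization.Away b) := Module.Flat.trans A B _
  have h' := h
  obtain ⟨e, he⟩ := h'
  change Module.Flat A B'
  have hsm : ∀ (x : A) (m : B'), x • m = ρ (α x) * m := fun x m ↦ Algebra.smul_def x m
  have hsm' : ∀ (x : A) (m : Localization.Away b), x • m = loc (α x) * m :=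
    fun x m ↦ Algebra.smul_def x m
  -- `B'` embeds in `B[b⁻¹]`, which is a localization of the flat algebra `B` and in which every
  -- element becomes a fraction-free one after multiplication by a power of `b`.
  refine flat_of_flat_mod_of_flat_localization (A₀ := A₀) (M₀ := M₀) (N := Localization.Away b)
    (b := a) (fun x hx ↦ (mem_nonZeroDivisors_iff.1 ha).1 x hx) (fun m hm ↦ ?_) πA hπA
    (fun x ↦ by rw [← Ideal.mem_span_singleton, ← hkA]; rfl) πM.toAddMonoidHom hπM (fun x m ↦ ?_)
    (fun m hm ↦ ?_)
    { toFun := fun z ↦ (e z).1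
      map_add' := fun x y ↦ by rw [map_add]; rfl
      map_smul' := fun x m ↦ by
        rw [hsm, map_mul, he, RingHom.id_apply, hsm']; rfl }
    (fun x y hxy ↦ e.injective (Subtype.ext hxy)) (fun z ↦ ?_)
  · exact h.eq_zero_of_mul_eq_zero (by rw [← hb, ← hsm, hm])
  · change πM _ = _ • πM m
    rw [hsm, map_mul, Algebra.smul_def, ← hc]; rfl
  · have : m ∈ RingHom.ker πM := hm
    rw [hkM, Ideal.mem_span_singleton] at this
    obtain ⟨m', rfl⟩ := this
    exact ⟨m', by rw [hsm, hb]⟩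
  · obtain ⟨⟨x, _, n, rfl⟩, hx⟩ := IsLocalization.surj (M := Submonoid.powers b) z
    refine ⟨n, ρ x, ?_⟩
    change _ = (e (ρ x)).1
    rw [he, hsm', map_pow, hb, map_pow]
    exact (mul_comm _ _).trans ((congrArg (z * ·) (map_pow _ _ _).symm).trans hx)

end IsBlowup

end IsBlowup

/-! ### Morphisms to affine opens and gluing of morphisms -/

section Glue

variable {T Y Y' : Scheme.{u}}

/-- Local solutions of a condition `Q` that is stable under restriction and has at most one solution
agree on overlaps, hence glue. -/
lemma exists_of_local (Q : ∀ {W : Scheme.{u}} (_ : W ⟶ T), (W ⟶ Y) → Prop)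
    (hQ : ∀ {W W' : Scheme.{u}} (l : W' ⟶ W) [IsOpenImmersion l] (k : W ⟶ T) [IsOpenImmersion k]
      (g : W ⟶ Y), Q k g → Q (l ≫ k) (l ≫ g))
    (huniq : ∀ {W : Scheme.{u}} (k : W ⟶ T) [IsOpenImmersion k] (g g' : W ⟶ Y),
      Q k g → Q k g' → g = g')
    (hloc : ∀ t : T, ∃ W : T.Opens, t ∈ W ∧ ∃ g : (W : Scheme) ⟶ Y, Q W.ι g) :
    ∃ g : T ⟶ Y, ∀ t : T, ∃ W : T.Opens, t ∈ W ∧ Q W.ι (W.ι ≫ g) := by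
  choose W hW g hg using hloc
  let 𝒰 : T.OpenCover := T.openCoverOfIsOpenCover W (by
    rw [IsOpenCover, eq_top_iff]
    exact fun t _ ↦ Opens.mem_iSup.2 ⟨t, hW t⟩)
  have hf : ∀ x y : 𝒰.I₀,
      pullback.fst (𝒰.f x) (𝒰.f y) ≫ g x = pullback.snd (𝒰.f x) (𝒰.f y) ≫ g y := by
    intro x y
    refine huniq (pullback.fst (𝒰.f x) (𝒰.f y) ≫ 𝒰.f x) _ _ (hQ _ _ _ (hg x)) ?_
    rw [pullback.condition]
    exact hQ _ (𝒰.f y) _ (hg y)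
  refine ⟨𝒰.glueMorphisms g hf, fun t ↦ ⟨W t, hW t, ?_⟩⟩
  have : (W t).ι ≫ 𝒰.glueMorphisms g hf = g t := 𝒰.ι_glueMorphisms g hf t
  rw [this]
  exact hg t

variable {V : T.Opens} {U : Y.Opens}

lemma toSpecΓ_appLE_fromSpec (hU : IsAffineOpen U) (f : T ⟶ Y) (h : V ≤ f ⁻¹ᵁ U) :
    V.toSpecΓ ≫ Spec.map (f.appLE U V h) ≫ hU.fromSpec = V.ι ≫ f := by
  rw [← Category.assoc, Scheme.Opens.toSpecΓ_SpecMap_appLE, Category.assoc, hU.toSpecΓ_fromSpec,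
    Scheme.Hom.resLE_comp_ι]

lemma hom_ext_of_appLE (hU : IsAffineOpen U) {f g : T ⟶ Y} (hf : V ≤ f ⁻¹ᵁ U) (hg : V ≤ g ⁻¹ᵁ U)
    (h : f.appLE U V hf = g.appLE U V hg) : V.ι ≫ f = V.ι ≫ g := by
  rw [← toSpecΓ_appLE_fromSpec hU f hf, ← toSpecΓ_appLE_fromSpec hU g hg, h]

/-- The morphism to an affine open subset given by a ring homomorphism. -/
def homOfRingHom (hU : IsAffineOpen U) (ψ : Γ(Y, U) →+* Γ(T, V)) : (V : Scheme) ⟶ Y :=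
  V.toSpecΓ ≫ Spec.map (CommRingCat.ofHom ψ) ≫ hU.fromSpec

lemma homOfRingHom_comp (hU : IsAffineOpen U) (ψ : Γ(Y, U) →+* Γ(T, V)) (π : Y ⟶ Y')
    {U' : Y'.Opens} (hU' : IsAffineOpen U') (h : U ≤ π ⁻¹ᵁ U') (f : T ⟶ Y') (hf : V ≤ f ⁻¹ᵁ U')
    (hψ : ∀ a, ψ ((π.appLE U' U h).hom a) = (f.appLE U' V hf).hom a) :
    homOfRingHom hU ψ ≫ π = V.ι ≫ f := by
  rw [← toSpecΓ_appLE_fromSpec hU' f hf]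
  simp only [homOfRingHom, Category.assoc]
  rw [← hU'.SpecMap_appLE_fromSpec π hU h, ← Spec.map_comp_assoc]
  congr 3
  ext a
  exact hψ a

end Glue

/-! ### The universal property of dilatations along a Cartier divisor of the base -/

section Dilatation

variable {S S₀ X X' T : Scheme.{u}}

lemma exists_isAffineOpen_le {X : Scheme.{u}} {x : X} {O : X.Opens} (hx : x ∈ O) :
    ∃ W : X.Opens, IsAffineOpen W ∧ x ∈ W ∧ W ≤ O := by
  obtain ⟨_, ⟨W, hW, rfl⟩, hxW, hle⟩ := X.isBasis_affineOpens.exists_subset_of_mem_open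
    (show x ∈ (O : Set X) from hx) O.isOpen
  exact ⟨W, hW, hxW, hle⟩

lemma appLE_appLE_apply {X Y Z : Scheme.{u}} (f : X ⟶ Y) (g : Y ⟶ Z) {U : Z.Opens} {V : Y.Opens}
    {W : X.Opens} (h₁ : V ≤ g ⁻¹ᵁ U) (h₂ : W ≤ f ⁻¹ᵁ V) (h : W ≤ (f ≫ g) ⁻¹ᵁ U) (a : Γ(Z, U)) :
    (f.appLE V W h₂).hom ((g.appLE U V h₁).hom a) = ((f ≫ g).appLE U W h).hom a := by
  rw [← CommRingCat.comp_apply, Scheme.Hom.appLE_comp_appLE]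

lemma appLE_app_apply {X Y Z : Scheme.{u}} (f : X ⟶ Y) (g : Y ⟶ Z) {U : Z.Opens}
    {W : X.Opens} (h₂ : W ≤ f ⁻¹ᵁ (g ⁻¹ᵁ U)) (h : W ≤ (f ≫ g) ⁻¹ᵁ U) (a : Γ(Z, U)) :
    (f.appLE (g ⁻¹ᵁ U) W h₂).hom ((g.app U).hom a) = ((f ≫ g).appLE U W h).hom a := by
  rw [Scheme.Hom.app_eq_appLE, appLE_appLE_apply f g le_rfl h₂ h]

lemma appLE_congr_apply {X Y : Scheme.{u}} {f g : X ⟶ Y} (e : f = g) {U : Y.Opens} {W : X.Opens}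
    (h : W ≤ f ⁻¹ᵁ U) (h' : W ≤ g ⁻¹ᵁ U) (a : Γ(Y, U)) :
    (f.appLE U W h).hom a = (g.appLE U W h').hom a := by
  subst e; rfl

/-- An affine open subset of `S` on which the divisor `S₀` is given by a non-zero-divisor `a`,
and an affine open subset of `X` lying over it. -/
structure CartierChart (j : S₀ ⟶ S) (p : X ⟶ S) where
  A : S.affineOpens
  a : Γ(S, A.1)
  mem_nonZeroDivisors : a ∈ nonZeroDivisors Γ(S, A.1)
  ideal_eq : j.ker.ideal A = Ideal.span {a}
  U : X.affineOpens
  le : U.1 ≤ p ⁻¹ᵁ A.1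

/-- The equation of the divisor on `X`. -/
def CartierChart.b {j : S₀ ⟶ S} {p : X ⟶ S} (c : CartierChart j p) : Γ(X, c.U.1) :=
  (p.appLE c.A.1 c.U.1 c.le).hom c.a

lemma exists_cartierChart {j : S₀ ⟶ S} (hj : IsEffectiveCartier j) (p : X ⟶ S) (x : X)
    (O : X.Opens) (hx : x ∈ O) : ∃ c : CartierChart j p, x ∈ c.U.1 ∧ c.U.1 ≤ O := by
  obtain ⟨A, hA, a, ha, e⟩ := hj (p x)
  obtain ⟨U, hU, hxU, hle⟩ := exists_isAffineOpen_le (O := p ⁻¹ᵁ A.1 ⊓ O) ⟨hA, hx⟩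
  exact ⟨⟨A, a, ha, e, ⟨U, hU⟩, fun y hy ↦ (hle hy).1⟩, hxU, fun y hy ↦ (hle hy).2⟩

variable {j : S₀ ⟶ S} {p : X ⟶ S} {π : X' ⟶ X} {I : X.IdealSheafData}

lemma CartierChart.ideal_comap_eq (c : CartierChart j p) :
    (j.ker.comap p).ideal c.U = Ideal.span {c.b} := by
  rw [ideal_comap j.ker p c.A c.U c.le, c.ideal_eq, Ideal.map_span, Set.image_singleton]
  rfl

lemma isLocallyPrincipal_comap (hj : IsEffectiveCartier j) (p : X ⟶ S) :
    IsLocallyPrincipal (j.ker.comap p) := fun x ↦ by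
  obtain ⟨c, hx, -⟩ := exists_cartierChart hj p x ⊤ trivial
  exact ⟨c.U, hx, c.b, c.ideal_comap_eq⟩

lemma CartierChart.isBlowup (c : CartierChart j p) (hπ : IsDilatation π I (j.ker.comap p)) :
    IsBlowup (I.ideal c.U) c.b (π.app c.U.1).hom :=
  hπ.exists_ringEquiv c.U c.b c.ideal_comap_eq

/-- Flat base change preserves non-zero-divisors on affine opens, and vanishing of a function is
local. This is the only way flatness enters the universal property. -/
lemma eq_zero_of_appLE_mul_eq_zero (s : T ⟶ S) [Flat s] {A : S.Opens} (hA : IsAffineOpen A)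
    {a : Γ(S, A)} (ha : a ∈ nonZeroDivisors Γ(S, A)) {W : T.Opens} (h : W ≤ s ⁻¹ᵁ A) (c : Γ(T, W))
    (hc : (s.appLE A W h).hom a * c = 0) : c = 0 := by
  refine T.IsSheaf.section_ext fun x hx ↦ ?_
  obtain ⟨V, hV, hxV, hle⟩ := exists_isAffineOpen_le (O := W) hx
  refine ⟨V, hle, hxV, ?_⟩
  have hf : (s.appLE A V (hle.trans h)).hom.Flat := s.flat_appLE hA hV _
  algebraize [(s.appLE A V (hle.trans h)).hom]
  have hr : IsSMulRegular Γ(S, A) a := isSMulRegular_iff_right_eq_zero_of_smul.2 fun x hx ↦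
    (mem_nonZeroDivisors_iff.1 ha).1 x hx
  have hr' := isSMulRegular_iff_right_eq_zero_of_smul.1 (hr.of_flat (S := Γ(T, V)))
  rw [map_zero]
  refine hr' _ ?_
  rw [Algebra.smul_def]
  have h1 := congrArg (T.presheaf.map (homOfLE hle).op).hom hc
  rw [map_mul, map_zero] at h1
  rw [← h1]
  congr 1
  change _ = (s.appLE A W h ≫ T.presheaf.map (homOfLE hle).op).hom a
  rw [Scheme.Hom.appLE_map]
  rfl

/-- Morphisms from a flat scheme to a dilatation are determined by their composition with the
projection. -/
theorem IsDilatation.hom_ext (hj : IsEffectiveCartier j) (hπ : IsDilatation π I (j.ker.comap p))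
    {f g : T ⟶ X'} (h : f ≫ π = g ≫ π) (hf : Flat (f ≫ π ≫ p)) : f = g := by
  refine Scheme.hom_ext_of_forall _ _ fun t ↦ ?_
  obtain ⟨c, hc, -⟩ := exists_cartierChart hj p ((f ≫ π) t) ⊤ trivial
  have := hπ.isAffineHom
  have hf' : (f ≫ π) ⁻¹ᵁ c.U.1 ≤ f ⁻¹ᵁ (π ⁻¹ᵁ c.U.1) := le_rfl
  have hg' : (f ≫ π) ⁻¹ᵁ c.U.1 ≤ g ⁻¹ᵁ (π ⁻¹ᵁ c.U.1) := by rw [h]; exact le_rfl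
  refine ⟨(f ≫ π) ⁻¹ᵁ c.U.1, hc, hom_ext_of_appLE (IsAffineHom.isAffine_preimage _ c.U.2)
    hf' hg' ?_⟩
  have key : ∀ (k : T ⟶ X') (hk : (f ≫ π) ⁻¹ᵁ c.U.1 ≤ k ⁻¹ᵁ (π ⁻¹ᵁ c.U.1)) (a),
      (k.appLE _ _ hk).hom ((π.app c.U.1).hom a) = ((k ≫ π).appLE c.U.1 _ hk).hom a := by
    intro k hk a
    rw [← CommRingCat.comp_apply, Scheme.Hom.app_eq_appLE, Scheme.Hom.appLE_comp_appLE]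
  ext1
  refine (c.isBlowup hπ).hom_ext (fun a ↦ ?_) fun z hz ↦ ?_
  · rw [key, key]
    congr 3
  · refine eq_zero_of_appLE_mul_eq_zero (f ≫ π ≫ p) c.A.2 c.mem_nonZeroDivisors
      (W := (f ≫ π) ⁻¹ᵁ c.U.1) (fun x hx ↦ c.le hx) z ?_
    rw [← hz, key, CartierChart.b]
    congr 1
    exact (appLE_congr_apply (Category.assoc f π p).symm _ _ _).trans
      (appLE_appLE_apply (f ≫ π) p c.le hf' (fun x hx ↦ c.le hx) c.a).symm

/-- A morphism from a flat scheme lifts to the dilatation if its restriction to the divisor factors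
through the centre. -/
theorem IsDilatation.exists_lift (hj : IsEffectiveCartier j)
    (hπ : IsDilatation π I (j.ker.comap p)) (f : T ⟶ X) (hf : Flat (f ≫ p))
    (hI : I.comap f ≤ j.ker.comap (f ≫ p)) : ∃ g : T ⟶ X', g ≫ π = f := by
  have := hπ.isAffineHom
  -- Lifts exist on affine pieces by the algebraic mapping property and glue because `hom_ext` makes
  -- them unique.
  obtain ⟨g, hg⟩ := exists_of_local (fun {W} (k : W ⟶ T) (g : W ⟶ X') ↦ g ≫ π = k ≫ f)
    (fun l _ k _ g h ↦ by rw [Category.assoc, h, Category.assoc])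
    (fun {W} k _ g g' h h' ↦ hπ.hom_ext hj (h.trans h'.symm) (by
      rw [← Category.assoc, h, Category.assoc]; infer_instance))
    (fun t ↦ by
      obtain ⟨c, hc, -⟩ := exists_cartierChart hj p (f t) ⊤ trivial
      obtain ⟨V, hV, htV, hle⟩ := exists_isAffineOpen_le (O := f ⁻¹ᵁ c.U.1) hc
      have hb : (f.appLE c.U.1 V hle).hom c.b =
          ((f ≫ p).appLE c.A.1 V (fun x hx ↦ c.le (hle hx))).hom c.a := by
        rw [CartierChart.b, appLE_appLE_apply f p c.le hle (fun x hx ↦ c.le (hle hx))]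
      obtain ⟨ψ, hψ⟩ := (c.isBlowup hπ).exists_lift (f.appLE c.U.1 V hle).hom
        (fun z hz ↦ eq_zero_of_appLE_mul_eq_zero (f ≫ p) c.A.2 c.mem_nonZeroDivisors
          (W := V) (fun x hx ↦ c.le (hle hx)) z (by rw [← hz, hb]))
        (fun x hx ↦ by
          rw [hb, ← Ideal.mem_span_singleton]
          have h1 := hI ⟨V, hV⟩
          rw [ideal_comap I f c.U ⟨V, hV⟩ hle, ideal_comap j.ker (f ≫ p) c.A ⟨V, hV⟩
            (fun x hx ↦ c.le (hle hx)), c.ideal_eq, Ideal.map_span, Set.image_singleton] at h1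
          exact h1 (Ideal.mem_map_of_mem _ hx))
      refine ⟨V, htV, homOfRingHom (IsAffineHom.isAffine_preimage _ c.U.2) ψ,
        homOfRingHom_comp _ ψ π c.U.2 le_rfl f hle fun a ↦ ?_⟩
      rw [← hψ, Scheme.Hom.app_eq_appLE])
  refine ⟨g, Scheme.hom_ext_of_forall _ _ fun t ↦ ?_⟩
  obtain ⟨W, hW, h⟩ := hg t
  exact ⟨W, hW, by rw [← h, Category.assoc]⟩

/-- On the dilatation `x = b · (x/b)` for every `x` in the ideal of the centre. -/
lemma IsDilatation.comap_le (hj : IsEffectiveCartier j)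
    (hπ : IsDilatation π I (j.ker.comap p)) : I.comap π ≤ j.ker.comap (π ≫ p) := by
  have := hπ.isAffineHom
  let c (x : X) := (exists_cartierChart hj p x ⊤ trivial).choose
  have hc (x : X) : x ∈ (c x).U.1 := (exists_cartierChart hj p x ⊤ trivial).choose_spec.1
  refine Scheme.IdealSheafData.le_of_iSup_eq_top
    (fun x : X ↦ ⟨π ⁻¹ᵁ (c x).U.1, IsAffineHom.isAffine_preimage _ (c x).U.2⟩) ?_ fun x ↦ ?_
  · exact top_le_iff.1 fun x _ ↦ Opens.mem_iSup.2 ⟨π x, hc (π x)⟩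
  · rw [ideal_comap I π (c x).U _ le_rfl, Scheme.IdealSheafData.comap_comp,
      ideal_comap _ π (c x).U _ le_rfl, (c x).ideal_comap_eq, Ideal.map_span,
      Set.image_singleton, Ideal.map_le_iff_le_comap]
    intro a ha
    obtain ⟨y, hy⟩ := ((c x).isBlowup hπ).exists_mul_eq ha
    rw [Ideal.mem_comap, Ideal.mem_span_singleton]
    rw [Scheme.Hom.app_eq_appLE] at hy
    exact ⟨y, hy.symm⟩

end Dilatation

/-! ### Charts on which the centre is given by a regular sequence -/

section RegularMod

variable {R R₀ : Type*} [CommRing R] [CommRing R₀]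

lemma regularMod_of_forall (rs : List R) : ∀ K : Ideal R,
    (∀ i (hi : i < rs.length) (a : R), rs[i] * a ∈ K ⊔ Ideal.ofList (rs.take i) →
      a ∈ K ⊔ Ideal.ofList (rs.take i)) → RegularMod K rs := by
  induction rs with
  | nil => intros; trivial
  | cons r rs ih =>
    intro K h
    refine ⟨fun a ha ↦ by simpa using h 0 (by simp) a (by simpa using ha), ih _ fun i hi a ha ↦ ?_⟩
    have := h (i + 1) (by simpa using hi) a
    simp only [List.take_succ_cons, Ideal.ofList_cons, ← sup_assoc, List.getElem_cons_succ] at this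
    exact this ha

lemma _root_.RingTheory.Sequence.IsWeaklyRegular.regularMod_bot {rs : List R}
    (h : RingTheory.Sequence.IsWeaklyRegular R rs) : RegularMod (⊥ : Ideal R) rs := by
  refine regularMod_of_forall rs _ fun i hi a ha ↦ ?_
  have h1 := isSMulRegular_iff_right_eq_zero_of_smul.1 (h.regular_mod_prev i hi)
    (Submodule.Quotient.mk a)
  rw [← Submodule.Quotient.mk_smul, Submodule.Quotient.mk_eq_zero,
    Submodule.Quotient.mk_eq_zero] at h1
  simpa using h1 (by simpa using ha)

lemma _root_.RingTheory.Sequence.IsWeaklyRegular.regularMod_bot_map {rs : List R}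
    (h : RingTheory.Sequence.IsWeaklyRegular R rs) (φ : R →+* R₀) (hφ : φ.Flat) :
    RegularMod (⊥ : Ideal R₀) (rs.map φ) := by
  algebraize [φ]
  exact (h.of_flat (S := R₀)).regularMod_bot

/-- For `K = ⊥`, a regular sequence on a closed subscheme lifts to a sequence regular modulo the
ideal of that subscheme. -/
lemma RegularMod.comap (φ : R →+* R₀) (hφ : Function.Surjective φ) (gs : List R) :
    ∀ K : Ideal R₀, RegularMod K (gs.map φ) → RegularMod (K.comap φ) gs := by
  induction gs with
  | nil => intros; trivial
  | cons g gs ih =>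
    intro K h
    refine ⟨fun a ha ↦ h.1 (φ a) (by rw [← map_mul]; exact ha), ?_⟩
    have h1 := ih _ h.2
    have h2 : (K ⊔ Ideal.span {φ g}).comap φ = K.comap φ ⊔ Ideal.span {g} := by
      have : K ⊔ Ideal.span {φ g} = (K.comap φ ⊔ Ideal.span {g}).map φ := by
        rw [Ideal.map_sup, Ideal.map_comap_of_surjective _ hφ, Ideal.map_span, Set.image_singleton]
      rw [this, Ideal.comap_map_of_surjective _ hφ, sup_eq_left]
      exact le_sup_of_le_left (Ideal.comap_mono bot_le)
    rwa [h2] at h1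

end RegularMod

section RegularChart

lemma flat_presheaf_map {X : Scheme.{u}} {U V : X.Opens} (hU : IsAffineOpen U)
    (hV : IsAffineOpen V) (h : V ≤ U) : (X.presheaf.map (homOfLE h).op).hom.Flat := by
  have := (𝟙 X : X ⟶ X).flat_appLE hU hV h
  have e : (𝟙 X : X ⟶ X).appLE U V h = X.presheaf.map (homOfLE h).op :=
    Category.id_comp _
  rwa [e] at this

lemma ideal_ker_comp {X Y Z : Scheme.{u}} (f : X ⟶ Y) (g : Y ⟶ Z) [QuasiCompact f]
    [IsAffineHom g] (U : Z.affineOpens) :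
    (f ≫ g).ker.ideal U = (f.ker.ideal ⟨g ⁻¹ᵁ U.1, U.2.preimage g⟩).comap (g.app U.1).hom := by
  rw [Scheme.Hom.ker_apply, Scheme.Hom.ker_apply, RingHom.comap_ker]
  rfl

variable {S S₀ X H : Scheme.{u}}

/-- A chart on which the centre of the dilatation is defined by the equation of the divisor
and a sequence which is regular modulo that equation. -/
structure RegularChart (j : S₀ ⟶ S) (p : X ⟶ S) (I : X.IdealSheafData)
    extends CartierChart j p where
  n : ℕ
  g : Fin n → Γ(X, U.1)
  regularMod : RegularMod (Ideal.span {toCartierChart.b}) (List.ofFn g)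
  ideal_center_eq : I.ideal U = Ideal.span {toCartierChart.b} ⊔ Ideal.ofList (List.ofFn g)

variable {j : S₀ ⟶ S} [IsClosedImmersion j] {p : X ⟶ S} {i : H ⟶ pullback p j}
  [IsClosedImmersion i]

/-- Away from the centre its ideal is the unit ideal, and the one-term sequence `(1)` serves. -/
lemma exists_regularChart_of_notMem_range (hj : IsEffectiveCartier j) {x : X} (O : X.Opens)
    (hx : x ∈ O) (hi : x ∉ Set.range (i ≫ pullback.fst p j)) :
    ∃ c : RegularChart j p (i ≫ pullback.fst p j).ker, x ∈ c.U.1 ∧ c.U.1 ≤ O := by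
  have hc : IsClosed (Set.range (i ≫ pullback.fst p j)) :=
    (i ≫ pullback.fst p j).isClosedEmbedding.isClosed_range
  obtain ⟨c, hxc, hle⟩ := exists_cartierChart hj p x (O ⊓ ⟨_, hc.isOpen_compl⟩) ⟨hx, hi⟩
  have htop : (i ≫ pullback.fst p j).ker.ideal c.U = ⊤ := by
    rw [Scheme.Hom.ker_apply]
    have hemp : (i ≫ pullback.fst p j) ⁻¹ᵁ c.U.1 = ⊥ := by
      ext z
      exact ⟨fun hz ↦ ((hle hz).2 ⟨z, rfl⟩).elim, fun hz ↦ hz.elim⟩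
    have : Subsingleton Γ(H, (i ≫ pullback.fst p j) ⁻¹ᵁ c.U.1) := by
      rw [hemp]; infer_instance
    exact Ideal.eq_top_iff_one _ |>.2 (Subsingleton.elim _ _)
  exact ⟨⟨c, 1, fun _ ↦ 1, ⟨fun a ha ↦ by simpa using ha, trivial⟩, by
    rw [htop]; simp [Ideal.ofList]⟩, hxc,
    hle.trans inf_le_left⟩

/-- The regular sequence on `X ×_S S₀` is restricted to the trace of an affine chart, by flatness of
restriction, and lifted along the surjection of functions, whose kernel is `(b)`. -/
lemma exists_regularChart_of_mem_range (hj : IsEffectiveCartier j) (hi : IsRegularImmersion i)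
    (h : H) (O : X.Opens) (hx : (i ≫ pullback.fst p j) h ∈ O) :
    ∃ c : RegularChart j p (i ≫ pullback.fst p j).ker,
      (i ≫ pullback.fst p j) h ∈ c.U.1 ∧ c.U.1 ≤ O := by
  obtain ⟨U₀, hU₀, rs, hrs, hI⟩ := hi h
  obtain ⟨O', hO', e⟩ := (pullback.fst p j).isClosedEmbedding.isInducing.isOpen_iff.1 U₀.1.isOpen
  have hxO' : (i ≫ pullback.fst p j) h ∈ O' := by
    have : i h ∈ (pullback.fst p j) ⁻¹' O' := by rw [e]; exact hU₀
    exact this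
  obtain ⟨c, hxc, hle⟩ := exists_cartierChart hj p ((i ≫ pullback.fst p j) h) (O ⊓ ⟨O', hO'⟩)
    ⟨hx, hxO'⟩
  set k := pullback.fst p j
  let W : (pullback p j).affineOpens := ⟨k ⁻¹ᵁ c.U.1, c.U.2.preimage k⟩
  have hW : W ≤ U₀ := fun z hz ↦ e.le (hle hz).2
  have hsurj : Function.Surjective (k.app c.U.1).hom := k.app_surjective c.U.1 c.U.2
  have hker : RingHom.ker (k.app c.U.1).hom = Ideal.span {c.b} := by
    rw [← Scheme.Hom.ker_apply, Scheme.IdealSheafData.ker_fst_of_isClosedImmersion,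
      c.ideal_comap_eq]
  set ρ := ((pullback p j).presheaf.map (homOfLE (show W.1 ≤ U₀.1 from hW)).op).hom with hρ
  have hreg : RegularMod ⊥ (rs.map ρ) :=
    hrs.toIsWeaklyRegular.regularMod_bot_map ρ (flat_presheaf_map U₀.2 W.2 hW)
  obtain ⟨gs, hgs⟩ : ∃ gs : List Γ(X, c.U.1), gs.map (k.app c.U.1).hom = rs.map ρ := by
    have : rs.map ρ ∈ Set.range (List.map (k.app c.U.1).hom) := by
      rw [Set.range_list_map, hsurj.range_eq]
      simp
    exact this
  have hg : List.ofFn gs.get = gs := List.ofFn_get gs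
  refine ⟨⟨c, gs.length, gs.get, ?_, ?_⟩, hxc, hle.trans inf_le_left⟩
  · rw [hg, ← hker]
    exact RegularMod.comap _ hsurj _ _ (hgs ▸ hreg)
  · rw [hg, ← hker, ideal_ker_comp]
    change Ideal.comap _ (i.ker.ideal W) = _
    rw [← i.ker.map_ideal hW, hI, Ideal.map_ofList]
    change Ideal.comap _ (Ideal.ofList (rs.map ρ)) = _
    rw [← hgs, ← Ideal.map_ofList, Ideal.comap_map_of_surjective _ hsurj, sup_comm]
    rfl

lemma exists_regularChart (hj : IsEffectiveCartier j) (hi : IsRegularImmersion i)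
    (x : X) (O : X.Opens) (hx : x ∈ O) :
    ∃ c : RegularChart j p (i ≫ pullback.fst p j).ker, x ∈ c.U.1 ∧ c.U.1 ≤ O := by
  by_cases h : x ∈ Set.range (i ≫ pullback.fst p j)
  · obtain ⟨h, rfl⟩ := h
    exact exists_regularChart_of_mem_range hj hi h O hx
  · exact exists_regularChart_of_notMem_range hj O hx h

end RegularChart

/-- The special fibre `B'/b` is the polynomial ring over `B/I` in the coordinates `gₖ/b`. In
`(B/I)[X]` both `b` and `gₖ` are zero, so the presentation yields a map `ψ : B' → (B/I)[X]` with
`gₖ/b ↦ Xₖ`; it kills `b` and induces the inverse. -/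
lemma IsBlowup.bijective_eval₂Hom {B R : Type u} {B' M₀ : Type*} [CommRing B] [CommRing B']
    [CommRing R] [CommRing M₀] {I : Ideal B} {b : B} {ρ : B →+* B'} (h : IsBlowup I b ρ) {n : ℕ}
    {g : Fin n → B} (hb : b ∈ nonZeroDivisors B) (hg : RegularMod (Ideal.span {b}) (List.ofFn g))
    (hI : I = Ideal.span {b} ⊔ Ideal.ofList (List.ofFn g)) (y : Fin n → B')
    (hy : ∀ k, ρ b * y k = ρ (g k)) (πB : B →+* R) (hπB : Function.Surjective πB)
    (hkB : RingHom.ker πB = I) (πM : B' →+* M₀) (hπM : Function.Surjective πM)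
    (hkM : RingHom.ker πM = Ideal.span {ρ b}) (r : R →+* M₀) (hr : ∀ a, r (πB a) = πM (ρ a)) :
    Function.Bijective (MvPolynomial.eval₂Hom r (fun k ↦ πM (y k))) := by
  have hb0 : πB b = 0 := by
    have : b ∈ RingHom.ker πB := by
      rw [hkB, hI]; exact Ideal.mem_sup_left (Ideal.mem_span_singleton_self b)
    exact this
  have hg0 : ∀ k, πB (g k) = 0 := fun k ↦ by
    have : g k ∈ RingHom.ker πB := by
      rw [hkB, hI]
      exact Ideal.mem_sup_right (Ideal.subset_span (List.mem_ofFn.2 ⟨k, rfl⟩))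
    exact this
  obtain ⟨ψ, hψ, hψy⟩ := h.exists_lift_of_regularMod hb hg hI y hy
    ((MvPolynomial.C (σ := Fin n)).comp πB) MvPolynomial.X (fun k ↦ by simp [hb0, hg0])
  have h1 : (MvPolynomial.eval₂Hom r (fun k ↦ πM (y k))).comp ψ = πM :=
    h.hom_ext_of_eq_ofList hI y hy (fun a ↦ by simp [hψ, hr]) (fun k ↦ by simp [hψy])
  have h1' := fun z ↦ RingHom.congr_fun h1 z
  have hs : Function.Surjective ψ := by
    intro P
    induction P using MvPolynomial.induction_on with
    | C a => obtain ⟨a, rfl⟩ := hπB a; exact ⟨ρ a, hψ a⟩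
    | add p q hp hq =>
      obtain ⟨p, rfl⟩ := hp; obtain ⟨q, rfl⟩ := hq; exact ⟨p + q, map_add _ _ _⟩
    | mul_X p i hp => obtain ⟨p, rfl⟩ := hp; exact ⟨p * y i, by rw [map_mul, hψy]⟩
  refine ⟨(injective_iff_map_eq_zero _).2 fun P hP ↦ ?_, fun m ↦ ?_⟩
  · obtain ⟨z, rfl⟩ := hs P
    have hz : z ∈ RingHom.ker πM := (h1' z).symm.trans hP
    rw [hkM, Ideal.mem_span_singleton] at hz
    obtain ⟨w, rfl⟩ := hz
    rw [map_mul, hψ, RingHom.comp_apply, hb0, map_zero, zero_mul]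
  · obtain ⟨z, rfl⟩ := hπM m
    exact ⟨ψ z, h1' z⟩

section RegularChart

set_option linter.unusedSectionVars false

variable {S S₀ X H X' : Scheme.{u}}
variable {j : S₀ ⟶ S} [IsClosedImmersion j] {p : X ⟶ S} {i : H ⟶ pullback p j}
  [IsClosedImmersion i] {π : X' ⟶ X}

lemma CartierChart.b_mem_nonZeroDivisors [Flat p] (c : CartierChart j p) :
    c.b ∈ nonZeroDivisors Γ(X, c.U.1) :=
  mem_nonZeroDivisors_iff.2 ⟨fun x hx ↦
    eq_zero_of_appLE_mul_eq_zero p c.A.2 c.mem_nonZeroDivisors c.le x hx, fun x hx ↦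
    eq_zero_of_appLE_mul_eq_zero p c.A.2 c.mem_nonZeroDivisors c.le x (by rwa [mul_comm] at hx)⟩

lemma RegularChart.exists_coordinates {I : X.IdealSheafData} (c : RegularChart j p I)
    (hπ : IsDilatation π I (j.ker.comap p)) :
    ∃ y : Fin c.n → Γ(X', π ⁻¹ᵁ c.U.1),
      ∀ k, (π.app c.U.1).hom c.b * y k = (π.app c.U.1).hom (c.g k) := by
  have h := c.isBlowup hπ
  choose y hy using fun k ↦ h.exists_mul_eq (x := c.g k) (by
    rw [c.ideal_center_eq]
    exact Ideal.mem_sup_right (Ideal.subset_span (List.mem_ofFn.2 ⟨k, rfl⟩)))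
  exact ⟨y, hy⟩

/-- The restriction of a dilatation to the divisor maps to the centre. -/
lemma exists_toCenter (hj : IsEffectiveCartier j)
    (hπ : IsDilatation π (i ≫ pullback.fst p j).ker (j.ker.comap p)) :
    ∃ q : pullback (π ≫ p) j ⟶ H, q ≫ i ≫ pullback.fst p j = pullback.fst (π ≫ p) j ≫ π := by
  have h : (i ≫ pullback.fst p j).ker ≤ (pullback.fst (π ≫ p) j ≫ π).ker := by
    rw [Scheme.Hom.ker_comp (pullback.fst (π ≫ p) j),
      Scheme.IdealSheafData.le_map_iff_comap_le,
      Scheme.IdealSheafData.ker_fst_of_isClosedImmersion]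
    exact hπ.comap_le hj
  exact ⟨IsClosedImmersion.lift _ _ h, IsClosedImmersion.lift_fac _ _ h⟩

variable {q : pullback (π ≫ p) j ⟶ H}

lemma RegularChart.bijective_eval₂Hom [Flat p]
    (c : RegularChart j p (i ≫ pullback.fst p j).ker)
    (hπ : IsDilatation π (i ≫ pullback.fst p j).ker (j.ker.comap p))
    (hq : q ≫ i ≫ pullback.fst p j = pullback.fst (π ≫ p) j ≫ π)
    (y : Fin c.n → Γ(X', π ⁻¹ᵁ c.U.1))
    (hy : ∀ k, (π.app c.U.1).hom c.b * y k = (π.app c.U.1).hom (c.g k))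
    (h : (pullback.fst (π ≫ p) j) ⁻¹ᵁ (π ⁻¹ᵁ c.U.1) ≤
      q ⁻¹ᵁ ((i ≫ pullback.fst p j) ⁻¹ᵁ c.U.1)) :
    Function.Bijective (MvPolynomial.eval₂Hom (q.appLE _ _ h).hom
      (fun k ↦ ((pullback.fst (π ≫ p) j).app _).hom (y k))) := by
  have := hπ.isAffineHom
  have hW : IsAffineOpen (π ⁻¹ᵁ c.U.1) := c.U.2.preimage π
  refine (c.isBlowup hπ).bijective_eval₂Hom c.b_mem_nonZeroDivisors c.regularMod
    c.ideal_center_eq y hy ((i ≫ pullback.fst p j).app c.U.1).hom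
    ((i ≫ pullback.fst p j).app_surjective _ c.U.2) ?_
    ((pullback.fst (π ≫ p) j).app _).hom ((pullback.fst (π ≫ p) j).app_surjective _ hW) ?_ _ ?_
  · rw [Scheme.Hom.ker_apply]
  · rw [← Scheme.Hom.ker_apply _ ⟨_, hW⟩, Scheme.IdealSheafData.ker_fst_of_isClosedImmersion,
      Scheme.IdealSheafData.comap_comp, ideal_comap _ π c.U _ le_rfl, c.ideal_comap_eq,
      Ideal.map_span, Set.image_singleton, Scheme.Hom.app_eq_appLE]
  · intro a
    have e1 := appLE_app_apply q (i ≫ pullback.fst p j) h h a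
    have e2 := appLE_app_apply (pullback.fst (π ≫ p) j) π le_rfl le_rfl a
    rw [← Scheme.Hom.app_eq_appLE] at e2
    exact e1.trans ((appLE_congr_apply hq _ _ _).trans e2.symm)

lemma preimage_le_of_toCenter (hq : q ≫ i ≫ pullback.fst p j = pullback.fst (π ≫ p) j ≫ π)
    (U : X.Opens) : (pullback.fst (π ≫ p) j) ⁻¹ᵁ (π ⁻¹ᵁ U) ≤
      q ⁻¹ᵁ ((i ≫ pullback.fst p j) ⁻¹ᵁ U) := by
  change (pullback.fst (π ≫ p) j ≫ π) ⁻¹ᵁ U ≤ (q ≫ i ≫ pullback.fst p j) ⁻¹ᵁ U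
  rw [hq]

/-- Locally on the source, `q` is the projection of an affine space. Flatness, finite presentation
and smoothness of `q` are read off from this form. -/
lemma exists_appLE_toCenter_comp_bijective [Flat p] (hj : IsEffectiveCartier j)
    (hi : IsRegularImmersion i)
    (hπ : IsDilatation π (i ≫ pullback.fst p j).ker (j.ker.comap p))
    (hq : q ≫ i ≫ pullback.fst p j = pullback.fst (π ≫ p) j ≫ π) (z : ↥(pullback (π ≫ p) j)) :
    ∃ (U : H.affineOpens) (V : (pullback (π ≫ p) j).affineOpens) (_ : z ∈ V.1)
      (e : V.1 ≤ q ⁻¹ᵁ U.1) (n : ℕ) (f : MvPolynomial (Fin n) Γ(H, U.1) →+*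
        Γ(pullback (π ≫ p) j, V.1)),
      Function.Bijective f ∧ (q.appLE U.1 V.1 e).hom = f.comp MvPolynomial.C := by
  have := hπ.isAffineHom
  obtain ⟨c, hc, -⟩ := exists_regularChart hj hi ((pullback.fst (π ≫ p) j ≫ π) z) ⊤ trivial
  obtain ⟨y, hy⟩ := c.exists_coordinates hπ
  exact ⟨⟨_, c.U.2.preimage _⟩, ⟨_, (c.U.2.preimage π).preimage _⟩, hc,
    preimage_le_of_toCenter hq _, c.n, _,
    c.bijective_eval₂Hom hπ hq y hy (preimage_le_of_toCenter hq _),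
    RingHom.ext fun a ↦ (MvPolynomial.eval₂Hom_C _ _ _).symm⟩

theorem flat_toCenter [Flat p] (hj : IsEffectiveCartier j) (hi : IsRegularImmersion i)
    (hπ : IsDilatation π (i ≫ pullback.fst p j).ker (j.ker.comap p))
    (hq : q ≫ i ≫ pullback.fst p j = pullback.fst (π ≫ p) j ≫ π) : Flat q := by
  rw [HasRingHomProperty.iff_exists_appLE (P := @Flat)
    (RingHom.Flat.stableUnderComposition.stableUnderCompositionWithLocalizationAway
      RingHom.Flat.holdsForLocalizationAway).1]
  intro z
  obtain ⟨U, V, hz, e, n, f, hf, h⟩ := exists_appLE_toCenter_comp_bijective hj hi hπ hq z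
  refine ⟨U, V, hz, e, ?_⟩
  rw [h]
  refine RingHom.Flat.comp ?_ (.of_bijective hf)
  exact RingHom.flat_algebraMap_iff.2 inferInstance

theorem locallyOfFinitePresentation_toCenter [Flat p] (hj : IsEffectiveCartier j)
    (hi : IsRegularImmersion i)
    (hπ : IsDilatation π (i ≫ pullback.fst p j).ker (j.ker.comap p))
    (hq : q ≫ i ≫ pullback.fst p j = pullback.fst (π ≫ p) j ≫ π) :
    LocallyOfFinitePresentation q := by
  rw [HasRingHomProperty.iff_exists_appLE (P := @LocallyOfFinitePresentation)
    (RingHom.finitePresentation_stableUnderComposition.stableUnderCompositionWithLocalizationAway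
      RingHom.finitePresentation_holdsForLocalizationAway).1]
  intro z
  obtain ⟨U, V, hz, e, n, f, hf, h⟩ := exists_appLE_toCenter_comp_bijective hj hi hπ hq z
  refine ⟨U, V, hz, e, ?_⟩
  rw [h]
  refine RingHom.FinitePresentation.comp (.of_bijective hf) ?_
  exact RingHom.finitePresentation_algebraMap.2 inferInstance

lemma appLE_eq_zero_of_mem_ker {Z T : Scheme.{u}} {k : Z ⟶ X} [QuasiCompact k] {f : T ⟶ X}
    {f₀ : T ⟶ Z} (hf : f₀ ≫ k = f) {U : X.affineOpens} {V : T.Opens} (hV : V ≤ f ⁻¹ᵁ U.1)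
    {x : Γ(X, U.1)} (hx : x ∈ k.ker.ideal U) : (f.appLE U.1 V hV).hom x = 0 := by
  subst hf
  rw [Scheme.Hom.ker_apply, RingHom.mem_ker] at hx
  have := appLE_app_apply f₀ k hV hV x
  rw [← this]
  change (f₀.appLE _ _ _).hom ((k.app U.1).hom x) = 0
  rw [hx, map_zero]

/-- Where `b` and all `gₖ` vanish, the equations `b tₖ = gₖ` are void, so the coordinates of a point
of the dilatation can be prescribed arbitrarily. -/
lemma RegularChart.exists_ringHom [Flat p] {I : X.IdealSheafData} (c : RegularChart j p I)
    (hπ : IsDilatation π I (j.ker.comap p)) (y : Fin c.n → Γ(X', π ⁻¹ᵁ c.U.1))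
    (hy : ∀ k, (π.app c.U.1).hom c.b * y k = (π.app c.U.1).hom (c.g k))
    {T : Scheme.{u}} {V : T.Opens} (f : T ⟶ X) (hV : V ≤ f ⁻¹ᵁ c.U.1)
    (hb : (f.appLE c.U.1 V hV).hom c.b = 0) (hg : ∀ k, (f.appLE c.U.1 V hV).hom (c.g k) = 0)
    (t : Fin c.n → Γ(T, V)) : ∃ ψ : Γ(X', π ⁻¹ᵁ c.U.1) →+* Γ(T, V),
      (∀ a, ψ ((π.app c.U.1).hom a) = (f.appLE c.U.1 V hV).hom a) ∧ ∀ k, ψ (y k) = t k :=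
  (c.isBlowup hπ).exists_lift_of_regularMod c.b_mem_nonZeroDivisors c.regularMod
    c.ideal_center_eq y hy (f.appLE c.U.1 V hV).hom t (fun k ↦ by rw [hb, hg, zero_mul])

lemma homOfRingHom_comp_eq [IsAffineHom π] {T : Scheme.{u}} {V : T.Opens} (f : T ⟶ X)
    {U : X.affineOpens} (hV : V ≤ f ⁻¹ᵁ U.1) (ψ : Γ(X', π ⁻¹ᵁ U.1) →+* Γ(T, V))
    (hψ : ∀ a, ψ ((π.app U.1).hom a) = (f.appLE U.1 V hV).hom a) :
    homOfRingHom (U.2.preimage π) ψ ≫ π = V.ι ≫ f :=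
  homOfRingHom_comp _ ψ π U.2 le_rfl f hV fun a ↦ by rw [← hψ, Scheme.Hom.app_eq_appLE]

lemma RegularChart.hom_ext {I : X.IdealSheafData} (c : RegularChart j p I)
    (hπ : IsDilatation π I (j.ker.comap p)) (y : Fin c.n → Γ(X', π ⁻¹ᵁ c.U.1))
    (hy : ∀ k, (π.app c.U.1).hom c.b * y k = (π.app c.U.1).hom (c.g k))
    {T : Scheme.{u}} {V : T.Opens} {f g : T ⟶ X'} (h : f ≫ π = g ≫ π)
    (hf : V ≤ f ⁻¹ᵁ (π ⁻¹ᵁ c.U.1)) (hg : V ≤ g ⁻¹ᵁ (π ⁻¹ᵁ c.U.1))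
    (H : ∀ k, (f.appLE _ V hf).hom (y k) = (g.appLE _ V hg).hom (y k)) : V.ι ≫ f = V.ι ≫ g := by
  have := hπ.isAffineHom
  refine hom_ext_of_appLE (c.U.2.preimage π) hf hg (CommRingCat.hom_ext ?_)
  refine (c.isBlowup hπ).hom_ext_of_eq_ofList c.ideal_center_eq y hy (fun a ↦ ?_) H
  rw [appLE_app_apply f π hf hf, appLE_app_apply g π hg hg]
  exact appLE_congr_apply h _ _ _

/-- Giving all coordinates the value `0` defines a section of `q` locally on `H`. -/
theorem surjective_toCenter [Flat p] (hj : IsEffectiveCartier j) (hi : IsRegularImmersion i)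
    (hπ : IsDilatation π (i ≫ pullback.fst p j).ker (j.ker.comap p))
    (hq : q ≫ i ≫ pullback.fst p j = pullback.fst (π ≫ p) j ≫ π) : Surjective q := by
  have := hπ.isAffineHom
  refine ⟨fun h ↦ ?_⟩
  obtain ⟨c, hc, -⟩ := exists_regularChart hj hi ((i ≫ pullback.fst p j) h) ⊤ trivial
  obtain ⟨y, hy⟩ := c.exists_coordinates hπ
  have hker : ∀ x ∈ (i ≫ pullback.fst p j).ker.ideal c.U,
      ((i ≫ pullback.fst p j).appLE c.U.1 _ le_rfl).hom x = 0 := fun x hx ↦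
    appLE_eq_zero_of_mem_ker (Category.id_comp _) _ hx
  rw [c.ideal_center_eq] at hker
  obtain ⟨ψ, hψ, -⟩ := c.exists_ringHom hπ y hy (i ≫ pullback.fst p j) le_rfl
    (hker _ (Ideal.mem_sup_left (Ideal.mem_span_singleton_self _)))
    (fun k ↦ hker _ (Ideal.mem_sup_right (Ideal.subset_span (List.mem_ofFn.2 ⟨k, rfl⟩))))
    (fun _ ↦ 0)
  have hκ := homOfRingHom_comp_eq _ _ ψ hψ
  let κ := pullback.lift (f := π ≫ p) (g := j) (homOfRingHom (c.U.2.preimage π) ψ)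
    (((i ≫ pullback.fst p j) ⁻¹ᵁ c.U.1).ι ≫ i ≫ pullback.snd p j) (by
      rw [← Category.assoc, hκ]; simp only [Category.assoc, pullback.condition])
  have hκq : κ ≫ q = ((i ≫ pullback.fst p j) ⁻¹ᵁ c.U.1).ι := by
    rw [← cancel_mono (i ≫ pullback.fst p j), Category.assoc, hq, ← Category.assoc,
      pullback.lift_fst, hκ]
  refine ⟨κ ⟨h, hc⟩, ?_⟩
  exact congrArg (fun f : ((((i ≫ pullback.fst p j) ⁻¹ᵁ c.U.1 : H.Opens) : Scheme.{u}) ⟶ H) ↦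
    f ⟨h, hc⟩) hκq

/-- A dilatation in a regularly immersed flat centre is flat. -/
theorem flat_dilatation [Flat p] (hj : IsEffectiveCartier j) (hi : IsRegularImmersion i)
    (hH : Flat (i ≫ pullback.snd p j))
    (hπ : IsDilatation π (i ≫ pullback.fst p j).ker (j.ker.comap p)) : Flat (π ≫ p) := by
  obtain ⟨q, hq⟩ := exists_toCenter hj hπ
  have := flat_toCenter hj hi hπ hq
  -- The special fibre is flat over `S₀`, being flat over the centre, which is flat over `S₀`.
  have hs : Flat (pullback.snd (π ≫ p) j) := by
    have : pullback.snd (π ≫ p) j = q ≫ i ≫ pullback.snd p j := by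
      rw [← cancel_mono j, ← pullback.condition, Category.assoc, Category.assoc,
        ← pullback.condition, ← Category.assoc i, ← Category.assoc q, hq, Category.assoc]
    rw [this]; infer_instance
  have := hπ.isAffineHom
  rw [HasRingHomProperty.iff_exists_appLE (P := @Flat)
    (RingHom.Flat.stableUnderComposition.stableUnderCompositionWithLocalizationAway
      RingHom.Flat.holdsForLocalizationAway).1]
  intro z
  obtain ⟨c, hc, -⟩ := exists_cartierChart hj p (π z) ⊤ trivial
  have hW : IsAffineOpen (π ⁻¹ᵁ c.U.1) := c.U.2.preimage π
  have hle : (pullback.fst (π ≫ p) j) ⁻¹ᵁ (π ⁻¹ᵁ c.U.1) ≤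
      pullback.snd (π ≫ p) j ⁻¹ᵁ (j ⁻¹ᵁ c.A.1) := by
    change _ ≤ (pullback.snd (π ≫ p) j ≫ j) ⁻¹ᵁ c.A.1
    rw [← pullback.condition]
    exact fun x hx ↦ c.le hx
  refine ⟨c.A, ⟨_, hW⟩, hc, fun x hx ↦ c.le hx, ?_⟩
  have := (c.isBlowup hπ).flat (p.appLE c.A.1 c.U.1 c.le).hom (p.flat_appLE c.A.2 c.U.2 c.le) c.a
    rfl c.mem_nonZeroDivisors (j.app c.A.1).hom (j.app_surjective _ c.A.2)
    (by rw [← Scheme.Hom.ker_apply, c.ideal_eq]) ((pullback.fst (π ≫ p) j).app _).hom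
    ((pullback.fst (π ≫ p) j).app_surjective _ hW)
    (by
      rw [← Scheme.Hom.ker_apply _ ⟨_, hW⟩, Scheme.IdealSheafData.ker_fst_of_isClosedImmersion,
        Scheme.IdealSheafData.comap_comp, ideal_comap _ π c.U _ le_rfl, c.ideal_comap_eq,
        Ideal.map_span, Set.image_singleton, Scheme.Hom.app_eq_appLE])
    ((pullback.snd (π ≫ p) j).appLE _ _ hle).hom
    ((pullback.snd (π ≫ p) j).flat_appLE (c.A.2.preimage j) (hW.preimage _) hle) (fun x ↦ by
      have hle' : (pullback.fst (π ≫ p) j) ⁻¹ᵁ (π ⁻¹ᵁ c.U.1) ≤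
          (pullback.fst (π ≫ p) j ≫ (π ≫ p)) ⁻¹ᵁ c.A.1 := fun x hx ↦ c.le hx
      have e1 := appLE_app_apply (pullback.snd (π ≫ p) j) j hle hle x
      have e2 := appLE_appLE_apply π p c.le le_rfl (fun x hx ↦ c.le hx) x
      have e3 := appLE_appLE_apply (pullback.fst (π ≫ p) j) (π ≫ p) (V := π ⁻¹ᵁ c.U.1)
        (fun x hx ↦ c.le hx) le_rfl hle' x
      rw [Scheme.Hom.app_eq_appLE π, e2, Scheme.Hom.app_eq_appLE (pullback.fst (π ≫ p) j), e3, e1]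
      exact appLE_congr_apply pullback.condition.symm _ _ _)
  convert this
  rw [← CommRingCat.hom_comp, Scheme.Hom.app_eq_appLE, Scheme.Hom.appLE_comp_appLE]

end RegularChart

/-! ### The group structure -/

section Group

set_option linter.unusedSectionVars false

variable {S S₀ : Scheme.{u}} {j : S₀ ⟶ S} [IsClosedImmersion j] {G : Over S} {H : Over S₀}
  {i : H ⟶ special j G} {G' : Scheme.{u}} {π : G' ⟶ G.left}

lemma IsNeronBlowup.isDilatation (hπ : IsNeronBlowup j i π) :
    IsDilatation π (i.left ≫ proj j G).ker (j.ker.comap G.hom) := by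
  have := hπ
  rwa [IsNeronBlowup, Scheme.IdealSheafData.ker_fst_of_isClosedImmersion] at this

theorem exists_isNeronBlowup (hj : IsEffectiveCartier j) (i : H ⟶ special j G) :
    ∃ (G' : Scheme.{u}) (π : G' ⟶ G.left), IsNeronBlowup j i π := by
  refine IsLocallyPrincipal.exists_isDilatation ?_ ?_
  · rw [Scheme.IdealSheafData.ker_fst_of_isClosedImmersion]
    exact isLocallyPrincipal_comap hj _
  · exact Scheme.Hom.le_ker_comp _ _

lemma proj_comp_left {T : Over S} (f : T ⟶ G) :
    proj j T ≫ f.left = ((Over.pullback j).map f).left ≫ proj j G :=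
  (pullback.lift_fst _ _ _).symm

variable (hj : IsEffectiveCartier j) (hπ : IsNeronBlowup j i π)

include hj hπ

lemma IsNeronBlowup.over_hom_ext {T : Over S} [Flat T.hom] {f g : T ⟶ Over.mk (π ≫ G.hom)}
    (h : f ≫ (Over.homMk π : Over.mk (π ≫ G.hom) ⟶ G) =
      g ≫ (Over.homMk π : Over.mk (π ≫ G.hom) ⟶ G)) : f = g := by
  refine Over.OverMorphism.ext (hπ.isDilatation.hom_ext hj (congrArg CommaMorphism.left h) ?_)
  have : f.left ≫ π ≫ G.hom = T.hom := Over.w f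
  rw [this]; infer_instance

/-- A factorization through `H` of the restriction of `f` to `S₀` is exactly the inclusion of ideals
demanded by `IsDilatation.exists_lift`. -/
lemma IsNeronBlowup.exists_over_lift {T : Over S} [Flat T.hom] (f : T ⟶ G)
    (hf : ∃ t : special j T ⟶ H, t ≫ i = (Over.pullback j).map f) :
    ∃ g : T ⟶ Over.mk (π ≫ G.hom), g ≫ (Over.homMk π : Over.mk (π ≫ G.hom) ⟶ G) = f := by
  obtain ⟨t, ht⟩ := hf
  have hw : f.left ≫ G.hom = T.hom := Over.w f
  obtain ⟨g, hg⟩ := hπ.isDilatation.exists_lift hj f.left (by rw [hw]; infer_instance) (by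
    rw [hw, ← Scheme.IdealSheafData.ker_fst_of_isClosedImmersion j T.hom,
      ← Scheme.IdealSheafData.le_map_iff_comap_le, Scheme.IdealSheafData.map_ker]
    have : pullback.fst T.hom j ≫ f.left = t.left ≫ i.left ≫ proj j G := by
      refine (proj_comp_left (j := j) f).trans ?_
      rw [← ht, Over.comp_left, Category.assoc]
    rw [this]
    exact Scheme.Hom.le_ker_comp _ _)
  refine ⟨Over.homMk g ?_, Over.OverMorphism.ext hg⟩
  change g ≫ π ≫ G.hom = T.hom
  rw [← hw, ← hg, Category.assoc]

lemma IsNeronBlowup.exists_over_toCenter [IsClosedImmersion i.left] :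
    ∃ q : special j (Over.mk (π ≫ G.hom)) ⟶ H, q ≫ i = (Over.pullback j).map (Over.homMk π) := by
  obtain ⟨q, hq⟩ := exists_toCenter (i := i.left) hj hπ.isDilatation
  have hm : q ≫ i.left = ((Over.pullback j).map
      (Over.homMk π : Over.mk (π ≫ G.hom) ⟶ G)).left := by
    refine pullback.hom_ext ?_ ?_
    · rw [Category.assoc]
      exact hq.trans (proj_comp_left (j := j) (Over.homMk π : Over.mk (π ≫ G.hom) ⟶ G))
    · rw [← cancel_mono j, Category.assoc, Category.assoc, Category.assoc, ← pullback.condition]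
      have := congrArg (· ≫ G.hom) hq
      simp only [Category.assoc] at this
      rw [this, pullback.condition]
      have h2 := congrArg (· ≫ j) (Over.w ((Over.pullback j).map
        (Over.homMk π : Over.mk (π ≫ G.hom) ⟶ G)))
      simp only [Category.assoc] at h2
      refine h2.symm.trans ?_
      exact congrArg (((Over.pullback j).map (Over.homMk π : Over.mk (π ≫ G.hom) ⟶ G)).left ≫ ·)
        pullback.condition.symm
  refine ⟨Over.homMk q ?_, Over.OverMorphism.ext hm⟩
  have h1 : q ≫ H.hom = (q ≫ i.left) ≫ (special j G).hom := by
    rw [Category.assoc, Over.w i]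
  rw [h1, hm]
  exact Over.w _

end Group

/-! ### Points of `G` whose restriction to `S₀` lies in `H` form a subgroup -/

section Lift

set_option linter.unusedSectionVars false

variable {S S₀ : Scheme.{u}} {j : S₀ ⟶ S} {G : Over S} [GrpObj G] {H : Over S₀} [GrpObj H]
  {i : H ⟶ special j G} [IsMonHom i]

lemma exists_lift_mul {T : Over S} {f g : T ⟶ G}
    (hf : ∃ t : special j T ⟶ H, t ≫ i = (Over.pullback j).map f)
    (hg : ∃ t : special j T ⟶ H, t ≫ i = (Over.pullback j).map g) :
    ∃ t : special j T ⟶ H, t ≫ i = (Over.pullback j).map (f * g) := by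
  obtain ⟨t, ht⟩ := hf
  obtain ⟨s, hs⟩ := hg
  exact ⟨t * s, by rw [Functor.map_mul, ← ht, ← hs, MonObj.mul_comp]⟩

lemma exists_lift_one (T : Over S) :
    ∃ t : special j T ⟶ H, t ≫ i = (Over.pullback j).map (1 : T ⟶ G) :=
  ⟨1, by rw [Functor.map_one, MonObj.one_comp]⟩

lemma exists_lift_inv {T : Over S} {f : T ⟶ G}
    (hf : ∃ t : special j T ⟶ H, t ≫ i = (Over.pullback j).map f) :
    ∃ t : special j T ⟶ H, t ≫ i = (Over.pullback j).map f⁻¹ := by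
  obtain ⟨t, ht⟩ := hf
  refine ⟨t⁻¹, ?_⟩
  rw [Functor.map_inv', ← ht, GrpObj.inv_comp]

lemma exists_lift_comp {T T' : Over S} {f : T ⟶ G} (u : T' ⟶ T)
    (hf : ∃ t : special j T ⟶ H, t ≫ i = (Over.pullback j).map f) :
    ∃ t : special j T' ⟶ H, t ≫ i = (Over.pullback j).map (u ≫ f) := by
  obtain ⟨t, ht⟩ := hf
  exact ⟨(Over.pullback j).map u ≫ t, by rw [Category.assoc, ht, Functor.map_comp]⟩

end Lift

/-! ### Lifting a group structure along a morphism that can be cancelled -/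

section Cartesian

variable {C : Type*} [Category C] [CartesianMonoidalCategory C]

/-- The group structure on `A` for which `p : A ⟶ G` is a homomorphism, when `G` is a group object
and morphisms into `A` from the relevant objects are determined by their composite with `p`. -/
abbrev grpObjOfHomExt {A G : C} [GrpObj G] (p : A ⟶ G) (m : A ⊗ A ⟶ A) (e : 𝟙_ C ⟶ A) (n : A ⟶ A)
    (hm : m ≫ p = (p ⊗ₘ p) ≫ μ[G]) (he : e ≫ p = η[G]) (hn : n ≫ p = p ≫ ι[G])
    (h₁ : ∀ f g : A ⟶ A, f ≫ p = g ≫ p → f = g)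
    (h₂ : ∀ f g : (A ⊗ A) ⊗ A ⟶ A, f ≫ p = g ≫ p → f = g) : GrpObj A where
  one := e
  mul := m
  inv := n
  one_mul := by
    rw [← cancel_epi (λ_ A).inv, Iso.inv_hom_id]
    apply h₁
    simp only [Category.assoc, hm, Category.id_comp]
    rw [← Category.assoc (e ▷ A), ← tensorHom_id, tensorHom_comp_tensorHom, he, Category.id_comp]
    have : (η[G] ⊗ₘ p) = (𝟙_ C ◁ p) ≫ (η[G] ▷ G) := by
      rw [← id_tensorHom, ← tensorHom_id, tensorHom_comp_tensorHom]; simp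
    rw [this, Category.assoc, MonObj.one_mul]
    simp
  mul_one := by
    rw [← cancel_epi (ρ_ A).inv, Iso.inv_hom_id]
    apply h₁
    simp only [Category.assoc, hm, Category.id_comp]
    rw [← Category.assoc (A ◁ e), ← id_tensorHom, tensorHom_comp_tensorHom, he, Category.id_comp]
    have : (p ⊗ₘ η[G]) = (p ▷ 𝟙_ C) ≫ (G ◁ η[G]) := by
      rw [← id_tensorHom, ← tensorHom_id, tensorHom_comp_tensorHom]; simp
    rw [this, Category.assoc, MonObj.mul_one]
    simp
  mul_assoc := by
    apply h₂
    simp only [Category.assoc, hm]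
    rw [← Category.assoc (m ▷ A), ← Category.assoc (A ◁ m), ← tensorHom_id, ← id_tensorHom,
      tensorHom_comp_tensorHom, tensorHom_comp_tensorHom, hm, Category.id_comp]
    have h3 : (((p ⊗ₘ p) ≫ μ[G]) ⊗ₘ p) = ((p ⊗ₘ p) ⊗ₘ p) ≫ (μ[G] ▷ G) := by
      rw [← tensorHom_id, tensorHom_comp_tensorHom]; simp
    have h4 : (p ⊗ₘ ((p ⊗ₘ p) ≫ μ[G])) = (p ⊗ₘ (p ⊗ₘ p)) ≫ (G ◁ μ[G]) := by
      rw [← id_tensorHom, tensorHom_comp_tensorHom]; simp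
    rw [h3, h4, Category.assoc, MonObj.mul_assoc]
    simp
  left_inv := by
    apply h₁
    rw [Category.assoc, Category.assoc, hm, he, ← Category.assoc, lift_map, hn, Category.id_comp]
    have : lift (p ≫ ι[G]) p = p ≫ lift ι[G] (𝟙 G) := by simp
    rw [this, Category.assoc, GrpObj.left_inv]
    simp
  right_inv := by
    apply h₁
    rw [Category.assoc, Category.assoc, hm, he, ← Category.assoc, lift_map, hn, Category.id_comp]
    have : lift p (p ≫ ι[G]) = p ≫ lift (𝟙 G) ι[G] := by simp
    rw [this, Category.assoc, GrpObj.right_inv]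
    simp

end Cartesian

section Flatness

variable {S : Scheme.{u}}

instance flat_tensor (T T' : Over S) [Flat T.hom] [Flat T'.hom] : Flat (T ⊗ T').hom := by
  change Flat (pullback.fst T.hom T'.hom ≫ T.hom)
  infer_instance

instance flat_tensorUnit : Flat (𝟙_ (Over S)).hom := by
  change Flat (𝟙 S)
  infer_instance

end Flatness

/-! ### The group law of the dilatation -/

section GroupStructure

set_option linter.unusedSectionVars false

variable {S S₀ : Scheme.{u}} {j : S₀ ⟶ S} [IsClosedImmersion j] {G : Over S} [GrpObj G]
  {H : Over S₀} [GrpObj H]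
  {i : H ⟶ special j G} [IsMonHom i] [IsClosedImmersion i.left] {G' : Scheme.{u}} {π : G' ⟶ G.left}
  (hj : IsEffectiveCartier j) (hπ : IsNeronBlowup j i π) [Flat (π ≫ G.hom)]

include hj hπ

instance flat_mk_hom : Flat (Over.mk (π ≫ G.hom)).hom := ‹Flat (π ≫ G.hom)›

/-- On flat `S`-schemes the dilatation represents the subgroup of points of `G` that reduce into
`H`. The powers of `𝒢` and the base are flat, so product, unit and inverse lift and the axioms
follow by cancelling `π`. -/
theorem IsNeronBlowup.exists_grpObj :
    ∃! _ : GrpObj (Over.mk (π ≫ G.hom)),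
          IsMonHom (Over.homMk π : Over.mk (π ≫ G.hom) ⟶ G) := by
  obtain ⟨q, hq⟩ := hπ.exists_over_toCenter hj
  set p : Over.mk (π ≫ G.hom) ⟶ G := Over.homMk π
  obtain ⟨m, hm⟩ := hπ.exists_over_lift hj _ (exists_lift_mul
    (exists_lift_comp (fst (Over.mk (π ≫ G.hom)) (Over.mk (π ≫ G.hom))) ⟨q, hq⟩)
    (exists_lift_comp (snd (Over.mk (π ≫ G.hom)) (Over.mk (π ≫ G.hom))) ⟨q, hq⟩))
  obtain ⟨e, he⟩ := hπ.exists_over_lift hj _ (exists_lift_one (i := i) (𝟙_ (Over S)))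
  obtain ⟨n, hn⟩ := hπ.exists_over_lift hj _ (exists_lift_inv ⟨q, hq⟩)
  have he' : e ≫ p = η[G] := by
    rw [he, Hom.one_def, toUnit_unit, Category.id_comp]
  have hm' : m ≫ p = (p ⊗ₘ p) ≫ μ[G] := by
    rw [hm, Hom.mul_def]
    congr 1
  have hn' : n ≫ p = p ≫ ι[G] := by
    rw [hn, Hom.inv_def]
  refine ⟨grpObjOfHomExt (G := G) p m e n hm' he' hn' (fun f g ↦ hπ.over_hom_ext hj)
    (fun f g ↦ hπ.over_hom_ext hj), @IsMonHom.mk _ _ _ _ _ (_) _ _ he' hm', ?_⟩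
  intro K hK
  -- A group structure is determined by its multiplication, and the multiplication by its composite
  -- with `π`.
  apply GrpObj.ext
  apply MonObj.ext
  apply hπ.over_hom_ext hj
  exact (IsMonHom.mul_hom p).trans hm'.symm

lemma IsNeronBlowup.isMonHom_lift [GrpObj (Over.mk (π ≫ G.hom))]
    [IsMonHom (Over.homMk π : Over.mk (π ≫ G.hom) ⟶ G)] {T : Over S} [GrpObj T] [Flat T.hom]
    {f : T ⟶ G} [IsMonHom f] {g : T ⟶ Over.mk (π ≫ G.hom)}
    (hg : g ≫ (Over.homMk π : Over.mk (π ≫ G.hom) ⟶ G) = f) : IsMonHom g := by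
  constructor
  · apply hπ.over_hom_ext hj
    rw [Category.assoc, hg, IsMonHom.one_hom f, IsMonHom.one_hom]
  · apply hπ.over_hom_ext hj
    rw [Category.assoc, hg, IsMonHom.mul_hom f, Category.assoc]
    have h2 : μ ≫ (Over.homMk π : Over.mk (π ≫ G.hom) ⟶ G) = _ := IsMonHom.mul_hom _
    rw [h2, tensorHom_comp_tensorHom_assoc, hg]

end GroupStructure

/-! ### Homomorphisms tested after a monomorphism, and kernels -/

section CenterHom

variable {C : Type*} [Category C] [CartesianMonoidalCategory C]

lemma isMonHom_of_comp_mono {A B D : C} [MonObj A] [MonObj B] [MonObj D] {f : A ⟶ B} (i : B ⟶ D)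
    [Mono i] [IsMonHom i] [h : IsMonHom (f ≫ i)] : IsMonHom f := by
  constructor
  · rw [← cancel_mono i, Category.assoc, IsMonHom.one_hom, IsMonHom.one_hom]
  · rw [← cancel_mono i, Category.assoc, IsMonHom.mul_hom (f ≫ i), Category.assoc,
      IsMonHom.mul_hom i, tensorHom_comp_tensorHom_assoc]

lemma isMonHom_of_comp_eq {A B D : C} [MonObj A] [MonObj B] [MonObj D] {f : A ⟶ B} {i : B ⟶ D}
    {g : A ⟶ D} [Mono i] [IsMonHom i] [h : IsMonHom g] (hg : f ≫ i = g) : IsMonHom f := by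
  subst hg
  exact isMonHom_of_comp_mono i

instance over_mono_of_left {S : Scheme.{u}} {T T' : Over S} (i : T ⟶ T') [Mono i.left] : Mono i :=
  Over.mono_of_mono_left i

end CenterHom

section Kernel

variable {C : Type*} [Category C] [CartesianMonoidalCategory C]

/-- The group structure on the kernel of a homomorphism. -/
theorem exists_grpObj_of_isPullback {K A B : C} [GrpObj A] [GrpObj B] {f : K ⟶ A} {q : A ⟶ B}
    [IsMonHom q] (h : IsPullback f (toUnit K) q η[B]) : ∃ _ : GrpObj K, IsMonHom f := by
  have hext : ∀ {T : C} (a b : T ⟶ K), a ≫ f = b ≫ f → a = b := fun a b hab ↦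
    h.hom_ext hab (toUnit_unique _ _)
  have hf : f ≫ q = 1 := by rw [h.w]; rfl
  have hex : ∀ {T : C} (a : T ⟶ A), a ≫ q = 1 → ∃ b, b ≫ f = a := fun a ha ↦
    ⟨h.lift a (toUnit _) ha, h.lift_fst _ _ _⟩
  obtain ⟨m, hm⟩ := hex ((fst K K ≫ f) * (snd K K ≫ f)) (by
    rw [MonObj.mul_comp, Category.assoc, Category.assoc, hf, MonObj.comp_one, MonObj.comp_one,
      one_mul])
  obtain ⟨e, he⟩ := hex (1 : 𝟙_ C ⟶ A) (by rw [MonObj.one_comp])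
  obtain ⟨n, hn⟩ := hex f⁻¹ (by rw [GrpObj.inv_comp, hf, inv_one])
  have he' : e ≫ f = η[A] := by
    rw [he, Hom.one_def, toUnit_unit, Category.id_comp]
  have hm' : m ≫ f = (f ⊗ₘ f) ≫ μ[A] := by
    rw [hm, Hom.mul_def]
    congr 1
    ext1 <;> simp
  have hn' : n ≫ f = f ≫ ι[A] := by
    rw [hn, Hom.inv_def]
  exact ⟨grpObjOfHomExt f m e n hm' he' hn' hext hext, @IsMonHom.mk _ _ _ _ _ (_) _ _ he' hm'⟩

end Kernel

/-! ### Base change of exact sequences -/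

section ShortExact

variable {S S' : Scheme.{u}}

lemma isPullback_map_left {A B : Over S} (q : A ⟶ B) (g : S' ⟶ S) :
    IsPullback (pullback.fst A.hom g) ((Over.pullback g).map q).left q.left
      (pullback.fst B.hom g) := by
  have h1 : IsPullback (pullback.fst B.hom g) (pullback.snd B.hom g) B.hom g :=
    IsPullback.of_hasPullback _ _
  have h2 : IsPullback (pullback.fst A.hom g) (pullback.snd A.hom g) A.hom g :=
    IsPullback.of_hasPullback _ _
  refine IsPullback.of_bot ?_ ?_ h1
  · have e1 : ((Over.pullback g).map q).left ≫ pullback.snd B.hom g = pullback.snd A.hom g :=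
      Over.w ((Over.pullback g).map q)
    have e2 : q.left ≫ B.hom = A.hom := Over.w q
    rw [e1, e2]
    exact h2
  · exact (pullback.lift_fst _ _ _).symm

instance isMonHom_map {A B : Over S} [GrpObj A] [GrpObj B] (q : A ⟶ B) [IsMonHom q] (g : S' ⟶ S) :
    IsMonHom ((Over.pullback g).map q) := inferInstance

/-- Base change preserves pullback squares, and the three conditions on `q` are stable under it. It
serves to restrict a global sequence to open subsets of the base. -/
lemma IsShortExact.pullback {A B D : Over S} [GrpObj A] [GrpObj B] [GrpObj D] {f : A ⟶ B}
    {q : B ⟶ D} (h : IsShortExact f q) (g : S' ⟶ S) :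
    IsShortExact ((Over.pullback g).map f) ((Over.pullback g).map q) := by
  have := h.isMonHom_left
  have := h.isMonHom_right
  have := h.flat
  have := h.surjective
  have := h.locallyOfFinitePresentation
  have hp := isPullback_map_left q g
  refine ⟨inferInstance, inferInstance, ?_, ?_, ?_, ?_⟩
  · have h1 := h.isPullback.map (Over.pullback g)
    refine IsPullback.of_iso h1 (Iso.refl _) (Iso.refl _)
      (Functor.Monoidal.εIso (Over.pullback g)).symm (Iso.refl _) ?_ ?_ ?_ ?_
    · simp
    · exact toUnit_unique _ _
    · simp
    · simp
  · exact MorphismProperty.of_isPullback hp ‹_›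
  · exact MorphismProperty.of_isPullback hp ‹_›
  · exact MorphismProperty.of_isPullback hp ‹_›

end ShortExact

/-! ### Linear forms with values in functions -/

section Functions

variable {X Y T : Scheme.{u}}

/-- The restriction of functions to a smaller open subset. -/
def resFun {U V : X.Opens} (h : V ≤ U) : Γ(X, U) →+* Γ(X, V) := (X.presheaf.map (homOfLE h).op).hom

lemma resFun_resFun {U V W : X.Opens} (h : V ≤ U) (h' : W ≤ V) (a : Γ(X, U)) :
    resFun h' (resFun h a) = resFun (h'.trans h) a := presheaf_map_map h h' a

@[simp]
lemma resFun_self {U : X.Opens} (a : Γ(X, U)) : resFun le_rfl a = a := by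
  change (X.presheaf.map (𝟙 _)).hom a = _
  rw [X.presheaf.map_id]
  rfl

lemma appLE_resFun (f : X ⟶ Y) {U V : Y.Opens} {W : X.Opens} (h : V ≤ U) (h' : W ≤ f ⁻¹ᵁ V)
    (a : Γ(Y, U)) :
    (f.appLE V W h').hom (resFun h a) = (f.appLE U W (h'.trans (f.preimage_mono h))).hom a := by
  rw [resFun, ← CommRingCat.comp_apply, Scheme.Hom.map_appLE]

lemma resFun_appLE (f : X ⟶ Y) {U : Y.Opens} {V W : X.Opens} (h : V ≤ f ⁻¹ᵁ U) (h' : W ≤ V)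
    (a : Γ(Y, U)) :
    resFun h' ((f.appLE U V h).hom a) = (f.appLE U W (h'.trans h)).hom a := by
  rw [resFun, ← CommRingCat.comp_apply, Scheme.Hom.appLE_map]

lemma resFun_app (f : X ⟶ Y) {U : Y.Opens} {W : X.Opens} (h' : W ≤ f ⁻¹ᵁ U)
    (a : Γ(Y, U)) :
    resFun h' ((f.app U).hom a) = (f.appLE U W h').hom a := rfl

lemma app_resFun (f : X ⟶ Y) {U V : Y.Opens} (h : V ≤ U) (a : Γ(Y, U)) :
    (f.app V).hom (resFun h a) = resFun (f.preimage_mono h) ((f.app U).hom a) := by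
  rw [resFun_app, Scheme.Hom.app_eq_appLE, appLE_resFun]

/-- Functions which agree locally are equal. -/
lemma fun_ext {O : X.Opens} {a a' : Γ(X, O)}
    (h : ∀ x ∈ O, ∃ (W : X.Opens) (hW : W ≤ O), x ∈ W ∧ resFun hW a = resFun hW a') : a = a' := by
  choose! W hW hx he using h
  refine X.sheaf.eq_of_locally_eq' (fun x : O ↦ W x.1) O (fun x ↦ homOfLE (hW x.1 x.2)) ?_ _ _
    fun x ↦ he x.1 x.2
  exact fun x hxO ↦ Opens.mem_iSup.mpr ⟨⟨x, hxO⟩, hx x hxO⟩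

/-- Functions can be constructed locally. -/
lemma exists_fun_of_local {O : X.Opens} (P : ∀ (W : X.Opens), Γ(X, W) → Prop)
    (hP : ∀ (W W' : X.Opens) (h : W' ≤ W) (a : Γ(X, W)), P W a → P W' (resFun h a))
    (huniq : ∀ (W : X.Opens) (a a' : Γ(X, W)), P W a → P W a' → a = a')
    (hloc : ∀ x ∈ O, ∃ W ≤ O, x ∈ W ∧ ∃ a, P W a) :
    ∃ a : Γ(X, O), ∀ x ∈ O, ∃ (W : X.Opens) (h : W ≤ O), x ∈ W ∧ P W (resFun h a) := by
  choose! W hW hx a ha using hloc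
  obtain ⟨s, hs, -⟩ := X.sheaf.existsUnique_gluing' (fun x : O ↦ W x.1) O
    (fun x ↦ homOfLE (hW x.1 x.2)) (fun x hxO ↦ Opens.mem_iSup.mpr ⟨⟨x, hxO⟩, hx x hxO⟩)
    (fun x ↦ a x.1) (fun x y ↦ huniq _ _ _ (hP _ _ inf_le_left _ (ha x.1 x.2))
      (hP _ _ inf_le_right _ (ha y.1 y.2)))
  refine ⟨s, fun x hxO ↦ ⟨W x, hW x hxO, hx x hxO, ?_⟩⟩
  have : resFun (hW x hxO) s = a x := hs ⟨x, hxO⟩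
  rw [this]
  exact ha x hxO

end Functions

/-- A linear form on the `𝒪_X`-module `M` with values in the functions on open subschemes of `Ω`,
where `k : T ⟶ X` and `Ω ⊆ T` is open. -/
@[ext]
structure LinForm {X T : Scheme.{u}} (M : X.Modules) (k : T ⟶ X) (Ω : T.Opens) where
  -- Values are recorded on every open `O ≤ k⁻¹W` inside `Ω`, so that forms over `Ω` can be
  -- restricted and multiplied without passing to the open subscheme.
  toFun : ∀ (W : X.Opens) (O : T.Opens), O ≤ Ω → O ≤ k ⁻¹ᵁ W → Γ(M, W) →+ Γ(T, O)
  map_smul : ∀ (W : X.Opens) (O : T.Opens) (hO : O ≤ Ω) (h : O ≤ k ⁻¹ᵁ W) (a : Γ(X, W))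
    (m : Γ(M, W)), toFun W O hO h (a • m) = (k.appLE W O h).hom a * toFun W O hO h m
  map_res : ∀ (W W' : X.Opens) (O O' : T.Opens) (hO : O ≤ Ω) (h : O ≤ k ⁻¹ᵁ W) (hW : W' ≤ W)
    (hO' : O' ≤ O) (h' : O' ≤ k ⁻¹ᵁ W') (m : Γ(M, W)),
    toFun W' O' (hO'.trans hO) h' (res hW m) = resFun hO' (toFun W O hO h m)

/-! ### Linear forms are morphisms of modules -/

section Modules

variable {X Y T : Scheme.{u}}

lemma res_add {M : X.Modules} {U V : X.Opens} (h : V ≤ U) (m n : Γ(M, U)) :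
    res h (m + n) = res h m + res h n := map_add _ _ _

lemma res_smul {M : X.Modules} {U V : X.Opens} (h : V ≤ U) (a : Γ(X, U)) (m : Γ(M, U)) :
    res h (a • m) = X.presheaf.map (homOfLE h).op a • res h m := M.map_smul (homOfLE h) a m

lemma res_res {M : X.Modules} {U V W : X.Opens} (h : V ≤ U) (h' : W ≤ V) (m : Γ(M, U)) :
    res h' (res h m) = res (h'.trans h) m := by
  change (M.presheaf.map _ ≫ M.presheaf.map _).hom m = _
  rw [← M.presheaf.map_comp]
  rfl

lemma res_self {M : X.Modules} {U : X.Opens} (m : Γ(M, U)) : res le_rfl m = m := by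
  change (M.presheaf.map (𝟙 _)).hom m = _
  rw [M.presheaf.map_id]
  rfl

lemma app_res {M N : X.Modules} (φ : M ⟶ N) {U V : X.Opens} (h : V ≤ U) (m : Γ(M, U)) :
    (φ.app V).hom (res h m) = res h ((φ.app U).hom m) :=
  ConcreteCategory.congr_hom (φ.mapPresheaf.naturality (homOfLE h).op) m

/-- The morphism of modules defined by a linear form. -/
def LinForm.hom {M : X.Modules} {k : T ⟶ X} (φ : LinForm M k ⊤) :
    M ⟶ (Scheme.Modules.pushforward k).obj (structureSheaf T) :=
  ⟨PresheafOfModules.homMk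
    { app := fun W ↦ AddCommGrpCat.ofHom (φ.toFun W.unop (k ⁻¹ᵁ W.unop) le_top le_rfl)
      naturality := fun W W' f ↦ by
        ext m
        exact φ.map_res W.unop W'.unop (k ⁻¹ᵁ W.unop) (k ⁻¹ᵁ W'.unop) le_top le_rfl f.unop.le
          (k.preimage_mono f.unop.le) le_rfl m }
    (fun W a m ↦ by
      refine (φ.map_smul W.unop (k ⁻¹ᵁ W.unop) le_top le_rfl a m).trans ?_
      rw [Scheme.Hom.appLE_eq_app]
      rfl)⟩

lemma LinForm.hom_app {M : X.Modules} {k : T ⟶ X} (φ : LinForm M k ⊤) (W : X.Opens) (m : Γ(M, W)) :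
    (φ.hom.app W).hom m = φ.toFun W (k ⁻¹ᵁ W) le_top le_rfl m := rfl

/-- The linear form defined by a morphism of modules. -/
def LinForm.ofHom {M : X.Modules} {k : T ⟶ X}
    (ℓ : M ⟶ (Scheme.Modules.pushforward k).obj (structureSheaf T)) : LinForm M k ⊤ where
  toFun W O _ h := ((structureSheaf T).presheaf.map (homOfLE h).op).hom.comp (ℓ.app W).hom
  map_smul W O _ h a m := by
    change res (M := structureSheaf T) h ((ℓ.app W).hom (a • m)) = _
    have h1 : (ℓ.app W).hom (a • m) = a • (ℓ.app W).hom m := ℓ.app_smul a m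
    rw [h1]
    exact res_smul (M := structureSheaf T) h ((k.app W).hom a) _
  map_res W W' O O' _ h hW hO' h' m := by
    change res (M := structureSheaf T) h' ((ℓ.app W').hom (res hW m)) =
      res (M := structureSheaf T) hO' (res (M := structureSheaf T) h ((ℓ.app W).hom m))
    rw [app_res]
    exact (res_res (M := structureSheaf T) (k.preimage_mono hW) h' _).trans
      (res_res (M := structureSheaf T) h hO' _).symm

lemma LinForm.ofHom_apply {M : X.Modules} {k : T ⟶ X}
    (ℓ : M ⟶ (Scheme.Modules.pushforward k).obj (structureSheaf T)) (W O hO h) (m : Γ(M, W)) :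
    (LinForm.ofHom ℓ).toFun W O hO h m = res (M := structureSheaf T) h ((ℓ.app W).hom m) := rfl

lemma LinForm.ofHom_injective {M : X.Modules} {k : T ⟶ X} :
    Function.Injective
      (LinForm.ofHom : (M ⟶ (Scheme.Modules.pushforward k).obj (structureSheaf T)) →
      LinForm M k ⊤) := by
  intro ℓ ℓ' h
  ext W m
  have := congrArg (fun φ : LinForm M k ⊤ ↦ φ.toFun W (k ⁻¹ᵁ W) le_top le_rfl m) h
  simp only [LinForm.ofHom_apply] at this
  exact (res_self (M := structureSheaf T) _).symm.trans
    (this.trans (res_self (M := structureSheaf T) _))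

lemma LinForm.ofHom_hom {M : X.Modules} {k : T ⟶ X} (φ : LinForm M k ⊤) :
    LinForm.ofHom φ.hom = φ := by
  ext W O hO h m
  rw [LinForm.ofHom_apply, LinForm.hom_app]
  refine (φ.map_res W W _ O le_top le_rfl le_rfl h h m).symm.trans ?_
  rw [res_self]

end Modules

/-! ### Operations on linear forms -/

section FormAlgebra

variable {X Y T : Scheme.{u}} {M : X.Modules} {k : T ⟶ X} {Ω : T.Opens}

lemma image_le_preimage {O : Ω.toScheme.Opens} {W : X.Opens} (h : O ≤ (Ω.ι ≫ k) ⁻¹ᵁ W) :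
    Ω.ι ''ᵁ O ≤ k ⁻¹ᵁ W := by
  rintro _ ⟨x, hx, rfl⟩
  exact h hx

lemma ι_comp_appLE_apply {O : Ω.toScheme.Opens} {W : X.Opens} (h : O ≤ (Ω.ι ≫ k) ⁻¹ᵁ W)
    (a : Γ(X, W)) :
    ((Ω.ι ≫ k).appLE W O h).hom a = (k.appLE W (Ω.ι ''ᵁ O) (image_le_preimage h)).hom a := by
  have h1 := appLE_appLE_apply Ω.ι k (U := W) (V := k ⁻¹ᵁ W) le_rfl h h a
  have h2 : Ω.ι.appLE (k ⁻¹ᵁ W) O h =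
    T.presheaf.map (homOfLE (image_le_preimage h)).op := Scheme.Opens.ι_appLE _ _ _ _
  have h3 := resFun_appLE k le_rfl (image_le_preimage h) a
  exact h1.symm.trans ((congrArg (fun f ↦ f.hom ((k.appLE W (k ⁻¹ᵁ W) le_rfl).hom a)) h2).trans h3)

lemma le_image_preimage {O : T.Opens} (hO : O ≤ Ω) : O ≤ Ω.ι ''ᵁ (Ω.ι ⁻¹ᵁ O) :=
  fun x hx ↦ ⟨⟨x, hO hx⟩, hx, rfl⟩

lemma ι_preimage_le {O : T.Opens} {W : X.Opens} (h : O ≤ k ⁻¹ᵁ W) :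
    Ω.ι ⁻¹ᵁ O ≤ (Ω.ι ≫ k) ⁻¹ᵁ W := Ω.ι.preimage_mono h

lemma le_preimage_preimage {t : T ⟶ Y} {f : Y ⟶ X} {O : T.Opens} {W : X.Opens}
    (h : O ≤ (t ≫ f) ⁻¹ᵁ W) : O ≤ t ⁻¹ᵁ (f ⁻¹ᵁ W) := h

/-- Functions on the open subscheme `Ω ∩ O` of `Ω` as functions on `O ≤ Ω`. -/
def opensFun {O : T.Opens} (hO : O ≤ Ω) : Γ(Ω, Ω.ι ⁻¹ᵁ O) →+* Γ(T, O) :=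
  (show Γ(Ω, Ω.ι ⁻¹ᵁ O) ⟶ Γ(T, O) from
    T.presheaf.map (homOfLE (le_image_preimage hO)).op).hom

lemma opensFun_appLE {O : T.Opens} (hO : O ≤ Ω) {W : X.Opens} (h : O ≤ k ⁻¹ᵁ W) (a : Γ(X, W)) :
    opensFun hO (((Ω.ι ≫ k).appLE W (Ω.ι ⁻¹ᵁ O) (Ω.ι.preimage_mono h)).hom a) =
      (k.appLE W O h).hom a :=
  (congrArg (resFun (X := T) (le_image_preimage hO)) (ι_comp_appLE_apply _ a)).trans
    (resFun_appLE k _ _ a)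

lemma opensFun_res {O O' : T.Opens} (hO : O ≤ Ω) (hO' : O' ≤ O) (a : Γ(Ω, Ω.ι ⁻¹ᵁ O)) :
    opensFun (hO'.trans hO) (resFun (Ω.ι.preimage_mono hO') a) = resFun hO' (opensFun hO a) :=
  (resFun_resFun (X := T) (Ω.ι.image_mono (Ω.ι.preimage_mono hO'))
      (le_image_preimage (hO'.trans hO)) _).trans
      (resFun_resFun (X := T) (le_image_preimage hO) hO' _).symm

namespace LinForm

lemma resFun_toFun (φ : LinForm M k Ω) (W : X.Opens) (O O' : T.Opens) (hO : O ≤ Ω)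
    (h : O ≤ k ⁻¹ᵁ W) (hO' : O' ≤ O) (m : Γ(M, W)) :
    resFun hO' (φ.toFun W O hO h m) = φ.toFun W O' (hO'.trans hO) (hO'.trans h) m := by
  have := φ.map_res W W O O' hO h le_rfl hO' (hO'.trans h) m
  rwa [res_self, eq_comm] at this

lemma toFun_res (φ : LinForm M k Ω) (W W' : X.Opens) (O : T.Opens) (hO : O ≤ Ω)
    (hW : W' ≤ W) (h' : O ≤ k ⁻¹ᵁ W') (m : Γ(M, W)) :
    φ.toFun W' O hO h' (res hW m) = φ.toFun W O hO (h'.trans (k.preimage_mono hW)) m := by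
  have := φ.map_res W W' O O hO (h'.trans (k.preimage_mono hW)) hW le_rfl h' m
  rwa [resFun_self] at this

instance : Add (LinForm M k Ω) where
  add φ ψ :=
    { toFun := fun W O hO h ↦ φ.toFun W O hO h + ψ.toFun W O hO h
      map_smul := fun W O hO h a m ↦ by
        simp only [AddMonoidHom.add_apply, φ.map_smul, ψ.map_smul, mul_add]
      map_res := fun W W' O O' hO h hW hO' h' m ↦ by
        simp only [AddMonoidHom.add_apply, φ.map_res W W' O O' hO h hW hO' h',
          ψ.map_res W W' O O' hO h hW hO' h', map_add] }

lemma add_toFun (φ ψ : LinForm M k Ω) (W O hO h) (m : Γ(M, W)) :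
    (φ + ψ).toFun W O hO h m = φ.toFun W O hO h m + ψ.toFun W O hO h m := rfl

instance : SMul Γ(T, Ω) (LinForm M k Ω) where
  smul r φ :=
    { toFun := fun W O hO h ↦ (AddMonoidHom.mulLeft (resFun hO r)).comp (φ.toFun W O hO h)
      map_smul := fun W O hO h a m ↦ by
        simp only [AddMonoidHom.comp_apply, AddMonoidHom.coe_mulLeft, φ.map_smul]
        ring
      map_res := fun W W' O O' hO h hW hO' h' m ↦ by
        simp only [AddMonoidHom.comp_apply, AddMonoidHom.coe_mulLeft,
          φ.map_res W W' O O' hO h hW hO' h', map_mul, resFun_resFun] }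

lemma smul_toFun (r : Γ(T, Ω)) (φ : LinForm M k Ω) (W O hO h) (m : Γ(M, W)) :
    (r • φ).toFun W O hO h m = resFun hO r * φ.toFun W O hO h m := rfl

/-- The restriction of a linear form to a smaller open subscheme. -/
def restrict (φ : LinForm M k Ω) {Ω' : T.Opens} (h : Ω' ≤ Ω) : LinForm M k Ω' where
  toFun W O hO hW := φ.toFun W O (hO.trans h) hW
  map_smul W O _ hW := φ.map_smul W O _ hW
  map_res W W' O O' _ hW hWW' := φ.map_res W W' O O' _ hW hWW'

/-- The form on the scheme `Ω` defined by a form on the open subset `Ω` of `T`. -/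
def ofOpen (φ : LinForm M k Ω) : LinForm M (Ω.ι ≫ k) ⊤ where
  toFun W O _ h := φ.toFun W (Ω.ι ''ᵁ O) (Scheme.Opens.ι_image_le Ω O) (image_le_preimage h)
  map_smul W O _ h a m := by
    refine (φ.map_smul _ _ _ _ _ _).trans ?_
    congr 1
    exact (ι_comp_appLE_apply h a).symm
  map_res W W' O O' _ h hW hO' h' m :=
    φ.map_res W W' (Ω.ι ''ᵁ O) (Ω.ι ''ᵁ O') _ _ hW (Ω.ι.image_mono hO') _ m

/-- The form on the open subset `Ω` of `T` defined by a form on the scheme `Ω`. -/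
def toOpen (φ : LinForm M (Ω.ι ≫ k) ⊤) : LinForm M k Ω where
  toFun W O hO h := (opensFun hO : _ →+ _).comp
      (φ.toFun W (Ω.ι ⁻¹ᵁ O) le_top (ι_preimage_le h))
  map_smul W O hO h a m := by
    change opensFun hO (φ.toFun W (Ω.ι ⁻¹ᵁ O) le_top (ι_preimage_le h) (a • m)) =
      _ * opensFun hO (φ.toFun W (Ω.ι ⁻¹ᵁ O) le_top (ι_preimage_le h) m)
    rw [φ.map_smul, map_mul, opensFun_appLE]
  map_res W W' O O' hO h hW hO' h' m := by
    change opensFun (hO'.trans hO) (φ.toFun W' (Ω.ι ⁻¹ᵁ O') le_top (ι_preimage_le h')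
      (res hW m)) = resFun hO' (opensFun hO (φ.toFun W (Ω.ι ⁻¹ᵁ O) le_top (ι_preimage_le h) m))
    rw [φ.map_res W W' (Ω.ι ⁻¹ᵁ O) (Ω.ι ⁻¹ᵁ O') le_top (ι_preimage_le h) hW
        (Ω.ι.preimage_mono hO') (ι_preimage_le h') m, opensFun_res]

lemma toOpen_toFun (φ : LinForm M (Ω.ι ≫ k) ⊤) (W O hO h) (m : Γ(M, W)) :
    (toOpen φ).toFun W O hO h m =
      opensFun hO (φ.toFun W (Ω.ι ⁻¹ᵁ O) le_top (ι_preimage_le h) m) := rfl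

lemma toOpen_ofOpen (φ : LinForm M k Ω) : toOpen (ofOpen φ) = φ := by
  ext W O hO h m
  rw [toOpen_toFun]
  exact φ.resFun_toFun W _ O (Scheme.Opens.ι_image_le Ω _)
    (image_le_preimage (ι_preimage_le h)) (le_image_preimage hO) m

lemma ofOpen_injective : Function.Injective (ofOpen : LinForm M k Ω → _) :=
  Function.LeftInverse.injective toOpen_ofOpen

/-- Forms along equal morphisms. -/
def congr {k' : T ⟶ X} (φ : LinForm M k Ω) (e : k = k') : LinForm M k' Ω where
  toFun W O hO h := φ.toFun W O hO (by rw [e]; exact h)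
  map_smul W O hO h a m := by
    rw [φ.map_smul]
    congr 1
    exact appLE_congr_apply e _ _ a
  map_res W W' O O' hO h hW hO' h' m := φ.map_res W W' O O' hO _ hW hO' _ m

/-- The form `m ↦ φ (f^* m)`. -/
def comapPullback {f : Y ⟶ X} {t : T ⟶ Y}
    (φ : LinForm ((Scheme.Modules.pullback f).obj M) t Ω) : LinForm M (t ≫ f) Ω where
  toFun W O hO h := (φ.toFun (f ⁻¹ᵁ W) O hO (le_preimage_preimage h)).comp
    (((Scheme.Modules.pullbackPushforwardAdjunction f).unit.app M).app W).hom
  map_smul W O hO h a m := by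
    have h1 : (((Scheme.Modules.pullbackPushforwardAdjunction f).unit.app M).app W).hom (a • m) =
      a • (((Scheme.Modules.pullbackPushforwardAdjunction f).unit.app M).app W).hom m :=
      Scheme.Modules.Hom.app_smul _ a m
    refine (congrArg (φ.toFun (f ⁻¹ᵁ W) O hO h) h1).trans ?_
    refine (φ.map_smul (f ⁻¹ᵁ W) O hO h ((f.app W).hom a) _).trans ?_
    exact congrArg (· * _) (appLE_app_apply t f h h a)
  map_res W W' O O' hO h hW hO' h' m := by
    refine (congrArg (φ.toFun (f ⁻¹ᵁ W') O' _ h') (app_res _ hW m)).trans ?_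
    exact φ.map_res (f ⁻¹ᵁ W) (f ⁻¹ᵁ W') O O' hO h (f.preimage_mono hW) hO' h' _

lemma comapPullback_toFun {f : Y ⟶ X} {t : T ⟶ Y}
    (φ : LinForm ((Scheme.Modules.pullback f).obj M) t Ω) (W O hO h) (m : Γ(M, W)) :
    φ.comapPullback.toFun W O hO h m =
      φ.toFun (f ⁻¹ᵁ W) O hO (le_preimage_preimage h) (pullbackSection f m) := rfl

lemma comapPullback_ofHom {f : Y ⟶ X} {t : T ⟶ Y} (ℓ : (Scheme.Modules.pullback f).obj M ⟶
      (Scheme.Modules.pushforward t).obj (structureSheaf T)) :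
    (ofHom ℓ).comapPullback =
      ofHom ((Scheme.Modules.pullbackPushforwardAdjunction f).homEquiv M _ ℓ ≫
        (Scheme.Modules.pushforwardComp t f).hom.app (structureSheaf T)) := by
  rw [Adjunction.homEquiv_unit]
  rfl

/-- The adjunction between pullback and pushforward of modules, in terms of forms. -/
lemma comapPullback_bijective_top {f : Y ⟶ X} {t : T ⟶ Y} :
    Function.Bijective
      (comapPullback : LinForm ((Scheme.Modules.pullback f).obj M) t ⊤ → LinForm M (t ≫ f) ⊤) := by
  constructor
  · intro ψ ψ' h
    rw [← ofHom_hom ψ, ← ofHom_hom ψ', comapPullback_ofHom, comapPullback_ofHom] at h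
    have h1 := (cancel_mono _).mp (ofHom_injective h)
    rw [← ofHom_hom ψ, ← ofHom_hom ψ', ((Scheme.Modules.pullbackPushforwardAdjunction
      f).homEquiv M _).injective h1]
  · intro φ
    refine ⟨ofHom (((Scheme.Modules.pullbackPushforwardAdjunction f).homEquiv M _).symm
      (φ.hom ≫ (Scheme.Modules.pushforwardComp t f).inv.app (structureSheaf T))), ?_⟩
    rw [comapPullback_ofHom, Equiv.apply_symm_apply, Category.assoc, Iso.inv_hom_id_app]
    exact (congrArg ofHom (Category.comp_id φ.hom)).trans (ofHom_hom φ)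

/-- Forms over an open `Ω` embed in forms over the scheme `Ω`, which reduces the assertion to the
case where all of the source is allowed. -/
lemma comapPullback_bijective {f : Y ⟶ X} {t : T ⟶ Y} :
    Function.Bijective
      (comapPullback : LinForm ((Scheme.Modules.pullback f).obj M) t Ω → LinForm M (t ≫ f) Ω) := by
  constructor
  · intro ψ ψ' h
    apply ofOpen_injective
    apply comapPullback_bijective_top.injective
    have h1 := congrArg ofOpen h
    ext W O hO hW m
    exact congrArg (fun φ ↦ φ.toFun W O hO hW m) h1
  · intro φ
    obtain ⟨ψ, hψ⟩ := (comapPullback_bijective_top (M := M) (f := f) (t := Ω.ι ≫ t)).surjective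
      ((ofOpen φ).congr (Category.assoc _ _ _).symm)
    refine ⟨toOpen ψ, ?_⟩
    ext W O hO h m
    have h0 : Ω.ι ⁻¹ᵁ O ≤ ((Ω.ι ≫ t) ≫ f) ⁻¹ᵁ W := Ω.ι.preimage_mono h
    have h1 := congrArg (fun φ ↦ φ.toFun W (Ω.ι ⁻¹ᵁ O) le_top h0 m) hψ
    have h2 : opensFun hO ((ofOpen φ).toFun W (Ω.ι ⁻¹ᵁ O) le_top (ι_preimage_le h) m) =
      φ.toFun W O hO h m := congrArg (fun φ ↦ φ.toFun W O hO h m) (toOpen_ofOpen φ)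
    rw [comapPullback_toFun, toOpen_toFun, ← h2]
    exact congrArg (opensFun hO) h1

end LinForm

end FormAlgebra

/-! ### Forms on `M ⊗ L^∨` as families of forms on `M` -/

section TensorDual

variable {X Y T : Scheme.{u}} {M L : X.Modules}

open Scheme.Modules in
/-- The universal morphism `tensorDualPresheaf M L ⟶ tensorDual M L`. -/
def toTensorDual (M L : X.Modules) : tensorDualPresheaf M L ⟶
    (PresheafOfModules.restrictScalars (𝟙 X.ringCatSheaf.obj)).obj
      ((SheafOfModules.forget _).obj (tensorDual M L)) :=
  (PresheafOfModules.sheafificationAdjunction (𝟙 X.ringCatSheaf.obj)).unit.app _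

/-- The linear map `m ⊗ δ ↦ m ⊗ δ` from the tensor product of modules of sections. -/
def tmulHom (M L : X.Modules) (U : X.Opens) :
    TensorProduct Γ(X, U) Γ(M, U) (dualSections L U) →ₗ[Γ(X, U)] Γ(tensorDual M L, U) where
  toFun z := ((toTensorDual M L).app (.op U)).hom z
  map_add' := ((toTensorDual M L).app (.op U)).hom.map_add
  map_smul' := ((toTensorDual M L).app (.op U)).hom.map_smul

lemma tmulHom_tmul {U : X.Opens} (m : Γ(M, U)) (δ : dualSections L U) :
    tmulHom M L U (TensorProduct.tmul Γ(X, U) m δ) = tmul m δ := rfl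

lemma tmul_add {U : X.Opens} (m : Γ(M, U)) (δ δ' : dualSections L U) :
    tmul m (δ + δ') = tmul m δ + tmul m δ' := by
  simp only [← tmulHom_tmul, TensorProduct.tmul_add, map_add]

lemma add_tmul {U : X.Opens} (m m' : Γ(M, U)) (δ : dualSections L U) :
    tmul (m + m') δ = tmul m δ + tmul m' δ := by
  simp only [← tmulHom_tmul, TensorProduct.add_tmul, map_add]

lemma smul_tmul {U : X.Opens} (a : Γ(X, U)) (m : Γ(M, U)) (δ : dualSections L U) :
    tmul (a • m) δ = a • tmul m δ := by
  rw [← tmulHom_tmul, ← TensorProduct.smul_tmul', LinearMap.map_smul, tmulHom_tmul]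

lemma tmul_smul {U : X.Opens} (a : Γ(X, U)) (m : Γ(M, U)) (δ : dualSections L U) :
    tmul m (a • δ) = a • tmul m δ := by
  rw [← tmulHom_tmul, TensorProduct.tmul_smul, LinearMap.map_smul, tmulHom_tmul]

lemma res_tmul {U V : X.Opens} (h : V ≤ U) (m : Γ(M, U)) (δ : dualSections L U) :
    res h (tmul m δ) = tmul (res h m) (dualSections.restrict L h δ) := by
  have := PresheafOfModules.naturality_apply (toTensorDual M L) (homOfLE h).op
    (TensorProduct.tmul Γ(X, U) m δ)
  exact this.symm

lemma le_preimage_inf {t : T ⟶ X} {O : T.Opens} {U W : X.Opens} (h : O ≤ t ⁻¹ᵁ U)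
    (h' : O ≤ t ⁻¹ᵁ W) : O ≤ t ⁻¹ᵁ (U ⊓ W) := le_inf h h'

/-- A linear map from sections of the dual of `L` to forms on `M`. -/
structure DualFamily (L : Y.Modules) (t : T ⟶ Y) (M : X.Modules) (k : T ⟶ X) where
  -- `L` and `M` may live on different schemes, related only through `T`: the dual may live on `H`
  -- or `S₀` while the forms are on an ideal sheaf of `G₀` or `S`.
  form : ∀ U : Y.Opens, dualSections L U → LinForm M k (t ⁻¹ᵁ U)
  form_add : ∀ (U : Y.Opens) (δ δ' : dualSections L U), form U (δ + δ') = form U δ + form U δ'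
  form_smul : ∀ (U : Y.Opens) (a : Γ(Y, U)) (δ : dualSections L U),
    form U (a • δ) = (t.app U).hom a • form U δ
  form_restrict : ∀ (U V : Y.Opens) (h : V ≤ U) (δ : dualSections L U),
    form V (dualSections.restrict L h δ) = (form U δ).restrict (t.preimage_mono h)

namespace LinForm

/-- The map `m ↦ φ (m ⊗ δ)`. -/
def contractHom {t : T ⟶ X} (φ : LinForm (tensorDual M L) t ⊤) {U : X.Opens} (δ : dualSections L U)
    (W : X.Opens) (O : T.Opens) (h : O ≤ t ⁻¹ᵁ (U ⊓ W)) : Γ(M, W) →+ Γ(T, O) :=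
  AddMonoidHom.mk' (fun m ↦ φ.toFun (U ⊓ W) O le_top h
        (tmul (res inf_le_right m) (dualSections.restrict L inf_le_left δ)))
    fun m m' ↦ by rw [res_add, add_tmul, map_add]

lemma contractHom_apply {t : T ⟶ X} (φ : LinForm (tensorDual M L) t ⊤) {U : X.Opens}
    (δ : dualSections L U) (W : X.Opens) (O : T.Opens) (h : O ≤ t ⁻¹ᵁ (U ⊓ W)) (m : Γ(M, W)) :
    φ.contractHom δ W O h m = φ.toFun (U ⊓ W) O le_top h
        (tmul (res inf_le_right m) (dualSections.restrict L inf_le_left δ)) := rfl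

lemma contractHom_smul {t : T ⟶ X} (φ : LinForm (tensorDual M L) t ⊤) {U : X.Opens}
    (δ : dualSections L U) (W : X.Opens) (O : T.Opens) (h : O ≤ t ⁻¹ᵁ (U ⊓ W)) (hW : O ≤ t ⁻¹ᵁ W)
    (a : Γ(X, W)) (m : Γ(M, W)) :
    φ.contractHom δ W O h (a • m) = (t.appLE W O hW).hom a * φ.contractHom δ W O h m := by
  rw [contractHom_apply, res_smul, smul_tmul, φ.map_smul]
  congr 1
  exact appLE_resFun t _ _ a

lemma res_tmul_res {U V W : X.Opens} (δ : dualSections L U) (h : V ≤ W) (m : Γ(M, W)) :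
    tmul (res inf_le_right (res h m)) (dualSections.restrict L inf_le_left δ) =
      res (inf_le_inf le_rfl h : U ⊓ V ≤ U ⊓ W)
        (tmul (res inf_le_right m) (dualSections.restrict L inf_le_left δ)) := by
  rw [res_tmul, res_res, res_res]
  rfl

lemma contractHom_res {t : T ⟶ X} (φ : LinForm (tensorDual M L) t ⊤) {U : X.Opens}
    (δ : dualSections L U) (W W' : X.Opens) (O O' : T.Opens) (h : O ≤ t ⁻¹ᵁ (U ⊓ W))
    (h' : O' ≤ t ⁻¹ᵁ (U ⊓ W')) (hW : W' ≤ W) (hO' : O' ≤ O) (m : Γ(M, W)) :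
    φ.contractHom δ W' O' h' (res hW m) = resFun hO' (φ.contractHom δ W O h m) := by
  rw [contractHom_apply, contractHom_apply, res_tmul_res]
  exact φ.map_res (U ⊓ W) (U ⊓ W') O O' le_top h (inf_le_inf le_rfl hW) hO' h' _

/-- The form `m ↦ φ (m ⊗ δ)`. -/
def contract {t : T ⟶ X} (φ : LinForm (tensorDual M L) t ⊤) {U : X.Opens} (δ : dualSections L U) :
    LinForm M t (t ⁻¹ᵁ U) where
  toFun W O hO h := φ.contractHom δ W O (le_preimage_inf hO h)
  map_smul W O _ h a m := φ.contractHom_smul δ W O _ h a m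
  map_res W W' O O' _ _ hW hO' _ m := φ.contractHom_res δ W W' O O' _ _ hW hO' m

lemma contract_toFun {t : T ⟶ X} (φ : LinForm (tensorDual M L) t ⊤) {U : X.Opens}
    (δ : dualSections L U) (W O hO h) (m : Γ(M, W)) :
    (φ.contract δ).toFun W O hO h m = φ.toFun (U ⊓ W) O le_top (le_preimage_inf hO h)
        (tmul (res inf_le_right m) (dualSections.restrict L inf_le_left δ)) := rfl

lemma contract_toFun_self {t : T ⟶ X} (φ : LinForm (tensorDual M L) t ⊤) {U : X.Opens}
    (δ : dualSections L U) (O : T.Opens) (h : O ≤ t ⁻¹ᵁ U) (m : Γ(M, U)) :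
    (φ.contract δ).toFun U O h h m = φ.toFun U O le_top h (tmul m δ) := by
  rw [contract_toFun, ← res_tmul]
  exact φ.toFun_res U (U ⊓ U) O le_top inf_le_left _ _

lemma contractHom_restrict {t : T ⟶ X} (φ : LinForm (tensorDual M L) t ⊤) {U V : X.Opens}
    (hV : V ≤ U) (δ : dualSections L U) (W : X.Opens) (O : T.Opens) (h : O ≤ t ⁻¹ᵁ (V ⊓ W))
    (h' : O ≤ t ⁻¹ᵁ (U ⊓ W)) (m : Γ(M, W)) :
    φ.contractHom (dualSections.restrict L hV δ) W O h m = φ.contractHom δ W O h' m := by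
  rw [contractHom_apply, contractHom_apply,
    ← φ.toFun_res (U ⊓ W) (V ⊓ W) O le_top (inf_le_inf hV le_rfl) h, res_tmul, res_res]
  rfl

/-- The family of all contractions of a form on `M ⊗ L^∨`. -/
def toDualFamily {t : T ⟶ X} (φ : LinForm (tensorDual M L) t ⊤) : DualFamily L t M t where
  form U δ := φ.contract δ
  form_add U δ δ' := by
    ext W O hO h m
    rw [add_toFun, contract_toFun, contract_toFun, contract_toFun, map_add, tmul_add, map_add]
  form_smul U a δ := by
    ext W O hO h m
    rw [smul_toFun, contract_toFun, contract_toFun, dualSections.restrict_smul, tmul_smul,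
      φ.map_smul]
    congr 1
    exact (appLE_resFun t _ _ a).trans (resFun_app t _ a).symm
  form_restrict U V h δ := by
    ext W O hO h m
    exact φ.contractHom_restrict ‹V ≤ U› δ W O _ _ m

end LinForm

end TensorDual

/-! ### The universal property of `M ⊗ L^∨` -/

section TensorDualHom

variable {X T : Scheme.{u}} {M L : X.Modules} {t : T ⟶ X}

/-- Functions on the preimage of `U`, as a module over functions on `U`. -/
abbrev pushSections (t : T ⟶ X) (U : X.Opens) : Type u :=
  Γ((Scheme.Modules.pushforward t).obj (structureSheaf T), U)

namespace DualFamily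

/-- The map on tensor products of sections defined by a family of forms. -/
def lift (Φ : DualFamily L t M t) (U : X.Opens) :
    TensorProduct Γ(X, U) Γ(M, U) (dualSections L U) →ₗ[Γ(X, U)] pushSections t U :=
  TensorProduct.lift (LinearMap.mk₂ Γ(X, U)
    (fun m δ ↦ ((Φ.form U δ).toFun U (t ⁻¹ᵁ U) le_rfl le_rfl m : Γ(T, t ⁻¹ᵁ U)))
    (fun m m' δ ↦ map_add _ _ _)
    (fun a m δ ↦ by
      refine ((Φ.form U δ).map_smul _ _ _ _ a m).trans ?_
      rw [Scheme.Hom.appLE_eq_app]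
      rfl)
    (fun m δ δ' ↦ by rw [Φ.form_add]; rfl)
    (fun a m δ ↦ by
      rw [Φ.form_smul]
      exact congrArg (· * _) (resFun_self _)))

lemma lift_tmul (Φ : DualFamily L t M t) (U : X.Opens) (m : Γ(M, U)) (δ : dualSections L U) :
    Φ.lift U (TensorProduct.tmul _ m δ) = (Φ.form U δ).toFun U (t ⁻¹ᵁ U) le_rfl le_rfl m := rfl

lemma lift_map (Φ : DualFamily L t M t) {U V : X.Opens} (h : V ≤ U) (m : Γ(M, U))
    (δ : dualSections L U) :
    Φ.lift V (TensorProduct.tmul _ (res h m) (dualSections.restrict L h δ)) =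
      res (M := (Scheme.Modules.pushforward t).obj (structureSheaf T)) h
        (Φ.lift U (TensorProduct.tmul _ m δ)) := by
  rw [lift_tmul, lift_tmul, Φ.form_restrict U V h]
  exact (Φ.form U δ).map_res U V _ _ le_rfl le_rfl h (t.preimage_mono h) le_rfl m

/-- The morphism of presheaves of modules defined by a family of forms. -/
def presheafHom (Φ : DualFamily L t M t) : tensorDualPresheaf M L ⟶
    (PresheafOfModules.restrictScalars (𝟙 X.ringCatSheaf.obj)).obj
      ((SheafOfModules.forget _).obj
        ((Scheme.Modules.pushforward t).obj (structureSheaf T))) :=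
  PresheafOfModules.homMk
    { app := fun U ↦ AddCommGrpCat.ofHom (Φ.lift U.unop).toAddMonoidHom
      naturality := fun U V f ↦ by
        ext z
        induction z using TensorProduct.induction_on with
        | zero => exact (map_zero _).trans (map_zero _).symm
        | tmul m δ => exact Φ.lift_map f.unop.le m δ
        | add z w hz hw =>
          exact (map_add _ _ _).trans ((congrArg₂ (· + ·) hz hw).trans (map_add _ _ _).symm) }
    (fun U a z ↦ (Φ.lift U.unop).map_smul a z)

/-- The form on `M ⊗ L^∨` defined by a family of forms on `M`. -/
theorem exists_form (Φ : DualFamily L t M t) : ∃ φ : LinForm (tensorDual M L) t ⊤,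
    ∀ (U : X.Opens) (δ : dualSections L U), φ.contract δ = Φ.form U δ := by
  -- A family is a morphism out of the tensor product presheaf, which extends to the associated
  -- sheaf.
  let ℓ : tensorDual M L ⟶ (Scheme.Modules.pushforward t).obj (structureSheaf T) :=
    ((PresheafOfModules.sheafificationAdjunction (𝟙 X.ringCatSheaf.obj)).homEquiv _ _).symm
      Φ.presheafHom
  have hℓ : ∀ (U : X.Opens) (m : Γ(M, U)) (δ : dualSections L U),
      (ℓ.app U).hom (tmul m δ) = (Φ.form U δ).toFun U (t ⁻¹ᵁ U) le_rfl le_rfl m := by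
    intro U m δ
    have h1 := ((PresheafOfModules.sheafificationAdjunction
      (𝟙 X.ringCatSheaf.obj)).homEquiv _ _).apply_symm_apply Φ.presheafHom
    have h2 := congrArg (fun g ↦ (PresheafOfModules.Hom.app g (.op U)).hom
      (TensorProduct.tmul Γ(X, U) m δ)) h1
    exact h2
  refine ⟨LinForm.ofHom ℓ, fun U δ ↦ ?_⟩
  ext W O hO h m
  rw [LinForm.contract_toFun, LinForm.ofHom_apply, hℓ, Φ.form_restrict U (U ⊓ W) inf_le_left]
  have h1 := (Φ.form U δ).map_res W (U ⊓ W) (t ⁻¹ᵁ (U ⊓ W)) O (t.preimage_mono inf_le_left)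
    (t.preimage_mono inf_le_right) inf_le_right (le_preimage_inf hO h) (le_preimage_inf hO h) m
  rw [← (Φ.form U δ).toFun_res W (U ⊓ W) O hO inf_le_right (le_preimage_inf hO h)]
  exact ((Φ.form U δ).resFun_toFun _ _ O _ _ (le_preimage_inf hO h) _)

end DualFamily

/-- Morphisms from the associated sheaf are determined on the presheaf, where the pure tensors `m ⊗
δ` generate. -/
lemma LinForm.contract_injective {φ ψ : LinForm (tensorDual M L) t ⊤}
    (h : ∀ (U : X.Opens) (δ : dualSections L U), φ.contract δ = ψ.contract δ) : φ = ψ := by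
  rw [← ofHom_hom φ, ← ofHom_hom ψ]
  congr 1
  apply ((PresheafOfModules.sheafificationAdjunction (𝟙 X.ringCatSheaf.obj)).homEquiv
    (tensorDualPresheaf M L) ((Scheme.Modules.pushforward t).obj (structureSheaf T))).injective
  ext U z
  induction z using TensorProduct.induction_on with
  | zero => exact (map_zero _).trans (map_zero _).symm
  | tmul m δ =>
    have h1 := congrArg (fun f ↦ f.toFun U.unop (t ⁻¹ᵁ U.unop) le_rfl le_rfl m) (h U.unop δ)
    have h2 := (contract_toFun_self φ δ _ le_rfl m).symm.trans
      (h1.trans (contract_toFun_self ψ δ _ le_rfl m))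
    have h3 : ∀ χ : LinForm (tensorDual M L) t ⊤,
        χ.toFun U.unop (t ⁻¹ᵁ U.unop) le_top le_rfl (tmul m δ) =
          (χ.hom.app U.unop).hom (tmul m δ) := fun χ ↦ rfl
    rw [h3, h3] at h2
    exact h2
  | add z w hz hw =>
    exact (map_add _ _ _).trans ((congrArg₂ (· + ·) hz hw).trans (map_add _ _ _).symm)

end TensorDualHom

/-! ### Families of forms on a pulled back module -/

section PullbackFamily

variable {X Y Z T : Scheme.{u}}

/-- The forms are lifted one by one; linearity and compatibility with restriction survive because
the lifts are unique. -/
theorem DualFamily.exists_pullback {L : Y.Modules} {t : T ⟶ Y} {M : X.Modules} {f : Z ⟶ X}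
    {s : T ⟶ Z} (Φ : DualFamily L t M (s ≫ f)) :
    ∃ Ψ : DualFamily L t ((Scheme.Modules.pullback f).obj M) s,
      ∀ (U : Y.Opens) (δ : dualSections L U), (Ψ.form U δ).comapPullback = Φ.form U δ := by
  choose Ψ hΨ using fun (U : Y.Opens) (δ : dualSections L U) ↦
    LinForm.comapPullback_bijective.surjective (Φ.form U δ)
  refine ⟨⟨Ψ, fun U δ δ' ↦ ?_, fun U a δ ↦ ?_, fun U V h δ ↦ ?_⟩, hΨ⟩
  · apply LinForm.comapPullback_bijective.injective
    refine (hΨ _ _).trans ((Φ.form_add U δ δ').trans ?_)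
    rw [← hΨ, ← hΨ]
    rfl
  · apply LinForm.comapPullback_bijective.injective
    refine (hΨ _ _).trans ((Φ.form_smul U a δ).trans ?_)
    rw [← hΨ]
    rfl
  · apply LinForm.comapPullback_bijective.injective
    refine (hΨ _ _).trans ((Φ.form_restrict U V h δ).trans ?_)
    rw [← hΨ]
    rfl

end PullbackFamily

/-! ### Sections of ideal sheaves as functions -/

section IdealSheaf

variable {X Y Z : Scheme.{u}}

/-- The functor of sections over `U`. -/
abbrev sectionsFunctor (X : Scheme.{u}) (U : X.Opens) : X.Modules ⥤ Ab.{u} :=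
  Scheme.Modules.toPresheaf X ⋙ (evaluation _ _).obj (.op U)

instance (U : X.Opens) : PreservesLimits (sectionsFunctor X U) := by
  have : PreservesLimits ((evaluation (Opens X)ᵒᵖ Ab.{u}).obj (.op U)) :=
    ⟨fun {J} _ ↦ inferInstance⟩
  exact comp_preservesLimits _ _

instance (U : X.Opens) : (sectionsFunctor X U).PreservesZeroMorphisms where
  map_zero _ _ := rfl

variable {i : Z ⟶ X}

/-- The functor of sections over `U` preserves limits, so the kernel defining the ideal sheaf is
computed on sections. The same applies to `exists_toFunction_eq`. -/
lemma toFunction_injective (U : X.Opens) :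
    Function.Injective (toFunction : Γ(idealSheaf i, U) → Γ(X, U)) := by
  have h : Mono ((sectionsFunctor X U).map (kernel.ι (sharp i))) :=
    CategoryTheory.Functor.map_mono _ _
  exact (AddCommGrpCat.mono_iff_injective _).mp h

lemma exists_toFunction_eq {U : X.Opens} (a : Γ(X, U)) (ha : (i.app U).hom a = 0) :
    ∃ ξ : Γ(idealSheaf i, U), toFunction ξ = a := by
  let C : ShortComplex X.Modules := ShortComplex.mk (kernel.ι (sharp i)) (sharp i)
    (kernel.condition _)
  have hC : C.Exact := ShortComplex.exact_of_f_is_kernel _ (kernelIsKernel _)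
  have hE : (C.map (sectionsFunctor X U)).Exact := by
    have : Mono C.f := by dsimp [C]; infer_instance
    exact hC.map_of_mono_of_preservesKernel _ inferInstance inferInstance
  exact (ShortComplex.ab_exact_iff _).mp hE a ha

lemma app_toFunction {U : X.Opens} (ξ : Γ(idealSheaf i, U)) :
    (i.app U).hom (toFunction ξ) = 0 := by
  have h := congrArg (fun φ ↦ (φ.app U).hom ξ) (kernel.condition (sharp i))
  exact h

lemma toFunction_add {U : X.Opens} (ξ ξ' : Γ(idealSheaf i, U)) :
    toFunction (ξ + ξ') = toFunction ξ + toFunction ξ' := map_add _ _ _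

lemma toFunction_smul {U : X.Opens} (a : Γ(X, U)) (ξ : Γ(idealSheaf i, U)) :
    toFunction (a • ξ) = a * toFunction ξ :=
  ((kernel.ι (sharp i)).app_smul a ξ)

lemma toFunction_res {U V : X.Opens} (h : V ≤ U) (ξ : Γ(idealSheaf i, U)) :
    toFunction (res h ξ) = resFun h (toFunction ξ) := app_res (kernel.ι (sharp i)) h ξ

/-- The section of the ideal sheaf defined by a function vanishing on `Z`. -/
def ofFunction {U : X.Opens} (a : Γ(X, U)) (ha : (i.app U).hom a = 0) : Γ(idealSheaf i, U) :=
  (exists_toFunction_eq a ha).choose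

@[simp]
lemma toFunction_ofFunction {U : X.Opens} (a : Γ(X, U)) (ha : (i.app U).hom a = 0) :
    toFunction (ofFunction (i := i) a ha) = a := (exists_toFunction_eq a ha).choose_spec

variable {Z' X' T : Scheme.{u}} {z : Z' ⟶ X'} {f : X ⟶ X'}

lemma app_app_toFunction (hf : ∃ g : Z ⟶ Z', g ≫ z = i ≫ f) {U : X'.Opens}
    (ξ : Γ(idealSheaf z, U)) : (i.app (f ⁻¹ᵁ U)).hom ((f.app U).hom (toFunction ξ)) = 0 := by
  obtain ⟨g, hg⟩ := hf
  have h1 : (i.app (f ⁻¹ᵁ U)).hom ((f.app U).hom (toFunction ξ)) =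
      ((i ≫ f).app U).hom (toFunction ξ) := by
    rw [Scheme.Hom.comp_app]; rfl
  have h2 : ((g ≫ z).app U).hom (toFunction ξ) = 0 := by
    have h3 := appLE_app_apply g z (U := U) (W := (g ≫ z) ⁻¹ᵁ U) le_rfl le_rfl (toFunction ξ)
    rw [app_toFunction, map_zero, Scheme.Hom.appLE_eq_app] at h3
    exact h3.symm
  have h3 := appLE_congr_apply hg (U := U) (W := (i ≫ f) ⁻¹ᵁ U) (by rw [hg]) le_rfl (toFunction ξ)
  rw [Scheme.Hom.appLE_eq_app, ← resFun_app, h2, map_zero] at h3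
  exact h1.trans h3.symm

/-- The pullback of functions vanishing on `Z'` to functions vanishing on `Z`. -/
def idealPullback (hf : ∃ g : Z ⟶ Z', g ≫ z = i ≫ f) (U : X'.Opens) :
    Γ(idealSheaf z, U) →+ Γ(idealSheaf i, f ⁻¹ᵁ U) :=
  AddMonoidHom.mk' (fun ξ ↦ ofFunction ((f.app U).hom (toFunction ξ)) (app_app_toFunction hf ξ))
    (fun ξ ξ' ↦ by
      apply toFunction_injective
      simp only [toFunction_ofFunction, toFunction_add, map_add])

lemma toFunction_idealPullback (hf : ∃ g : Z ⟶ Z', g ≫ z = i ≫ f) (U : X'.Opens)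
    (ξ : Γ(idealSheaf z, U)) :
    toFunction (idealPullback hf U ξ) = (f.app U).hom (toFunction ξ) :=
  toFunction_ofFunction _ (app_app_toFunction hf ξ)

/-- The form `ξ ↦ φ (f^* ξ)` on functions vanishing on `Z'`. -/
def LinForm.comapIdeal (hf : ∃ g : Z ⟶ Z', g ≫ z = i ≫ f) {k : T ⟶ X} {Ω : T.Opens}
    (φ : LinForm (idealSheaf i) k Ω) : LinForm (idealSheaf z) (k ≫ f) Ω where
  toFun W O hO h := (φ.toFun (f ⁻¹ᵁ W) O hO (le_preimage_preimage h)).comp (idealPullback hf W)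
  map_smul W O hO h a m := by
    rw [AddMonoidHom.comp_apply, AddMonoidHom.comp_apply, show idealPullback hf W (a • m) =
      (f.app W).hom a • idealPullback hf W m from toFunction_injective _ (by
        simp only [toFunction_idealPullback, toFunction_smul, map_mul]), φ.map_smul,
      appLE_app_apply k f]
  map_res W W' O O' hO h hW hO' h' m := by
    rw [AddMonoidHom.comp_apply, AddMonoidHom.comp_apply, show idealPullback hf W' (res hW m) =
      res (f.preimage_mono hW) (idealPullback hf W m) from toFunction_injective _ (by
        simp only [toFunction_idealPullback, toFunction_res, app_resFun])]
    exact φ.map_res (f ⁻¹ᵁ W) (f ⁻¹ᵁ W') O O' hO h (f.preimage_mono hW) hO' h' _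

end IdealSheaf

/-! ### Refinement of charts, and twisted forms -/

section Charts

variable {S S₀ X H T : Scheme.{u}} {j : S₀ ⟶ S} {p : X ⟶ S}

lemma mem_ker_ideal_iff {X Y : Scheme.{u}} (f : X ⟶ Y) [QuasiCompact f] (U : Y.affineOpens)
    (x : Γ(Y, U.1)) : x ∈ f.ker.ideal U ↔ (f.app U.1).hom x = 0 := by
  rw [Scheme.Hom.ker_apply, RingHom.mem_ker]

lemma resFun_mem_ideal (I : X.IdealSheafData) {U V : X.affineOpens} (h : V.1 ≤ U.1) {x : Γ(X, U.1)}
    (hx : x ∈ I.ideal U) : resFun h x ∈ I.ideal V :=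
  I.ideal_le_comap_ideal h hx

lemma ideal_eq_map_resFun (I : X.IdealSheafData) {U V : X.affineOpens} (h : V.1 ≤ U.1) :
    I.ideal V = (I.ideal U).map (resFun h) :=
  (I.map_ideal h).symm

lemma resFun_mem_nonZeroDivisors {U V : X.Opens} (hU : IsAffineOpen U) (h : V ≤ U) {a : Γ(X, U)}
    (ha : a ∈ nonZeroDivisors Γ(X, U)) : resFun h a ∈ nonZeroDivisors Γ(X, V) := by
  have key : ∀ c : Γ(X, V), resFun h a * c = 0 → c = 0 := fun c hc ↦
    eq_zero_of_appLE_mul_eq_zero (𝟙 X) hU ha (W := V) h c (by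
      have e : (𝟙 X : X ⟶ X).appLE U V h = X.presheaf.map (homOfLE h).op :=
        Category.id_comp _
      rw [e]; exact hc)
  exact mem_nonZeroDivisors_iff.2 ⟨key, fun c hc ↦ key c (by rwa [mul_comm] at hc)⟩

lemma exists_cartierChart_le (hj : IsEffectiveCartier j) (p : X ⟶ S) (x : X)
    (O : X.Opens) (hx : x ∈ O) (Q : S.Opens) (hQ : p x ∈ Q) :
    ∃ c : CartierChart j p, x ∈ c.U.1 ∧ c.U.1 ≤ O ∧ c.A.1 ≤ Q := by
  obtain ⟨A, hA, a, ha, e⟩ := hj (p x)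
  obtain ⟨B, hB, hxB, hle⟩ := exists_isAffineOpen_le (O := A.1 ⊓ Q) ⟨hA, hQ⟩
  obtain ⟨U, hU, hxU, hleU⟩ := exists_isAffineOpen_le (O := p ⁻¹ᵁ B ⊓ O) ⟨hxB, hx⟩
  refine ⟨⟨⟨B, hB⟩, resFun (hle.trans inf_le_left) a, resFun_mem_nonZeroDivisors A.2 _ ha, ?_,
    ⟨U, hU⟩, fun y hy ↦ (hleU hy).1⟩, hxU, fun y hy ↦ (hleU hy).2, fun y hy ↦ (hle hy).2⟩
  rw [ideal_eq_map_resFun j.ker (U := A) (V := ⟨B, hB⟩) (hle.trans inf_le_left), e,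
    Ideal.map_span, Set.image_singleton]

namespace CartierChart

lemma app_a [QuasiCompact j] (c : CartierChart j p) : (j.app c.A.1).hom c.a = 0 := by
  rw [← mem_ker_ideal_iff, c.ideal_eq]
  exact Ideal.mem_span_singleton_self _

/-- The equation of the divisor, as a section of its ideal sheaf. -/
def β [QuasiCompact j] (c : CartierChart j p) : Γ(idealSheaf j, c.A.1) := ofFunction c.a c.app_a

lemma toFunction_β [QuasiCompact j] (c : CartierChart j p) : toFunction c.β = c.a :=
  toFunction_ofFunction _ _

/-- The chart `c'` refines the chart `c`. -/
structure Le (c' c : CartierChart j p) : Prop where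
  le_A : c'.A.1 ≤ c.A.1
  le_U : c'.U.1 ≤ c.U.1

lemma Le.exists_mul_eq {c' c : CartierChart j p} (h : c'.Le c) :
    ∃ w, resFun h.le_A c.a = w * c'.a := by
  have h1 := resFun_mem_ideal j.ker h.le_A (x := c.a) (by
    rw [c.ideal_eq]; exact Ideal.mem_span_singleton_self _)
  rw [c'.ideal_eq, Ideal.mem_span_singleton'] at h1
  obtain ⟨w, hw⟩ := h1
  exact ⟨w, hw.symm⟩

lemma Le.res_β [QuasiCompact j] {c' c : CartierChart j p} (h : c'.Le c) {w}
    (hw : resFun h.le_A c.a = w * c'.a) : res h.le_A c.β = w • c'.β := by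
  apply toFunction_injective
  rw [toFunction_res, toFunction_smul, toFunction_β, toFunction_β, hw]

lemma Le.resFun_b {c' c : CartierChart j p} (h : c'.Le c) {w}
    (hw : resFun h.le_A c.a = w * c'.a) :
    resFun h.le_U c.b = (p.appLE c'.A.1 c'.U.1 c'.le).hom w * c'.b := by
  rw [b, b, ← map_mul, ← hw, resFun_appLE, appLE_resFun]

lemma app_fst_eq_zero_iff [IsClosedImmersion j] (c : CartierChart j p) (x : Γ(X, c.U.1)) :
    ((pullback.fst p j).app c.U.1).hom x = 0 ↔ ∃ a, x = c.b * a := by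
  rw [← mem_ker_ideal_iff, Scheme.IdealSheafData.ker_fst_of_isClosedImmersion, c.ideal_comap_eq,
    Ideal.mem_span_singleton]
  rfl

lemma exists_le (hj : IsEffectiveCartier j) (c c' : CartierChart j p) (x : X) (hx : x ∈ c.U.1)
    (hx' : x ∈ c'.U.1) : ∃ d : CartierChart j p, x ∈ d.U.1 ∧ d.Le c ∧ d.Le c' := by
  obtain ⟨d, hd, hU, hA⟩ := exists_cartierChart_le hj p x (c.U.1 ⊓ c'.U.1) ⟨hx, hx'⟩
    (c.A.1 ⊓ c'.A.1) ⟨c.le hx, c'.le hx'⟩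
  exact ⟨d, hd, ⟨hA.trans inf_le_left, hU.trans inf_le_left⟩,
    ⟨hA.trans inf_le_right, hU.trans inf_le_right⟩⟩

end CartierChart

/-- A linear form on functions `x` vanishing along `I`, twisted by the inverse of the ideal of the
divisor: the value `val c x` is thought of as the value on `x / b`. -/
@[ext]
structure TwistedForm (j : S₀ ⟶ S) (p : X ⟶ S) (I : X.IdealSheafData) (k : T ⟶ X) where
  val : ∀ (c : CartierChart j p) (x : Γ(X, c.U.1)), x ∈ I.ideal c.U → Γ(T, k ⁻¹ᵁ c.U.1)
  val_add : ∀ (c : CartierChart j p) (x x' : Γ(X, c.U.1)) (hx : x ∈ I.ideal c.U)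
    (hx' : x' ∈ I.ideal c.U) (hxx : x + x' ∈ I.ideal c.U),
    val c (x + x') hxx = val c x hx + val c x' hx'
  val_mul : ∀ (c : CartierChart j p) (a x : Γ(X, c.U.1)) (hx : x ∈ I.ideal c.U)
    (hax : a * x ∈ I.ideal c.U), val c (a * x) hax = (k.app c.U.1).hom a * val c x hx
  -- For `x = ba` the quotient `x/b` is the function `a` on `X`, on which two points with the same
  -- image in `X` agree.
  val_b : ∀ (c : CartierChart j p) (a : Γ(X, c.U.1)) (h : c.b * a ∈ I.ideal c.U),
    val c (c.b * a) h = 0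
  -- The equations are related by `b = w b'`, so that `x/b' = w · (x/b)`.
  val_res : ∀ (c c' : CartierChart j p) (h : c'.Le c) (w : Γ(S, c'.A.1)),
    resFun h.le_A c.a = w * c'.a → ∀ (x : Γ(X, c.U.1)) (hx : x ∈ I.ideal c.U)
    (hx' : resFun h.le_U x ∈ I.ideal c'.U),
    val c' (resFun h.le_U x) hx' =
      (k.app c'.U.1).hom ((p.appLE c'.A.1 c'.U.1 c'.le).hom w) *
        resFun (k.preimage_mono h.le_U) (val c x hx)

end Charts

/-! ### Contraction of a twisted form with a form on the ideal of the divisor -/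

section Contraction

set_option linter.unusedSectionVars false

variable {S S₀ X H T : Scheme.{u}} {j : S₀ ⟶ S} [IsClosedImmersion j] {p : X ⟶ S}
  {I : X.IdealSheafData} {k : T ⟶ X}

namespace TwistedForm

/-- The value of a twisted form on an open subset. -/
def at' (E : TwistedForm j p I k) (c : CartierChart j p) (x : Γ(X, c.U.1)) (hx : x ∈ I.ideal c.U)
    (O : T.Opens) (h : O ≤ k ⁻¹ᵁ c.U.1) : Γ(T, O) := resFun h (E.val c x hx)

variable (E : TwistedForm j p I k)

lemma resFun_at (c : CartierChart j p) (x : Γ(X, c.U.1)) (hx : x ∈ I.ideal c.U)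
    {O O' : T.Opens} (h : O ≤ k ⁻¹ᵁ c.U.1) (h' : O' ≤ O) :
    resFun h' (E.at' c x hx O h) = E.at' c x hx O' (h'.trans h) := resFun_resFun _ _ _

lemma at_add (c : CartierChart j p) (x x' : Γ(X, c.U.1)) (hx : x ∈ I.ideal c.U)
    (hx' : x' ∈ I.ideal c.U) (O : T.Opens) (h : O ≤ k ⁻¹ᵁ c.U.1) :
    E.at' c (x + x') (add_mem hx hx') O h = E.at' c x hx O h + E.at' c x' hx' O h := by
  rw [at', E.val_add c x x' hx hx', map_add]
  rfl

lemma at_mul (c : CartierChart j p) (a x : Γ(X, c.U.1)) (hx : x ∈ I.ideal c.U)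
    (O : T.Opens) (h : O ≤ k ⁻¹ᵁ c.U.1) :
    E.at' c (a * x) (Ideal.mul_mem_left _ a hx) O h =
      (k.appLE c.U.1 O h).hom a * E.at' c x hx O h := by
  rw [at', E.val_mul c a x hx, map_mul, resFun_app]
  rfl

/-- Two functions with the same restriction to `X ×_S S₀` differ by a multiple of `b`, which a
twisted form kills. Thus a twisted form depends only on functions on the special fibre. -/
lemma at_eq_of_app_fst_eq (c : CartierChart j p) {x x' : Γ(X, c.U.1)} (hx : x ∈ I.ideal c.U)
    (hx' : x' ∈ I.ideal c.U)
    (e : ((pullback.fst p j).app c.U.1).hom x = ((pullback.fst p j).app c.U.1).hom x')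
    (O : T.Opens) (h : O ≤ k ⁻¹ᵁ c.U.1) : E.at' c x hx O h = E.at' c x' hx' O h := by
  obtain ⟨a, ha⟩ := (c.app_fst_eq_zero_iff (x - x')).1 (by rw [map_sub, e, sub_self])
  have hxx : x - x' ∈ I.ideal c.U := sub_mem hx hx'
  have h1 := E.at_add c (x - x') x' hxx hx' O h
  have h2 : E.at' c (x - x') hxx O h = 0 := by
    rw [at']
    have : E.val c (x - x') hxx = E.val c (c.b * a) (by rw [← ha]; exact hxx) := by
      congr 1
    rw [this, E.val_b, map_zero]
  rw [h2, zero_add] at h1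
  rw [← h1]
  congr 1
  ring

lemma at_le {c c' : CartierChart j p} (hc : c'.Le c) {w : Γ(S, c'.A.1)}
    (hw : resFun hc.le_A c.a = w * c'.a) (x : Γ(X, c.U.1)) (hx : x ∈ I.ideal c.U)
    (O : T.Opens) (h : O ≤ k ⁻¹ᵁ c'.U.1) (h' : O ≤ (k ≫ p) ⁻¹ᵁ c'.A.1) :
    E.at' c' (resFun hc.le_U x) (resFun_mem_ideal I hc.le_U hx) O h =
      ((k ≫ p).appLE c'.A.1 O h').hom w *
        E.at' c x hx O (h.trans (k.preimage_mono hc.le_U)) := by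
  rw [at', E.val_res c c' hc w hw x hx, map_mul, resFun_app, resFun_resFun,
    appLE_appLE_apply k p c'.le h h']
  rfl

end TwistedForm

variable {Ω : T.Opens} (lam : LinForm (idealSheaf j) (k ≫ p) Ω)

/-- The product of the values of a form on `b` and of a twisted form on `x / b`. -/
def TwistedForm.eval (E : TwistedForm j p I k) (c : CartierChart j p) (x : Γ(X, c.U.1))
    (hx : x ∈ I.ideal c.U) (O : T.Opens) (hO : O ≤ Ω) (h : O ≤ k ⁻¹ᵁ c.U.1) : Γ(T, O) :=
  lam.toFun c.A.1 O hO (h.trans (k.preimage_mono c.le)) c.β * E.at' c x hx O h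

namespace TwistedForm

variable (E : TwistedForm j p I k)

lemma resFun_eval (c : CartierChart j p) (x : Γ(X, c.U.1)) (hx : x ∈ I.ideal c.U) (O O' : T.Opens)
    (hO : O ≤ Ω) (h : O ≤ k ⁻¹ᵁ c.U.1) (h' : O' ≤ O) :
    resFun h' (E.eval lam c x hx O hO h) = E.eval lam c x hx O' (h'.trans hO) (h'.trans h) := by
  rw [eval, map_mul, lam.resFun_toFun, resFun_at]
  rfl

/-- If `b = w b'`, then `lam b = w · lam b'` while `E (x/b') = w · E (x/b)`; hence the product `lam
b · E (x/b)` does not depend on the chart. -/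
lemma eval_le {c c' : CartierChart j p} (hc : c'.Le c) (x : Γ(X, c.U.1)) (hx : x ∈ I.ideal c.U)
    (O : T.Opens) (hO : O ≤ Ω) (h : O ≤ k ⁻¹ᵁ c'.U.1) :
    E.eval lam c x hx O hO (h.trans (k.preimage_mono hc.le_U)) =
      E.eval lam c' (resFun hc.le_U x) (resFun_mem_ideal I hc.le_U hx) O hO h := by
  obtain ⟨w, hw⟩ := hc.exists_mul_eq
  have h' : O ≤ (k ≫ p) ⁻¹ᵁ c'.A.1 := h.trans (k.preimage_mono c'.le)
  rw [eval, eval, E.at_le hc hw x hx O h h', ← lam.toFun_res c.A.1 c'.A.1 O hO hc.le_A h',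
    hc.res_β hw, lam.map_smul]
  ring

lemma eval_eq_of_app_fst_eq (hj : IsEffectiveCartier j) (c c' : CartierChart j p) (x : Γ(X, c.U.1))
    (hx : x ∈ I.ideal c.U) (x' : Γ(X, c'.U.1)) (hx' : x' ∈ I.ideal c'.U)
    (e : ∀ (V : X.Opens) (hV : V ≤ c.U.1) (hV' : V ≤ c'.U.1),
      ((pullback.fst p j).app V).hom (resFun hV x) = ((pullback.fst p j).app V).hom (resFun hV' x'))
    (O : T.Opens) (hO : O ≤ Ω) (h : O ≤ k ⁻¹ᵁ c.U.1) (h' : O ≤ k ⁻¹ᵁ c'.U.1) :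
    E.eval lam c x hx O hO h = E.eval lam c' x' hx' O hO h' := by
  refine fun_ext fun z hz ↦ ?_
  obtain ⟨d, hd, hdc, hdc'⟩ := c.exists_le hj c' (k z) (h hz) (h' hz)
  refine ⟨O ⊓ k ⁻¹ᵁ d.U.1, inf_le_left, ⟨hz, hd⟩, ?_⟩
  rw [resFun_eval, resFun_eval, E.eval_le lam hdc x hx (O ⊓ k ⁻¹ᵁ d.U.1) _ inf_le_right,
    E.eval_le lam hdc' x' hx' (O ⊓ k ⁻¹ᵁ d.U.1) _ inf_le_right, eval, eval,
    E.at_eq_of_app_fst_eq d (resFun_mem_ideal I hdc.le_U hx) (resFun_mem_ideal I hdc'.le_U hx')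
      (e _ hdc.le_U hdc'.le_U)]

end TwistedForm

lemma exists_preimage_le {X Y : Scheme.{u}} (f : X ⟶ Y) [IsClosedImmersion f] {W : X.Opens} {x : X}
    (hx : x ∈ W) : ∃ V : Y.Opens, f x ∈ V ∧ f ⁻¹ᵁ V ≤ W := by
  obtain ⟨V, hV, e⟩ := f.isClosedEmbedding.isInducing.isOpen_iff.1 W.isOpen
  refine ⟨⟨V, hV⟩, ?_, fun y hy ↦ ?_⟩
  · have : x ∈ f ⁻¹' V := by rw [e]; exact hx
    exact this
  · have : y ∈ f ⁻¹' V := hy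
    rw [e] at this
    exact this

variable {i : H ⟶ pullback p j} [IsClosedImmersion i]

/-- Functions vanishing on `H` lift to functions on the ambient scheme, locally. -/
lemma exists_chart_lift (hj : IsEffectiveCartier j) {W : (pullback p j).Opens}
    (ξ : Γ(idealSheaf i, W)) (x : ↥(pullback p j)) (hx : x ∈ W) (O : X.Opens)
    (hO : pullback.fst p j x ∈ O) :
    ∃ (c : CartierChart j p) (hc : pullback.fst p j ⁻¹ᵁ c.U.1 ≤ W) (y : Γ(X, c.U.1)),
      pullback.fst p j x ∈ c.U.1 ∧ c.U.1 ≤ O ∧ y ∈ (i ≫ pullback.fst p j).ker.ideal c.U ∧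
      ((pullback.fst p j).app c.U.1).hom y = resFun hc (toFunction ξ) := by
  obtain ⟨V, hV, hle⟩ := exists_preimage_le (pullback.fst p j) hx
  obtain ⟨c, hc, hcV⟩ := exists_cartierChart hj p (pullback.fst p j x) (V ⊓ O) ⟨hV, hO⟩
  have hcW : pullback.fst p j ⁻¹ᵁ c.U.1 ≤ W := fun z hz ↦ hle (hcV hz).1
  obtain ⟨y, hy⟩ := (pullback.fst p j).app_surjective c.U.1 c.U.2 (resFun hcW (toFunction ξ))
  refine ⟨c, hcW, y, hc, hcV.trans inf_le_right, ?_, hy⟩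
  rw [mem_ker_ideal_iff]
  have h1 := appLE_app_apply i (pullback.fst p j) (U := c.U.1)
    (W := (i ≫ pullback.fst p j) ⁻¹ᵁ c.U.1) le_rfl le_rfl y
  rw [Scheme.Hom.appLE_eq_app] at h1
  rw [← h1]
  refine (congrArg _ hy).trans ?_
  refine (appLE_resFun i hcW _ _).trans ?_
  rw [← resFun_app, app_toFunction, map_zero]

end Contraction

section ContractionForm

set_option linter.unusedSectionVars false

variable {S S₀ X H T : Scheme.{u}} {j : S₀ ⟶ S} [IsClosedImmersion j] {p : X ⟶ S}
  {i : H ⟶ pullback p j} [IsClosedImmersion i] {k₀ : T ⟶ pullback p j} {Ω : T.Opens}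

namespace TwistedForm

variable (E : TwistedForm j p (i ≫ pullback.fst p j).ker (k₀ ≫ pullback.fst p j))
  (lam : LinForm (idealSheaf j) ((k₀ ≫ pullback.fst p j) ≫ p) Ω)

/-- `f` is locally the product of the values of `lam` on `b` and of `E` on `x / b`, where `x` lifts
`ξ`. -/
def IsContraction {W : (pullback p j).Opens} {O : T.Opens} (hO : O ≤ Ω) (ξ : Γ(idealSheaf i, W))
    (f : Γ(T, O)) : Prop :=
  ∀ (c : CartierChart j p) (hc : pullback.fst p j ⁻¹ᵁ c.U.1 ≤ W) (x : Γ(X, c.U.1))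
    (hx : x ∈ (i ≫ pullback.fst p j).ker.ideal c.U),
    ((pullback.fst p j).app c.U.1).hom x = resFun hc (toFunction ξ) →
    ∀ (O' : T.Opens) (h : O' ≤ O) (h' : O' ≤ (k₀ ≫ pullback.fst p j) ⁻¹ᵁ c.U.1),
      resFun h f = E.eval lam c x hx O' (h.trans hO) h'

variable {E lam}

lemma IsContraction.mono {W : (pullback p j).Opens} {O O' : T.Opens} {hO : O ≤ Ω}
    {ξ : Γ(idealSheaf i, W)} {f : Γ(T, O)} (h : E.IsContraction lam hO ξ f) (h' : O' ≤ O) :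
    E.IsContraction lam (h'.trans hO) ξ (resFun h' f) := by
  intro c hc x hx e O'' h1 h2
  rw [resFun_resFun]
  exact h c hc x hx e O'' (h1.trans h') h2

lemma IsContraction.res {W W' : (pullback p j).Opens} {O : T.Opens} {hO : O ≤ Ω}
    {ξ : Γ(idealSheaf i, W)} {f : Γ(T, O)} (h : E.IsContraction lam hO ξ f) (hW : W' ≤ W) :
    E.IsContraction lam hO (NeronBlowup.res hW ξ) f := by
  intro c hc x hx e O' h1 h2
  refine h c (hc.trans hW) x hx ?_ O' h1 h2
  rw [e, toFunction_res, resFun_resFun]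

lemma IsContraction.unique (hj : IsEffectiveCartier j) {W : (pullback p j).Opens} {O : T.Opens}
    {hO : O ≤ Ω} (hW : O ≤ k₀ ⁻¹ᵁ W) {ξ : Γ(idealSheaf i, W)} {f f' : Γ(T, O)}
    (h : E.IsContraction lam hO ξ f) (h' : E.IsContraction lam hO ξ f') : f = f' := by
  refine fun_ext fun z hz ↦ ?_
  obtain ⟨c, hc, x, hz', -, hx, e⟩ := exists_chart_lift hj ξ (k₀ z) (hW hz) ⊤ trivial
  refine ⟨O ⊓ (k₀ ≫ pullback.fst p j) ⁻¹ᵁ c.U.1, inf_le_left, ⟨hz, hz'⟩, ?_⟩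
  rw [h c hc x hx e _ inf_le_left inf_le_right, h' c hc x hx e _ inf_le_left inf_le_right]

variable (E lam)

/-- On each chart the product with a lift of `ξ` is a candidate; independence of chart and lift
makes the candidates glue. -/
lemma exists_isContraction (hj : IsEffectiveCartier j) {W : (pullback p j).Opens} {O : T.Opens}
    (hO : O ≤ Ω) (hW : O ≤ k₀ ⁻¹ᵁ W) (ξ : Γ(idealSheaf i, W)) :
    ∃ f, E.IsContraction lam hO ξ f := by
  obtain ⟨f, hf⟩ := exists_fun_of_local (O := O)
    (fun V f ↦ ∃ hV : V ≤ O, E.IsContraction lam (hV.trans hO) ξ f)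
    (fun V V' h a ⟨hV, ha⟩ ↦ ⟨h.trans hV, ha.mono h⟩)
    (fun V a a' ⟨hV, ha⟩ ⟨_, ha'⟩ ↦ ha.unique hj (hV.trans hW) ha')
    (fun z hz ↦ by
      obtain ⟨c, hc, x, hz', -, hx, e⟩ := exists_chart_lift hj ξ (k₀ z) (hW hz) ⊤ trivial
      refine ⟨O ⊓ (k₀ ≫ pullback.fst p j) ⁻¹ᵁ c.U.1, inf_le_left, ⟨hz, hz'⟩,
        E.eval lam c x hx _ (inf_le_left.trans hO) inf_le_right, inf_le_left, ?_⟩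
      intro c' hc' x' hx' e' O' h1 h2
      rw [resFun_eval]
      refine E.eval_eq_of_app_fst_eq lam hj c c' x hx x' hx' ?_ O' _ _ _
      intro V hV hV'
      rw [app_resFun, app_resFun, e, e', resFun_resFun, resFun_resFun])
  refine ⟨f, fun c hc x hx e O' h1 h2 ↦ fun_ext fun z hz ↦ ?_⟩
  obtain ⟨V, hVO, hzV, hV, hfV⟩ := hf z (h1 hz)
  refine ⟨O' ⊓ V, inf_le_left, ⟨hz, hzV⟩, ?_⟩
  have := hfV c hc x hx e (O' ⊓ V) inf_le_right (inf_le_left.trans h2)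
  rw [resFun_resFun] at this
  rw [resFun_resFun, resFun_eval, this]

lemma isContraction_add (hj : IsEffectiveCartier j) {W : (pullback p j).Opens} {O : T.Opens}
    (hO : O ≤ Ω) (hW : O ≤ k₀ ⁻¹ᵁ W) {ξ ξ' : Γ(idealSheaf i, W)} {f f' f'' : Γ(T, O)}
    (h : E.IsContraction lam hO ξ f) (h' : E.IsContraction lam hO ξ' f')
    (h'' : E.IsContraction lam hO (ξ + ξ') f'') : f'' = f + f' := by
  refine fun_ext fun z hz ↦ ?_
  obtain ⟨c, hc, x, hz', -, hx, e⟩ := exists_chart_lift hj ξ (k₀ z) (hW hz) ⊤ trivial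
  obtain ⟨c', hc', x', hz'', -, hx', e'⟩ := exists_chart_lift hj ξ' (k₀ z) (hW hz) ⊤ trivial
  obtain ⟨d, hd, hdc, hdc'⟩ := c.exists_le hj c' _ hz' hz''
  have hdW : pullback.fst p j ⁻¹ᵁ d.U.1 ≤ W := ((pullback.fst p j).preimage_mono hdc.le_U).trans hc
  have e1 : ((pullback.fst p j).app d.U.1).hom (resFun hdc.le_U x) = resFun hdW (toFunction ξ) := by
    rw [app_resFun, e, resFun_resFun]
  have e2 : ((pullback.fst p j).app d.U.1).hom (resFun hdc'.le_U x') =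
      resFun hdW (toFunction ξ') := by
    rw [app_resFun, e', resFun_resFun]
  have hx1 := resFun_mem_ideal _ hdc.le_U hx
  have hx2 := resFun_mem_ideal _ hdc'.le_U hx'
  refine ⟨O ⊓ (k₀ ≫ pullback.fst p j) ⁻¹ᵁ d.U.1, inf_le_left, ⟨hz, hd⟩, ?_⟩
  rw [map_add, h d hdW _ hx1 e1 _ inf_le_left inf_le_right,
    h' d hdW _ hx2 e2 _ inf_le_left inf_le_right,
    h'' d hdW _ (add_mem hx1 hx2) (by rw [map_add, e1, e2, toFunction_add, map_add]) _
      inf_le_left inf_le_right, eval, E.at_add d _ _ hx1 hx2, mul_add]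
  rfl

lemma isContraction_smul (hj : IsEffectiveCartier j) {W : (pullback p j).Opens} {O : T.Opens}
    (hO : O ≤ Ω) (hW : O ≤ k₀ ⁻¹ᵁ W) {a : Γ(pullback p j, W)} {ξ : Γ(idealSheaf i, W)}
    {f f' : Γ(T, O)}
    (h : E.IsContraction lam hO ξ f) (h' : E.IsContraction lam hO (a • ξ) f') :
    f' = (k₀.appLE W O hW).hom a * f := by
  refine fun_ext fun z hz ↦ ?_
  obtain ⟨c, hc, x, hz', -, hx, e⟩ := exists_chart_lift hj ξ (k₀ z) (hW hz) ⊤ trivial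
  obtain ⟨y, hy⟩ := (pullback.fst p j).app_surjective c.U.1 c.U.2 (resFun hc a)
  refine ⟨O ⊓ (k₀ ≫ pullback.fst p j) ⁻¹ᵁ c.U.1, inf_le_left, ⟨hz, hz'⟩, ?_⟩
  rw [map_mul, h c hc _ hx e _ inf_le_left inf_le_right,
    h' c hc (y * x) (Ideal.mul_mem_left _ y hx) (by
      rw [map_mul, e, toFunction_smul, map_mul]
      exact congrArg (· * _) hy) _ inf_le_left inf_le_right, eval, E.at_mul _ _ _ hx, resFun_appLE]
  have h1 : ((k₀ ≫ pullback.fst p j).appLE c.U.1 (O ⊓ (k₀ ≫ pullback.fst p j) ⁻¹ᵁ c.U.1)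
      inf_le_right).hom y = (k₀.appLE W (O ⊓ (k₀ ≫ pullback.fst p j) ⁻¹ᵁ c.U.1)
        (inf_le_left.trans hW)).hom a := by
    have h2 := appLE_app_apply k₀ (pullback.fst p j) (U := c.U.1)
      (W := O ⊓ (k₀ ≫ pullback.fst p j) ⁻¹ᵁ c.U.1) inf_le_right inf_le_right y
    rw [← h2]
    refine (congrArg _ hy).trans ?_
    exact appLE_resFun k₀ hc _ a
  rw [h1, eval]
  ring

/-- The contraction of a twisted form with a form on the ideal of the divisor. -/
def contraction (hj : IsEffectiveCartier j) : LinForm (idealSheaf i) k₀ Ω where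
  toFun W O hO hW := AddMonoidHom.mk' (fun ξ ↦ (E.exists_isContraction lam hj hO hW ξ).choose)
    fun ξ ξ' ↦ E.isContraction_add lam hj hO hW
      (E.exists_isContraction lam hj hO hW ξ).choose_spec
      (E.exists_isContraction lam hj hO hW ξ').choose_spec
      (E.exists_isContraction lam hj hO hW (ξ + ξ')).choose_spec
  map_smul W O hO hW a ξ := E.isContraction_smul lam hj hO hW
      (E.exists_isContraction lam hj hO hW ξ).choose_spec
      (E.exists_isContraction lam hj hO hW (a • ξ)).choose_spec
  map_res W W' O O' hO hW hWW' hO' hW' ξ := by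
    refine ((E.exists_isContraction lam hj (hO'.trans hO) hW' _).choose_spec).unique hj hW'
      (((E.exists_isContraction lam hj hO hW ξ).choose_spec.mono hO').res hWW')

lemma isContraction_contraction (hj : IsEffectiveCartier j) (W O hO hW) (ξ : Γ(idealSheaf i, W)) :
    E.IsContraction lam hO ξ ((E.contraction lam hj).toFun W O hO hW ξ) :=
  (E.exists_isContraction lam hj hO hW ξ).choose_spec

variable {E lam}

lemma IsContraction.eq_contraction (hj : IsEffectiveCartier j) {W O hO} (hW : O ≤ k₀ ⁻¹ᵁ W)
    {ξ : Γ(idealSheaf i, W)} {f : Γ(T, O)} (h : E.IsContraction lam hO ξ f) :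
    (E.contraction lam hj).toFun W O hO hW ξ = f :=
  (E.isContraction_contraction lam hj W O hO hW ξ).unique hj hW h

end TwistedForm

end ContractionForm

/-! ### Contractions with a family, and local generators of the dual -/

section TwistedFamily

set_option linter.unusedSectionVars false

variable {S S₀ X Y H T : Scheme.{u}} {j : S₀ ⟶ S} [IsClosedImmersion j] {p : X ⟶ S}
  {i : H ⟶ pullback p j} [IsClosedImmersion i] {k₀ : T ⟶ pullback p j}

namespace TwistedForm

variable (E : TwistedForm j p (i ≫ pullback.fst p j).ker (k₀ ≫ pullback.fst p j))

lemma contraction_add {Ω : T.Opens}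
    (lam lam' : LinForm (idealSheaf j) ((k₀ ≫ pullback.fst p j) ≫ p) Ω)
    (hj : IsEffectiveCartier j) :
    E.contraction (lam + lam') hj = E.contraction lam hj + E.contraction lam' hj := by
  ext W O hO hW ξ
  refine IsContraction.eq_contraction hj hW fun c hc x hx e O' h h' ↦ ?_
  rw [LinForm.add_toFun, map_add,
    E.isContraction_contraction lam hj W O hO hW ξ c hc x hx e O' h h',
    E.isContraction_contraction lam' hj W O hO hW ξ c hc x hx e O' h h', eval, eval, eval,
    LinForm.add_toFun, add_mul]

lemma contraction_smul {Ω : T.Opens} (r : Γ(T, Ω))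
    (lam : LinForm (idealSheaf j) ((k₀ ≫ pullback.fst p j) ≫ p) Ω)
    (hj : IsEffectiveCartier j) : E.contraction (r • lam) hj = r • E.contraction lam hj := by
  ext W O hO hW ξ
  refine IsContraction.eq_contraction hj hW fun c hc x hx e O' h h' ↦ ?_
  rw [LinForm.smul_toFun, map_mul,
    E.isContraction_contraction lam hj W O hO hW ξ c hc x hx e O' h h', eval, eval,
    LinForm.smul_toFun, mul_assoc, resFun_resFun]

lemma contraction_restrict {Ω Ω' : T.Opens} (hΩ : Ω' ≤ Ω)
    (lam : LinForm (idealSheaf j) ((k₀ ≫ pullback.fst p j) ≫ p) Ω)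
    (hj : IsEffectiveCartier j) :
    E.contraction (lam.restrict hΩ) hj = (E.contraction lam hj).restrict hΩ := by
  ext W O hO hW ξ
  refine IsContraction.eq_contraction hj hW fun c hc x hx e O' h h' ↦ ?_
  exact E.isContraction_contraction lam hj W O (hO.trans hΩ) hW ξ c hc x hx e O' h h'

/-- The contractions of a twisted form with a family of forms. -/
def toDualFamily (hj : IsEffectiveCartier j) {L : Y.Modules} {t : T ⟶ Y}
    (Λ : DualFamily L t (idealSheaf j) ((k₀ ≫ pullback.fst p j) ≫ p)) :
    DualFamily L t (idealSheaf i) k₀ where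
  form U δ := E.contraction (Λ.form U δ) hj
  form_add U δ δ' := by rw [Λ.form_add, contraction_add]
  form_smul U a δ := by rw [Λ.form_smul, contraction_smul]
  form_restrict U V h δ := by rw [Λ.form_restrict U V h, contraction_restrict]

end TwistedForm

/-- The sections of `L^∨` are locally multiples of the sections `d`, which take the value `1` on
the local equations of the divisor. -/
def HasDualGenerators {L : Y.Modules} {t : T ⟶ Y} {k : T ⟶ X} (r : Y ⟶ X)
    (Λ : DualFamily L t (idealSheaf j) (k ≫ p))
    (d : ∀ c : CartierChart j p, dualSections L (r ⁻¹ᵁ c.U.1)) : Prop :=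
  ∀ c : CartierChart j p, (∀ O hO h, (Λ.form _ (d c)).toFun c.A.1 O hO h c.β = 1) ∧
    ∀ (U : Y.Opens) (hU : U ≤ r ⁻¹ᵁ c.U.1) (δ' : dualSections L U),
      ∃ f : Γ(Y, U), δ' = f • dualSections.restrict L hU (d c)

lemma DualFamily.form_smul_toFun {L : Y.Modules} {t : T ⟶ Y} {M : X.Modules} {k : T ⟶ X}
    (Λ : DualFamily L t M k) {U V : Y.Opens} (hV : V ≤ U) (f : Γ(Y, V)) (δ : dualSections L U)
    (W O hO h) (m : Γ(M, W)) :
    (Λ.form V (f • dualSections.restrict L hV δ)).toFun W O hO h m =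
      (t.appLE V O hO).hom f * (Λ.form U δ).toFun W O (hO.trans (t.preimage_mono hV)) h m := by
  rw [Λ.form_smul, Λ.form_restrict U V hV, LinForm.smul_toFun, resFun_app]
  rfl

/-- Dual families agree if they agree on the local generators. -/
theorem DualFamily.ext_of_hasDualGenerators (hj : IsEffectiveCartier j) {L : Y.Modules} {t : T ⟶ Y}
    {r : Y ⟶ X} (hr : t ≫ r = k₀ ≫ pullback.fst p j)
    {Λ : DualFamily L t (idealSheaf j) ((k₀ ≫ pullback.fst p j) ≫ p)}
    {d : ∀ c : CartierChart j p, dualSections L (r ⁻¹ᵁ c.U.1)} (hΛ : HasDualGenerators r Λ d)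
    {Φ Φ' : DualFamily L t (idealSheaf i) k₀}
    (h : ∀ (c : CartierChart j p) (x : Γ(X, c.U.1))
      (_ : x ∈ (i ≫ pullback.fst p j).ker.ideal c.U)
      (ξ : Γ(idealSheaf i, pullback.fst p j ⁻¹ᵁ c.U.1)),
      toFunction ξ = ((pullback.fst p j).app c.U.1).hom x → ∀ O hO h,
      (Φ.form _ (d c)).toFun _ O hO h ξ = (Φ'.form _ (d c)).toFun _ O hO h ξ) (U : Y.Opens)
    (δ : dualSections L U) : Φ.form U δ = Φ'.form U δ := by
  ext W O hO hW ξ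
  refine fun_ext fun z hz ↦ ?_
  obtain ⟨c, hc, x, hz', -, hx, e⟩ := exists_chart_lift hj ξ (k₀ z) (hW hz) ⊤ trivial
  obtain ⟨hd, hgen⟩ := hΛ c
  have hzr : r (t z) = pullback.fst p j (k₀ z) := by
    have := congrArg (fun f : T ⟶ X ↦ f z) hr
    exact this
  -- Near `z` the section `δ` is `f` times the generator of a chart on which `ξ` has a lift, so the
  -- hypothesis applies.
  obtain ⟨f, hf⟩ := hgen (U ⊓ r ⁻¹ᵁ c.U.1) inf_le_right (dualSections.restrict L inf_le_left δ)
  have ht : O ⊓ k₀ ⁻¹ᵁ (pullback.fst p j ⁻¹ᵁ c.U.1) ≤ t ⁻¹ᵁ (U ⊓ r ⁻¹ᵁ c.U.1) := by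
    intro y hy
    refine ⟨hO hy.1, ?_⟩
    have h1 : r (t y) = pullback.fst p j (k₀ y) := congrArg (fun f : T ⟶ X ↦ f y) hr
    change r (t y) ∈ c.U.1
    rw [h1]
    exact hy.2
  refine ⟨O ⊓ k₀ ⁻¹ᵁ (pullback.fst p j ⁻¹ᵁ c.U.1), inf_le_left, ⟨hz, hz'⟩, ?_⟩
  have key : ∀ Ψ : DualFamily L t (idealSheaf i) k₀,
      (Ψ.form U δ).toFun W (O ⊓ k₀ ⁻¹ᵁ (pullback.fst p j ⁻¹ᵁ c.U.1)) (inf_le_left.trans hO)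
        (inf_le_left.trans hW) ξ =
      (t.appLE _ _ ht).hom f * (Ψ.form _ (d c)).toFun _ _ (ht.trans (t.preimage_mono inf_le_right))
        inf_le_right (res hc ξ) := by
    intro Ψ
    rw [← Ψ.form_smul_toFun inf_le_right, ← hf, Ψ.form_restrict U _ inf_le_left,
      ← (Ψ.form U δ).toFun_res W _ _ _ hc inf_le_right]
    rfl
  rw [LinForm.resFun_toFun, LinForm.resFun_toFun, key, key,
    h c x hx (res hc ξ) (by rw [e, toFunction_res])]

end TwistedFamily

/-! ### The twisted form attached to a family of forms -/

section TwistedFormOfFamily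

set_option linter.unusedSectionVars false

variable {S S₀ X Y H T : Scheme.{u}} {j : S₀ ⟶ S} [IsClosedImmersion j] {p : X ⟶ S}
  {i : H ⟶ pullback p j} [IsClosedImmersion i] {k₀ : T ⟶ pullback p j}

lemma app_app_eq_zero {A B C : Scheme.{u}} (f : A ⟶ B) (g : B ⟶ C) {U : C.Opens} (x : Γ(C, U))
    (h : ((f ≫ g).app U).hom x = 0) : (f.app (g ⁻¹ᵁ U)).hom ((g.app U).hom x) = 0 := by
  rw [Scheme.Hom.comp_app] at h
  exact h

lemma eq_of_mul_eq_one {R : Type*} [CommRing R] {f w v : R} (h₁ : f * v = 1) (h₂ : w * v = 1) :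
    f = w := by
  linear_combination w * h₁ - f * h₂

/-- The section of the ideal sheaf of `H ⊆ X₀` defined by a function on `X` vanishing on `H`. -/
def CartierChart.section' (c : CartierChart j p) (x : Γ(X, c.U.1))
    (hx : x ∈ (i ≫ pullback.fst p j).ker.ideal c.U) :
    Γ(idealSheaf i, pullback.fst p j ⁻¹ᵁ c.U.1) :=
  ofFunction (((pullback.fst p j).app c.U.1).hom x)
    (app_app_eq_zero i (pullback.fst p j) x ((mem_ker_ideal_iff _ _ _).1 hx))

lemma CartierChart.toFunction_section' (c : CartierChart j p) (x : Γ(X, c.U.1))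
    (hx : x ∈ (i ≫ pullback.fst p j).ker.ideal c.U) :
    toFunction (c.section' x hx) = ((pullback.fst p j).app c.U.1).hom x :=
  toFunction_ofFunction _ _

lemma TwistedForm.contraction_section' {Ω : T.Opens}
    (E : TwistedForm j p (i ≫ pullback.fst p j).ker (k₀ ≫ pullback.fst p j))
    (lam : LinForm (idealSheaf j) ((k₀ ≫ pullback.fst p j) ≫ p) Ω) (hj : IsEffectiveCartier j)
    (c : CartierChart j p) (x : Γ(X, c.U.1)) (hx : x ∈ (i ≫ pullback.fst p j).ker.ideal c.U)
    (O : T.Opens) (hO : O ≤ Ω) (h : O ≤ k₀ ⁻¹ᵁ (pullback.fst p j ⁻¹ᵁ c.U.1)) :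
    (E.contraction lam hj).toFun _ O hO h (c.section' x hx) = E.eval lam c x hx O hO h := by
  have := E.isContraction_contraction lam hj _ O hO h (c.section' x hx) c le_rfl x hx
    (by rw [c.toFunction_section', resFun_self]) O le_rfl h
  rwa [resFun_self] at this


variable {L : Y.Modules} {t : T ⟶ Y} {r : Y ⟶ X} (hr : t ≫ r = k₀ ≫ pullback.fst p j)
    {Λ : DualFamily L t (idealSheaf j) ((k₀ ≫ pullback.fst p j) ≫ p)}
    {d : ∀ c : CartierChart j p, dualSections L (r ⁻¹ᵁ c.U.1)} (hΛ : HasDualGenerators r Λ d)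

include hr in
lemma le_preimage_of_eq {U : X.Opens} {O : T.Opens} (h : O ≤ (k₀ ≫ pullback.fst p j) ⁻¹ᵁ U) :
    O ≤ t ⁻¹ᵁ (r ⁻¹ᵁ U) := by
  rw [← hr] at h
  exact h

namespace DualFamily

/-- The values of a dual family on generators. -/
def genVal (d : ∀ c : CartierChart j p, dualSections L (r ⁻¹ᵁ c.U.1))
    (Φ : DualFamily L t (idealSheaf i) k₀) (c : CartierChart j p)
    (x : Γ(X, c.U.1)) (hx : x ∈ (i ≫ pullback.fst p j).ker.ideal c.U) (O : T.Opens)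
    (h : O ≤ (k₀ ≫ pullback.fst p j) ⁻¹ᵁ c.U.1) : Γ(T, O) :=
  (Φ.form _ (d c)).toFun _ O (le_preimage_of_eq hr h) (le_preimage_preimage h)
    (c.section' x hx)

lemma resFun_genVal (Φ : DualFamily L t (idealSheaf i) k₀) (c : CartierChart j p)
    (x : Γ(X, c.U.1)) (hx : x ∈ (i ≫ pullback.fst p j).ker.ideal c.U) (O O' : T.Opens)
    (h : O ≤ (k₀ ≫ pullback.fst p j) ⁻¹ᵁ c.U.1) (h' : O' ≤ O) :
    resFun h' (genVal hr d Φ c x hx O h) = genVal hr d Φ c x hx O' (h'.trans h) :=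
  LinForm.resFun_toFun _ _ _ _ _ _ _ _

-- Write `δ = f · d c`. Evaluating at `β'` and at `β = w β'` shows that `f` and `w` are both inverse
-- to `Λ (d c) β'`, hence equal.
include hΛ in
lemma genVal_eq (Φ : DualFamily L t (idealSheaf i) k₀) {c c' : CartierChart j p}
    (hc : c'.Le c) {w : Γ(S, c'.A.1)} (hw : resFun hc.le_A c.a = w * c'.a)
    (x : Γ(X, c.U.1)) (hx : x ∈ (i ≫ pullback.fst p j).ker.ideal c.U)
    (δ : dualSections L (r ⁻¹ᵁ c'.U.1))
    (hδ : ∀ O hO h, (Λ.form _ δ).toFun c'.A.1 O hO h c'.β = 1)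
    (ξ : Γ(idealSheaf i, pullback.fst p j ⁻¹ᵁ c'.U.1))
    (hξ : toFunction ξ = ((pullback.fst p j).app c'.U.1).hom (resFun hc.le_U x))
    (O : T.Opens) (h : O ≤ (k₀ ≫ pullback.fst p j) ⁻¹ᵁ c'.U.1)
    (h' : O ≤ ((k₀ ≫ pullback.fst p j) ≫ p) ⁻¹ᵁ c'.A.1) :
    (Φ.form _ δ).toFun _ O (le_preimage_of_eq hr h) (le_preimage_preimage h) ξ =
      (((k₀ ≫ pullback.fst p j) ≫ p).appLE c'.A.1 O h').hom w *
        genVal hr d Φ c x hx O (h.trans ((k₀ ≫ pullback.fst p j).preimage_mono hc.le_U)) := by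
  obtain ⟨hd, hgen⟩ := hΛ c
  obtain ⟨f, hf⟩ := hgen (r ⁻¹ᵁ c'.U.1) (r.preimage_mono hc.le_U) δ
  have ht : O ≤ t ⁻¹ᵁ (r ⁻¹ᵁ c'.U.1) := le_preimage_of_eq hr h
  have hO := h.trans ((k₀ ≫ pullback.fst p j).preimage_mono hc.le_U)
  have h1 := hδ O ht h'
  have h2 := hd O (le_preimage_of_eq hr hO) (h'.trans
    (((k₀ ≫ pullback.fst p j) ≫ p).preimage_mono hc.le_A))
  rw [hf, Λ.form_smul_toFun] at h1
  rw [← LinForm.toFun_res _ c.A.1 c'.A.1 O _ hc.le_A h', hc.res_β hw, LinForm.map_smul] at h2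
  have h3 : (t.appLE _ O ht).hom f = (((k₀ ≫ pullback.fst p j) ≫ p).appLE c'.A.1 O h').hom w :=
    eq_of_mul_eq_one h1 h2
  rw [hf, Φ.form_smul_toFun, h3, genVal]
  congr 1
  rw [← LinForm.toFun_res _ (pullback.fst p j ⁻¹ᵁ c.U.1) (pullback.fst p j ⁻¹ᵁ c'.U.1) O _
    ((pullback.fst p j).preimage_mono hc.le_U) (le_preimage_preimage h)]
  congr 1
  apply toFunction_injective
  rw [hξ, toFunction_res, c.toFunction_section', app_resFun]

-- The value on `x/b` is that of the form `Φ (d c)` on `x`, where `d c` is dual to `b`; `genVal_eq`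
-- gives the change of chart.
include hΛ in
theorem exists_twistedForm (Φ : DualFamily L t (idealSheaf i) k₀) :
    ∃ E : TwistedForm j p (i ≫ pullback.fst p j).ker (k₀ ≫ pullback.fst p j),
      ∀ (c : CartierChart j p) (x : Γ(X, c.U.1))
        (hx : x ∈ (i ≫ pullback.fst p j).ker.ideal c.U) (O : T.Opens)
        (h : O ≤ (k₀ ≫ pullback.fst p j) ⁻¹ᵁ c.U.1),
        E.at' c x hx O h = genVal hr d Φ c x hx O h := by
  refine ⟨⟨fun c x hx ↦ genVal hr d Φ c x hx _ le_rfl, ?_, ?_, ?_, ?_⟩, ?_⟩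
  · intro c x x' hx hx' hxx
    rw [genVal, show c.section' (x + x') hxx = c.section' x hx + c.section' x' hx' from
      toFunction_injective _ (by
        simp only [toFunction_add, CartierChart.toFunction_section', map_add]), map_add]
    rfl
  · intro c a x hx hax
    rw [genVal, show c.section' (a * x) hax =
      ((pullback.fst p j).app c.U.1).hom a • c.section' x hx from toFunction_injective _ (by
        simp only [toFunction_smul, CartierChart.toFunction_section', map_mul]), LinForm.map_smul,
      appLE_app_apply k₀ (pullback.fst p j) (U := c.U.1) _ le_rfl, Scheme.Hom.appLE_eq_app]
    rfl
  · intro c a h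
    rw [genVal, show c.section' (c.b * a) h = 0 from toFunction_injective _ (by
        rw [c.toFunction_section', (c.app_fst_eq_zero_iff _).2 ⟨a, rfl⟩]
        exact (map_zero ((kernel.ι (sharp i)).app _).hom).symm), map_zero]
  · intro c c' h w hw x hx hx'
    have := genVal_eq hr hΛ Φ h hw x hx _ (hΛ c').1
      (c'.section' (resFun h.le_U x) hx') (c'.toFunction_section' _ _) _ le_rfl
      ((k₀ ≫ pullback.fst p j).preimage_mono c'.le)
    refine this.trans ?_
    rw [← Scheme.Hom.appLE_eq_app, appLE_appLE_apply (k₀ ≫ pullback.fst p j) p c'.le le_rfl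
      ((k₀ ≫ pullback.fst p j).preimage_mono c'.le), resFun_genVal]
  · intro c x hx O h
    exact resFun_genVal hr Φ c x hx _ O le_rfl h

end DualFamily

end TwistedFormOfFamily

/-! ### Twisted forms and families of forms are equivalent -/

section TwistedFormEquiv

set_option linter.unusedSectionVars false

variable {S S₀ X Y H T : Scheme.{u}} {j : S₀ ⟶ S} [IsClosedImmersion j] {p : X ⟶ S}
  {i : H ⟶ pullback p j} [IsClosedImmersion i] {k₀ : T ⟶ pullback p j}
  {L : Y.Modules} {t : T ⟶ Y} {r : Y ⟶ X}
  {Λ : DualFamily L t (idealSheaf j) ((k₀ ≫ pullback.fst p j) ≫ p)}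
  {d : ∀ c : CartierChart j p, dualSections L (r ⁻¹ᵁ c.U.1)}

/-- A dual family is the family of contractions of a twisted form if and only if this holds on
local generators. -/
theorem TwistedForm.toDualFamily_form_eq_iff (hr : t ≫ r = k₀ ≫ pullback.fst p j)
    (hΛ : HasDualGenerators r Λ d) (hj : IsEffectiveCartier j)
    (E : TwistedForm j p (i ≫ pullback.fst p j).ker (k₀ ≫ pullback.fst p j))
    (Φ : DualFamily L t (idealSheaf i) k₀) :
    (∀ U δ, (E.toDualFamily hj Λ).form U δ = Φ.form U δ) ↔
      ∀ (c : CartierChart j p) (x : Γ(X, c.U.1)) (hx : x ∈ (i ≫ pullback.fst p j).ker.ideal c.U)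
        (O : T.Opens) (h : O ≤ (k₀ ≫ pullback.fst p j) ⁻¹ᵁ c.U.1),
          (Φ.form _ (d c)).toFun _ O (le_preimage_of_eq hr h) (le_preimage_preimage h)
            (c.section' x hx) = E.at' c x hx O h := by
  have key : ∀ (c : CartierChart j p) (x : Γ(X, c.U.1))
      (hx : x ∈ (i ≫ pullback.fst p j).ker.ideal c.U) (δ : dualSections L (r ⁻¹ᵁ c.U.1)),
      (∀ O hO h, (Λ.form _ δ).toFun c.A.1 O hO h c.β = 1) →
      ∀ (O : T.Opens) (hO : O ≤ t ⁻¹ᵁ (r ⁻¹ᵁ c.U.1))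
        (h : O ≤ k₀ ⁻¹ᵁ (pullback.fst p j ⁻¹ᵁ c.U.1)),
        ((E.toDualFamily hj Λ).form _ δ).toFun _ O hO h (c.section' x hx) = E.at' c x hx O h := by
    intro c x hx δ hδ O hO h
    refine (E.contraction_section' (Λ.form _ δ) hj c x hx O hO h).trans ?_
    exact (congrArg (· * E.at' c x hx O h) (hδ O hO _)).trans (one_mul _)
  constructor
  · intro H c x hx O h
    rw [← H]
    exact key c x hx (d c) (hΛ c).1 O _ _
  · intro H U δ
    refine DualFamily.ext_of_hasDualGenerators hj hr hΛ (fun c x hx ξ hξ O hO h ↦ ?_) U δ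
    have : ξ = c.section' x hx := toFunction_injective _ (by rw [hξ, c.toFunction_section'])
    rw [this, key c x hx (d c) (hΛ c).1, ← H c x hx O h]

theorem TwistedForm.toDualFamily_injective (hr : t ≫ r = k₀ ≫ pullback.fst p j)
    (hΛ : HasDualGenerators r Λ d) (hj : IsEffectiveCartier j)
    {E E' : TwistedForm j p (i ≫ pullback.fst p j).ker (k₀ ≫ pullback.fst p j)}
    (h : ∀ U δ, (E.toDualFamily hj Λ).form U δ = (E'.toDualFamily hj Λ).form U δ) : E = E' := by
  have h1 := (E.toDualFamily_form_eq_iff hr hΛ hj _).1 h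
  have h2 := (E'.toDualFamily_form_eq_iff hr hΛ hj (E'.toDualFamily hj Λ)).1 fun _ _ ↦ rfl
  ext c x hx
  have h3 := (h1 c x hx _ le_rfl).symm.trans (h2 c x hx _ le_rfl)
  exact (resFun_self _).symm.trans (h3.trans (resFun_self _))

theorem DualFamily.exists_toDualFamily_form_eq (hr : t ≫ r = k₀ ≫ pullback.fst p j)
    (hΛ : HasDualGenerators r Λ d) (hj : IsEffectiveCartier j)
    (Φ : DualFamily L t (idealSheaf i) k₀) :
    ∃ E : TwistedForm j p (i ≫ pullback.fst p j).ker (k₀ ≫ pullback.fst p j),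
      ∀ U δ, (E.toDualFamily hj Λ).form U δ = Φ.form U δ := by
  obtain ⟨E, hE⟩ := exists_twistedForm hr hΛ Φ
  refine ⟨E, (E.toDualFamily_form_eq_iff hr hΛ hj Φ).2 fun c x hx O h ↦ ?_⟩
  have hle : c.Le c := ⟨le_rfl, le_rfl⟩
  have h1 := genVal_eq hr hΛ Φ hle (w := 1) (by rw [resFun_self, one_mul]) x hx (d c) (hΛ c).1
    (c.section' x hx) (by rw [c.toFunction_section', resFun_self]) O h
    (h.trans ((k₀ ≫ pullback.fst p j).preimage_mono c.le))
  rw [map_one, one_mul] at h1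
  rw [h1, hE]

end TwistedFormEquiv

/-! ### The twisted form of a pair of points of the dilatation -/

section Pair

set_option linter.unusedSectionVars false

variable {S S₀ X X' T T' : Scheme.{u}} {j : S₀ ⟶ S} [IsClosedImmersion j] {p : X ⟶ S}
  {I : X.IdealSheafData} {π : X' ⟶ X} (hπ : IsDilatation π I (j.ker.comap p))

namespace CartierChart

variable (c : CartierChart j p)

/-- The function `x / b` on the dilatation. -/
def quot (x : Γ(X, c.U.1)) (hx : x ∈ I.ideal c.U) : Γ(X', π ⁻¹ᵁ c.U.1) :=
  ((c.isBlowup hπ).exists_mul_eq hx).choose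

lemma app_b_mul_quot (x : Γ(X, c.U.1)) (hx : x ∈ I.ideal c.U) :
    (π.app c.U.1).hom c.b * c.quot hπ x hx = (π.app c.U.1).hom x :=
  ((c.isBlowup hπ).exists_mul_eq hx).choose_spec

include hπ in
lemma eq_of_app_b_mul_eq {y y' : Γ(X', π ⁻¹ᵁ c.U.1)}
    (h : (π.app c.U.1).hom c.b * y = (π.app c.U.1).hom c.b * y') : y = y' := by
  rw [← sub_eq_zero]
  exact (c.isBlowup hπ).eq_zero_of_mul_eq_zero (by rw [mul_sub, h, sub_self])

lemma quot_eq {x : Γ(X, c.U.1)} (hx : x ∈ I.ideal c.U) {y : Γ(X', π ⁻¹ᵁ c.U.1)}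
    (h : (π.app c.U.1).hom c.b * y = (π.app c.U.1).hom x) : c.quot hπ x hx = y :=
  c.eq_of_app_b_mul_eq hπ (by rw [h, c.app_b_mul_quot])

lemma quot_add (x x' : Γ(X, c.U.1)) (hx : x ∈ I.ideal c.U) (hx' : x' ∈ I.ideal c.U)
    (hxx : x + x' ∈ I.ideal c.U) :
    c.quot hπ (x + x') hxx = c.quot hπ x hx + c.quot hπ x' hx' :=
  c.quot_eq hπ hxx (by rw [mul_add, c.app_b_mul_quot, c.app_b_mul_quot, map_add])

lemma quot_mul (a x : Γ(X, c.U.1)) (hx : x ∈ I.ideal c.U) (hxx : a * x ∈ I.ideal c.U) :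
    c.quot hπ (a * x) hxx = (π.app c.U.1).hom a * c.quot hπ x hx :=
  c.quot_eq hπ hxx (by rw [mul_left_comm, c.app_b_mul_quot, map_mul])

lemma quot_b (a : Γ(X, c.U.1)) (h : c.b * a ∈ I.ideal c.U) :
    c.quot hπ (c.b * a) h = (π.app c.U.1).hom a := c.quot_eq hπ h (map_mul _ _ _).symm

lemma quot_res {c c' : CartierChart j p} (h : c'.Le c) {w : Γ(S, c'.A.1)}
    (hw : resFun h.le_A c.a = w * c'.a) (x : Γ(X, c.U.1)) (hx : x ∈ I.ideal c.U)
    (hx' : resFun h.le_U x ∈ I.ideal c'.U) :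
    c'.quot hπ (resFun h.le_U x) hx' =
      (π.app c'.U.1).hom ((p.appLE c'.A.1 c'.U.1 c'.le).hom w) *
        resFun (π.preimage_mono h.le_U) (c.quot hπ x hx) := by
  refine c'.quot_eq hπ hx' ?_
  rw [← mul_assoc, ← map_mul, mul_comm c'.b, ← h.resFun_b hw, app_resFun, ← map_mul,
    c.app_b_mul_quot, app_resFun]

end CartierChart

namespace TwistedForm

variable {k : T ⟶ X}

lemma le_preimage_of_comp_eq {κ : T ⟶ X'} (h : κ ≫ π = k) {O : T.Opens} {U : X.Opens}
    (hO : O ≤ k ⁻¹ᵁ U) : O ≤ κ ⁻¹ᵁ (π ⁻¹ᵁ U) := by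
  subst h; exact hO

/-- The difference of the values of two points of the dilatation on `x / b`. -/
def ofPair (κ κ' : T ⟶ X') (h : κ ≫ π = k) (h' : κ' ≫ π = k) : TwistedForm j p I k where
  val c x hx := (κ.appLE (π ⁻¹ᵁ c.U.1) _ (le_preimage_of_comp_eq h le_rfl)).hom (c.quot hπ x hx) -
    (κ'.appLE (π ⁻¹ᵁ c.U.1) _ (le_preimage_of_comp_eq h' le_rfl)).hom (c.quot hπ x hx)
  val_add c x x' hx hx' hxx := by
    rw [c.quot_add hπ x x' hx hx', map_add, map_add]
    ring
  val_mul c a x hx hax := by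
    subst h
    rw [c.quot_mul hπ a x hx, map_mul, map_mul, appLE_app_apply κ π _ le_rfl,
      appLE_app_apply κ' π _ (by rw [h']), appLE_congr_apply h' _ le_rfl,
      Scheme.Hom.appLE_eq_app, mul_sub]
  -- Both points have the same composite with `π`, and the quotient is pulled back along `π`.
  val_b c a hx := by
    subst h
    rw [c.quot_b hπ a, appLE_app_apply κ π _ le_rfl,
      appLE_app_apply κ' π _ (by rw [h']), appLE_congr_apply h' _ le_rfl, sub_self]
  val_res c c' hc w hw x hx hx' := by
    subst h
    rw [CartierChart.quot_res hπ hc hw x hx, map_mul, map_mul, appLE_app_apply κ π _ le_rfl,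
      appLE_app_apply κ' π _ (by rw [h']), appLE_congr_apply h' _ le_rfl,
      Scheme.Hom.appLE_eq_app, ← mul_sub, appLE_resFun, appLE_resFun, map_sub, resFun_appLE,
      resFun_appLE]

lemma ofPair_at (κ κ' : T ⟶ X') (h : κ ≫ π = k) (h' : κ' ≫ π = k) (c : CartierChart j p)
    (x : Γ(X, c.U.1)) (hx : x ∈ I.ideal c.U) (O : T.Opens) (hO : O ≤ k ⁻¹ᵁ c.U.1) :
    (ofPair hπ κ κ' h h').at' c x hx O hO =
      (κ.appLE (π ⁻¹ᵁ c.U.1) O (le_preimage_of_comp_eq h hO)).hom (c.quot hπ x hx) -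
      (κ'.appLE (π ⁻¹ᵁ c.U.1) O (le_preimage_of_comp_eq h' hO)).hom (c.quot hπ x hx) := by
  rw [at', ofPair]
  simp only [map_sub, resFun_appLE]

/-- The pullback of a twisted form along a morphism `T' ⟶ T`. -/
def precomp (E : TwistedForm j p I k) (l : T' ⟶ T) : TwistedForm j p I (l ≫ k) where
  val c x hx := (l.app (k ⁻¹ᵁ c.U.1)).hom (E.val c x hx)
  val_add c x x' hx hx' hxx := by rw [E.val_add c x x' hx hx', map_add]; rfl
  val_mul c a x hx hax := by
    rw [E.val_mul c a x hx, map_mul, Scheme.Hom.comp_app]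
    rfl
  val_b c a h := by rw [E.val_b, map_zero]; rfl
  val_res c c' hc w hw x hx hx' := by
    rw [E.val_res c c' hc w hw x hx, map_mul, app_resFun, Scheme.Hom.comp_app]
    rfl

lemma precomp_at (E : TwistedForm j p I k) (l : T' ⟶ T) (c : CartierChart j p)
    (x : Γ(X, c.U.1)) (hx : x ∈ I.ideal c.U) (O : T.Opens) (hO : O ≤ k ⁻¹ᵁ c.U.1) (O' : T'.Opens)
    (hO' : O' ≤ l ⁻¹ᵁ O) (h : O' ≤ (l ≫ k) ⁻¹ᵁ c.U.1) :
    (E.precomp l).at' c x hx O' h = (l.appLE O O' hO').hom (E.at' c x hx O hO) := by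
  rw [at', at', precomp, appLE_resFun]
  exact resFun_app l (le_preimage_preimage h) _

/-- Twisted forms are equal if they are equal locally. -/
lemma ext_of_local {E E' : TwistedForm j p I k}
    (h : ∀ z : T, ∀ (c : CartierChart j p) (_ : k z ∈ c.U.1) (x : Γ(X, c.U.1))
      (hx : x ∈ I.ideal c.U), ∃ (O : T.Opens) (hO : O ≤ k ⁻¹ᵁ c.U.1), z ∈ O ∧
        E.at' c x hx O hO = E'.at' c x hx O hO) : E = E' := by
  ext c x hx
  refine fun_ext fun z hz ↦ ?_
  obtain ⟨O, hO, hzO, e⟩ := h z c hz x hx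
  exact ⟨O, hO, hzO, e⟩

/-- Both equations generate the ideal of the divisor on the smaller chart and are non-zero-divisors,
so the transition factor is a unit. -/
lemma exists_mul_eq_one {c c' : CartierChart j p} (hc : c'.Le c) :
    ∃ v w, v * w = 1 ∧ resFun hc.le_A c.a = w * c'.a := by
  obtain ⟨w, hw⟩ := hc.exists_mul_eq
  have h1 : c'.a ∈ j.ker.ideal c'.A := by
    rw [c'.ideal_eq]; exact Ideal.mem_span_singleton_self _
  rw [ideal_eq_map_resFun j.ker hc.le_A, c.ideal_eq, Ideal.map_span, Set.image_singleton,
    Ideal.mem_span_singleton'] at h1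
  obtain ⟨v, hv⟩ := h1
  refine ⟨v, w, ?_, hw⟩
  have h2 : (v * w - 1) * c'.a = 0 := by
    rw [sub_mul, mul_assoc, ← hw, hv, one_mul, sub_self]
  exact sub_eq_zero.1 ((mul_right_mem_nonZeroDivisors_eq_zero_iff c'.mem_nonZeroDivisors).1 h2)

/-- Two twisted forms are equal on a chart if they agree on generators of the ideal of the
centre. -/
lemma at_eq_of_generators {E E' : TwistedForm j p I k} (c : RegularChart j p I)
    (O : T.Opens) (hO : O ≤ k ⁻¹ᵁ c.U.1)
    (h : ∀ l hl, E.at' c.toCartierChart (c.g l) hl O hO = E'.at' c.toCartierChart (c.g l) hl O hO)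
    (d : CartierChart j p) (x : Γ(X, d.U.1)) (hx : x ∈ I.ideal d.U) (z : T) (hz : z ∈ O)
    (hd : k z ∈ d.U.1) (hj : IsEffectiveCartier j) :
    ∃ (V : T.Opens) (hV : V ≤ k ⁻¹ᵁ d.U.1), z ∈ V ∧ E.at' d x hx V hV = E'.at' d x hx V hV := by
  obtain ⟨d', hzd', hd', hc⟩ := d.exists_le hj c.toCartierChart (k z) hd (hO hz)
  obtain ⟨w, hw⟩ := hc.exists_mul_eq
  obtain ⟨v', w', hvw, hw'⟩ := exists_mul_eq_one hd'
  let V : T.Opens := O ⊓ k ⁻¹ᵁ d'.U.1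
  have hVd' : V ≤ k ⁻¹ᵁ d'.U.1 := inf_le_right
  have hVA : V ≤ (k ≫ p) ⁻¹ᵁ d'.A.1 := hVd'.trans (k.preimage_mono d'.le)
  have key : ∀ x' (hx' : x' ∈ I.ideal d'.U), E.at' d' x' hx' V hVd' = E'.at' d' x' hx' V hVd' := by
    -- On a common refinement the ideal of the centre is generated by `b` and the `g l`. Twisted
    -- forms vanish on `b`, which is a multiple of the equation of `d'`, so the hypothesis on the `g
    -- l` is enough.
    have hI : I.ideal d'.U = Ideal.span ({resFun hc.le_U c.b} ∪
        Set.range fun l ↦ resFun hc.le_U (c.g l)) := by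
      rw [ideal_eq_map_resFun I hc.le_U, c.ideal_center_eq, Ideal.map_sup, Ideal.map_span,
        Ideal.ofList, Ideal.map_span, Ideal.span_union, Set.image_singleton]
      congr 2
      ext y
      simp [List.mem_ofFn]
    intro x' hx'
    have hx'' := hx'
    rw [hI] at hx''
    induction hx'' using Submodule.span_induction with
    | mem y hy =>
      rcases hy with rfl | ⟨l, rfl⟩
      · have h0 : ∀ F : TwistedForm j p I k, F.at' d' (resFun hc.le_U c.b) hx' V hVd' = 0 := by
          intro F
          have h1 : resFun hc.le_U c.b = d'.b * (p.appLE d'.A.1 d'.U.1 d'.le).hom w := by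
            rw [hc.resFun_b hw, mul_comm]
          have h2 : F.val d' (resFun hc.le_U c.b) hx' = 0 := by
            rw [← F.val_b d' _ (by rw [← h1]; exact hx')]
            congr 1
          rw [at', h2, map_zero]
        rw [h0, h0]
      · have hl : c.g l ∈ I.ideal c.U := by
          rw [c.ideal_center_eq]
          exact Ideal.mem_sup_right (Ideal.subset_span (List.mem_ofFn.2 ⟨l, rfl⟩))
        rw [E.at_le hc hw _ hl V hVd' hVA, E'.at_le hc hw _ hl V hVd' hVA]
        congr 1
        have := congrArg (resFun (inf_le_left : V ≤ O)) (h l hl)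
        rwa [resFun_at, resFun_at] at this
    | zero =>
      have h0 : ∀ F : TwistedForm j p I k, F.at' d' 0 hx' V hVd' = 0 := by
        intro F
        have h2 : F.val d' 0 hx' = 0 := by
          rw [← F.val_b d' 0 (by rw [mul_zero]; exact hx')]
          congr 1
          rw [mul_zero]
        rw [at', h2, map_zero]
      rw [h0, h0]
    | add y y' hy hy' ih ih' =>
      replace hy : y ∈ I.ideal d'.U := by rw [hI]; exact hy
      replace hy' : y' ∈ I.ideal d'.U := by rw [hI]; exact hy'
      rw [E.at_add d' y y' hy hy', E'.at_add d' y y' hy hy', ih, ih']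
    | smul a y hy ih =>
      replace hy : y ∈ I.ideal d'.U := by rw [hI]; exact hy
      exact (E.at_mul d' a y hy V hVd').trans ((congrArg _ (ih hy)).trans
        (E'.at_mul d' a y hy V hVd').symm)
  refine ⟨V, hVd'.trans (k.preimage_mono hd'.le_U), ⟨hz, hzd'⟩, ?_⟩
  have h1 := key _ (resFun_mem_ideal I hd'.le_U hx)
  rw [E.at_le hd' hw' x hx V hVd' hVA, E'.at_le hd' hw' x hx V hVd' hVA] at h1
  -- The transition factor from `d` to `d'` is a unit and can be cancelled, which returns the
  -- equality to the chart `d`.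
  have h2 := congrArg (((k ≫ p).appLE d'.A.1 V hVA).hom v' * ·) h1
  simpa only [← mul_assoc, ← map_mul, hvw, map_one, one_mul] using h2

end TwistedForm

end Pair

/-! ### Functions pulled back along morphisms to affine opens -/

section HomOfRingHom

variable {T Y : Scheme.{u}} {V : T.Opens} {U : Y.Opens}

lemma toSpecΓ_comp_SpecMap_injective {R : CommRingCat.{u}} {φ φ' : R ⟶ Γ(T, V)}
    (h : V.toSpecΓ ≫ Spec.map φ = V.toSpecΓ ≫ Spec.map φ') : φ = φ' := by
  have h2 := congrArg (fun f ↦ Scheme.Hom.appTop f) h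
  simp only [Scheme.Hom.comp_appTop, Scheme.Opens.toSpecΓ_appTop] at h2
  have h3 : ∀ φ : R ⟶ Γ(T, V), (Spec.map φ).appTop = (Scheme.ΓSpecIso _).hom ≫ φ ≫
      (Scheme.ΓSpecIso _).inv := fun φ ↦ by
    rw [Scheme.ΓSpecIso_inv_naturality, Iso.hom_inv_id_assoc]
  rw [h3, h3] at h2
  simp only [Category.assoc, Iso.inv_hom_id_assoc, cancel_epi] at h2
  rwa [cancel_mono] at h2

lemma homOfRingHom_appLE (hU : IsAffineOpen U) (ψ : Γ(Y, U) →+* Γ(T, V))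
    (h : ⊤ ≤ homOfRingHom hU ψ ⁻¹ᵁ U) (hV : ⊤ ≤ V.ι ⁻¹ᵁ V) (a : Γ(Y, U)) :
    ((homOfRingHom hU ψ).appLE U ⊤ h).hom a = (V.ι.appLE V ⊤ hV).hom (ψ a) := by
  have h1 := toSpecΓ_appLE_fromSpec hU (homOfRingHom hU ψ) h
  have h2 := Scheme.Opens.toSpecΓ_SpecMap_appLE V.ι V ⊤ hV
  have h3 : V.ι.resLE V ⊤ hV = (⊤ : V.toScheme.Opens).ι := by
    rw [← cancel_mono V.ι, Scheme.Hom.resLE_comp_ι]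
  have h4 : (⊤ : V.toScheme.Opens).ι ≫ homOfRingHom hU ψ = (⊤ : V.toScheme.Opens).toSpecΓ ≫
      Spec.map (CommRingCat.ofHom ψ ≫ V.ι.appLE V ⊤ hV) ≫ hU.fromSpec := by
    change _ ≫ V.toSpecΓ ≫ Spec.map (CommRingCat.ofHom ψ) ≫ hU.fromSpec = _
    rw [Spec.map_comp, Category.assoc, ← Category.assoc, ← h3, ← h2, Category.assoc]
  rw [h4, ← Category.assoc, ← Category.assoc, cancel_mono] at h1
  exact congrArg (fun f ↦ f.hom a) (toSpecΓ_comp_SpecMap_injective h1)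

lemma opensFun_ι_appLE {Ω O : T.Opens} (hO : O ≤ Ω) (a : Γ(T, O)) :
    opensFun hO ((Ω.ι.appLE O (Ω.ι ⁻¹ᵁ O) le_rfl).hom a) = a := by
  rw [Scheme.Opens.ι_appLE]
  exact (resFun_resFun (X := T) _ (le_image_preimage hO) a).trans (resFun_self _)

end HomOfRingHom

/-! ### Points of the dilatation over a point of the centre correspond to twisted forms -/

section PointsOfTwistedForm

set_option linter.unusedSectionVars false

variable {S S₀ X X' H T : Scheme.{u}} {j : S₀ ⟶ S} [IsClosedImmersion j] {p : X ⟶ S}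
  {i : H ⟶ pullback p j} [IsClosedImmersion i] {π : X' ⟶ X} {k : T ⟶ X}

namespace RegularChart

variable {I : X.IdealSheafData} (c : RegularChart j p I)

lemma g_mem (l : Fin c.n) : c.g l ∈ I.ideal c.U := by
  rw [c.ideal_center_eq]
  exact Ideal.mem_sup_right (Ideal.subset_span (List.mem_ofFn.2 ⟨l, rfl⟩))

lemma b_mem : c.b ∈ I.ideal c.U := by
  rw [c.ideal_center_eq]
  exact Ideal.mem_sup_left (Ideal.mem_span_singleton_self _)

end RegularChart

namespace TwistedForm

/-- A point of the dilatation is determined by its twisted form. -/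
theorem ofPair_injective (hj : IsEffectiveCartier j) (hi : IsRegularImmersion i)
    (hπ : IsDilatation π (i ≫ pullback.fst p j).ker (j.ker.comap p)) {κ κ' κ₀ : T ⟶ X'}
    (h : κ ≫ π = k) (h' : κ' ≫ π = k) (h₀ : κ₀ ≫ π = k)
    (e : ofPair hπ κ κ₀ h h₀ = ofPair hπ κ' κ₀ h' h₀) : κ = κ' := by
  refine Scheme.hom_ext_of_forall _ _ fun z ↦ ?_
  obtain ⟨c, hc, -⟩ := exists_regularChart (p := p) hj hi (k z) ⊤ trivial
  refine ⟨k ⁻¹ᵁ c.U.1, hc, c.hom_ext hπ (fun l ↦ c.quot hπ (c.g l) (c.g_mem l))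
    (fun l ↦ c.app_b_mul_quot hπ _ _) (h.trans h'.symm) (le_preimage_of_comp_eq h le_rfl)
    (le_preimage_of_comp_eq h' le_rfl) fun l ↦ ?_⟩
  have h1 := congrArg (fun E ↦ E.val c.toCartierChart (c.g l) (c.g_mem l)) e
  exact sub_left_injective h1

/-- The morphism `g` is the point with twisted form `E` over `W`. -/
def Matches (hπ : IsDilatation π (i ≫ pullback.fst p j).ker (j.ker.comap p))
    (E : TwistedForm j p (i ≫ pullback.fst p j).ker k) (κ₀ : T ⟶ X') {W : Scheme.{u}} (l : W ⟶ T)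
    (g : W ⟶ X') : Prop :=
  ∃ (h₁ : g ≫ π = l ≫ k) (h₂ : (l ≫ κ₀) ≫ π = l ≫ k), ofPair hπ g (l ≫ κ₀) h₁ h₂ = E.precomp l

lemma Matches.comp {hπ : IsDilatation π (i ≫ pullback.fst p j).ker (j.ker.comap p)}
    {E : TwistedForm j p (i ≫ pullback.fst p j).ker k} {κ₀ : T ⟶ X'} {W W' : Scheme.{u}}
    {l : W ⟶ T} {g : W ⟶ X'} (h : Matches hπ E κ₀ l g) (l' : W' ⟶ W) :
    Matches hπ E κ₀ (l' ≫ l) (l' ≫ g) := by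
  obtain ⟨h₁, h₂, e⟩ := h
  refine ⟨by rw [Category.assoc, h₁, Category.assoc], by
    rw [Category.assoc, Category.assoc, ← Category.assoc l, h₂, Category.assoc], ?_⟩
  ext c x hx
  have h3 := congrArg (fun E ↦ (l'.app _).hom (E.val c x hx)) e
  have h4 : ((l' ≫ l).app (k ⁻¹ᵁ c.U.1)).hom (E.val c x hx) =
      (l'.app _).hom ((l.app (k ⁻¹ᵁ c.U.1)).hom (E.val c x hx)) := by
    rw [Scheme.Hom.comp_app]; rfl
  refine Eq.trans ?_ (h3.trans h4.symm)
  simp only [ofPair]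
  rw [map_sub, ← Scheme.Hom.appLE_eq_app, appLE_appLE_apply l' _ _ le_rfl
    (le_preimage_of_comp_eq (π := π) (k := l' ≫ l ≫ k) (by rw [Category.assoc, h₁]) le_rfl),
    appLE_appLE_apply l' _ _ le_rfl
    (le_preimage_of_comp_eq (π := π) (k := l' ≫ l ≫ k) (by rw [Category.assoc, h₂]) le_rfl)]
  rfl

/-- Every twisted form is the form of a point of the dilatation. -/
theorem exists_ofPair_eq [Flat p] (hj : IsEffectiveCartier j) (hi : IsRegularImmersion i)
    (hπ : IsDilatation π (i ≫ pullback.fst p j).ker (j.ker.comap p)) {κ₀ : T ⟶ X'}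
    (h₀ : κ₀ ≫ π = k) (hk : ∃ f : T ⟶ H, f ≫ i ≫ pullback.fst p j = k)
    (E : TwistedForm j p (i ≫ pullback.fst p j).ker k) :
    ∃ (κ : T ⟶ X') (h : κ ≫ π = k), ofPair hπ κ κ₀ h h₀ = E := by
  have := hπ.isAffineHom
  obtain ⟨g, hg⟩ := exists_of_local (fun {W} (l : W ⟶ T) (g : W ⟶ X') ↦ Matches hπ E κ₀ l g)
    (fun l' _ l _ g h ↦ h.comp l')
    (fun {W} l _ g g' ⟨h₁, h₂, e⟩ ⟨h₁', h₂', e'⟩ ↦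
      ofPair_injective hj hi hπ h₁ h₁' h₂ (e.trans e'.symm)) (fun z ↦ by
    obtain ⟨c, hc, -⟩ := exists_regularChart (p := p) hj hi (k z) ⊤ trivial
    obtain ⟨f, hf⟩ := hk
    let V := k ⁻¹ᵁ c.U.1
    have hV : V ≤ κ₀ ⁻¹ᵁ (π ⁻¹ᵁ c.U.1) := le_preimage_of_comp_eq h₀ le_rfl
    -- The coordinates of the required point are those of `κ₀` shifted by the values of `E`. They
    -- are unconstrained because `k` factors through the centre, where `b` and the `g l` vanish.
    obtain ⟨ψ, hψ, hψy⟩ := c.exists_ringHom hπ (fun l ↦ c.quot hπ (c.g l) (c.g_mem l))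
      (fun l ↦ c.app_b_mul_quot hπ _ _) k (V := V) le_rfl
      (appLE_eq_zero_of_mem_ker hf le_rfl c.b_mem)
      (fun l ↦ appLE_eq_zero_of_mem_ker hf le_rfl (c.g_mem l))
      (fun l ↦ E.val c.toCartierChart (c.g l) (c.g_mem l) +
        (κ₀.appLE _ V hV).hom (c.quot hπ (c.g l) (c.g_mem l)))
    have h₁ := homOfRingHom_comp_eq k (U := c.U) (V := V) le_rfl ψ hψ
    have h₂ : (V.ι ≫ κ₀) ≫ π = V.ι ≫ k := by rw [Category.assoc, h₀]
    refine ⟨V, hc, homOfRingHom (c.U.2.preimage π) ψ, h₁, h₂, ?_⟩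
    refine ext_of_local fun w d hd x hx ↦ ?_
    have hT : (⊤ : V.toScheme.Opens) ≤ (V.ι ≫ k) ⁻¹ᵁ c.U.1 := fun w _ ↦ w.2
    have hT' : (⊤ : V.toScheme.Opens) ≤ V.ι ⁻¹ᵁ V := fun w _ ↦ w.2
    refine at_eq_of_generators c ⊤ hT (fun l hl ↦ ?_) d x hx w trivial hd hj
    rw [ofPair_at, E.precomp_at V.ι _ _ hl V le_rfl ⊤ hT' hT,
      homOfRingHom_appLE (c.U.2.preimage π) ψ _ hT', hψy, map_add,
      appLE_appLE_apply V.ι κ₀ hV hT' (le_preimage_of_comp_eq h₂ hT), add_sub_cancel_right]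
    exact congrArg _ (resFun_self _).symm)
  refine ⟨g, Scheme.hom_ext_of_forall _ _ fun z ↦ ?_, ?_⟩
  · obtain ⟨W, hW, h₁, -⟩ := hg z
    exact ⟨W, hW, by rw [← Category.assoc, h₁]⟩
  · refine ext_of_local fun z c hc x hx ↦ ?_
    obtain ⟨W, hW, h₁, h₂, e⟩ := hg z
    refine ⟨W ⊓ k ⁻¹ᵁ c.U.1, inf_le_right, ⟨hW, hc⟩, ?_⟩
    have hO : W.ι ⁻¹ᵁ (W ⊓ k ⁻¹ᵁ c.U.1) ≤ (W.ι ≫ k) ⁻¹ᵁ c.U.1 := fun w hw ↦ hw.2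
    have h3 := congrArg (fun E ↦ E.at' c x hx (W.ι ⁻¹ᵁ (W ⊓ k ⁻¹ᵁ c.U.1)) hO) e
    rw [ofPair_at, E.precomp_at W.ι c x hx (W ⊓ k ⁻¹ᵁ c.U.1) inf_le_right _ le_rfl hO] at h3
    rw [ofPair_at, ← opensFun_appLE inf_le_left, ← opensFun_appLE inf_le_left, ← map_sub]
    exact (congrArg _ h3).trans (opensFun_ι_appLE _ _)

end TwistedForm

end PointsOfTwistedForm

/-! ### Additivity of the quotients `x/b` -/

section Additivity

set_option linter.unusedSectionVars false

variable {S S₀ X X' T P Q : Scheme.{u}} {j : S₀ ⟶ S} [IsClosedImmersion j] {p : X ⟶ S}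
  {I : X.IdealSheafData} {π : X' ⟶ X}

/-- If functions in `I` are additive to first order along `m`, then the quotients `x / b` are
additive on the points of the dilatation over a given point of `Q`. -/
theorem quot_additive (hπ : IsDilatation π I (j.ker.comap p)) {σ : Q ⟶ S} {m pr₁ pr₂ : Q ⟶ X}
    (hm : m ≫ p = σ) (h₁ : pr₁ ≫ p = σ) (h₂ : pr₂ ≫ p = σ)
    (hI : I.comap m ≤ I.comap pr₁ ⊔ I.comap pr₂) {ϖ : P ⟶ Q} {M p₁ p₂ : P ⟶ X'}
    (hM : M ≫ π = ϖ ≫ m) (hp₁ : p₁ ≫ π = ϖ ≫ pr₁) (hp₂ : p₂ ≫ π = ϖ ≫ pr₂) [Flat (ϖ ≫ σ)]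
    {s : T ⟶ Q} {s₁₂ s₁ s₂ s₀ : T ⟶ P} (e₁₂ : s₁₂ ≫ ϖ = s) (e₁ : s₁ ≫ ϖ = s) (e₂ : s₂ ≫ ϖ = s)
    (e₀ : s₀ ≫ ϖ = s) (f₁ : s₁₂ ≫ p₁ = s₁ ≫ p₁) (f₁' : s₂ ≫ p₁ = s₀ ≫ p₁)
    (f₂ : s₁₂ ≫ p₂ = s₂ ≫ p₂) (f₂' : s₁ ≫ p₂ = s₀ ≫ p₂) {k : T ⟶ X} (hk : s ≫ m = k)
    (hk₁ : s ≫ pr₁ = k) (hk₂ : s ≫ pr₂ = k) (c : CartierChart j p) (x : Γ(X, c.U.1))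
    (hx : x ∈ I.ideal c.U) (O : T.Opens) (hO : O ≤ k ⁻¹ᵁ c.U.1)
    (O₁₂ : O ≤ (s₁₂ ≫ M) ⁻¹ᵁ (π ⁻¹ᵁ c.U.1)) (O₁ : O ≤ (s₁ ≫ M) ⁻¹ᵁ (π ⁻¹ᵁ c.U.1))
    (O₂ : O ≤ (s₂ ≫ M) ⁻¹ᵁ (π ⁻¹ᵁ c.U.1)) (O₀ : O ≤ (s₀ ≫ M) ⁻¹ᵁ (π ⁻¹ᵁ c.U.1)) :
    ((s₁₂ ≫ M).appLE _ O O₁₂).hom (c.quot hπ x hx) + ((s₀ ≫ M).appLE _ O O₀).hom (c.quot hπ x hx) =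
      ((s₁ ≫ M).appLE _ O O₁).hom (c.quot hπ x hx) +
        ((s₂ ≫ M).appLE _ O O₂).hom (c.quot hπ x hx) := by
  refine fun_ext fun z hz ↦ ?_
  have hzW : s z ∈ m ⁻¹ᵁ c.U.1 ⊓ (pr₁ ⁻¹ᵁ c.U.1 ⊓ pr₂ ⁻¹ᵁ c.U.1) := by
    refine ⟨?_, ?_, ?_⟩
    · change (s ≫ m) z ∈ c.U.1
      rw [hk]; exact hO hz
    · change (s ≫ pr₁) z ∈ c.U.1
      rw [hk₁]; exact hO hz
    · change (s ≫ pr₂) z ∈ c.U.1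
      rw [hk₂]; exact hO hz
  obtain ⟨W, hW, hzW, hle⟩ := exists_isAffineOpen_le hzW
  have hWm : W ≤ m ⁻¹ᵁ c.U.1 := hle.trans inf_le_left
  have hW₁ : W ≤ pr₁ ⁻¹ᵁ c.U.1 := hle.trans (inf_le_right.trans inf_le_left)
  have hW₂ : W ≤ pr₂ ⁻¹ᵁ c.U.1 := hle.trans (inf_le_right.trans inf_le_right)
  have hWσ : W ≤ σ ⁻¹ᵁ c.A.1 := by
    rw [← hm]; exact hWm.trans (m.preimage_mono c.le)
  have hMW : ϖ ⁻¹ᵁ W ≤ M ⁻¹ᵁ (π ⁻¹ᵁ c.U.1) :=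
    TwistedForm.le_preimage_of_comp_eq hM (ϖ.preimage_mono hWm)
  have hpW₁ : ϖ ⁻¹ᵁ W ≤ p₁ ⁻¹ᵁ (π ⁻¹ᵁ c.U.1) :=
    TwistedForm.le_preimage_of_comp_eq hp₁ (ϖ.preimage_mono hW₁)
  have hpW₂ : ϖ ⁻¹ᵁ W ≤ p₂ ⁻¹ᵁ (π ⁻¹ᵁ c.U.1) :=
    TwistedForm.le_preimage_of_comp_eq hp₂ (ϖ.preimage_mono hW₂)
  -- Multiplying by the equation of the divisor turns the pullback of `x/b` along `M'` into a
  -- function pulled back from `Q`. It is used for `m` and for both projections.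
  have hb : ∀ {μ' : Q ⟶ X} (e : μ' ≫ p = σ) {M' : P ⟶ X'} (e' : M' ≫ π = ϖ ≫ μ')
      (hμ : W ≤ μ' ⁻¹ᵁ c.U.1) (hM' : ϖ ⁻¹ᵁ W ≤ M' ⁻¹ᵁ (π ⁻¹ᵁ c.U.1)) (x : Γ(X, c.U.1))
      (hx : x ∈ I.ideal c.U),
      ((ϖ ≫ σ).appLE c.A.1 (ϖ ⁻¹ᵁ W) (ϖ.preimage_mono hWσ)).hom c.a *
        (M'.appLE _ _ hM').hom (c.quot hπ x hx) = (ϖ.app W).hom ((μ'.appLE _ W hμ).hom x) := by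
    intro μ' e M' e' hμ hM' x hx
    have hMπ : ϖ ⁻¹ᵁ W ≤ (M' ≫ π) ⁻¹ᵁ c.U.1 := hM'
    have h0 : ϖ ⁻¹ᵁ W ≤ (ϖ ≫ μ') ⁻¹ᵁ c.U.1 := ϖ.preimage_mono hμ
    have hA : ϖ ⁻¹ᵁ W ≤ ((ϖ ≫ μ') ≫ p) ⁻¹ᵁ c.A.1 := h0.trans ((ϖ ≫ μ').preimage_mono c.le)
    have h1 := congrArg (M'.appLE _ _ hM').hom (c.app_b_mul_quot hπ x hx)
    rw [map_mul, appLE_app_apply M' π _ hMπ, appLE_app_apply M' π _ hMπ,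
      appLE_congr_apply e' hMπ h0, appLE_congr_apply e' hMπ h0, CartierChart.b,
      appLE_appLE_apply (ϖ ≫ μ') p c.le h0 hA,
      appLE_congr_apply ((Category.assoc _ _ _).trans (congrArg (ϖ ≫ ·) e)) hA
        (ϖ.preimage_mono hWσ)] at h1
    rw [← Scheme.Hom.appLE_eq_app, appLE_appLE_apply ϖ μ' hμ le_rfl h0]
    exact h1
  let V : T.Opens := O ⊓ s ⁻¹ᵁ W
  have hV : ∀ {s' : T ⟶ P}, s' ≫ ϖ = s → V ≤ s' ⁻¹ᵁ (ϖ ⁻¹ᵁ W) := by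
    rintro s' rfl
    exact inf_le_right
  have hp : ∀ {p' : P ⟶ X'} {s' s'' : T ⟶ P} (e : s' ≫ ϖ = s) (e' : s'' ≫ ϖ = s)
      (_ : s' ≫ p' = s'' ≫ p') (h : ϖ ⁻¹ᵁ W ≤ p' ⁻¹ᵁ (π ⁻¹ᵁ c.U.1)) (q : Γ(X', π ⁻¹ᵁ c.U.1)),
      (s'.appLE _ V (hV e)).hom ((p'.appLE _ _ h).hom q) =
        (s''.appLE _ V (hV e')).hom ((p'.appLE _ _ h).hom q) := by
    intro p' s' s'' e e' f h q
    have h' : V ≤ (s' ≫ p') ⁻¹ᵁ (π ⁻¹ᵁ c.U.1) := (hV e).trans (s'.preimage_mono h)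
    have h'' : V ≤ (s'' ≫ p') ⁻¹ᵁ (π ⁻¹ᵁ c.U.1) := (hV e').trans (s''.preimage_mono h)
    rw [appLE_appLE_apply s' p' h (hV e) h', appLE_appLE_apply s'' p' h (hV e') h'',
      appLE_congr_apply f h' h'']
  -- Each `w` in the sum of the ideals has a quotient by the equation on `P` that satisfies the
  -- four-point identity. A quotient coming from `p₁` takes equal values at `s₁₂, s₁` and at `s₂,
  -- s₀`, and symmetrically for `p₂`; coefficients from `Q` take the same value at all four points.
  have key : ∀ w ∈ (I.comap pr₁ ⊔ I.comap pr₂).ideal ⟨W, hW⟩, ∃ y : Γ(P, ϖ ⁻¹ᵁ W),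
      ((ϖ ≫ σ).appLE c.A.1 (ϖ ⁻¹ᵁ W) (ϖ.preimage_mono hWσ)).hom c.a * y = (ϖ.app W).hom w ∧
      (s₁₂.appLE _ V (hV e₁₂)).hom y + (s₀.appLE _ V (hV e₀)).hom y =
        (s₁.appLE _ V (hV e₁)).hom y + (s₂.appLE _ V (hV e₂)).hom y := by
    intro w hw
    rw [Scheme.IdealSheafData.ideal_sup, Pi.sup_apply, ideal_comap I pr₁ c.U ⟨W, hW⟩ hW₁,
      ideal_comap I pr₂ c.U ⟨W, hW⟩ hW₂, Ideal.map, Ideal.map, ← Ideal.span_union] at hw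
    induction hw using Submodule.span_induction with
    | mem w hw =>
      rcases hw with ⟨ξ, hξ, rfl⟩ | ⟨ξ, hξ, rfl⟩
      · refine ⟨(p₁.appLE _ _ hpW₁).hom (c.quot hπ ξ hξ), hb h₁ hp₁ hW₁ hpW₁ ξ hξ, ?_⟩
        rw [hp e₁₂ e₁ f₁ hpW₁, hp e₂ e₀ f₁' hpW₁]
      · refine ⟨(p₂.appLE _ _ hpW₂).hom (c.quot hπ ξ hξ), hb h₂ hp₂ hW₂ hpW₂ ξ hξ, ?_⟩
        rw [hp e₁₂ e₂ f₂ hpW₂, hp e₁ e₀ f₂' hpW₂, add_comm]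
    | zero => exact ⟨0, by simp only [mul_zero, map_zero], by simp only [map_zero]⟩
    | add w w' _ _ ih ih' =>
      obtain ⟨y, hy, hys⟩ := ih
      obtain ⟨y', hy', hys'⟩ := ih'
      refine ⟨y + y', by rw [mul_add, hy, hy', map_add], ?_⟩
      simp only [map_add]
      linear_combination hys + hys'
    | smul a w _ ih =>
      obtain ⟨y, hy, hys⟩ := ih
      refine ⟨(ϖ.app W).hom a * y, by rw [mul_left_comm, hy, smul_eq_mul, map_mul], ?_⟩
      have ha : ∀ {s' : T ⟶ P} (e : s' ≫ ϖ = s), (s'.appLE _ V (hV e)).hom ((ϖ.app W).hom a) =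
          (s.appLE W V inf_le_right).hom a := by
        rintro s' rfl
        exact appLE_app_apply s' ϖ _ _ a
      simp only [map_mul, ha e₁₂, ha e₁, ha e₂, ha e₀]
      linear_combination (s.appLE W V inf_le_right).hom a * hys
  obtain ⟨y, hy, hys⟩ := key ((m.appLE c.U.1 W hWm).hom x) (by
    have := hI ⟨W, hW⟩
    refine this ?_
    rw [ideal_comap I m c.U ⟨W, hW⟩ hWm]
    exact Ideal.mem_map_of_mem _ hx)
  -- `P` is flat over `S`, so the quotient by the equation is unique and is the pullback of `x/b`
  -- along `M`.
  have hyM : y = (M.appLE _ _ hMW).hom (c.quot hπ x hx) := by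
    rw [← sub_eq_zero]
    refine eq_zero_of_appLE_mul_eq_zero (ϖ ≫ σ) c.A.2 c.mem_nonZeroDivisors
      (ϖ.preimage_mono hWσ) _ ?_
    rw [mul_sub, hy, hb hm hM hWm hMW x hx, sub_self]
  subst hyM
  refine ⟨V, inf_le_left, ⟨hz, hzW⟩, ?_⟩
  have hf : ∀ {s' : T ⟶ P} (e : s' ≫ ϖ = s) (h : O ≤ (s' ≫ M) ⁻¹ᵁ (π ⁻¹ᵁ c.U.1)),
      resFun (inf_le_left : V ≤ O) (((s' ≫ M).appLE _ O h).hom (c.quot hπ x hx)) =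
        (s'.appLE _ V (hV e)).hom ((M.appLE _ _ hMW).hom (c.quot hπ x hx)) := by
    intro s' e h
    rw [resFun_appLE, appLE_appLE_apply s' M hMW (hV e)]
  rw [map_add, map_add, hf e₁₂, hf e₁, hf e₂, hf e₀, hys]

end Additivity

/-! ### Points of `G₀` over `S₀` as points of `G` over `S` -/

section GroupPoints

set_option linter.unusedSectionVars false

variable {S S₀ : Scheme.{u}} {j : S₀ ⟶ S} {G : Over S} {T : Over S₀}

/-- The morphism over `S` corresponding to a morphism over `S₀` to `G₀`. -/
def toBase (a : T ⟶ special j G) : (Over.map j).obj T ⟶ G :=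
  ((Over.mapPullbackAdj j).homEquiv _ _).symm a

lemma toBase_left (a : T ⟶ special j G) : (toBase a).left = a.left ≫ proj j G := by
  rw [toBase, Adjunction.homEquiv_counit]
  rfl

lemma toBase_injective : Function.Injective (toBase : (T ⟶ special j G) → _) :=
  ((Over.mapPullbackAdj j).homEquiv _ _).symm.injective

/-- The morphism over `S₀` to `G₀` corresponding to a morphism over `S` to `G`. -/
def ofBase (a : (Over.map j).obj T ⟶ G) : T ⟶ special j G :=
  (Over.mapPullbackAdj j).homEquiv _ _ a

lemma toBase_ofBase (a : (Over.map j).obj T ⟶ G) : toBase (ofBase a) = a :=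
  Equiv.symm_apply_apply _ _

lemma ofBase_toBase (a : T ⟶ special j G) : ofBase (toBase a) = a :=
  Equiv.apply_symm_apply _ _

lemma toBase_comp {G' : Over S} (a : T ⟶ special j G) (f : G ⟶ G') :
    toBase (a ≫ (Over.pullback j).map f) = toBase a ≫ f :=
  (Over.mapPullbackAdj j).homEquiv_naturality_right_symm _ _

lemma ofBase_mul [GrpObj G] (a b : (Over.map j).obj T ⟶ G) :
    ofBase (a * b) = ofBase a * ofBase b := by
  simp only [ofBase, Adjunction.homEquiv_unit, Functor.map_mul, MonObj.comp_mul]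

lemma ofBase_one [GrpObj G] : ofBase (1 : (Over.map j).obj T ⟶ G) = 1 := by
  simp only [ofBase, Adjunction.homEquiv_unit, Functor.map_one, MonObj.comp_one]

lemma toBase_mul [GrpObj G] (a b : T ⟶ special j G) : toBase (a * b) = toBase a * toBase b := by
  rw [← ofBase_toBase a, ← ofBase_toBase b, ← ofBase_mul, toBase_ofBase, toBase_ofBase,
    toBase_ofBase]

lemma toBase_one [GrpObj G] : toBase (1 : T ⟶ special j G) = 1 := by
  rw [← ofBase_one, toBase_ofBase]

end GroupPoints

/-! ### Additivity of the twisted form on the kernel -/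

section GroupAdditivity

set_option linter.unusedSectionVars false

variable {S S₀ : Scheme.{u}} {j : S₀ ⟶ S} [IsClosedImmersion j] {G : Over S}
  {H : Over S₀} {i : H ⟶ special j G} [IsClosedImmersion i.left]

lemma exists_over_of_left {Z : Over S} {f : Z ⟶ G} {t : (special j Z).left ⟶ H.left}
    (ht : t ≫ i.left ≫ proj j G = proj j Z ≫ f.left) :
    ∃ t : special j Z ⟶ H, t ≫ i = (Over.pullback j).map f := by
  have hm : t ≫ i.left = ((Over.pullback j).map f).left := by
    refine pullback.hom_ext ?_ ?_
    · rw [Category.assoc]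
      exact ht.trans (proj_comp_left (j := j) f)
    · rw [← cancel_mono j, Category.assoc, Category.assoc, Category.assoc, ← pullback.condition]
      have := congrArg (· ≫ G.hom) ht
      simp only [Category.assoc, Over.w f] at this
      rw [this, pullback.condition]
      exact ((congrArg (· ≫ j) (Over.w ((Over.pullback j).map f)).symm).trans
        (Category.assoc _ _ _)).trans (congrArg (_ ≫ ·) pullback.condition.symm)
  refine ⟨Over.homMk t ?_, Over.OverMorphism.ext hm⟩
  have h1 : t ≫ H.hom = (t ≫ i.left) ≫ (special j G).hom := by
    rw [Category.assoc, Over.w i]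
  rw [h1, hm]
  exact Over.w _

lemma exists_lift_of_ker_le {Z : Over S} {f : Z ⟶ G}
    (h : (i.left ≫ proj j G).ker ≤ f.left.ker) :
    ∃ t : special j Z ⟶ H, t ≫ i = (Over.pullback j).map f :=
  exists_over_of_left (IsClosedImmersion.lift_fac (i.left ≫ proj j G) (proj j Z ≫ f.left)
    (h.trans (Scheme.Hom.le_ker_comp _ _)))

/-- On the closed subscheme `Z` of `G × G` defined by the right-hand side both projections land in
`H`. Since `H` is a subgroup, so does their product, which says that its ideal vanishes on `Z`. -/
lemma comap_mul_le [GrpObj G] [GrpObj H] [IsMonHom i] :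
    (i.left ≫ proj j G).ker.comap μ[G].left ≤
      (i.left ≫ proj j G).ker.comap (fst G G).left ⊔
        (i.left ≫ proj j G).ker.comap (snd G G).left := by
  set K := (i.left ≫ proj j G).ker.comap (fst G G).left ⊔
        (i.left ≫ proj j G).ker.comap (snd G G).left with hK
  let Z : Over S := Over.mk (K.subschemeι ≫ (G ⊗ G).hom)
  let z : Z ⟶ G ⊗ G := Over.homMk K.subschemeι
  have h : ∀ f : G ⊗ G ⟶ G, (i.left ≫ proj j G).ker.comap f.left ≤ K ↔
      (i.left ≫ proj j G).ker ≤ (z ≫ f).left.ker := by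
    intro f
    rw [Over.comp_left, Scheme.Hom.ker_comp z.left, Scheme.IdealSheafData.le_map_iff_comap_le]
    change _ ↔ _ ≤ K.subschemeι.ker
    rw [Scheme.IdealSheafData.ker_subschemeι]
  have h₁ := (h (fst G G)).1 le_sup_left
  have h₂ := (h (snd G G)).1 le_sup_right
  have e : z ≫ μ[G] = (z ≫ fst G G) * (z ≫ snd G G) := by
    rw [Hom.mul_def, ← comp_lift, lift_fst_snd, Category.comp_id]
  have h₃ := exists_lift_mul (exists_lift_of_ker_le h₁) (exists_lift_of_ker_le h₂)
  rw [← e] at h₃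
  obtain ⟨t, ht⟩ := h₃
  refine (h μ[G]).2 ?_
  have h₄ := IsClosedImmersion.lift_fac (i.left ≫ proj j G) (z ≫ fst G G).left h₁
  set l := IsClosedImmersion.lift (i.left ≫ proj j G) (z ≫ fst G G).left h₁
  -- `Z` already lies over `S₀`, because its first projection factors through `H`; thus statements
  -- about `Z ×_S S₀` descend to `Z`.
  have h₅ : 𝟙 Z.left ≫ Z.hom = (l ≫ i.left ≫ pullback.snd G.hom j) ≫ j := by
    rw [Category.id_comp, Category.assoc, Category.assoc, ← pullback.condition,
      ← Over.w (z ≫ fst G G),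
      ← h₄]
    simp only [Category.assoc]
  have h₆ : (z ≫ μ[G]).left = (pullback.lift _ _ h₅ ≫ t.left) ≫ i.left ≫ proj j G := by
    have h₇ := proj_comp_left (j := j) (z ≫ μ[G])
    rw [← ht, Over.comp_left _ _ _ t i, Category.assoc] at h₇
    rw [Category.assoc, ← h₇]
    exact (Category.id_comp _).symm.trans ((congrArg (· ≫ (z ≫ μ[G]).left)
      (pullback.lift_fst _ _ h₅).symm).trans (Category.assoc _ _ _))
  rw [h₆]
  exact Scheme.Hom.le_ker_comp _ _

variable {G' : Scheme.{u}} {π : G' ⟶ G.left} [GrpObj G] [GrpObj H] [IsMonHom i] {T : Over S₀}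
  [GrpObj (Over.mk (π ≫ G.hom))] [IsMonHom (Over.homMk π : Over.mk (π ≫ G.hom) ⟶ G)]
  [Flat (π ≫ G.hom)]

lemma left_comp_eq_of_comp_eq {f : (Over.map j).obj T ⟶ Over.mk (π ≫ G.hom)}
    (h : f ≫ (Over.homMk π : Over.mk (π ≫ G.hom) ⟶ G) = 1) :
    f.left ≫ π = (1 : (Over.map j).obj T ⟶ G).left := congrArg CommaMorphism.left h

lemma mul_comp_homMk {f g : (Over.map j).obj T ⟶ Over.mk (π ≫ G.hom)}
    (hf : f ≫ (Over.homMk π : Over.mk (π ≫ G.hom) ⟶ G) = 1)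
    (hg : g ≫ (Over.homMk π : Over.mk (π ≫ G.hom) ⟶ G) = 1) :
    (f * g) ≫ (Over.homMk π : Over.mk (π ≫ G.hom) ⟶ G) = 1 := by
  rw [MonObj.mul_comp, hf, hg, one_mul]

/-- The twisted form of a point of the dilatation over the unit section is additive. -/
theorem ofPair_mul (hπ : IsNeronBlowup j i π) {f g : (Over.map j).obj T ⟶ Over.mk (π ≫ G.hom)}
    (hf : f ≫ (Over.homMk π : Over.mk (π ≫ G.hom) ⟶ G) = 1)
    (hg : g ≫ (Over.homMk π : Over.mk (π ≫ G.hom) ⟶ G) = 1)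
    (c : CartierChart j G.hom) (x : Γ(G.left, c.U.1))
    (hx : x ∈ (i.left ≫ proj j G).ker.ideal c.U) (O : T.left.Opens)
    (hO : O ≤ (1 : (Over.map j).obj T ⟶ G).left ⁻¹ᵁ c.U.1) :
    (TwistedForm.ofPair hπ.isDilatation _ _ (left_comp_eq_of_comp_eq (mul_comp_homMk hf hg))
        (left_comp_eq_of_comp_eq (MonObj.one_comp _))).at' c x hx O hO =
      (TwistedForm.ofPair hπ.isDilatation _ _ (left_comp_eq_of_comp_eq hf)
        (left_comp_eq_of_comp_eq (MonObj.one_comp _))).at' c x hx O hO +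
      (TwistedForm.ofPair hπ.isDilatation _ _ (left_comp_eq_of_comp_eq hg)
        (left_comp_eq_of_comp_eq (MonObj.one_comp _))).at' c x hx O hO := by
  set p : Over.mk (π ≫ G.hom) ⟶ G := Over.homMk π
  have : Flat ((p ⊗ₘ p).left ≫ (G ⊗ G).hom) := by
    rw [Over.w (p ⊗ₘ p)]; infer_instance
  have hl : ∀ {a b : (Over.map j).obj T ⟶ Over.mk (π ≫ G.hom)}, a ≫ p = 1 → b ≫ p = 1 →
      (lift a b).left ≫ (p ⊗ₘ p).left =
        (lift (1 : (Over.map j).obj T ⟶ G) (1 : (Over.map j).obj T ⟶ G)).left := by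
    intro a b ha hb
    rw [← Over.comp_left, lift_map, ha, hb]
  have hp1 : (1 : (Over.map j).obj T ⟶ Over.mk (π ≫ G.hom)) ≫ p = 1 := MonObj.one_comp _
  have hM : ∀ a b : (Over.map j).obj T ⟶ Over.mk (π ≫ G.hom), a * b = lift a b ≫ μ :=
    fun a b ↦ Hom.mul_def a b
  -- Here `Q = G × G` and `P = 𝒢 × 𝒢`, and the four points are `(f, g)`, `(f, 1)`, `(1, g)` and `(1,
  -- 1)`, all above the unit of `G × G`. Their products are `f * g`, `f`, `g` and `1`.
  have key := quot_additive hπ.isDilatation (Over.w μ[G]) (Over.w (fst G G)) (Over.w (snd G G))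
    (comap_mul_le (i := i)) (ϖ := (p ⊗ₘ p).left) (M := μ[Over.mk (π ≫ G.hom)].left)
    (p₁ := (fst (Over.mk (π ≫ G.hom)) (Over.mk (π ≫ G.hom))).left)
    (p₂ := (snd (Over.mk (π ≫ G.hom)) (Over.mk (π ≫ G.hom))).left)
    (congrArg CommaMorphism.left (IsMonHom.mul_hom p))
    (congrArg CommaMorphism.left (tensorHom_fst p p).symm)
    (congrArg CommaMorphism.left (tensorHom_snd p p).symm)
    (hl hf hg) (hl hf hp1) (hl hp1 hg) (hl hp1 hp1)
    (by rw [← Over.comp_left, ← Over.comp_left, lift_fst, lift_fst])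
    (by rw [← Over.comp_left, ← Over.comp_left, lift_fst, lift_fst])
    (by rw [← Over.comp_left, ← Over.comp_left, lift_snd, lift_snd])
    (by rw [← Over.comp_left, ← Over.comp_left, lift_snd, lift_snd])
    (k := (1 : (Over.map j).obj T ⟶ G).left)
    (by rw [← Over.comp_left, ← Hom.mul_def, one_mul])
    (by rw [← Over.comp_left, lift_fst]) (by rw [← Over.comp_left, lift_snd]) c x hx O hO
  have hE : ∀ {a b d : (Over.map j).obj T ⟶ Over.mk (π ≫ G.hom)} (_ : a * b = d) (hd : d ≫ p = 1),
      (lift a b).left ≫ μ[Over.mk (π ≫ G.hom)].left = d.left ∧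
        O ≤ ((lift a b).left ≫ μ[Over.mk (π ≫ G.hom)].left) ⁻¹ᵁ (π ⁻¹ᵁ c.U.1) ∧
          O ≤ d.left ⁻¹ᵁ (π ⁻¹ᵁ c.U.1) := by
    rintro a b d rfl hd
    have h1 : (lift a b).left ≫ μ[Over.mk (π ≫ G.hom)].left = (a * b).left := by
      rw [hM, Over.comp_left]
    have h2 : O ≤ (a * b).left ⁻¹ᵁ (π ⁻¹ᵁ c.U.1) :=
      TwistedForm.le_preimage_of_comp_eq (left_comp_eq_of_comp_eq hd) hO
    exact ⟨h1, by rw [h1]; exact h2, h2⟩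
  obtain ⟨a₁, a₂, a₃⟩ := hE (rfl : f * g = f * g) (mul_comp_homMk hf hg)
  obtain ⟨b₁, b₂, b₃⟩ := hE (mul_one f) hf
  obtain ⟨c₁, c₂, c₃⟩ := hE (one_mul g) hg
  obtain ⟨d₁, d₂, d₃⟩ := hE (mul_one 1) hp1
  have key := key a₂ b₂ c₂ d₂
  rw [appLE_congr_apply a₁ a₂ a₃, appLE_congr_apply b₁ b₂ b₃, appLE_congr_apply c₁ c₂ c₃,
    appLE_congr_apply d₁ d₂ d₃] at key
  rw [TwistedForm.ofPair_at, TwistedForm.ofPair_at, TwistedForm.ofPair_at]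
  linear_combination key

end GroupAdditivity

/-! ### Sections of the dual as linear forms -/

section DualForms

variable {X Y Z T : Scheme.{u}}

lemma id_appLE_apply {U V : X.Opens} (h : V ≤ 𝟙 X ⁻¹ᵁ U) (a : Γ(X, U)) :
    ((𝟙 X : X ⟶ X).appLE U V h).hom a = resFun h a := by
  have e : (𝟙 X : X ⟶ X).appLE U V h = X.presheaf.map (homOfLE h).op := Category.id_comp _
  rw [e]
  rfl

lemma le_id_preimage {U V : X.Opens} (h : V ≤ U) : V ≤ 𝟙 X ⁻¹ᵁ U := h

lemma pullbackSection_res (f : Y ⟶ X) {M : X.Modules} {U V : X.Opens} (h : V ≤ U) (m : Γ(M, U)) :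
    pullbackSection f (res h m) = res (f.preimage_mono h) (pullbackSection f m) :=
  app_res ((Scheme.Modules.pullbackPushforwardAdjunction f).unit.app M) h m

lemma dualSections_map_res {L : Y.Modules} {U : Y.Opens} (δ : dualSections L U)
    {V W : Y.Opens} (hV : V ≤ U) (h : W ≤ V) (s : Γ(L, V)) :
    δ.1 ⟨W, h.trans hV⟩ (res h s) = resFun h (δ.1 ⟨V, hV⟩ s) :=
  δ.2 ⟨V, hV⟩ ⟨W, h.trans hV⟩ h s

/-- A section of the dual of `L` over `U`, as a linear form on `L` over `t⁻¹ U`. -/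
def LinForm.ofDual {L : Y.Modules} (t : T ⟶ Y) {U : Y.Opens} (δ : dualSections L U) :
    LinForm L t (t ⁻¹ᵁ U) where
  toFun W O hO h := ((t.appLE (U ⊓ W) O (le_preimage_inf hO h)).hom : _ →+ _).comp
    ((δ.1 ⟨U ⊓ W, inf_le_left⟩).toAddMonoidHom.comp
      (L.presheaf.map (homOfLE (inf_le_right : U ⊓ W ≤ W)).op).hom)
  map_smul W O hO h a m := by
    change (t.appLE (U ⊓ W) O _).hom (δ.1 ⟨U ⊓ W, inf_le_left⟩ (res inf_le_right (a • m))) =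
      _ * (t.appLE (U ⊓ W) O _).hom (δ.1 ⟨U ⊓ W, inf_le_left⟩ (res inf_le_right m))
    rw [res_smul, _root_.map_smul, smul_eq_mul, map_mul]
    congr 1
    exact appLE_resFun t _ _ a
  map_res W W' O O' hO h hW hO' h' m := by
    change (t.appLE (U ⊓ W') O' _).hom (δ.1 ⟨U ⊓ W', inf_le_left⟩ (res inf_le_right (res hW m))) =
      resFun hO' ((t.appLE (U ⊓ W) O _).hom (δ.1 ⟨U ⊓ W, inf_le_left⟩ (res inf_le_right m)))
    rw [res_res, ← res_res inf_le_right (inf_le_inf le_rfl hW),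
      dualSections_map_res δ inf_le_left (inf_le_inf le_rfl hW), appLE_resFun, resFun_appLE]

lemma LinForm.ofDual_toFun {L : Y.Modules} (t : T ⟶ Y) {U : Y.Opens} (δ : dualSections L U)
    (W O hO h) (m : Γ(L, W)) :
    (LinForm.ofDual t δ).toFun W O hO h m = (t.appLE (U ⊓ W) O (le_preimage_inf hO h)).hom
      (δ.1 ⟨U ⊓ W, inf_le_left⟩ (res inf_le_right m)) := rfl

lemma LinForm.ofDual_toFun_of_le {L : Y.Modules} (t : T ⟶ Y) {U : Y.Opens} (δ : dualSections L U)
    {W : Y.Opens} (hW : W ≤ U) (O hO h) (m : Γ(L, W)) :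
    (LinForm.ofDual t δ).toFun W O hO h m = (t.appLE W O h).hom (δ.1 ⟨W, hW⟩ m) := by
  rw [ofDual_toFun, dualSections_map_res δ hW inf_le_right, appLE_resFun]

lemma LinForm.ofDual_id_injective {L : Y.Modules} {U : Y.Opens} :
    Function.Injective (LinForm.ofDual (𝟙 Y) : dualSections L U → _) := by
  intro δ δ' h
  apply Subtype.ext
  funext ⟨V, hV⟩
  ext s
  have h1 := congrArg (fun φ ↦ φ.toFun V V (le_id_preimage hV) (le_id_preimage le_rfl) s) h
  have h2 : ∀ δ : dualSections L U,
      (LinForm.ofDual (𝟙 Y) δ).toFun V V (le_id_preimage hV) (le_id_preimage le_rfl) s =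
      resFun le_rfl (δ.1 ⟨V, hV⟩ s) := fun δ ↦ by
    rw [ofDual_toFun_of_le (𝟙 Y) δ hV, id_appLE_apply (le_id_preimage le_rfl)]
    rfl
  rw [h2, h2] at h1
  exact (resFun_self _).symm.trans (h1.trans (resFun_self _))

/-- The section of the dual of `L` defined by a form. -/
def LinForm.toDual {L : Y.Modules} {U : Y.Opens} (φ : LinForm L (𝟙 Y) (𝟙 Y ⁻¹ᵁ U)) :
    dualSections L U :=
  ⟨fun V ↦
    { toFun := fun s ↦ φ.toFun V.1 V.1 V.2 le_rfl s
      map_add' := fun s s' ↦ map_add _ s s'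
      map_smul' := fun a s ↦ by
        exact (φ.map_smul V.1 V.1 V.2 le_rfl a s).trans
          (congrArg (· * _) ((id_appLE_apply (le_id_preimage le_rfl) a).trans (resFun_self a))) },
    fun V W h s ↦ φ.map_res V.1 W.1 V.1 W.1 V.2 le_rfl h h le_rfl s⟩

/-- Sections of the dual of `L`, as a family of forms on `L`. -/
def DualFamily.ofDual (L : Y.Modules) (t : T ⟶ Y) : DualFamily L t L t where
  form U δ := LinForm.ofDual t δ
  form_add U δ δ' := by
    ext W O hO h m
    exact map_add (t.appLE (U ⊓ W) O (le_preimage_inf hO h)).hom _ _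
  form_smul U a δ := by
    ext W O hO h m
    rw [LinForm.smul_toFun, resFun_app, LinForm.ofDual_toFun, LinForm.ofDual_toFun]
    refine (map_mul (t.appLE (U ⊓ W) O (le_preimage_inf hO h)).hom _ _).trans ?_
    congr 1
    exact appLE_resFun t _ _ a
  form_restrict U V h δ := by
    ext W O hO hW m
    rw [LinForm.ofDual_toFun]
    change _ = (LinForm.ofDual t δ).toFun W O (hO.trans (t.preimage_mono h)) hW m
    rw [LinForm.ofDual_toFun]
    change (t.appLE (V ⊓ W) O _).hom (δ.1 ⟨V ⊓ W, inf_le_left.trans h⟩ (res inf_le_right m)) = _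
    rw [← res_res (inf_le_right : U ⊓ W ≤ W) (inf_le_inf h le_rfl : V ⊓ W ≤ U ⊓ W),
      dualSections_map_res δ inf_le_left, appLE_resFun]

/-- The composites of a family of forms with `m ↦ f^* m`. -/
def DualFamily.comapPullback {L : Y.Modules} {t : T ⟶ Y} {M : X.Modules} {f : Z ⟶ X}
    {s : T ⟶ Z} (Φ : DualFamily L t ((Scheme.Modules.pullback f).obj M) s) :
    DualFamily L t M (s ≫ f) where
  form U δ := (Φ.form U δ).comapPullback
  form_add U δ δ' := by rw [Φ.form_add]; rfl
  form_smul U a δ := by rw [Φ.form_smul]; rfl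
  form_restrict U V h δ := by rw [Φ.form_restrict U V h]; rfl

/-- Families of forms along equal morphisms. -/
def DualFamily.congr {L : Y.Modules} {t : T ⟶ Y} {M : X.Modules} {k k' : T ⟶ X}
    (Φ : DualFamily L t M k) (e : k = k') : DualFamily L t M k' where
  form U δ := (Φ.form U δ).congr e
  form_add U δ δ' := by rw [Φ.form_add]; rfl
  form_smul U a δ := by rw [Φ.form_smul]; rfl
  form_restrict U V h δ := by rw [Φ.form_restrict U V h]; rfl

/-- The composites of a family of forms with the pullback of functions. -/
def DualFamily.comapIdeal {X' Z' : Scheme.{u}} {L : Y.Modules} {t : T ⟶ Y} {i : Z ⟶ X}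
    {z : Z' ⟶ X'} {f : X ⟶ X'} (hf : ∃ g : Z ⟶ Z', g ≫ z = i ≫ f) {k : T ⟶ X}
    (Φ : DualFamily L t (idealSheaf i) k) : DualFamily L t (idealSheaf z) (k ≫ f) where
  form U δ := (Φ.form U δ).comapIdeal hf
  form_add U δ δ' := by rw [Φ.form_add]; rfl
  form_smul U a δ := by rw [Φ.form_smul]; rfl
  form_restrict U V h δ := by rw [Φ.form_restrict U V h]; rfl

end DualForms

/-! ### The dual of the ideal of a Cartier divisor -/

section DualGenerator

variable {X Y Z : Scheme.{u}} (z : Z ⟶ X) [IsClosedImmersion z] {U : X.affineOpens}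
  {b : Γ(X, U.1)} (hb : b ∈ nonZeroDivisors Γ(X, U.1)) (hz : z.ker.ideal U = Ideal.span {b})

include hz in
lemma app_eq_zero_of_ideal_eq_span : (z.app U.1).hom b = 0 := by
  rw [← mem_ker_ideal_iff, hz]
  exact Ideal.mem_span_singleton_self _

include hb hz in
lemma exists_eq_mul_of_toFunction {W : X.Opens} (hW : W ≤ U.1) (ξ : Γ(idealSheaf z, W)) :
    ∃ a : Γ(X, W), toFunction ξ = resFun hW b * a := by
  obtain ⟨a, ha⟩ := exists_fun_of_local (O := W)
    (fun V a ↦ ∃ h : V ≤ W, resFun h (toFunction ξ) = resFun (h.trans hW) b * a)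
    (fun V V' h a ⟨h₁, e⟩ ↦ ⟨h.trans h₁, by
      rw [← resFun_resFun h₁ h, e, map_mul, resFun_resFun]⟩)
    (fun V a a' ⟨h₁, e⟩ ⟨_, e'⟩ ↦ (mul_cancel_left_mem_nonZeroDivisors
      (resFun_mem_nonZeroDivisors U.2 (h₁.trans hW) hb)).1 (e.symm.trans e'))
    (fun x hx ↦ by
      obtain ⟨V, hV, hxV, hle⟩ := exists_isAffineOpen_le hx
      have h1 : resFun hle (toFunction ξ) ∈ z.ker.ideal ⟨V, hV⟩ := by
        rw [mem_ker_ideal_iff, ← toFunction_res]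
        exact app_toFunction _
      rw [ideal_eq_map_resFun z.ker (V := ⟨V, hV⟩) (hle.trans hW), hz, Ideal.map_span,
        Set.image_singleton, Ideal.mem_span_singleton] at h1
      obtain ⟨a, ha⟩ := h1
      exact ⟨V, hle, hxV, a, hle, ha⟩)
  refine ⟨a, fun_ext fun x hx ↦ ?_⟩
  obtain ⟨V, hV, hxV, h, e⟩ := ha x hx
  exact ⟨V, hV, hxV, by rw [e, map_mul, resFun_resFun]⟩

/-- The quotient of a function vanishing on `Z` by the local equation of `Z`. -/
def divBy {W : X.Opens} (hW : W ≤ U.1) (ξ : Γ(idealSheaf z, W)) : Γ(X, W) :=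
  (exists_eq_mul_of_toFunction z hb hz hW ξ).choose

lemma toFunction_eq_mul_divBy {W : X.Opens} (hW : W ≤ U.1) (ξ : Γ(idealSheaf z, W)) :
    toFunction ξ = resFun hW b * divBy z hb hz hW ξ :=
  (exists_eq_mul_of_toFunction z hb hz hW ξ).choose_spec

lemma divBy_eq {W : X.Opens} (hW : W ≤ U.1) {ξ : Γ(idealSheaf z, W)} {a : Γ(X, W)}
    (h : toFunction ξ = resFun hW b * a) : divBy z hb hz hW ξ = a :=
  (mul_cancel_left_mem_nonZeroDivisors (resFun_mem_nonZeroDivisors U.2 hW hb)).1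
    ((toFunction_eq_mul_divBy z hb hz hW ξ).symm.trans h)

/-- The form `b a ↦ r^* a` on functions vanishing on `Z`. -/
def divForm (r : Y ⟶ X) : LinForm (idealSheaf z) r (r ⁻¹ᵁ U.1) where
  toFun W O hO h := AddMonoidHom.mk' (fun ξ ↦ (r.appLE (U.1 ⊓ W) O (le_preimage_inf hO h)).hom
      (divBy z hb hz inf_le_left (res inf_le_right ξ))) fun ξ ξ' ↦ by
    rw [← map_add]
    congr 1
    refine divBy_eq z hb hz _ ?_
    rw [res_add, toFunction_add, mul_add, ← toFunction_eq_mul_divBy, ← toFunction_eq_mul_divBy]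
  map_smul W O hO h a ξ := by
    change (r.appLE (U.1 ⊓ W) O _).hom (divBy z hb hz inf_le_left (res inf_le_right (a • ξ))) =
      _ * (r.appLE (U.1 ⊓ W) O _).hom (divBy z hb hz inf_le_left (res inf_le_right ξ))
    rw [← appLE_resFun r (inf_le_right : U.1 ⊓ W ≤ W) (le_preimage_inf hO h), ← map_mul]
    congr 1
    refine divBy_eq z hb hz _ ?_
    rw [res_smul, toFunction_smul, mul_left_comm, ← toFunction_eq_mul_divBy]
    rfl
  map_res W W' O O' hO h hW hO' h' ξ := by
    change (r.appLE (U.1 ⊓ W') O' _).hom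
        (divBy z hb hz inf_le_left (res inf_le_right (res hW ξ))) =
      resFun hO' ((r.appLE (U.1 ⊓ W) O _).hom (divBy z hb hz inf_le_left (res inf_le_right ξ)))
    rw [resFun_appLE, ← appLE_resFun r (inf_le_inf le_rfl hW : U.1 ⊓ W' ≤ U.1 ⊓ W)
      (le_preimage_inf (hO'.trans hO) h')]
    congr 1
    refine divBy_eq z hb hz _ ?_
    rw [res_res, ← resFun_resFun (inf_le_left : U.1 ⊓ W ≤ U.1) (inf_le_inf le_rfl hW), ← map_mul,
      ← toFunction_eq_mul_divBy, ← toFunction_res, res_res]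

/-- The equation of `Z`, as a section of its ideal sheaf. -/
def equation : Γ(idealSheaf z, U.1) := ofFunction b (app_eq_zero_of_ideal_eq_span z hz)

lemma toFunction_equation : toFunction (equation z hz) = b := toFunction_ofFunction _ _

include hb hz in
/-- A form on the pullback of the ideal sheaf is determined by its value on the equation. -/
lemma toFun_pullbackSection_eq {T : Scheme.{u}} {r : Y ⟶ X} {t : T ⟶ Y} {Ω : T.Opens}
    (φ : LinForm ((Scheme.Modules.pullback r).obj (idealSheaf z)) t Ω)
    {W : X.Opens} (hW : W ≤ U.1) (O : T.Opens) (hO : O ≤ Ω) (h : O ≤ (t ≫ r) ⁻¹ᵁ W)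
    (ξ : Γ(idealSheaf z, W)) :
    φ.comapPullback.toFun W O hO h ξ = ((t ≫ r).appLE W O h).hom (divBy z hb hz hW ξ) *
      φ.comapPullback.toFun U.1 O hO (h.trans ((t ≫ r).preimage_mono hW)) (equation z hz) := by
  have h1 : ξ = divBy z hb hz hW ξ • res hW (equation z hz) := toFunction_injective _ (by
    rw [toFunction_smul, toFunction_res, toFunction_equation, mul_comm,
      ← toFunction_eq_mul_divBy])
  conv_lhs => rw [h1]
  rw [LinForm.map_smul, LinForm.toFun_res]

include hb in
/-- The dual of the pullback of the ideal sheaf of a Cartier divisor is locally free of rank one. -/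
theorem exists_dual_generator (r : Y ⟶ X) :
    ∃ δ : dualSections ((Scheme.Modules.pullback r).obj (idealSheaf z)) (r ⁻¹ᵁ U.1),
      pair δ (pullbackSection r (equation z hz)) = 1 ∧
      ∀ (V : Y.Opens) (hV : V ≤ r ⁻¹ᵁ U.1)
        (δ' : dualSections ((Scheme.Modules.pullback r).obj (idealSheaf z)) V),
        ∃ f : Γ(Y, V), δ' = f • dualSections.restrict _ hV δ := by
  -- The generator is the form `ba ↦ a`, carried to the pulled back module by adjunction.
  obtain ⟨φ, hφ⟩ := (LinForm.comapPullback_bijective (f := r) (t := 𝟙 Y)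
    (Ω := 𝟙 Y ⁻¹ᵁ (r ⁻¹ᵁ U.1))).surjective
    ((divForm z hb hz r).congr (Category.id_comp r).symm)
  have hval : ∀ (V : Y.Opens) (hV : V ≤ r ⁻¹ᵁ U.1),
      φ.toFun (r ⁻¹ᵁ U.1) V (le_id_preimage hV) (le_id_preimage hV)
        (pullbackSection r (equation z hz)) = 1 := by
    intro V hV
    have h1 := congrArg (fun ψ ↦ ψ.toFun U.1 V (le_id_preimage hV) hV (equation z hz)) hφ
    refine h1.trans ?_
    change (r.appLE (U.1 ⊓ U.1) V _).hom (divBy z hb hz inf_le_left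
      (res inf_le_right (equation z hz))) = 1
    rw [divBy_eq z hb hz (a := 1) inf_le_left (by
      rw [toFunction_res, toFunction_equation, mul_one]), map_one]
  -- The coefficient of `δ'` is its value on the equation. Both sides agree there, and a form on the
  -- pullback is determined by that value.
  refine ⟨φ.toDual, hval _ le_rfl, fun V hV δ' ↦
    ⟨δ'.1 ⟨V, le_rfl⟩ (res hV (pullbackSection r (equation z hz))), ?_⟩⟩
  apply LinForm.ofDual_id_injective
  apply LinForm.comapPullback_bijective.injective
  have key : ∀ δ' : dualSections ((Scheme.Modules.pullback r).obj (idealSheaf z)) V,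
      ∀ (O : Y.Opens) (hO : O ≤ V) (h : O ≤ (𝟙 Y ≫ r) ⁻¹ᵁ U.1),
      (LinForm.ofDual (𝟙 Y) δ').comapPullback.toFun U.1 O (le_id_preimage hO) h (equation z hz) =
        resFun hO (δ'.1 ⟨V, le_rfl⟩ (res hV (pullbackSection r (equation z hz)))) := by
    intro δ' O hO h
    rw [LinForm.comapPullback_toFun, ← LinForm.toFun_res _ (r ⁻¹ᵁ U.1) V O (le_id_preimage hO) hV
      (le_id_preimage hO), LinForm.ofDual_toFun_of_le (𝟙 Y) δ' le_rfl, id_appLE_apply]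
    rfl
  ext W O hO h ξ
  have hO' : O ≤ V := hO
  have hU : O ≤ (𝟙 Y ≫ r) ⁻¹ᵁ U.1 := by
    rw [Category.id_comp]
    exact hO'.trans hV
  have hWU : O ≤ (𝟙 Y ≫ r) ⁻¹ᵁ (W ⊓ U.1) := le_preimage_inf h hU
  rw [← LinForm.toFun_res _ W (W ⊓ U.1) O hO inf_le_left hWU,
    ← LinForm.toFun_res _ W (W ⊓ U.1) O hO inf_le_left hWU,
    toFun_pullbackSection_eq z hb hz _ inf_le_right O hO hWU,
    toFun_pullbackSection_eq z hb hz _ inf_le_right O hO hWU]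
  congr 1
  refine (key _ O hO' hU).trans ((congrArg (resFun hO') ?_).trans (key _ O hO' hU).symm)
  have h2 : (φ.toDual).1 ⟨V, hV⟩ (res hV (pullbackSection r (equation z hz))) = 1 :=
    (φ.toFun_res _ _ V (le_id_preimage hV) hV (le_id_preimage le_rfl) _).trans (hval V hV)
  have h3 : ∀ f : Γ(Y, V), (f • dualSections.restrict ((Scheme.Modules.pullback r).obj
      (idealSheaf z)) hV φ.toDual).1 ⟨V, le_rfl⟩ (res hV (pullbackSection r (equation z hz))) =
      resFun le_rfl f * (φ.toDual).1 ⟨V, hV⟩ (res hV (pullbackSection r (equation z hz))) :=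
    fun f ↦ rfl
  rw [h3, h2, mul_one, resFun_self]

end DualGenerator

/-! ### The families of forms on the ideal of the divisor defined by the two duals -/

section DualFamilies

set_option linter.unusedSectionVars false

variable {S S₀ X H T : Scheme.{u}} {j : S₀ ⟶ S} [IsClosedImmersion j] {p : X ⟶ S}
  {i : H ⟶ pullback p j} [IsClosedImmersion i]

/-- The values of sections of the dual of the restriction to `H` of the ideal sheaf of `X₀` on
the functions defining the divisor. -/
def restrictedFamily (i : H ⟶ pullback p j) (t : T ⟶ H) :
    DualFamily ((Scheme.Modules.pullback (i ≫ pullback.fst p j)).obj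
      (idealSheaf (pullback.fst p j))) t (idealSheaf j) (((t ≫ i) ≫ pullback.fst p j) ≫ p) :=
  (((DualFamily.ofDual _ t).comapPullback).congr (Category.assoc _ _ _).symm).comapIdeal
    ⟨pullback.snd p j, pullback.condition.symm⟩

lemma restrictedFamily_toFun (t : T ⟶ H) {U : H.Opens}
    (δ : dualSections ((Scheme.Modules.pullback (i ≫ pullback.fst p j)).obj
      (idealSheaf (pullback.fst p j))) U) {A : S.Opens} (β : Γ(idealSheaf j, A))
    {W : X.Opens} (hW : W ≤ p ⁻¹ᵁ A) (hU : (i ≫ pullback.fst p j) ⁻¹ᵁ W ≤ U)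
    (O : T.Opens) (hO : O ≤ t ⁻¹ᵁ U) (h : O ≤ (((t ≫ i) ≫ pullback.fst p j) ≫ p) ⁻¹ᵁ A)
    (hOW : O ≤ t ⁻¹ᵁ ((i ≫ pullback.fst p j) ⁻¹ᵁ W)) :
    ((restrictedFamily i t).form U δ).toFun A O hO h β =
      (t.appLE _ O hOW).hom (δ.1 ⟨_, hU⟩ (pullbackSection (i ≫ pullback.fst p j)
        (res hW (idealPullback ⟨pullback.snd p j, pullback.condition.symm⟩ A β)))) := by
  rw [pullbackSection_res, ← LinForm.ofDual_toFun_of_le t δ hU O hO hOW]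
  exact ((LinForm.ofDual t δ).toFun_res _ _ _ _ _ _ _).symm

lemma CartierChart.ker_fst_ideal_eq (c : CartierChart j p) :
    (pullback.fst p j).ker.ideal c.U = Ideal.span {c.b} := by
  rw [Scheme.IdealSheafData.ker_fst_of_isClosedImmersion, c.ideal_comap_eq]

/-- The section of the dual of the restricted ideal sheaf which is dual to the equation of the
divisor. -/
def restrictedGenerator [Flat p] (i : H ⟶ pullback p j) (c : CartierChart j p) :
    dualSections ((Scheme.Modules.pullback (i ≫ pullback.fst p j)).obj
      (idealSheaf (pullback.fst p j))) ((i ≫ pullback.fst p j) ⁻¹ᵁ c.U.1) :=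
  (exists_dual_generator (pullback.fst p j) c.b_mem_nonZeroDivisors c.ker_fst_ideal_eq
    (i ≫ pullback.fst p j)).choose

theorem hasDualGenerators_restrictedFamily [Flat p] (t : T ⟶ H) :
    HasDualGenerators (k := (t ≫ i) ≫ pullback.fst p j) (i ≫ pullback.fst p j)
      (restrictedFamily i t) (restrictedGenerator i) := by
  intro c
  obtain ⟨hδ, hgen⟩ := (exists_dual_generator (pullback.fst p j) c.b_mem_nonZeroDivisors
    c.ker_fst_ideal_eq (i ≫ pullback.fst p j)).choose_spec
  refine ⟨fun O hO h ↦ ?_, hgen⟩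
  refine (restrictedFamily_toFun t (restrictedGenerator i c) c.β c.le le_rfl O hO h hO).trans ?_
  have h1 : res c.le (idealPullback ⟨pullback.snd p j, pullback.condition.symm⟩ c.A.1 c.β) =
      equation (pullback.fst p j) c.ker_fst_ideal_eq := toFunction_injective _ (by
    rw [toFunction_equation, toFunction_res, toFunction_idealPullback, c.toFunction_β,
      resFun_app]
    rfl)
  rw [h1]
  exact (congrArg _ hδ).trans (map_one _)

/-- The values of sections of the dual of the conormal sheaf of the divisor on functions defining
the divisor. -/
def conormalFamily (t : T ⟶ S₀) {k : T ⟶ S} (e : t ≫ j = k) :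
    DualFamily (conormal j) t (idealSheaf j) k :=
  (DualFamily.ofDual (conormal j) t).comapPullback.congr e

lemma conormalFamily_toFun (t : T ⟶ S₀) {k : T ⟶ S} (e : t ≫ j = k) {U : S₀.Opens}
    (δ : dualSections (conormal j) U) {A : S.Opens} (β : Γ(idealSheaf j, A)) {V : S₀.Opens}
    (hV : V ≤ j ⁻¹ᵁ A) (hU : V ≤ U) (O : T.Opens) (hO : O ≤ t ⁻¹ᵁ U) (h : O ≤ k ⁻¹ᵁ A)
    (hOV : O ≤ t ⁻¹ᵁ V) :
    ((conormalFamily t e).form U δ).toFun A O hO h β =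
      (t.appLE _ O hOV).hom (δ.1 ⟨V, hU⟩ (res hV (pullbackSection j β))) := by
  rw [← LinForm.ofDual_toFun_of_le t δ hU O hO hOV]
  exact ((LinForm.ofDual t δ).toFun_res _ _ _ _ _ _ _).symm

lemma CartierChart.preimage_le_of_comp_eq {r : S₀ ⟶ X} (hr : r ≫ p = j) (c : CartierChart j p) :
    r ⁻¹ᵁ c.U.1 ≤ j ⁻¹ᵁ c.A.1 := by
  have h1 : ∀ A : S.Opens, j ⁻¹ᵁ A = r ⁻¹ᵁ (p ⁻¹ᵁ A) := fun A ↦ by rw [← hr]; rfl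
  rw [h1]
  exact r.preimage_mono c.le

/-- The section of the dual of the conormal sheaf which is dual to the equation of the divisor. -/
def conormalGenerator {r : S₀ ⟶ X} (hr : r ≫ p = j) (c : CartierChart j p) :
    dualSections (conormal j) (r ⁻¹ᵁ c.U.1) :=
  dualSections.restrict _ (c.preimage_le_of_comp_eq hr)
    (exists_dual_generator j c.mem_nonZeroDivisors c.ideal_eq j).choose

theorem hasDualGenerators_conormalFamily {k : T ⟶ X} (t : T ⟶ S₀) (e : t ≫ j = k ≫ p)
    {r : S₀ ⟶ X} (hr : r ≫ p = j) :
    HasDualGenerators r (conormalFamily t e) (conormalGenerator hr) := by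
  intro c
  obtain ⟨hδ, hgen⟩ := (exists_dual_generator j c.mem_nonZeroDivisors c.ideal_eq j).choose_spec
  set δ := (exists_dual_generator j c.mem_nonZeroDivisors c.ideal_eq j).choose with hδ'
  have hle := c.preimage_le_of_comp_eq hr
  refine ⟨fun O hO h ↦ ?_, fun V hV δ' ↦ hgen V (hV.trans hle) δ'⟩
  refine (conormalFamily_toFun t e _ c.β hle le_rfl O hO h hO).trans ?_
  have h1 : (dualSections.restrict _ hle δ).1 ⟨r ⁻¹ᵁ c.U.1, le_rfl⟩
      (res hle (pullbackSection j c.β)) = 1 := by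
    refine (dualSections_map_res δ le_rfl hle _).trans ?_
    exact (congrArg _ hδ).trans (map_one _)
  exact (congrArg _ h1).trans (map_one _)

end DualFamilies

/-! ### Pullback of forms and the functor represented by `𝕍(ℱ)` -/

section Precomp

variable {X T T' : Scheme.{u}} {M : X.Modules} {k : T ⟶ X}

/-- The composite of a linear form with the pullback of functions. -/
def LinForm.precomp (φ : LinForm M k ⊤) (l : T' ⟶ T) : LinForm M (l ≫ k) ⊤ where
  toFun W O _ h := ((l.appLE (k ⁻¹ᵁ W) O (le_preimage_preimage h)).hom : _ →+ _).comp
    (φ.toFun W (k ⁻¹ᵁ W) le_top le_rfl)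
  map_smul W O _ h a m := by
    refine (congrArg (l.appLE (k ⁻¹ᵁ W) O (le_preimage_preimage h)).hom
      (φ.map_smul W _ le_top le_rfl a m)).trans ?_
    rw [map_mul]
    exact congrArg (· * _) (appLE_appLE_apply l k le_rfl (le_preimage_preimage h) h a)
  map_res W W' O O' _ h hW hO' h' m := by
    have h1 := φ.map_res W W' _ _ le_top le_rfl hW (k.preimage_mono hW) le_rfl m
    refine (congrArg (l.appLE (k ⁻¹ᵁ W') O' (le_preimage_preimage h')).hom h1).trans ?_
    refine (appLE_resFun l _ _ _).trans ?_
    exact (resFun_appLE l _ hO' _).symm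

lemma LinForm.precomp_toFun (φ : LinForm M k ⊤) (l : T' ⟶ T) (W : X.Opens) (O : T.Opens)
    (h : O ≤ k ⁻¹ᵁ W) (O' : T'.Opens) (h' : O' ≤ l ⁻¹ᵁ O) (h'' : O' ≤ (l ≫ k) ⁻¹ᵁ W)
    (m : Γ(M, W)) :
    (φ.precomp l).toFun W O' le_top h'' m = (l.appLE O O' h').hom (φ.toFun W O le_top h m) := by
  rw [← φ.resFun_toFun W _ O le_top le_rfl h m, appLE_resFun]
  rfl

lemma pushforwardCongr_comp_app {X Y T : Scheme.{u}} (f : T ⟶ Y) (g : Y ⟶ X) (k : T ⟶ X)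
    (e : f ≫ g = k) (W : X.Opens) (a : Γ((Scheme.Modules.pushforward g).obj (structureSheaf Y), W))
    (O : T.Opens) (h : O ≤ k ⁻¹ᵁ W) (h' : O ≤ f ⁻¹ᵁ (g ⁻¹ᵁ W)) :
    res (M := structureSheaf T) h ((((Scheme.Modules.pushforward g).map (sharp f) ≫
      (Scheme.Modules.pushforwardComp f g).hom.app _ ≫
      (Scheme.Modules.pushforwardCongr e).hom.app _).app W).hom a) =
        (f.appLE (g ⁻¹ᵁ W) O h').hom a := by
  subst e
  have h2 : ∀ b, ((((Scheme.Modules.pushforwardCongr (rfl : f ≫ g = f ≫ g)).hom.app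
      (structureSheaf T))).app W).hom b = res (M := structureSheaf T) le_rfl b := fun b ↦ by
    rw [Scheme.Modules.pushforwardCongr_hom_app_app]
    rfl
  exact congrArg (res (M := structureSheaf T) h) ((h2 _).trans (res_self _))

lemma ofHom_comp_pushStructure {S : Scheme.{u}} {T V : Over S} (f : T ⟶ V) {F : S.Modules}
    (u : F ⟶ (Scheme.Modules.pushforward V.hom).obj (structureSheaf V.left)) :
    LinForm.ofHom (u ≫ pushStructure f) = ((LinForm.ofHom u).precomp f.left).congr (Over.w f) := by
  ext W O hO h m
  have h1 : O ≤ f.left ⁻¹ᵁ (V.hom ⁻¹ᵁ W) := by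
    have := h
    rw [← Over.w f] at this
    exact this
  refine (pushforwardCongr_comp_app f.left V.hom T.hom (Over.w f) W ((u.app W).hom m) O h
    h1).trans ?_
  refine Eq.trans ?_ (LinForm.precomp_toFun (LinForm.ofHom u) f.left W (V.hom ⁻¹ᵁ W) le_rfl O h1
    h1 m).symm
  exact congrArg (f.left.appLE (V.hom ⁻¹ᵁ W) O h1).hom
    (res_self (M := structureSheaf V.left) _).symm

end Precomp

/-! ### Modules described by families of forms -/

section FormModel

variable {B Y X₀ : Scheme.{u}}

/-- A description of the linear forms on `F` as families of forms on `M` indexed by the sections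
of the dual of `L`. -/
structure FormModel (F : B.Modules) (L : Y.Modules) (M : X₀.Modules) (e : B ⟶ Y) (i : Y ⟶ X₀) where
  dom : Y.Opens → X₀.Opens → B.Opens
  sec : ∀ (U : Y.Opens) (_ : dualSections L U) (W : X₀.Opens), Γ(M, W) → Γ(F, dom U W)
  -- An inclusion rather than an equation: in the cotangent model the natural domain of `sec` is the
  -- preimage of an open subset of the self-product, which is not this open subset by definition.
  le_dom : ∀ (U : Y.Opens) (W : X₀.Opens), e ⁻¹ᵁ (U ⊓ i ⁻¹ᵁ W) ≤ dom U W

variable {F : B.Modules} {L : Y.Modules} {M : X₀.Modules} {e : B ⟶ Y} {i : Y ⟶ X₀}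
  {T : Scheme.{u}} {v : T ⟶ B}

lemma FormModel.le_preimage_dom (A : FormModel F L M e i) {U : Y.Opens} {W : X₀.Opens}
    {O : T.Opens} (hO : O ≤ (v ≫ e) ⁻¹ᵁ U) (h : O ≤ ((v ≫ e) ≫ i) ⁻¹ᵁ W) :
    O ≤ v ⁻¹ᵁ A.dom U W :=
  (show O ≤ v ⁻¹ᵁ (e ⁻¹ᵁ (U ⊓ i ⁻¹ᵁ W)) from le_inf hO h).trans (v.preimage_mono (A.le_dom U W))

/-- The linear form `ψ` corresponds to the family `Φ`. -/
def FormModel.Rel (A : FormModel F L M e i) (ψ : LinForm F v ⊤)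
    (Φ : DualFamily L (v ≫ e) M ((v ≫ e) ≫ i)) : Prop :=
  ∀ U δ W O hO h ξ, (Φ.form U δ).toFun W O hO h ξ =
    ψ.toFun (A.dom U W) O le_top (A.le_preimage_dom hO h) (A.sec U δ W ξ)

/-- The model is faithful: forms and families correspond bijectively. -/
structure FormModel.IsFaithful (A : FormModel F L M e i) : Prop where
  exists_family : ∀ {T : Scheme.{u}} {v : T ⟶ B} (ψ : LinForm F v ⊤), ∃ Φ, A.Rel ψ Φ
  exists_form : ∀ {T : Scheme.{u}} {v : T ⟶ B} (Φ : DualFamily L (v ≫ e) M ((v ≫ e) ≫ i)),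
    ∃ ψ, A.Rel ψ Φ
  form_unique : ∀ {T : Scheme.{u}} {v : T ⟶ B} {ψ ψ' : LinForm F v ⊤}
    {Φ : DualFamily L (v ≫ e) M ((v ≫ e) ≫ i)}, A.Rel ψ Φ → A.Rel ψ' Φ → ψ = ψ'

/-- Linear forms on `e^* (i^* M ⊗ L^∨)` are families of forms on `M`. -/
def pullbackModel (L : Y.Modules) (M : X₀.Modules) (e : B ⟶ Y) (i : Y ⟶ X₀) :
    FormModel ((Scheme.Modules.pullback e).obj
      (tensorDual ((Scheme.Modules.pullback i).obj M) L)) L M e i where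
  dom U W := e ⁻¹ᵁ (U ⊓ i ⁻¹ᵁ W)
  sec _ δ _ ξ := pullbackSection e
    (tmul (res inf_le_right (pullbackSection i ξ)) (dualSections.restrict L inf_le_left δ))
  le_dom _ _ := le_rfl

lemma pullbackModel_rel_iff {ψ : LinForm ((Scheme.Modules.pullback e).obj
      (tensorDual ((Scheme.Modules.pullback i).obj M) L)) v ⊤}
    {Φ : DualFamily L (v ≫ e) M ((v ≫ e) ≫ i)} :
    (pullbackModel L M e i).Rel ψ Φ ↔ ∀ U δ, Φ.form U δ =
      ((LinForm.comapPullback ψ).contract δ).comapPullback := by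
  constructor
  · intro h U δ
    ext W O hO hW ξ
    exact h U δ W O hO hW ξ
  · intro h U δ W O hO hW ξ
    rw [h]
    rfl

/-- Adjunction for `e`, the universal property of the tensor product with the dual, and adjunction
for `i`. -/
lemma isFaithful_pullbackModel : (pullbackModel L M e i).IsFaithful where
  exists_family ψ := ⟨(LinForm.comapPullback ψ).toDualFamily.comapPullback,
    pullbackModel_rel_iff.2 fun _ _ ↦ rfl⟩
  exists_form Φ := by
    obtain ⟨Ψ, hΨ⟩ := Φ.exists_pullback
    obtain ⟨φ, hφ⟩ := Ψ.exists_form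
    obtain ⟨ψ, hψ⟩ := LinForm.comapPullback_bijective.surjective φ
    exact ⟨ψ, pullbackModel_rel_iff.2 fun U δ ↦ by rw [hψ, hφ, hΨ]⟩
  form_unique h h' := by
    rw [pullbackModel_rel_iff] at h h'
    apply LinForm.comapPullback_bijective.injective
    apply LinForm.contract_injective
    intro U δ
    apply LinForm.comapPullback_bijective.injective
    rw [← h, ← h']

end FormModel

/-! ### Points of the dilatation and linear forms -/

section Correspondence

variable {S S₀ B X X' H T T' : Scheme.{u}} {j : S₀ ⟶ S} [IsClosedImmersion j] {p : X ⟶ S}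
  {i : H ⟶ pullback p j} [IsClosedImmersion i] {π : X' ⟶ X} {e : B ⟶ H} {v : T ⟶ B}
  {F : B.Modules} {L : H.Modules} (A : FormModel F L (idealSheaf i) e i)
  (d : ∀ c : CartierChart j p, dualSections L ((i ≫ pullback.fst p j) ⁻¹ᵁ c.U.1))
  (hπ : IsDilatation π (i ≫ pullback.fst p j).ker (j.ker.comap p))

/-- The linear form `ψ` corresponds to the difference of the points `κ` and `κ₀` of the
dilatation. -/
def Corresponds (κ κ₀ : T ⟶ X') (ψ : LinForm F v ⊤) : Prop :=
  ∀ (c : CartierChart j p) (x : Γ(X, c.U.1)) (hx : x ∈ (i ≫ pullback.fst p j).ker.ideal c.U)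
    (O : T.Opens) (hκ : O ≤ κ ⁻¹ᵁ (π ⁻¹ᵁ c.U.1)) (hκ₀ : O ≤ κ₀ ⁻¹ᵁ (π ⁻¹ᵁ c.U.1))
    (hD : O ≤ v ⁻¹ᵁ A.dom ((i ≫ pullback.fst p j) ⁻¹ᵁ c.U.1) (pullback.fst p j ⁻¹ᵁ c.U.1)),
    ψ.toFun _ O le_top hD (A.sec _ (d c) _ (c.section' x hx)) =
      (κ.appLE _ O hκ).hom (c.quot hπ x hx) - (κ₀.appLE _ O hκ₀).hom (c.quot hπ x hx)

variable {A d hπ}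

lemma le_preimage_of_comp_eq' {k : T ⟶ X} {κ : T ⟶ X'} (h : κ ≫ π = k) {O : T.Opens} {U : X.Opens}
    (hO : O ≤ κ ⁻¹ᵁ (π ⁻¹ᵁ U)) : O ≤ k ⁻¹ᵁ U := by
  subst h; exact hO

/-- `Corresponds` compares a form with a pair of points on chart equations; dual generators turn
this into equality of families over all sections. Existence and uniqueness, for forms and for
points, then follow from those for twisted forms. -/
lemma corresponds_iff (hj : IsEffectiveCartier j)
    {Λ : DualFamily L (v ≫ e) (idealSheaf j) ((((v ≫ e) ≫ i) ≫ pullback.fst p j) ≫ p)}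
    (hΛ : HasDualGenerators (i ≫ pullback.fst p j) Λ d) {κ κ₀ : T ⟶ X'}
    (h : κ ≫ π = ((v ≫ e) ≫ i) ≫ pullback.fst p j)
    (h₀ : κ₀ ≫ π = ((v ≫ e) ≫ i) ≫ pullback.fst p j)
    {ψ : LinForm F v ⊤} {Φ : DualFamily L (v ≫ e) (idealSheaf i) ((v ≫ e) ≫ i)}
    (hΦ : A.Rel ψ Φ) :
    Corresponds A d hπ κ κ₀ ψ ↔ ∀ U δ,
      ((TwistedForm.ofPair hπ κ κ₀ h h₀).toDualFamily hj Λ).form U δ = Φ.form U δ := by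
  rw [TwistedForm.toDualFamily_form_eq_iff (Category.assoc _ _ _).symm hΛ hj]
  constructor
  · intro H c x hx O hO
    rw [TwistedForm.ofPair_at]
    exact (hΦ _ _ _ _ _ _ _).trans (H c x hx O _ _ _)
  · intro H c x hx O hκ hκ₀ hD
    have h1 := H c x hx O (le_preimage_of_comp_eq' h hκ)
    rw [TwistedForm.ofPair_at] at h1
    exact (hΦ _ _ _ _ _ _ _).symm.trans h1

lemma Corresponds.form_unique (hj : IsEffectiveCartier j) (hA : A.IsFaithful)
    {Λ : DualFamily L (v ≫ e) (idealSheaf j) ((((v ≫ e) ≫ i) ≫ pullback.fst p j) ≫ p)}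
    (hΛ : HasDualGenerators (i ≫ pullback.fst p j) Λ d) {κ κ₀ : T ⟶ X'}
    (h : κ ≫ π = ((v ≫ e) ≫ i) ≫ pullback.fst p j)
    (h₀ : κ₀ ≫ π = ((v ≫ e) ≫ i) ≫ pullback.fst p j) {ψ ψ' : LinForm F v ⊤}
    (hψ : Corresponds A d hπ κ κ₀ ψ) (hψ' : Corresponds A d hπ κ κ₀ ψ') : ψ = ψ' := by
  obtain ⟨Φ, hΦ⟩ := hA.exists_family ψ
  obtain ⟨Φ', hΦ'⟩ := hA.exists_family ψ'
  have h1 := (corresponds_iff hj hΛ h h₀ hΦ).1 hψ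
  have h2 := (corresponds_iff hj hΛ h h₀ hΦ').1 hψ'
  refine hA.form_unique hΦ fun U δ W O hO hW ξ ↦ ?_
  rw [← h1, h2]
  exact hΦ' U δ W O hO hW ξ

lemma exists_form_corresponds (hj : IsEffectiveCartier j) (hA : A.IsFaithful)
    {Λ : DualFamily L (v ≫ e) (idealSheaf j) ((((v ≫ e) ≫ i) ≫ pullback.fst p j) ≫ p)}
    (hΛ : HasDualGenerators (i ≫ pullback.fst p j) Λ d) {κ κ₀ : T ⟶ X'}
    (h : κ ≫ π = ((v ≫ e) ≫ i) ≫ pullback.fst p j)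
    (h₀ : κ₀ ≫ π = ((v ≫ e) ≫ i) ≫ pullback.fst p j) :
    ∃ ψ : LinForm F v ⊤, Corresponds A d hπ κ κ₀ ψ := by
  obtain ⟨ψ, hψ⟩ := hA.exists_form ((TwistedForm.ofPair hπ κ κ₀ h h₀).toDualFamily hj Λ)
  exact ⟨ψ, (corresponds_iff hj hΛ h h₀ hψ).2 fun _ _ ↦ rfl⟩

lemma Corresponds.point_unique (hj : IsEffectiveCartier j) (hi : IsRegularImmersion i)
    (hA : A.IsFaithful)
    {Λ : DualFamily L (v ≫ e) (idealSheaf j) ((((v ≫ e) ≫ i) ≫ pullback.fst p j) ≫ p)}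
    (hΛ : HasDualGenerators (i ≫ pullback.fst p j) Λ d) {κ κ' κ₀ : T ⟶ X'}
    (h : κ ≫ π = ((v ≫ e) ≫ i) ≫ pullback.fst p j)
    (h' : κ' ≫ π = ((v ≫ e) ≫ i) ≫ pullback.fst p j)
    (h₀ : κ₀ ≫ π = ((v ≫ e) ≫ i) ≫ pullback.fst p j) {ψ : LinForm F v ⊤}
    (hκ : Corresponds A d hπ κ κ₀ ψ) (hκ' : Corresponds A d hπ κ' κ₀ ψ) : κ = κ' := by
  obtain ⟨Φ, hΦ⟩ := hA.exists_family ψ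
  refine TwistedForm.ofPair_injective hj hi hπ h h' h₀
    (TwistedForm.toDualFamily_injective (Category.assoc _ _ _).symm hΛ hj fun U δ ↦ ?_)
  rw [(corresponds_iff hj hΛ h h₀ hΦ).1 hκ, (corresponds_iff hj hΛ h' h₀ hΦ).1 hκ']

/-- From a form to a family, to a twisted form, to a point; the last passage uses the regularity of
the centre. -/
lemma exists_point_corresponds [Flat p] (hj : IsEffectiveCartier j) (hi : IsRegularImmersion i)
    (hA : A.IsFaithful)
    {Λ : DualFamily L (v ≫ e) (idealSheaf j) ((((v ≫ e) ≫ i) ≫ pullback.fst p j) ≫ p)}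
    (hΛ : HasDualGenerators (i ≫ pullback.fst p j) Λ d) {κ₀ : T ⟶ X'}
    (h₀ : κ₀ ≫ π = ((v ≫ e) ≫ i) ≫ pullback.fst p j) (ψ : LinForm F v ⊤) :
    ∃ κ : T ⟶ X', κ ≫ π = ((v ≫ e) ≫ i) ≫ pullback.fst p j ∧ Corresponds A d hπ κ κ₀ ψ := by
  obtain ⟨Φ, hΦ⟩ := hA.exists_family ψ
  obtain ⟨E, hE⟩ := DualFamily.exists_toDualFamily_form_eq (Category.assoc _ _ _).symm hΛ hj Φ
  obtain ⟨κ, h, rfl⟩ := TwistedForm.exists_ofPair_eq hj hi hπ h₀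
    ⟨v ≫ e, (Category.assoc _ _ _).symm⟩ E
  exact ⟨κ, h, (corresponds_iff hj hΛ h h₀ hΦ).2 hE⟩

lemma Corresponds.comp {κ κ₀ : T ⟶ X'} {ψ : LinForm F v ⊤} (l : T' ⟶ T)
    (h : κ ≫ π = ((v ≫ e) ≫ i) ≫ pullback.fst p j)
    (h₀ : κ₀ ≫ π = ((v ≫ e) ≫ i) ≫ pullback.fst p j)
    (hκ : Corresponds A d hπ κ κ₀ ψ) : Corresponds A d hπ (l ≫ κ) (l ≫ κ₀) (ψ.precomp l) := by
  intro c x hx O hO hO₀ hD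
  have h1 : κ ⁻¹ᵁ (π ⁻¹ᵁ c.U.1) ≤ (((v ≫ e) ≫ i) ≫ pullback.fst p j) ⁻¹ᵁ c.U.1 :=
    le_preimage_of_comp_eq' h le_rfl
  have h2 : κ ⁻¹ᵁ (π ⁻¹ᵁ c.U.1) ≤ κ₀ ⁻¹ᵁ (π ⁻¹ᵁ c.U.1) := TwistedForm.le_preimage_of_comp_eq h₀ h1
  have hD' : κ ⁻¹ᵁ (π ⁻¹ᵁ c.U.1) ≤ v ⁻¹ᵁ A.dom ((i ≫ pullback.fst p j) ⁻¹ᵁ c.U.1)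
    (pullback.fst p j ⁻¹ᵁ c.U.1) := A.le_preimage_dom h1 h1
  rw [LinForm.precomp_toFun ψ l _ (κ ⁻¹ᵁ (π ⁻¹ᵁ c.U.1)) hD' O (le_preimage_preimage hO) hD,
    hκ c x hx _ le_rfl h2 hD', map_sub, appLE_appLE_apply l κ _ _ hO,
    appLE_appLE_apply l κ₀ h2 (le_preimage_preimage hO) hO₀]

lemma Corresponds.congr {v' : T ⟶ B} (hv : v = v') {κ κ₀ : T ⟶ X'} {ψ : LinForm F v ⊤}
    (hκ : Corresponds A d hπ κ κ₀ ψ) : Corresponds A d hπ κ κ₀ (ψ.congr hv) := by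
  subst hv
  exact hκ

lemma Corresponds.add {κ κ₁ κ₂ κ₀ : T ⟶ X'} {ψ₁ ψ₂ : LinForm F v ⊤}
    (h₁ : κ₁ ≫ π = κ₀ ≫ π) (h₂ : κ₂ ≫ π = κ₀ ≫ π)
    (hκ₁ : Corresponds A d hπ κ₁ κ₀ ψ₁) (hκ₂ : Corresponds A d hπ κ₂ κ₀ ψ₂)
    (hadd : ∀ (c : CartierChart j p) (x : Γ(X, c.U.1))
      (hx : x ∈ (i ≫ pullback.fst p j).ker.ideal c.U) (O : T.Opens) (h h₁ h₂ h₀),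
      (κ.appLE (π ⁻¹ᵁ c.U.1) O h).hom (c.quot hπ x hx) -
        (κ₀.appLE (π ⁻¹ᵁ c.U.1) O h₀).hom (c.quot hπ x hx) =
      ((κ₁.appLE (π ⁻¹ᵁ c.U.1) O h₁).hom (c.quot hπ x hx) -
        (κ₀.appLE (π ⁻¹ᵁ c.U.1) O h₀).hom (c.quot hπ x hx)) +
      ((κ₂.appLE (π ⁻¹ᵁ c.U.1) O h₂).hom (c.quot hπ x hx) -
        (κ₀.appLE (π ⁻¹ᵁ c.U.1) O h₀).hom (c.quot hπ x hx))) :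
    Corresponds A d hπ κ κ₀ (ψ₁ + ψ₂) := by
  intro c x hx O hκ hκ₀ hD
  have h3 : O ≤ (κ₀ ≫ π) ⁻¹ᵁ c.U.1 := hκ₀
  have h4 := TwistedForm.le_preimage_of_comp_eq h₁ h3
  have h5 := TwistedForm.le_preimage_of_comp_eq h₂ h3
  rw [LinForm.add_toFun, hκ₁ c x hx O h4 hκ₀ hD, hκ₂ c x hx O h5 hκ₀ hD,
    hadd c x hx O hκ h4 h5 hκ₀]

end Correspondence

/-! ### The kernel of `q` is a vector group -/

section VectorGroup

set_option linter.unusedSectionVars false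

lemma LinForm.ofHom_add {X T : Scheme.{u}} {M : X.Modules} {k : T ⟶ X}
    (a b : M ⟶ (Scheme.Modules.pushforward k).obj (structureSheaf T)) :
    LinForm.ofHom (a + b) = LinForm.ofHom a + LinForm.ofHom b := by
  ext W O hO h m
  rw [LinForm.add_toFun, LinForm.ofHom_apply, LinForm.ofHom_apply, LinForm.ofHom_apply]
  exact map_add ((structureSheaf T).presheaf.map (homOfLE h).op).hom _ _

variable {S S₀ : Scheme.{u}} {j : S₀ ⟶ S} [IsClosedImmersion j] {G : Over S}
  {H : Over S₀} {i : H ⟶ special j G} [IsClosedImmersion i.left]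
  {G' : Scheme.{u}} {π : G' ⟶ G.left} [GrpObj G] [GrpObj H] [IsMonHom i]
  [GrpObj (Over.mk (π ≫ G.hom))] [IsMonHom (Over.homMk π : Over.mk (π ≫ G.hom) ⟶ G)]

/-- The unit point of the dilatation. -/
def unitPoint (π : G' ⟶ G.left) [GrpObj (Over.mk (π ≫ G.hom))] (T : Over S₀) : T.left ⟶ G' :=
  (1 : (Over.map j).obj T ⟶ Over.mk (π ≫ G.hom)).left

lemma comp_unitPoint {T T' : Over S₀} (g : T' ⟶ T) :
    g.left ≫ unitPoint (j := j) π T = unitPoint (j := j) π T' := by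
  have : (Over.map j).map g ≫ (1 : (Over.map j).obj T ⟶ Over.mk (π ≫ G.hom)) = 1 :=
    MonObj.comp_one _
  exact congrArg CommaMorphism.left this

lemma one_eq_comp (T : Over S₀) : (1 : T ⟶ special j G) = toUnit T ≫ η[H] ≫ i := by
  rw [IsMonHom.one_hom]
  rfl

lemma unitPoint_comp {e : S₀ ⟶ H.left} (he : e = η[H].left) (T : Over S₀) :
    unitPoint (j := j) π T ≫ π = ((T.hom ≫ e) ≫ i.left) ≫ proj j G := by
  have h1 : (1 : (Over.map j).obj T ⟶ Over.mk (π ≫ G.hom)) ≫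
    (Over.homMk π : Over.mk (π ≫ G.hom) ⟶ G) = 1 := MonObj.one_comp _
  have h2 : (1 : (Over.map j).obj T ⟶ G) = toBase (toUnit T ≫ η[H] ≫ i) := by
    rw [← toBase_one, one_eq_comp (i := i)]
  refine (congrArg CommaMorphism.left (h1.trans h2)).trans ((toBase_left _).trans ?_)
  rw [he, Over.comp_left, Over.comp_left, Over.toUnit_left]
  simp only [Category.assoc]

variable {V : Over S₀} {f : V ⟶ special j (Over.mk (π ≫ G.hom))}
  {q : special j (Over.mk (π ≫ G.hom)) ⟶ H}

/-- The points of the kernel of `q` are the points of the dilatation over the unit section. -/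
lemma exists_kernel_point (hq : q ≫ i = (Over.pullback j).map (Over.homMk π))
    (hf : IsPullback f (toUnit V) q η[H]) {T : Over S₀} {κ : T.left ⟶ G'}
    (h : κ ≫ π = unitPoint (j := j) π T ≫ π) : ∃ g : T ⟶ V, (toBase (g ≫ f)).left = κ := by
  have := over_mono_of_left i
  have h1 : (1 : (Over.map j).obj T ⟶ Over.mk (π ≫ G.hom)) ≫
    (Over.homMk π : Over.mk (π ≫ G.hom) ⟶ G) = 1 := MonObj.one_comp _
  let a : (Over.map j).obj T ⟶ Over.mk (π ≫ G.hom) := Over.homMk κ (by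
    have h2 := Over.w (1 : (Over.map j).obj T ⟶ Over.mk (π ≫ G.hom))
    change _ ≫ π ≫ G.hom = _ at h2
    change κ ≫ π ≫ G.hom = _
    rw [← h2, ← Category.assoc, h]
    simp only [unitPoint, Category.assoc])
  have ha : a ≫ (Over.homMk π : Over.mk (π ≫ G.hom) ⟶ G) = 1 := by
    rw [← h1]
    ext1
    exact h
  have h3 : ofBase a ≫ q = toUnit T ≫ η[H] := by
    rw [← cancel_mono i, Category.assoc, hq, Category.assoc, ← one_eq_comp]
    apply toBase_injective
    rw [toBase_comp, toBase_ofBase, ha, toBase_one]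
  refine ⟨hf.lift (ofBase a) (toUnit T) h3, ?_⟩
  rw [hf.lift_fst, toBase_ofBase]
  rfl

lemma kernel_point_comp (hq : q ≫ i = (Over.pullback j).map (Over.homMk π))
    (hf : IsPullback f (toUnit V) q η[H]) {T : Over S₀} (g : T ⟶ V) :
    toBase (g ≫ f) ≫ (Over.homMk π : Over.mk (π ≫ G.hom) ⟶ G) = 1 := by
  rw [← toBase_comp, ← hq, Category.assoc, ← Category.assoc f, hf.w, ← toBase_one,
    one_eq_comp (i := i), Category.assoc, ← Category.assoc g]
  congr 2
  exact toUnit_unique _ _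

lemma kernel_point_injective (hf : IsPullback f (toUnit V) q η[H]) {T : Over S₀} {g g' : T ⟶ V}
    (h : (toBase (g ≫ f)).left = (toBase (g' ≫ f)).left) : g = g' := by
  refine hf.hom_ext (toBase_injective ?_) (toUnit_unique _ _)
  ext1
  exact h

/-- The kernel of `q` is a vector group. -/
theorem exists_isVectorGroup [Flat G.hom] [Flat (π ≫ G.hom)] [GrpObj V] [IsMonHom f]
    (hj : IsEffectiveCartier j) (hi : IsRegularImmersion i.left) (hπ : IsNeronBlowup j i π)
    (hq : q ≫ i = (Over.pullback j).map (Over.homMk π))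
    (hf : IsPullback f (toUnit V) q η[H]) {e : S₀ ⟶ H.left} (he : e = η[H].left)
    {F : S₀.Modules} {L : H.left.Modules} {A : FormModel F L (idealSheaf i.left) e i.left}
    (hA : A.IsFaithful)
    {d : ∀ c : CartierChart j G.hom, dualSections L ((i.left ≫ proj j G) ⁻¹ᵁ c.U.1)}
    (hΛ : ∀ {T : Scheme.{u}} (v : T ⟶ S₀),
      ∃ Λ : DualFamily L (v ≫ e) (idealSheaf j) ((((v ≫ e) ≫ i.left) ≫ proj j G) ≫ G.hom),
        HasDualGenerators (i.left ≫ proj j G) Λ d) :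
    ∃ u : F ⟶ (Scheme.Modules.pushforward V.hom).obj (structureSheaf V.left),
      IsVectorGroup F V u ∧ Corresponds A d hπ.isDilatation (toBase f).left
        (unitPoint (j := j) π V) (LinForm.ofHom u) := by
  have hu : ∀ T : Over S₀, unitPoint (j := j) π T ≫ π = ((T.hom ≫ e) ≫ i.left) ≫ proj j G :=
    unitPoint_comp he
  have hk : ∀ {T : Over S₀} (g : T ⟶ V),
      (toBase (g ≫ f)).left ≫ π = ((T.hom ≫ e) ≫ i.left) ≫ proj j G := fun {T} g ↦ by
    have h1 : (1 : (Over.map j).obj T ⟶ Over.mk (π ≫ G.hom)) ≫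
      (Over.homMk π : Over.mk (π ≫ G.hom) ⟶ G) = 1 := MonObj.one_comp _
    rw [← hu]
    exact congrArg CommaMorphism.left ((kernel_point_comp hq hf g).trans h1.symm)
  have hkV : (toBase f).left ≫ π = ((V.hom ≫ e) ≫ i.left) ≫ proj j G := by
    rw [← hk (𝟙 V), Category.id_comp]
  obtain ⟨Λ, hΛV⟩ := hΛ V.hom
  -- The universal linear map is the form of the tautological point `f`, relative to the unit point.
  obtain ⟨ψ, hψ⟩ := exists_form_corresponds (hπ := hπ.isDilatation) hj hA hΛV hkV (hu V)
  -- The correspondence is natural in `T`, so the point `g` has as its form the pullback of the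
  -- universal one. Bijectivity of the correspondence is then representability.
  have key : ∀ {T : Over S₀} (g : T ⟶ V), Corresponds A d hπ.isDilatation (toBase (g ≫ f)).left
      (unitPoint (j := j) π T) (LinForm.ofHom (ψ.hom ≫ pushStructure g)) := by
    intro T g
    rw [ofHom_comp_pushStructure, LinForm.ofHom_hom]
    have h1 := (hψ.comp g.left hkV (hu V)).congr (Over.w g)
    rw [comp_unitPoint] at h1
    have h2 : (toBase (g ≫ f)).left = g.left ≫ (toBase f).left := by
      rw [toBase_left, toBase_left, Over.comp_left, Category.assoc]
    rwa [h2]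
  refine ⟨ψ.hom, ⟨fun T ↦ ⟨fun g g' h ↦ ?_, fun w ↦ ?_⟩, fun T g g' ↦ ?_⟩, ?_⟩
  · obtain ⟨Λ, hΛT⟩ := hΛ T.hom
    have h1 := key g
    have h2 := key g'
    dsimp only at h
    rw [← h] at h2
    exact kernel_point_injective hf (h1.point_unique hj hi hA hΛT (hk g) (hk g') (hu T) h2)
  · obtain ⟨Λ, hΛT⟩ := hΛ T.hom
    obtain ⟨κ, h, hκ⟩ := exists_point_corresponds (hπ := hπ.isDilatation) hj hi hA hΛT (hu T)
      (LinForm.ofHom w)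
    obtain ⟨g, rfl⟩ := exists_kernel_point hq hf (h.trans (hu T).symm)
    exact ⟨g, LinForm.ofHom_injective ((key g).form_unique hj hA hΛT (hk g) (hu T) hκ)⟩
  · obtain ⟨Λ, hΛT⟩ := hΛ T.hom
    apply LinForm.ofHom_injective
    rw [LinForm.ofHom_add]
    refine (key (g * g')).form_unique hj hA hΛT (hk _) (hu T) ((key g).add
      ((hk g).trans (hu T).symm) ((hk g').trans (hu T).symm) (key g') ?_)
    intro c x hx O h h₁ h₂ h₀
    -- Additivity of the represented functor is additivity of the twisted form of a product of
    -- points over the unit section.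
    have h3 := ofPair_mul hπ (kernel_point_comp hq hf g) (kernel_point_comp hq hf g') c x hx O
      (by
        have h4 : O ≤ (unitPoint (j := j) π T ≫ π) ⁻¹ᵁ c.U.1 := h₀
        rw [show unitPoint (j := j) π T ≫ π = (1 : (Over.map j).obj T ⟶ G).left from
          left_comp_eq_of_comp_eq (MonObj.one_comp _)] at h4
        exact h4)
    rw [TwistedForm.ofPair_at, TwistedForm.ofPair_at, TwistedForm.ofPair_at] at h3
    have h5 : (toBase ((g * g') ≫ f)).left = (toBase (g ≫ f) * toBase (g' ≫ f)).left := by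
      rw [MonObj.mul_comp, toBase_mul]
    rw [appLE_congr_apply h5 h (by rw [← h5]; exact h)]
    exact h3
  · rw [LinForm.ofHom_hom]
    exact hψ

end VectorGroup

/-! ### Evaluation on a quotient `x/β` by an arbitrary generator -/

section Value

variable {S S₀ X X' Y H T : Scheme.{u}} {j : S₀ ⟶ S} [IsClosedImmersion j] {p : X ⟶ S}
  {i : H ⟶ pullback p j} [IsClosedImmersion i] {π : X' ⟶ X}
  (hπ : IsDilatation π (i ≫ pullback.fst p j).ker (j.ker.comap p))

lemma mem_ker_ideal_of_toFunction {W : X.Opens} {x : Γ(X, W)}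
    {ξ : Γ(idealSheaf i, pullback.fst p j ⁻¹ᵁ W)}
    (hξ : toFunction ξ = ((pullback.fst p j).app W).hom x) (c : CartierChart j p) (hc : c.U.1 ≤ W) :
    resFun hc x ∈ (i ≫ pullback.fst p j).ker.ideal c.U := by
  rw [mem_ker_ideal_iff, app_resFun]
  have h1 : ((i ≫ pullback.fst p j).app W).hom x = 0 := by
    have h2 := app_toFunction ξ
    rw [hξ] at h2
    rw [Scheme.Hom.comp_app]
    exact h2
  rw [h1, map_zero]

/-- The value of the family of forms given by a point of the dilatation on a function `x` for which
`x / β` is regular. -/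
theorem TwistedForm.toDualFamily_ofPair_toFun (hj : IsEffectiveCartier j)
    {k₀ : T ⟶ pullback p j} {κ κ₀ : T ⟶ X'}
    (h : κ ≫ π = k₀ ≫ pullback.fst p j) (h₀ : κ₀ ≫ π = k₀ ≫ pullback.fst p j)
    {L : Y.Modules} {t : T ⟶ Y}
    (Λ : DualFamily L t (idealSheaf j) ((k₀ ≫ pullback.fst p j) ≫ p))
    {U : Y.Opens} (δ : dualSections L U) {W : X.Opens} (x : Γ(X, W))
    (ξ : Γ(idealSheaf i, pullback.fst p j ⁻¹ᵁ W))
    (hξ : toFunction ξ = ((pullback.fst p j).app W).hom x) (y : Γ(X', π ⁻¹ᵁ W))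
    (O : T.Opens) (hO : O ≤ t ⁻¹ᵁ U) (hW : O ≤ k₀ ⁻¹ᵁ (pullback.fst p j ⁻¹ᵁ W))
    (hκ : O ≤ κ ⁻¹ᵁ (π ⁻¹ᵁ W))
    (h₁ : ∀ (c : CartierChart j p) (hc : c.U.1 ≤ W) (O' : T.Opens)
      (h' : O' ≤ κ₀ ⁻¹ᵁ (π ⁻¹ᵁ c.U.1)), (κ₀.appLE _ O' h').hom
        (c.quot hπ (resFun hc x) (mem_ker_ideal_of_toFunction hξ c hc)) = 0)
    (h₂ : ∀ z ∈ O, ∃ (c : CartierChart j p) (hc : c.U.1 ≤ W) (w : Γ(X, c.U.1)),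
      (k₀ ≫ pullback.fst p j) z ∈ c.U.1 ∧
      (π.app c.U.1).hom (c.b * w) * resFun (π.preimage_mono hc) y =
        (π.app c.U.1).hom (resFun hc x) ∧
      ∀ (O' : T.Opens) (hO' : O' ≤ t ⁻¹ᵁ U) (h' : O' ≤ (k₀ ≫ pullback.fst p j) ⁻¹ᵁ c.U.1),
        (Λ.form U δ).toFun c.A.1 O' hO'
            (h'.trans ((k₀ ≫ pullback.fst p j).preimage_mono c.le)) c.β *
          ((k₀ ≫ pullback.fst p j).appLE c.U.1 O' h').hom w = 1) :
    (((TwistedForm.ofPair hπ κ κ₀ h h₀).toDualFamily hj Λ).form U δ).toFun _ O hO hW ξ =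
      (κ.appLE _ O hκ).hom y := by
  refine fun_ext fun z hz ↦ ?_
  obtain ⟨c, hc, w, hzc, e, hw⟩ := h₂ z hz
  have hx := mem_ker_ideal_of_toFunction hξ c hc
  let O' : T.Opens := O ⊓ (k₀ ≫ pullback.fst p j) ⁻¹ᵁ c.U.1
  have h' : O' ≤ (k₀ ≫ pullback.fst p j) ⁻¹ᵁ c.U.1 := inf_le_right
  have hκ' : O' ≤ κ ⁻¹ᵁ (π ⁻¹ᵁ c.U.1) := TwistedForm.le_preimage_of_comp_eq h h'
  have hκ'' : O' ≤ (κ ≫ π) ⁻¹ᵁ c.U.1 := hκ'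
  refine ⟨O', inf_le_left, ⟨hz, hzc⟩, ?_⟩
  have h3 := (TwistedForm.ofPair hπ κ κ₀ h h₀).isContraction_contraction (Λ.form U δ) hj _ O hO hW ξ
    c ((pullback.fst p j).preimage_mono hc) (resFun hc x) hx
    (by rw [app_resFun, ← hξ]) O' inf_le_left h'
  refine h3.trans ?_
  -- If `β = bw` and `y = x/β`, then `x/b = wy`. The factor `w` cancels against the value of `Λ δ`
  -- on `b`, and the contribution of `κ₀` vanishes by hypothesis.
  have h4 : c.quot hπ (resFun hc x) hx =
      (π.app c.U.1).hom w * resFun (π.preimage_mono hc) y :=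
    c.quot_eq hπ hx (by rw [← mul_assoc, ← map_mul, e])
  rw [TwistedForm.eval, TwistedForm.ofPair_at, h₁, sub_zero, h4, map_mul, ← mul_assoc,
    appLE_app_apply κ π hκ' hκ'', appLE_congr_apply h _ h', hw, one_mul, appLE_resFun,
    resFun_appLE]

omit [IsClosedImmersion i] in
lemma pullbackSection_smul {Z Z' : Scheme.{u}} (f : Z' ⟶ Z) {M : Z.Modules} {U : Z.Opens}
    (a : Γ(Z, U)) (m : Γ(M, U)) :
    pullbackSection f (a • m) = (f.app U).hom a • pullbackSection f m :=
  Scheme.Modules.Hom.app_smul ((Scheme.Modules.pullbackPushforwardAdjunction f).unit.app M) a m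

/-- A generator of the restricted ideal sheaf is locally a unit multiple of the equation of the
divisor. -/
lemma exists_chart_restrictedFamily (hj : IsEffectiveCartier j) {v : T ⟶ H} {W : X.Opens}
    (x : Γ(X, W)) (β : Γ(idealSheaf (pullback.fst p j), W)) {U : H.Opens}
    (δ : dualSections ((Scheme.Modules.pullback (i ≫ pullback.fst p j)).obj
      (idealSheaf (pullback.fst p j))) U)
    (hU' : (i ≫ pullback.fst p j) ⁻¹ᵁ W ≤ U)
    (hδ : δ.1 ⟨_, hU'⟩ (pullbackSection (i ≫ pullback.fst p j) β) = 1)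
    (y : Γ(X', π ⁻¹ᵁ W)) (hy : (π.app W).hom x = (π.app W).hom (toFunction β) * y)
    (z : T) (hz : ((v ≫ i) ≫ pullback.fst p j) z ∈ W) :
    ∃ (c : CartierChart j p) (hc : c.U.1 ≤ W) (w : Γ(X, c.U.1)),
      ((v ≫ i) ≫ pullback.fst p j) z ∈ c.U.1 ∧
      (π.app c.U.1).hom (c.b * w) * resFun (π.preimage_mono hc) y =
        (π.app c.U.1).hom (resFun hc x) ∧
      ∀ (O' : T.Opens) (hO' : O' ≤ v ⁻¹ᵁ U)
        (h' : O' ≤ ((v ≫ i) ≫ pullback.fst p j) ⁻¹ᵁ c.U.1),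
        ((restrictedFamily i v).form U δ).toFun c.A.1 O' hO'
          (h'.trans (((v ≫ i) ≫ pullback.fst p j).preimage_mono c.le)) c.β *
          (((v ≫ i) ≫ pullback.fst p j).appLE c.U.1 O' h').hom w = 1 := by
  obtain ⟨c, hzc, hc⟩ := exists_cartierChart hj p _ W hz
  have h1 : ((pullback.fst p j).app c.U.1).hom (resFun hc (toFunction β)) = 0 := by
    rw [app_resFun, app_toFunction, map_zero]
  -- `β` vanishes on the special fibre, so `β = bw`; then `δ(β) = 1` says that `w` is inverse to
  -- `δ(b)` on `H`.
  obtain ⟨w, hw⟩ := (c.app_fst_eq_zero_iff _).1 h1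
  refine ⟨c, hc, w, hzc, ?_, fun O' hO' h' ↦ ?_⟩
  · rw [← hw, app_resFun, ← map_mul, ← hy, app_resFun]
  · have hcU : (i ≫ pullback.fst p j) ⁻¹ᵁ c.U.1 ≤ U :=
      ((i ≫ pullback.fst p j).preimage_mono hc).trans hU'
    have hO'' : O' ≤ v ⁻¹ᵁ ((i ≫ pullback.fst p j) ⁻¹ᵁ c.U.1) := by
      rw [Category.assoc] at h'
      exact h'
    have h2 : w • res c.le (idealPullback ⟨pullback.snd p j, pullback.condition.symm⟩ c.A.1 c.β) =
        res hc β := toFunction_injective _ (by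
      rw [toFunction_smul, toFunction_res, toFunction_idealPullback, c.toFunction_β,
        resFun_app, toFunction_res, hw, mul_comm]
      rfl)
    have h3 := (dualSections_map_res δ hU' ((i ≫ pullback.fst p j).preimage_mono hc)
      (pullbackSection (i ≫ pullback.fst p j) β)).trans
      ((congrArg (resFun _) hδ).trans (map_one _))
    rw [← pullbackSection_res (i ≫ pullback.fst p j) hc β, ← h2, pullbackSection_smul] at h3
    have h4 := (_root_.map_smul (δ.1 ⟨_, hcU⟩) _ _).symm.trans h3
    have h5 := congrArg (v.appLE _ O' hO'').hom h4
    rw [restrictedFamily_toFun v δ c.β c.le hcU O' hO' _ hO'', mul_comm]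
    rw [smul_eq_mul, map_mul, map_one] at h5
    refine Eq.trans ?_ h5
    congr 1

/-- A generator of the ideal of the divisor is locally a unit multiple of the chosen equation. -/
lemma exists_chart_conormalFamily (hj : IsEffectiveCartier j) {v : T ⟶ S₀} {k : T ⟶ X}
    (e : v ≫ j = k ≫ p) {W : X.Opens} (x : Γ(X, W)) {U : S.Opens} (β : Γ(idealSheaf j, U))
    {U₀ : S₀.Opens} (hU₀ : U₀ ≤ j ⁻¹ᵁ U) (δ : dualSections (conormal j) U₀)
    (hδ : pair δ (res hU₀ (pullbackSection j β)) = 1) (hW : W ≤ p ⁻¹ᵁ U)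
    (y : Γ(X', π ⁻¹ᵁ W))
    (hy : (π.app W).hom x = (π.app W).hom ((p.appLE U W hW).hom (toFunction β)) * y)
    (z : T) (hz : k z ∈ W) :
    ∃ (c : CartierChart j p) (hc : c.U.1 ≤ W) (w : Γ(X, c.U.1)),
      k z ∈ c.U.1 ∧
      (π.app c.U.1).hom (c.b * w) * resFun (π.preimage_mono hc) y =
        (π.app c.U.1).hom (resFun hc x) ∧
      ∀ (O' : T.Opens) (hO' : O' ≤ v ⁻¹ᵁ U₀) (h' : O' ≤ k ⁻¹ᵁ c.U.1),
        ((conormalFamily v e).form U₀ δ).toFun c.A.1 O' hO'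
          (h'.trans (k.preimage_mono c.le)) c.β * (k.appLE c.U.1 O' h').hom w = 1 := by
  obtain ⟨c, hzc, hc, hcA⟩ := exists_cartierChart_le hj p _ W hz U (hW hz)
  have h1 : resFun hcA (toFunction β) ∈ j.ker.ideal c.A := by
    rw [mem_ker_ideal_iff, app_resFun, app_toFunction, map_zero]
  rw [c.ideal_eq, Ideal.mem_span_singleton] at h1
  obtain ⟨w, hw⟩ := h1
  have h2 : w • c.β = res hcA β := toFunction_injective _ (by
    rw [toFunction_smul, toFunction_res, c.toFunction_β, hw, mul_comm])
  have h3 : resFun hc ((p.appLE U W hW).hom (toFunction β)) =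
      c.b * (p.appLE c.A.1 c.U.1 c.le).hom w := by
    rw [CartierChart.b, ← map_mul, ← hw, resFun_appLE, appLE_resFun]
  refine ⟨c, hc, (p.appLE c.A.1 c.U.1 c.le).hom w, hzc, ?_, fun O' hO' h' ↦ ?_⟩
  · rw [← h3, app_resFun, ← map_mul, ← hy, app_resFun]
  · have hA : O' ≤ (k ≫ p) ⁻¹ᵁ c.A.1 := h'.trans (k.preimage_mono c.le)
    have h4 := ((conormalFamily v e).form U₀ δ).map_smul c.A.1 O' hO' hA w c.β
    rw [h2, LinForm.toFun_res, conormalFamily_toFun v e δ β hU₀ le_rfl O' hO' _ hO'] at h4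
    have h5 := (congrArg (v.appLE U₀ O' hO').hom hδ).symm.trans h4
    rw [map_one] at h5
    rw [appLE_appLE_apply k p c.le h' hA, mul_comm]
    exact h5.symm

end Value

/-! ### Vanishing of `x/b`, and values of the corresponding form -/

section Canonical

set_option linter.unusedSectionVars false

variable {S S₀ B X X' H T T' : Scheme.{u}} {j : S₀ ⟶ S} [IsClosedImmersion j] {p : X ⟶ S}
  {i : H ⟶ pullback p j} [IsClosedImmersion i] {π : X' ⟶ X}
  (hπ : IsDilatation π (i ≫ pullback.fst p j).ker (j.ker.comap p))

/-- The quotients `x / b` vanish on flat schemes on which `x` vanishes. -/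
lemma CartierChart.appLE_quot_eq_zero (c : CartierChart j p) (σ : T ⟶ X') [Flat (σ ≫ π ≫ p)]
    {W : X.Opens} {x : Γ(X, W)} (hx : ((σ ≫ π).app W).hom x = 0) (hc : c.U.1 ≤ W)
    (h : resFun hc x ∈ (i ≫ pullback.fst p j).ker.ideal c.U) (O : T.Opens)
    (hO : O ≤ σ ⁻¹ᵁ (π ⁻¹ᵁ c.U.1)) :
    (σ.appLE _ O hO).hom (c.quot hπ (resFun hc x) h) = 0 := by
  have hO' : O ≤ (σ ≫ π) ⁻¹ᵁ c.U.1 := hO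
  have hO'' : O ≤ ((σ ≫ π) ≫ p) ⁻¹ᵁ c.A.1 := hO'.trans ((σ ≫ π).preimage_mono c.le)
  have hA : O ≤ (σ ≫ π ≫ p) ⁻¹ᵁ c.A.1 := by
    rw [Category.assoc] at hO''
    exact hO''
  -- `b · (x/b) = x` is zero on `T`, and flatness allows `b` to be cancelled.
  refine eq_zero_of_appLE_mul_eq_zero (σ ≫ π ≫ p) c.A.2 c.mem_nonZeroDivisors hA _ ?_
  have h1 := congrArg (σ.appLE _ O hO).hom (c.app_b_mul_quot hπ (resFun hc x) h)
  rw [map_mul, appLE_app_apply σ π hO hO', appLE_app_apply σ π hO hO', appLE_resFun (σ ≫ π),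
    ← resFun_app (σ ≫ π) (hO'.trans ((σ ≫ π).preimage_mono hc)), hx, map_zero, CartierChart.b,
    appLE_appLE_apply (σ ≫ π) p c.le hO' hO''] at h1
  refine Eq.trans ?_ h1
  congr 1

variable {e : B ⟶ H} {v : T ⟶ B}
  {F : B.Modules} {L : H.Modules} {A : FormModel F L (idealSheaf i) e i}
  {d : ∀ c : CartierChart j p, dualSections L ((i ≫ pullback.fst p j) ⁻¹ᵁ c.U.1)} {hπ}

/-- The value of the linear form given by a point of the dilatation on a function `x` for which
`x / β` is regular. -/
theorem Corresponds.toFun_sec (hj : IsEffectiveCartier j) (hA : A.IsFaithful)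
    {Λ : DualFamily L (v ≫ e) (idealSheaf j) ((((v ≫ e) ≫ i) ≫ pullback.fst p j) ≫ p)}
    (hΛ : HasDualGenerators (i ≫ pullback.fst p j) Λ d) {κ κ₀ : T ⟶ X'}
    (h : κ ≫ π = ((v ≫ e) ≫ i) ≫ pullback.fst p j)
    (h₀ : κ₀ ≫ π = ((v ≫ e) ≫ i) ≫ pullback.fst p j)
    {ψ : LinForm F v ⊤} (hψ : Corresponds A d hπ κ κ₀ ψ)
    {U : H.Opens} (δ : dualSections L U) {W : X.Opens} (x : Γ(X, W))
    (ξ : Γ(idealSheaf i, pullback.fst p j ⁻¹ᵁ W))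
    (hξ : toFunction ξ = ((pullback.fst p j).app W).hom x) (y : Γ(X', π ⁻¹ᵁ W))
    (O : T.Opens) (hO : O ≤ (v ≫ e) ⁻¹ᵁ U)
    (hW : O ≤ ((v ≫ e) ≫ i) ⁻¹ᵁ (pullback.fst p j ⁻¹ᵁ W))
    (hκ : O ≤ κ ⁻¹ᵁ (π ⁻¹ᵁ W))
    (h₁ : ∀ (c : CartierChart j p) (hc : c.U.1 ≤ W) (O' : T.Opens)
      (h' : O' ≤ κ₀ ⁻¹ᵁ (π ⁻¹ᵁ c.U.1)), (κ₀.appLE _ O' h').hom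
        (c.quot hπ (resFun hc x) (mem_ker_ideal_of_toFunction hξ c hc)) = 0)
    (h₂ : ∀ z ∈ O, ∃ (c : CartierChart j p) (hc : c.U.1 ≤ W) (w : Γ(X, c.U.1)),
      (((v ≫ e) ≫ i) ≫ pullback.fst p j) z ∈ c.U.1 ∧
      (π.app c.U.1).hom (c.b * w) * resFun (π.preimage_mono hc) y =
        (π.app c.U.1).hom (resFun hc x) ∧
      ∀ (O' : T.Opens) (hO' : O' ≤ (v ≫ e) ⁻¹ᵁ U)
        (h' : O' ≤ (((v ≫ e) ≫ i) ≫ pullback.fst p j) ⁻¹ᵁ c.U.1),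
        (Λ.form U δ).toFun c.A.1 O' hO'
          (h'.trans ((((v ≫ e) ≫ i) ≫ pullback.fst p j).preimage_mono c.le)) c.β *
          ((((v ≫ e) ≫ i) ≫ pullback.fst p j).appLE c.U.1 O' h').hom w = 1) :
    ψ.toFun (A.dom U _) O le_top (A.le_preimage_dom hO hW) (A.sec U δ _ ξ) =
      (κ.appLE _ O hκ).hom y := by
  obtain ⟨Φ, hΦ⟩ := hA.exists_family ψ
  have h3 := (corresponds_iff hj hΛ h h₀ hΦ).1 hψ U δ
  rw [← TwistedForm.toDualFamily_ofPair_toFun hπ hj h h₀ Λ δ x ξ hξ y O hO hW hκ h₁ h₂, h3]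
  exact (hΦ U δ _ O hO hW ξ).symm

end Canonical

lemma pullbackModel_sec {B Y X₀ : Scheme.{u}} {L : Y.Modules} {M : X₀.Modules} {e : B ⟶ Y}
    {i : Y ⟶ X₀} {W : X₀.Opens} (ξ : Γ(M, W)) (δ : dualSections L (i ⁻¹ᵁ W)) :
    (pullbackModel L M e i).sec _ δ W ξ =
      res (e.preimage_mono inf_le_left) (pullbackSection e (tmul (pullbackSection i ξ) δ)) := by
  rw [← pullbackSection_res, res_tmul]
  rfl

/-! ### The canonical inclusion in the presence of a lift of `H` -/

section CanonicalInclusion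

set_option linter.unusedSectionVars false

variable {S S₀ : Scheme.{u}} {j : S₀ ⟶ S} [IsClosedImmersion j] {G : Over S}
  {H : Over S₀} {i : H ⟶ special j G} [IsClosedImmersion i.left]
  {G' : Scheme.{u}} {π : G' ⟶ G.left} [GrpObj G] [GrpObj H] [IsMonHom i]
  [GrpObj (Over.mk (π ≫ G.hom))] [IsMonHom (Over.homMk π : Over.mk (π ≫ G.hom) ⟶ G)]

/-- The quotients `x / b` vanish on the unit section if `x` vanishes on a flat subgroup scheme. -/
lemma unitPoint_appLE_quot_eq_zero (hπ : IsNeronBlowup j i π) {H' : Over S} [GrpObj H']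
    [Flat H'.hom] {σ : H' ⟶ Over.mk (π ≫ G.hom)} [IsMonHom σ] {W : G.left.Opens}
    {x : Γ(G.left, W)} (hx : ((σ.left ≫ π).app W).hom x = 0) (T : Over S₀)
    (c : CartierChart j G.hom) (hc : c.U.1 ≤ W)
    (h : resFun hc x ∈ (i.left ≫ proj j G).ker.ideal c.U) (O : T.left.Opens)
    (hO : O ≤ unitPoint (j := j) π T ⁻¹ᵁ (π ⁻¹ᵁ c.U.1)) :
    ((unitPoint (j := j) π T).appLE _ O hO).hom
      (c.quot hπ.isDilatation (resFun hc x) h) = 0 := by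
  -- The unit point factors through the flat subgroup scheme `H'`, on which `x/b` vanishes already.
  have h1 : unitPoint (j := j) π T =
      (toUnit ((Over.map j).obj T) ≫ η[H']).left ≫ σ.left := by
    have : (1 : (Over.map j).obj T ⟶ Over.mk (π ≫ G.hom)) =
        (toUnit ((Over.map j).obj T) ≫ η[H']) ≫ σ := by
      rw [Category.assoc, IsMonHom.one_hom]
      rfl
    exact congrArg CommaMorphism.left this
  set ρ := (toUnit ((Over.map j).obj T) ≫ η[H']).left
  have hF : Flat (σ.left ≫ π ≫ G.hom) := by
    have : σ.left ≫ π ≫ G.hom = H'.hom := Over.w σ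
    rw [this]
    infer_instance
  have hO' : O ≤ (ρ ≫ σ.left) ⁻¹ᵁ (π ⁻¹ᵁ c.U.1) := by
    rw [← h1]
    exact hO
  have hO'' : O ≤ ρ ⁻¹ᵁ (σ.left ⁻¹ᵁ (π ⁻¹ᵁ c.U.1)) := hO'
  rw [appLE_congr_apply h1 hO hO', ← appLE_appLE_apply ρ σ.left le_rfl hO'' hO',
    c.appLE_quot_eq_zero hπ.isDilatation σ.left hx hc h _ le_rfl, map_zero]

variable {V : Over S₀} {f : V ⟶ special j (Over.mk (π ≫ G.hom))}
  {q : special j (Over.mk (π ≫ G.hom)) ⟶ H}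

/-- The universal form is the difference of the values at the point and at the unit. For `x`
vanishing on `H'` the second value is zero, so the linear function is the pullback of `x/β` itself.
-/
theorem isCanonicalInclusion [Flat G.hom] (hj : IsEffectiveCartier j) (hπ : IsNeronBlowup j i π)
    (hq : q ≫ i = (Over.pullback j).map (Over.homMk π))
    (hf : IsPullback f (toUnit V) q η[H])
    {u : twistedConormal j i ⟶ (Scheme.Modules.pushforward V.hom).obj (structureSheaf V.left)}
    (hu : Corresponds (pullbackModel (restrictedIdeal j i) (idealSheaf i.left)
        (η[H].left : S₀ ⟶ H.left) i.left)
      (restrictedGenerator i.left) hπ.isDilatation (toBase f).left (unitPoint (j := j) π V)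
      (LinForm.ofHom u)) {H' : Over S} [GrpObj H'] [Flat H'.hom] (h : H' ⟶ G)
    {σ : H' ⟶ Over.mk (π ≫ G.hom)} [IsMonHom σ]
    (hσ : σ ≫ (Over.homMk π : Over.mk (π ≫ G.hom) ⟶ G) = h) :
    IsCanonicalInclusion j i π u f h := by
  intro W x hx ξ hξ β δ hδ y hy O h₁ h₂
  have h3 : f.left ≫ proj j (Over.mk (π ≫ G.hom)) = (toBase f).left := (toBase_left f).symm
  have hx' : ((σ.left ≫ π).app W).hom x = 0 := by
    subst hσ
    exact hx
  have hκ : O ≤ (toBase f).left ⁻¹ᵁ (π ⁻¹ᵁ W) := by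
    rw [← h3]
    exact h₁
  have hb := unitPoint_comp (j := j) (π := π) (i := i) (e := η[H].left) rfl V
  have ha : (toBase f).left ≫ π =
      ((V.hom ≫ (η[H].left : S₀ ⟶ H.left)) ≫ i.left) ≫ proj j G := by
    have h1 : (1 : (Over.map j).obj V ⟶ Over.mk (π ≫ G.hom)) ≫
      (Over.homMk π : Over.mk (π ≫ G.hom) ⟶ G) = 1 := MonObj.one_comp _
    have h2 := kernel_point_comp hq hf (𝟙 V)
    rw [Category.id_comp] at h2
    rw [← hb]
    exact congrArg CommaMorphism.left (h2.trans h1.symm)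
  have h4 := hu.toFun_sec hj isFaithful_pullbackModel
    (hasDualGenerators_restrictedFamily (V.hom ≫ (η[H].left : S₀ ⟶ H.left))) ha hb δ x ξ hξ y O
    h₂ h₂ hκ (fun c hc O' h' ↦ unitPoint_appLE_quot_eq_zero hπ hx' V c hc _ O' h')
    (fun z hz ↦ exists_chart_restrictedFamily hj x β δ le_rfl hδ y hy z (h₂ hz))
  rw [appLE_congr_apply h3 h₁ hκ, ← h4]
  have h5 := pullbackModel_sec (L := restrictedIdeal j i) (e := (η[H].left : S₀ ⟶ H.left)) ξ δ
  exact (congrArg ((LinForm.ofHom u).toFun _ O le_top _) h5).trans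
    ((LinForm.ofHom u).toFun_res _ _ O le_top _ _ _)

end CanonicalInclusion

/-! ### The extension and its splitting -/

section Extension

set_option linter.unusedSectionVars false

variable {S S₀ : Scheme.{u}} {j : S₀ ⟶ S} [IsClosedImmersion j] {G : Over S}
  {H : Over S₀} {i : H ⟶ special j G} [IsClosedImmersion i.left]
  {G' : Scheme.{u}} {π : G' ⟶ G.left}

lemma flat_neronBlowup [Flat G.hom] [Flat H.hom] (hj : IsEffectiveCartier j)
    (hi : IsRegularImmersion i.left) (hπ : IsNeronBlowup j i π) : Flat (π ≫ G.hom) :=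
  flat_dilatation (i := i.left) hj hi (by
    have : i.left ≫ pullback.snd G.hom j = H.hom := Over.w i
    rw [this]
    infer_instance) hπ.isDilatation

variable {q : special j (Over.mk (π ≫ G.hom)) ⟶ H}

lemma left_comp_proj (hq : q ≫ i = (Over.pullback j).map (Over.homMk π)) :
    q.left ≫ i.left ≫ proj j G = proj j (Over.mk (π ≫ G.hom)) ≫ π := by
  refine Eq.trans ?_ (proj_comp_left (j := j) (Over.homMk π : Over.mk (π ≫ G.hom) ⟶ G)).symm
  rw [← hq, Over.comp_left, Category.assoc]

variable [GrpObj G] [GrpObj H] [IsMonHom i]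
  [GrpObj (Over.mk (π ≫ G.hom))] [IsMonHom (Over.homMk π : Over.mk (π ≫ G.hom) ⟶ G)]

/-- A lift of the centre to a flat subgroup scheme lifts to the dilatation. -/
theorem exists_lift_subgroup [Flat (π ≫ G.hom)] (hj : IsEffectiveCartier j)
    (hπ : IsNeronBlowup j i π)
    (hq : q ≫ i = (Over.pullback j).map (Over.homMk π)) {H' : Over S} [GrpObj H'] (h : H' ⟶ G)
    [IsMonHom h] [Flat H'.hom] (ε : special j H' ≅ H) (hε : ε.hom ≫ i = (Over.pullback j).map h) :
    ∃ σ : H' ⟶ Over.mk (π ≫ G.hom),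
      (∀ τ : H' ⟶ Over.mk (π ≫ G.hom), τ ≫ Over.homMk π = h ↔ τ = σ) ∧
      IsMonHom σ ∧ IsMonHom (ε.inv ≫ (Over.pullback j).map σ) ∧
      (ε.inv ≫ (Over.pullback j).map σ) ≫ q = 𝟙 H := by
  have hmi : Mono i := over_mono_of_left i
  -- The isomorphism `ε` says precisely that `h` restricts over `S₀` to a morphism into `H`.
  obtain ⟨σ, hσ⟩ := hπ.exists_over_lift hj h ⟨ε.hom, hε⟩
  have hσm : IsMonHom σ := hπ.isMonHom_lift hj hσ
  have hεi : ε.inv ≫ (Over.pullback j).map h = i := by rw [← hε, Iso.inv_hom_id_assoc]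
  have hεh : IsMonHom ε.hom := isMonHom_of_comp_eq (g := (Over.pullback j).map h) hε
  have hεm : IsMonHom ε.inv := inferInstance
  refine ⟨σ, fun τ ↦ ⟨fun hτ ↦ hπ.over_hom_ext hj (hτ.trans hσ.symm), ?_⟩, hσm, inferInstance, ?_⟩
  · rintro rfl
    exact hσ
  · rw [← cancel_mono i, Category.assoc, Category.assoc, hq, ← Functor.map_comp, hσ, hεi,
      Category.id_comp]

/-- The homomorphism from the special fibre of the dilatation to the centre, and its kernel. -/
theorem exists_extension [Flat G.hom] [Flat H.hom] (hj : IsEffectiveCartier j)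
    (hi : IsRegularImmersion i.left) (hπ : IsNeronBlowup j i π) :
    ∃ q : special j (Over.mk (π ≫ G.hom)) ⟶ H,
      q ≫ i = (Over.pullback j).map (Over.homMk π) ∧ IsMonHom q ∧
      ∃ (V : Over S₀) (_ : GrpObj V) (u : twistedConormal j i ⟶
          (Scheme.Modules.pushforward V.hom).obj (structureSheaf V.left))
        (f : V ⟶ special j (Over.mk (π ≫ G.hom))),
        IsVectorGroup (twistedConormal j i) V u ∧ IsShortExact f q ∧
        ∀ (H' : Over S) [GrpObj H'] (h : H' ⟶ G) [IsMonHom h], Flat H'.hom →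
          ∀ σ : H' ⟶ Over.mk (π ≫ G.hom), σ ≫ Over.homMk π = h →
            IsCanonicalInclusion j i π u f h := by
  have hmi : Mono i := over_mono_of_left i
  have hF : Flat (π ≫ G.hom) := flat_neronBlowup hj hi hπ
  obtain ⟨q, hq⟩ := hπ.exists_over_toCenter hj
  have hqm : IsMonHom q :=
    isMonHom_of_comp_eq (g := (Over.pullback j).map (Over.homMk π)) hq
  have hql := left_comp_proj hq
  -- `V` is taken to be the kernel of `q` over all of `S₀`; no lift of `H` is involved, since the
  -- unit point serves as origin.
  have hf : IsPullback (pullback.fst q η[H]) (toUnit _) q η[H] := by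
    have := IsPullback.of_hasPullback q η[H]
    rwa [toUnit_unique (pullback.snd q η[H]) (toUnit _)] at this
  obtain ⟨_, hfm⟩ := exists_grpObj_of_isPullback hf
  obtain ⟨u, hu, hc⟩ := exists_isVectorGroup hj hi hπ hq hf (e := (η[H].left : S₀ ⟶ H.left)) rfl
    (F := twistedConormal j i) (L := restrictedIdeal j i)
    (A := pullbackModel (restrictedIdeal j i) (idealSheaf i.left) _ i.left)
    isFaithful_pullbackModel fun v ↦ ⟨_, hasDualGenerators_restrictedFamily _⟩
  refine ⟨q, hq, hqm, _, _, u, pullback.fst q η[H], hu, ⟨hfm, hqm, hf, ?_, ?_, ?_⟩,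
    fun H' _ h _ _ σ hσ ↦ ?_⟩
  · exact flat_toCenter hj hi hπ.isDilatation hql
  · exact surjective_toCenter hj hi hπ.isDilatation hql
  · exact locallyOfFinitePresentation_toCenter hj hi hπ.isDilatation hql
  · have : IsMonHom σ := hπ.isMonHom_lift hj hσ
    exact isCanonicalInclusion hj hπ hq hf hc h hσ

end Extension

/-! ### Differentials along a section and functions vanishing on it -/

section Diagonal

variable {X Y T : Scheme.{u}}

lemma appLE_SpecMap_comp_fromSpec {U : X.Opens} (hU : IsAffineOpen U) {R : CommRingCat.{u}}
    (φ : Γ(X, U) ⟶ R) (h : ⊤ ≤ (Spec.map φ ≫ hU.fromSpec) ⁻¹ᵁ U) :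
    (Spec.map φ ≫ hU.fromSpec).appLE U ⊤ h = φ ≫ (Scheme.ΓSpecIso R).inv := by
  have h1 : ⊤ ≤ hU.fromSpec ⁻¹ᵁ U := hU.fromSpec_preimage_self.ge
  rw [← Scheme.Hom.appLE_comp_appLE (Spec.map φ) hU.fromSpec U ⊤ ⊤ h1 le_top]
  rw [Scheme.ΓSpecIso_inv_naturality]
  congr 1
  · rw [Scheme.Hom.appLE, hU.fromSpec_app_self, Category.assoc, ← Functor.map_comp]
    exact (congrArg _ ((Spec _).presheaf.map_id _)).trans (Category.comp_id _)

/-- The ideal of the diagonal is locally generated by the functions `1 ⊗ x - x ⊗ 1`. -/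
lemma mem_span_of_app_diagonal_eq_zero (g : X ⟶ Y) {U : X.Opens} (hU : IsAffineOpen U)
    {Q : (pullback g g).Opens} (hQ : IsAffineOpen Q)
    (h₁ : Q ≤ pullback.fst g g ⁻¹ᵁ U) (h₂ : Q ≤ pullback.snd g g ⁻¹ᵁ U)
    {a : Γ(pullback g g, Q)} (ha : ((pullback.diagonal g).app Q).hom a = 0) :
    a ∈ Ideal.span (Set.range fun x : Γ(X, U) ↦ ((pullback.snd g g).appLE U Q h₂).hom x -
      ((pullback.fst g g).appLE U Q h₁).hom x) := by
  set K := Ideal.span (Set.range fun x : Γ(X, U) ↦ ((pullback.snd g g).appLE U Q h₂).hom x -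
      ((pullback.fst g g).appLE U Q h₁).hom x) with hK
  -- Modulo these differences the two projections agree, so the closed subscheme they define factors
  -- through the diagonal, where `a` vanishes.
  let m : Γ(pullback g g, Q) ⟶ CommRingCat.of (Γ(pullback g g, Q) ⧸ K) :=
    CommRingCat.ofHom (Ideal.Quotient.mk K)
  let ι' := Spec.map m ≫ hQ.fromSpec
  have h3 : (pullback.fst g g).appLE U Q h₁ ≫ m = (pullback.snd g g).appLE U Q h₂ ≫ m := by
    ext x
    have hm : ((pullback.snd g g).appLE U Q h₂).hom x -
      ((pullback.fst g g).appLE U Q h₁).hom x ∈ K := Ideal.subset_span ⟨x, rfl⟩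
    exact (Ideal.Quotient.eq.2 hm).symm
  have h4 : ι' ≫ pullback.fst g g = ι' ≫ pullback.snd g g := by
    simp only [ι', Category.assoc]
    rw [← hU.SpecMap_appLE_fromSpec _ hQ h₁, ← hU.SpecMap_appLE_fromSpec _ hQ h₂,
      ← Spec.map_comp_assoc, ← Spec.map_comp_assoc, h3]
  have h5 : ι' = (ι' ≫ pullback.fst g g) ≫ pullback.diagonal g := by
    apply pullback.hom_ext
    · simp
    · simp [h4]
  have h6 : ⊤ ≤ ι' ⁻¹ᵁ Q := by
    change ⊤ ≤ Spec.map m ⁻¹ᵁ (hQ.fromSpec ⁻¹ᵁ Q)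
    rw [hQ.fromSpec_preimage_self]
    exact le_rfl
  have h7 : ⊤ ≤ ((ι' ≫ pullback.fst g g) ≫ pullback.diagonal g) ⁻¹ᵁ Q := by
    rw [← h5]
    exact h6
  have h8 : (ι'.appLE Q ⊤ h6).hom a = 0 := by
    rw [appLE_congr_apply h5 h6 h7,
      ← appLE_app_apply (ι' ≫ pullback.fst g g) (pullback.diagonal g) h7 h7, ha, map_zero]
  rw [appLE_SpecMap_comp_fromSpec hQ m h6] at h8
  have h9 : m.hom a = 0 := by
    have := congrArg (Scheme.ΓSpecIso _).hom h8
    rw [map_zero] at this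
    rwa [← CommRingCat.comp_apply, Category.assoc, Iso.inv_hom_id, Category.comp_id] at this
  exact Ideal.Quotient.eq_zero_iff_mem.1 h9

variable {e : Y ⟶ X} {g : X ⟶ Y}

/-- The function `1 ⊗ x - x ⊗ 1`. -/
def diffFun (g : X ⟶ Y) {W : X.Opens} (x : Γ(X, W)) :
    Γ(pullback g g, pullback.fst g g ⁻¹ᵁ W ⊓ pullback.snd g g ⁻¹ᵁ W) :=
  ((pullback.snd g g).appLE W _ inf_le_right).hom x -
    ((pullback.fst g g).appLE W _ inf_le_left).hom x

lemma appLE_diffFun (g : X ⟶ Y) {W : X.Opens} (x : Γ(X, W)) (s : T ⟶ pullback g g) {O : T.Opens}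
    (h : O ≤ s ⁻¹ᵁ (pullback.fst g g ⁻¹ᵁ W ⊓ pullback.snd g g ⁻¹ᵁ W))
    (h₁ : O ≤ (s ≫ pullback.fst g g) ⁻¹ᵁ W) (h₂ : O ≤ (s ≫ pullback.snd g g) ⁻¹ᵁ W) :
    (s.appLE _ O h).hom (diffFun g x) = ((s ≫ pullback.snd g g).appLE W O h₂).hom x -
      ((s ≫ pullback.fst g g).appLE W O h₁).hom x := by
  rw [diffFun, map_sub, appLE_appLE_apply s (pullback.snd g g) inf_le_right h h₂,
    appLE_appLE_apply s (pullback.fst g g) inf_le_left h h₁]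

lemma le_preimage_diagonal {g : X ⟶ Y} {k : T ⟶ X} {O : T.Opens} {W : X.Opens} (h : O ≤ k ⁻¹ᵁ W) :
    O ≤ (k ≫ pullback.diagonal g) ⁻¹ᵁ
      (pullback.fst g g ⁻¹ᵁ W ⊓ pullback.snd g g ⁻¹ᵁ W) := by
  have h₁ : O ≤ ((k ≫ pullback.diagonal g) ≫ pullback.fst g g) ⁻¹ᵁ W := by simpa using h
  have h₂ : O ≤ ((k ≫ pullback.diagonal g) ≫ pullback.snd g g) ⁻¹ᵁ W := by simpa using h
  exact le_inf h₁ h₂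

lemma app_diagonal_diffFun (g : X ⟶ Y) {W : X.Opens} (x : Γ(X, W)) :
    ((pullback.diagonal g).app _).hom (diffFun g x) = 0 := by
  rw [← resFun_self (((pullback.diagonal g).app _).hom (diffFun g x)), resFun_app,
    appLE_diffFun g x (pullback.diagonal g) le_rfl (fun z hz ↦ hz.1) (fun z hz ↦ hz.2), sub_eq_zero]
  exact appLE_congr_apply (by simp) _ _ _

/-- The section of the ideal sheaf of the diagonal defined by `1 ⊗ x - x ⊗ 1`. -/
def diffSection (g : X ⟶ Y) {W : X.Opens} (x : Γ(X, W)) :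
    Γ(idealSheaf (pullback.diagonal g), pullback.fst g g ⁻¹ᵁ W ⊓ pullback.snd g g ⁻¹ᵁ W) :=
  ofFunction (diffFun g x) (app_diagonal_diffFun g x)

lemma toFunction_diffSection (g : X ⟶ Y) {W : X.Opens} (x : Γ(X, W)) :
    toFunction (diffSection g x) = diffFun g x := toFunction_ofFunction _ _

lemma diffFun_add (g : X ⟶ Y) {W : X.Opens} (x y : Γ(X, W)) :
    diffFun g (x + y) = diffFun g x + diffFun g y := by
  rw [diffFun, map_add, map_add, diffFun, diffFun]
  ring

lemma diffFun_mul (g : X ⟶ Y) {W : X.Opens} (a x : Γ(X, W)) :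
    diffFun g (a * x) = ((pullback.snd g g).appLE W _ inf_le_right).hom a * diffFun g x +
      ((pullback.fst g g).appLE W _ inf_le_left).hom x * diffFun g a := by
  rw [diffFun, map_mul, map_mul, diffFun, diffFun]
  ring

lemma resFun_diffFun (g : X ⟶ Y) {W W' : X.Opens} (h : W' ≤ W) (x : Γ(X, W)) :
    resFun (inf_le_inf ((pullback.fst g g).preimage_mono h) ((pullback.snd g g).preimage_mono h))
      (diffFun g x) = diffFun g (resFun h x) := by
  rw [diffFun, map_sub, resFun_appLE, resFun_appLE, diffFun, appLE_resFun, appLE_resFun]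

/-- The form `x ↦ φ (1 ⊗ x - x ⊗ 1)` on functions vanishing on a section. -/
def LinForm.diff {k : T ⟶ Y} {Ω : T.Opens}
    (φ : LinForm (idealSheaf (pullback.diagonal g)) ((k ≫ e) ≫ pullback.diagonal g) Ω) :
    LinForm (idealSheaf e) (k ≫ e) Ω where
  toFun W O hO h := AddMonoidHom.mk'
    (fun ξ ↦ φ.toFun _ O hO (le_preimage_diagonal h) (diffSection g (toFunction ξ)))
    fun ξ ξ' ↦ by
      rw [← map_add]
      congr 1
      apply toFunction_injective
      simp only [toFunction_add, toFunction_diffSection, diffFun_add]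
  map_smul W O hO h a ξ := by
    change φ.toFun _ O hO _ (diffSection g (toFunction (a • ξ))) =
      _ * φ.toFun _ O hO _ (diffSection g (toFunction ξ))
    have h1 : diffSection g (toFunction (a • ξ)) =
        ((pullback.snd g g).appLE W (pullback.fst g g ⁻¹ᵁ W ⊓ pullback.snd g g ⁻¹ᵁ W)
          inf_le_right).hom a • diffSection g (toFunction ξ) +
        ((pullback.fst g g).appLE W (pullback.fst g g ⁻¹ᵁ W ⊓ pullback.snd g g ⁻¹ᵁ W)
          inf_le_left).hom (toFunction ξ) • diffSection g a :=
      toFunction_injective _ (by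
        simp only [toFunction_add, toFunction_smul, toFunction_diffSection, diffFun_mul])
    have hd := le_preimage_diagonal (g := g) h
    have e₁ : ((k ≫ e) ≫ pullback.diagonal g) ≫ pullback.fst g g = k ≫ e := by simp
    have e₂ : ((k ≫ e) ≫ pullback.diagonal g) ≫ pullback.snd g g = k ≫ e := by simp
    have h₁ : O ≤ (((k ≫ e) ≫ pullback.diagonal g) ≫ pullback.fst g g) ⁻¹ᵁ W := by
      rw [e₁]; exact h
    have h₂ : O ≤ (((k ≫ e) ≫ pullback.diagonal g) ≫ pullback.snd g g) ⁻¹ᵁ W := by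
      rw [e₂]; exact h
    -- The second term of the Leibniz rule has coefficient `ξ`, which vanishes on the section.
    have h3 : ((k ≫ e).appLE W O h).hom (toFunction ξ) = 0 := by
      rw [← appLE_app_apply k e h h, app_toFunction, map_zero]
    rw [h1, map_add, φ.map_smul, φ.map_smul,
      appLE_appLE_apply _ (pullback.snd g g) inf_le_right hd h₂,
      appLE_appLE_apply _ (pullback.fst g g) inf_le_left hd h₁,
      appLE_congr_apply e₁ h₁ h, h3, zero_mul, add_zero, appLE_congr_apply e₂ h₂ h]
  map_res W W' O O' hO h hW hO' h' ξ := by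
    change φ.toFun _ O' _ _ (diffSection g (toFunction (res hW ξ))) =
      resFun hO' (φ.toFun _ O hO _ (diffSection g (toFunction ξ)))
    rw [← φ.map_res _ _ O O' hO (le_preimage_diagonal h)
      (inf_le_inf ((pullback.fst g g).preimage_mono hW) ((pullback.snd g g).preimage_mono hW)) hO'
      (le_preimage_diagonal h')]
    congr 1
    apply toFunction_injective
    simp only [toFunction_res, toFunction_diffSection]
    exact (resFun_diffFun g hW _).symm

lemma LinForm.diff_toFun {k : T ⟶ Y} {Ω : T.Opens}
    (φ : LinForm (idealSheaf (pullback.diagonal g)) ((k ≫ e) ≫ pullback.diagonal g) Ω)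
    (W O hO h) (ξ : Γ(idealSheaf e, W)) : φ.diff.toFun W O hO h ξ =
      φ.toFun _ O hO (le_preimage_diagonal h) (diffSection g (toFunction ξ)) := rfl

end Diagonal

section DiagonalForms

variable {X Y T : Scheme.{u}} {e : Y ⟶ X} {g : X ⟶ Y}

/-- The morphism `(e ∘ g, id)` from `X` to the self-product agrees with the diagonal on the section.
It pulls functions vanishing on the diagonal back to functions vanishing on `e`, and carries `1 ⊗ x
- x ⊗ 1` to `x` when `x` vanishes on `e`. -/
lemma LinForm.diff_surjective (he : e ≫ g = 𝟙 Y) {k : T ⟶ Y} {Ω : T.Opens}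
    (φ : LinForm (idealSheaf e) (k ≫ e) Ω) :
    ∃ φ' : LinForm (idealSheaf (pullback.diagonal g)) ((k ≫ e) ≫ pullback.diagonal g) Ω,
      φ'.diff = φ := by
  let s : X ⟶ pullback g g := pullback.lift (g ≫ e) (𝟙 X) (by simp [he])
  have hs₁ : s ≫ pullback.fst g g = g ≫ e := pullback.lift_fst _ _ _
  have hs₂ : s ≫ pullback.snd g g = 𝟙 X := pullback.lift_snd _ _ _
  have hs : e ≫ s = e ≫ pullback.diagonal g := by
    apply pullback.hom_ext
    · simp [hs₁, reassoc_of% he]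
    · simp [hs₂]
  have hf : ∃ g' : Y ⟶ X, g' ≫ pullback.diagonal g = e ≫ s := ⟨e, hs.symm⟩
  have hk : (k ≫ e) ≫ s = (k ≫ e) ≫ pullback.diagonal g := by
    rw [Category.assoc, hs, Category.assoc]
  refine ⟨(φ.comapIdeal hf).congr hk, ?_⟩
  ext W O hO h ξ
  let D : (pullback g g).Opens := pullback.fst g g ⁻¹ᵁ W ⊓ pullback.snd g g ⁻¹ᵁ W
  have hD₂ : s ⁻¹ᵁ D ≤ (s ≫ pullback.snd g g) ⁻¹ᵁ W := fun z hz ↦ hz.2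
  have hD₁ : s ⁻¹ᵁ D ≤ (s ≫ pullback.fst g g) ⁻¹ᵁ W := fun z hz ↦ hz.1
  have hD₁' : s ⁻¹ᵁ D ≤ (g ≫ e) ⁻¹ᵁ W := by rw [← hs₁]; exact hD₁
  have hD₂' : s ⁻¹ᵁ D ≤ W := by rw [hs₂] at hD₂; exact hD₂
  have h1 : idealPullback hf D (diffSection g (toFunction ξ)) = res hD₂' ξ :=
    toFunction_injective _ (by
      rw [toFunction_idealPullback, toFunction_diffSection, toFunction_res,
        ← resFun_self ((s.app D).hom _), resFun_app,
        appLE_diffFun g (toFunction ξ) s le_rfl hD₁ hD₂, appLE_congr_apply hs₁ hD₁ hD₁',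
        ← appLE_app_apply g e hD₁' hD₁', app_toFunction, map_zero, sub_zero,
        appLE_congr_apply hs₂ hD₂ (le_id_preimage hD₂'), id_appLE_apply]
      rfl)
  have hOD : O ≤ (k ≫ e) ⁻¹ᵁ (s ⁻¹ᵁ D) := by
    have := le_preimage_diagonal (g := g) h
    rw [← hk] at this
    exact this
  have h2 := φ.toFun_res W (s ⁻¹ᵁ D) O hO hD₂' hOD ξ
  rw [← h1] at h2
  exact h2

/-- The differences `1 ⊗ x - x ⊗ 1` generate the ideal of the diagonal locally, and each is already
the difference of a function vanishing on the section. -/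
lemma LinForm.diff_injective {k : T ⟶ Y} {Ω : T.Opens} (he : e ≫ g = 𝟙 Y) :
    Function.Injective (LinForm.diff :
      LinForm (idealSheaf (pullback.diagonal g)) ((k ≫ e) ≫ pullback.diagonal g) Ω → _) := by
  intro φ φ' hφ
  ext W O hO h ξ
  refine fun_ext fun z hz ↦ ?_
  obtain ⟨U, hU, hzU, -⟩ := exists_isAffineOpen_le (O := (⊤ : X.Opens)) (x := (k ≫ e) z) trivial
  let U' : X.Opens := U ⊓ (g ≫ e) ⁻¹ᵁ U
  have hzU' : (k ≫ e) z ∈ U' := by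
    refine ⟨hzU, ?_⟩
    change (k ≫ e ≫ g ≫ e) z ∈ U
    rw [reassoc_of% he]
    exact hzU
  have hzD : z ∈ ((k ≫ e) ≫ pullback.diagonal g) ⁻¹ᵁ
      (pullback.fst g g ⁻¹ᵁ U' ⊓ pullback.snd g g ⁻¹ᵁ U') :=
    le_preimage_diagonal (O := (k ≫ e) ⁻¹ᵁ U') le_rfl hzU'
  obtain ⟨Q, hQ, hzQ, hQle⟩ := exists_isAffineOpen_le
    (O := W ⊓ (pullback.fst g g ⁻¹ᵁ U' ⊓ pullback.snd g g ⁻¹ᵁ U'))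
    (x := ((k ≫ e) ≫ pullback.diagonal g) z) ⟨h hz, hzD⟩
  have hQW : Q ≤ W := hQle.trans inf_le_left
  have hQU : Q ≤ pullback.fst g g ⁻¹ᵁ U' ⊓ pullback.snd g g ⁻¹ᵁ U' := hQle.trans inf_le_right
  have h₁ : Q ≤ pullback.fst g g ⁻¹ᵁ U := fun w hw ↦ (hQU hw).1.1
  have h₂ : Q ≤ pullback.snd g g ⁻¹ᵁ U := fun w hw ↦ (hQU hw).2.1
  let O' : T.Opens := O ⊓ ((k ≫ e) ≫ pullback.diagonal g) ⁻¹ᵁ Q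
  have hO' : O' ≤ O := inf_le_left
  have hOQ : O' ≤ ((k ≫ e) ≫ pullback.diagonal g) ⁻¹ᵁ Q := inf_le_right
  have hOU : O' ≤ (k ≫ e) ⁻¹ᵁ U' := by
    have h3 : ((k ≫ e) ≫ pullback.diagonal g) ≫ pullback.fst g g = k ≫ e := by simp
    have h4 : O' ≤ (((k ≫ e) ≫ pullback.diagonal g) ≫ pullback.fst g g) ⁻¹ᵁ U' :=
      fun w hw ↦ (hQU (hOQ hw)).1
    rwa [h3] at h4
  refine ⟨O', hO', ⟨hz, hzQ⟩, ?_⟩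
  rw [LinForm.resFun_toFun, LinForm.resFun_toFun, ← φ.toFun_res W Q O' (hO'.trans hO) hQW hOQ,
    ← φ'.toFun_res W Q O' (hO'.trans hO) hQW hOQ]
  have hspan := mem_span_of_app_diagonal_eq_zero g hU hQ h₁ h₂ (app_toFunction (res hQW ξ))
  have key : ∀ a ∈ Ideal.span (Set.range fun x : Γ(X, U) ↦
      ((pullback.snd g g).appLE U Q h₂).hom x - ((pullback.fst g g).appLE U Q h₁).hom x),
      ∃ ζ : Γ(idealSheaf (pullback.diagonal g), Q), toFunction ζ = a ∧
        φ.toFun Q O' (hO'.trans hO) hOQ ζ = φ'.toFun Q O' (hO'.trans hO) hOQ ζ := by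
    intro a ha
    induction ha using Submodule.span_induction with
    | mem a ha =>
      obtain ⟨x, rfl⟩ := ha
      -- Subtracting the pullback of `x` along `e ∘ g` gives a function vanishing on `e`. The
      -- difference is unchanged because `e ∘ g` takes the same value on both factors of the fibre
      -- product.
      let x' : Γ(X, U') := resFun inf_le_left x - ((g ≫ e).appLE U U' inf_le_right).hom x
      have hx' : (e.app U').hom x' = 0 := by
        have e1 : e ≫ g ≫ e = e := by rw [reassoc_of% he]
        have h3 : e ⁻¹ᵁ U' ≤ (e ≫ g ≫ e) ⁻¹ᵁ U := fun w hw ↦ hw.2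
        rw [map_sub, sub_eq_zero, app_resFun, resFun_app, ← resFun_self ((e.app U').hom _),
          resFun_app, appLE_appLE_apply e (g ≫ e) inf_le_right le_rfl h3]
        exact (appLE_congr_apply e1 h3 _ x).symm
      have hφx := congrArg (fun ψ ↦ ψ.toFun U' O' (hO'.trans hO) hOU (ofFunction x' hx')) hφ
      simp only [LinForm.diff_toFun, toFunction_ofFunction] at hφx
      refine ⟨res hQU (diffSection g x'), ?_, ?_⟩
      · have h₁' : Q ≤ (pullback.fst g g ≫ g ≫ e) ⁻¹ᵁ U := fun w hw ↦ (hQU hw).1.2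
        have h₂' : Q ≤ (pullback.snd g g ≫ g ≫ e) ⁻¹ᵁ U := fun w hw ↦ (hQU hw).2.2
        have hc : pullback.fst g g ≫ g ≫ e = pullback.snd g g ≫ g ≫ e := by
          rw [← Category.assoc, pullback.condition, Category.assoc]
        have hQ₁ : Q ≤ pullback.fst g g ⁻¹ᵁ U' := fun w hw ↦ (hQU hw).1
        have hQ₂ : Q ≤ pullback.snd g g ⁻¹ᵁ U' := fun w hw ↦ (hQU hw).2
        rw [toFunction_res, toFunction_diffSection, diffFun, map_sub, resFun_appLE, resFun_appLE,
          map_sub, map_sub, appLE_resFun, appLE_resFun,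
          appLE_appLE_apply (pullback.snd g g) (g ≫ e) inf_le_right hQ₂ h₂',
          appLE_appLE_apply (pullback.fst g g) (g ≫ e) inf_le_right hQ₁ h₁',
          appLE_congr_apply hc h₁' h₂']
        ring
      · rw [LinForm.toFun_res, LinForm.toFun_res]
        exact hφx
    | zero => exact ⟨0, map_zero _, by rw [map_zero, map_zero]⟩
    | add a b _ _ ha hb =>
      obtain ⟨ζ, rfl, h3⟩ := ha
      obtain ⟨ζ', rfl, h4⟩ := hb
      exact ⟨ζ + ζ', toFunction_add _ _, by rw [map_add, map_add, h3, h4]⟩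
    | smul c a _ ha =>
      obtain ⟨ζ, rfl, h3⟩ := ha
      exact ⟨c • ζ, toFunction_smul _ _, by rw [LinForm.map_smul, LinForm.map_smul, h3]⟩
  obtain ⟨ζ, hζ, h3⟩ := key _ hspan
  rwa [toFunction_injective _ hζ] at h3

end DiagonalForms

/-! ### The model of the twisted cotangent module -/

section CotangentModel

variable {B X T : Scheme.{u}} {e : B ⟶ X} {g : X ⟶ B}

/-- The composites of a family of forms with `x ↦ 1 ⊗ x - x ⊗ 1`. -/
def DualFamily.diff {Y : Scheme.{u}} {L : Y.Modules} {t : T ⟶ Y} {k : T ⟶ B}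
    (Φ : DualFamily L t (idealSheaf (pullback.diagonal g)) ((k ≫ e) ≫ pullback.diagonal g)) :
    DualFamily L t (idealSheaf e) (k ≫ e) where
  form U δ := (Φ.form U δ).diff
  form_add U δ δ' := by rw [Φ.form_add]; rfl
  form_smul U a δ := by rw [Φ.form_smul]; rfl
  form_restrict U V h δ := by rw [Φ.form_restrict U V h]; rfl

/-- Linear forms on `e^* Ω ⊗ L^∨` are families of forms on the functions vanishing on the section
`e`. -/
def cotangentModel (L : B.Modules) (e : B ⟶ X) (g : X ⟶ B) :
    FormModel (tensorDual ((Scheme.Modules.pullback e).obj (differentials g)) L) L (idealSheaf e)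
      (𝟙 B) e where
  dom U W := U ⊓ e ⁻¹ᵁ (pullback.diagonal g ⁻¹ᵁ
    (pullback.fst g g ⁻¹ᵁ W ⊓ pullback.snd g g ⁻¹ᵁ W))
  sec _ δ _ ξ := tmul (res inf_le_right (pullbackSection e
      (pullbackSection (pullback.diagonal g) (diffSection g (toFunction ξ)))))
    (dualSections.restrict L inf_le_left δ)
  le_dom U W := by
    refine le_inf inf_le_left ?_
    exact (le_preimage_diagonal (g := g) (k := e) (O := e ⁻¹ᵁ W) le_rfl).trans' inf_le_right

variable {L : B.Modules}

/-- The correspondence of forms on `e^* Ω ⊗ L^∨` and families of forms on functions. -/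
def CotangentRel {v t : T ⟶ B} (_h : t = v)
    (ψ : LinForm (tensorDual ((Scheme.Modules.pullback e).obj (differentials g)) L) t ⊤)
    (Φ : DualFamily L v (idealSheaf e) (v ≫ e)) : Prop :=
  ∀ U δ W O hO hW hD ξ, (Φ.form U δ).toFun W O hO hW ξ =
    ψ.toFun ((cotangentModel L e g).dom U W) O le_top hD ((cotangentModel L e g).sec U δ W ξ)

lemma cotangentRel_iff {v : T ⟶ B}
    {ψ : LinForm (tensorDual ((Scheme.Modules.pullback e).obj (differentials g)) L) v ⊤}
    {Φ : DualFamily L v (idealSheaf e) (v ≫ e)} :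
    CotangentRel rfl ψ Φ ↔ ∀ U δ, Φ.form U δ =
      (LinForm.comapPullback (f := pullback.diagonal g)
        (LinForm.comapPullback (f := e) (ψ.contract δ))).diff := by
  constructor
  · intro H U δ
    ext W O hO hW ξ
    exact H U δ W O hO hW (le_inf hO (le_preimage_diagonal (g := g) hW)) ξ
  · intro H U δ W O hO hW hD ξ
    rw [H]
    rfl

lemma exists_family_cotangentRel {v t : T ⟶ B} (h : t = v)
    (ψ : LinForm (tensorDual ((Scheme.Modules.pullback e).obj (differentials g)) L) t ⊤) :
    ∃ Φ : DualFamily L v (idealSheaf e) (v ≫ e), CotangentRel h ψ Φ := by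
  subst h
  exact ⟨(DualFamily.comapPullback (f := pullback.diagonal g)
    (DualFamily.comapPullback (f := e) ψ.toDualFamily)).diff, cotangentRel_iff.2 fun U δ ↦ rfl⟩

/-- The family is lifted along `diff`, then through the pullbacks along the diagonal and the
section, and finally to the tensor product with the dual. Injectivity of `diff` gives linearity of
the lift. -/
lemma exists_form_cotangentRel (he : e ≫ g = 𝟙 B) {v t : T ⟶ B} (h : t = v)
    (Φ : DualFamily L v (idealSheaf e) (v ≫ e)) :
    ∃ ψ : LinForm (tensorDual ((Scheme.Modules.pullback e).obj (differentials g)) L) t ⊤,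
      CotangentRel h ψ Φ := by
  subst h
  obtain ⟨Φ₁, hΦ₁⟩ : ∃ Φ₁ : DualFamily L t (idealSheaf (pullback.diagonal g))
      ((t ≫ e) ≫ pullback.diagonal g), ∀ U δ, (Φ₁.form U δ).diff = Φ.form U δ := by
    choose Ψ hΨ using fun (U : B.Opens) (δ : dualSections L U) ↦
      LinForm.diff_surjective he (Φ.form U δ)
    refine ⟨⟨Ψ, fun U δ δ' ↦ ?_, fun U a δ ↦ ?_, fun U V h δ ↦ ?_⟩, hΨ⟩
    · apply LinForm.diff_injective he
      refine (hΨ _ _).trans ?_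
      rw [Φ.form_add, ← hΨ, ← hΨ]
      rfl
    · apply LinForm.diff_injective he
      refine (hΨ _ _).trans ?_
      rw [Φ.form_smul, ← hΨ]
      rfl
    · apply LinForm.diff_injective he
      refine (hΨ _ _).trans ?_
      rw [Φ.form_restrict U V h, ← hΨ]
      rfl
  obtain ⟨Φ₂, hΦ₂⟩ := Φ₁.exists_pullback
  obtain ⟨Φ₃, hΦ₃⟩ := Φ₂.exists_pullback
  obtain ⟨ψ, hψ⟩ := Φ₃.exists_form
  refine ⟨ψ, cotangentRel_iff.2 fun U δ ↦ ?_⟩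
  rw [← hΦ₁, ← hΦ₂, ← hΦ₃]
  exact congrArg (fun φ ↦ (LinForm.comapPullback (f := pullback.diagonal g)
    (LinForm.comapPullback (f := e) φ)).diff) (hψ U δ).symm

lemma CotangentRel.form_unique (he : e ≫ g = 𝟙 B) {v t : T ⟶ B} {h : t = v}
    {ψ ψ' : LinForm (tensorDual ((Scheme.Modules.pullback e).obj (differentials g)) L) t ⊤}
    {Φ : DualFamily L v (idealSheaf e) (v ≫ e)} (hψ : CotangentRel h ψ Φ)
    (hψ' : CotangentRel h ψ' Φ) : ψ = ψ' := by
  subst h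
  apply LinForm.contract_injective
  intro U δ
  apply (LinForm.comapPullback_bijective (f := e)).injective
  apply (LinForm.comapPullback_bijective (f := pullback.diagonal g)).injective
  apply LinForm.diff_injective he
  exact (cotangentRel_iff.1 hψ U δ).symm.trans (cotangentRel_iff.1 hψ' U δ)

/-- In this model the base maps by the identity; `CotangentRel` carries an equality of morphisms so
that `v ≫ 𝟙 B` can be treated as `v`. -/
lemma isFaithful_cotangentModel (he : e ≫ g = 𝟙 B) : (cotangentModel L e g).IsFaithful where
  exists_family ψ := by
    obtain ⟨Φ, hΦ⟩ := exists_family_cotangentRel (Category.comp_id _).symm ψ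
    exact ⟨Φ, fun U δ W O hO h ξ ↦ hΦ U δ W O hO h _ ξ⟩
  exists_form Φ := by
    obtain ⟨ψ, hψ⟩ := exists_form_cotangentRel he (Category.comp_id _).symm Φ
    exact ⟨ψ, fun U δ W O hO h ξ ↦ hψ U δ W O hO h _ ξ⟩
  form_unique h h' := CotangentRel.form_unique he (h := (Category.comp_id _).symm)
    (fun U δ W O hO hW _ ξ ↦ h U δ W O hO hW ξ) (fun U δ W O hO hW _ ξ ↦ h' U δ W O hO hW ξ)

end CotangentModel

/-! ### The special fibre of the dilatation of the unit section -/

section LieMap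

set_option linter.unusedSectionVars false

variable {S S₀ : Scheme.{u}} {j : S₀ ⟶ S} [IsClosedImmersion j] {G : Over S} [GrpObj G]
  {G' : Scheme.{u}} {π : G' ⟶ G.left}

lemma unit_special_comp_hom : (η[special j G].left : S₀ ⟶ _) ≫ (special j G).hom = 𝟙 S₀ :=
  Over.w η[special j G]

lemma unit_special_comp_proj :
    (η[special j G].left : S₀ ⟶ _) ≫ proj j G = j ≫ (η[G].left : S ⟶ G.left) := by
  set ε := Functor.LaxMonoidal.ε (Over.pullback j)
  have h1 : η[special j G] = ε ≫ (Over.pullback j).map η[G] := Functor.obj.η_def ..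
  have h2 : (ε.left : S₀ ⟶ _) ≫ (special j (𝟙_ (Over S))).hom = 𝟙 S₀ := Over.w ε
  have h3 : (ε.left : S₀ ⟶ _) ≫ proj j (𝟙_ (Over S)) = j := by
    have h4 : proj j (𝟙_ (Over S)) = (special j (𝟙_ (Over S))).hom ≫ j :=
      (Category.comp_id _).symm.trans pullback.condition
    refine (congrArg (ε.left ≫ ·) h4).trans ?_
    exact (Category.assoc _ _ _).symm.trans ((congrArg (· ≫ j) h2).trans (Category.id_comp j))
  have h5 : (η[special j G].left : S₀ ⟶ _) =
      (ε.left : S₀ ⟶ _) ≫ ((Over.pullback j).map η[G]).left := congrArg CommaMorphism.left h1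
  refine (congrArg (· ≫ proj j G) h5).trans ?_
  refine (Category.assoc _ _ _).trans ?_
  refine (congrArg (ε.left ≫ ·) (proj_comp_left η[G]).symm).trans ?_
  exact (Category.assoc _ _ _).symm.trans (congrArg (· ≫ (η[G].left : S ⟶ G.left)) h3)

lemma unit_special_proj_hom :
    ((η[special j G].left : S₀ ⟶ _) ≫ proj j G) ≫ G.hom = j := by
  rw [Category.assoc, pullback.condition, ← Category.assoc]
  exact (congrArg (· ≫ j) (unit_special_comp_hom (j := j) (G := G))).trans (Category.id_comp j)

lemma comp_unit_special {T : Scheme.{u}} (k : T ⟶ S₀) :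
    ((k ≫ (η[special j G].left : S₀ ⟶ _)) ≫ proj j G) ≫ G.hom = k ≫ j := by
  rw [Category.assoc _ (proj j G) G.hom, Category.assoc k]
  exact congrArg (k ≫ ·) ((Category.assoc _ _ _).symm.trans
    (unit_special_proj_hom (j := j) (G := G)))

lemma app_unit_special_eq_zero {W : G.left.Opens} {x : Γ(G.left, W)}
    (hx : (η[G].left.app W).hom x = 0) :
    ((η[special j G].left : S₀ ⟶ _).app (proj j G ⁻¹ᵁ W)).hom (((proj j G).app W).hom x) = 0 := by
  have h : ((j ≫ (η[G].left : S ⟶ G.left)).app W).hom x = 0 :=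
    (congrArg (j.app _).hom hx).trans (map_zero _)
  rw [← unit_special_comp_proj] at h
  exact h

variable [GrpObj (Over.mk (π ≫ G.hom))]
  [IsMonHom (Over.homMk π : Over.mk (π ≫ G.hom) ⟶ G)]

/-- The centre is the trivial group over `S₀`, so `q` is the structure morphism and its kernel is
the whole special fibre. -/
theorem exists_corresponds_twistedCotangent [IsClosedImmersion η[special j G].left] [Flat G.hom]
    [Flat (π ≫ G.hom)] (hj : IsEffectiveCartier j) (hi : IsRegularImmersion η[special j G].left)
    (hπ : IsNeronBlowup j η[special j G] π) :
    ∃ u : twistedCotangent j G ⟶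
        (Scheme.Modules.pushforward (special j (Over.mk (π ≫ G.hom))).hom).obj
          (structureSheaf (special j (Over.mk (π ≫ G.hom))).left),
      IsVectorGroup (twistedCotangent j G) (special j (Over.mk (π ≫ G.hom))) u ∧
      Corresponds (cotangentModel (conormal j) (η[special j G].left : S₀ ⟶ _) (special j G).hom)
        (conormalGenerator unit_special_proj_hom) hπ.isDilatation
        (toBase (𝟙 (special j (Over.mk (π ≫ G.hom))))).left
        (unitPoint (j := j) π (special j (Over.mk (π ≫ G.hom)))) (LinForm.ofHom u) := by
  obtain ⟨q, hq⟩ := hπ.exists_over_toCenter hj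
  have hf : IsPullback (𝟙 _) (toUnit (special j (Over.mk (π ≫ G.hom)))) q η[𝟙_ (Over S₀)] := by
    have h1 : q = toUnit _ := toUnit_unique _ _
    have h2 : (η[𝟙_ (Over S₀)]) = 𝟙 _ := toUnit_unique _ _
    rw [h1, h2]
    exact IsPullback.of_horiz_isIso ⟨(Category.id_comp _).trans (Category.comp_id _).symm⟩
  exact exists_isVectorGroup hj hi hπ hq hf (F := twistedCotangent j G) (L := conormal j)
    (e := 𝟙 S₀)
    (A := cotangentModel (conormal j) (η[special j G].left : S₀ ⟶ _) (special j G).hom)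
    (d := conormalGenerator unit_special_proj_hom)
    rfl (isFaithful_cotangentModel unit_special_comp_hom)
    fun v ↦ ⟨conormalFamily (v ≫ 𝟙 _) (comp_unit_special _).symm,
      hasDualGenerators_conormalFamily _ _ _⟩

lemma cotangentModel_sec {B X : Scheme.{u}} {L : B.Modules} {e : B ⟶ X} {g : X ⟶ B}
    {W : X.Opens} {ξ : Γ(idealSheaf e, W)} {ω : Γ(differentials g, W)}
    (hω : IsDifferential g (toFunction ξ) ω) {U : B.Opens} (h : U ≤ e ⁻¹ᵁ W)
    (δ : dualSections L U) :
    (cotangentModel L e g).sec U δ W ξ =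
      res (show (cotangentModel L e g).dom U W ≤ U from inf_le_left)
        (tmul (res h (pullbackSection e ω)) δ) := by
  obtain ⟨ζ, hW, hζ, rfl⟩ := hω
  have h1 : diffSection g (toFunction ξ) = ζ :=
    toFunction_injective _ ((toFunction_diffSection _ _).trans hζ.symm)
  have h2 := pullbackSection_res e hW (pullbackSection (pullback.diagonal g) ζ)
  have h3 := congrArg (fun s ↦ tmul (res h s) δ) h2
  refine Eq.trans ?_ (congrArg (res _) h3).symm
  have h4 := res_tmul (M := (Scheme.Modules.pullback e).obj (differentials g))
    (inf_le_left (a := U) (b := e ⁻¹ᵁ (pullback.diagonal g ⁻¹ᵁ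
    (pullback.fst g g ⁻¹ᵁ W ⊓ pullback.snd g g ⁻¹ᵁ W)))) (res h (res (e.preimage_mono hW)
      (pullbackSection e (pullbackSection (pullback.diagonal g) ζ)))) δ
  refine Eq.trans ?_ h4.symm
  rw [res_res, res_res, ← h1]
  rfl

/-- The trivial group over `S` is a flat lift of the centre, so the unit point contributes nothing
to the value on `x/β` when `x` vanishes on the unit section of `G`. -/
theorem exists_isCanonicalLieMap [IsClosedImmersion η[special j G].left] [Flat G.hom]
    [Flat (π ≫ G.hom)] (hj : IsEffectiveCartier j) (hi : IsRegularImmersion η[special j G].left)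
    (hπ : IsNeronBlowup j η[special j G] π) :
    ∃ u : twistedCotangent j G ⟶
        (Scheme.Modules.pushforward (special j (Over.mk (π ≫ G.hom))).hom).obj
          (structureSheaf (special j (Over.mk (π ≫ G.hom))).left),
      IsVectorGroup (twistedCotangent j G) (special j (Over.mk (π ≫ G.hom))) u ∧
        IsCanonicalLieMap j π u := by
  obtain ⟨u, hu, hc⟩ := exists_corresponds_twistedCotangent hj hi hπ
  refine ⟨u, hu, ?_⟩
  intro W x hx ω hω U β U₀ h h' δ hδ hW y hy O h₁ h₂
  have hκe : (toBase (𝟙 (special j (Over.mk (π ≫ G.hom))))).left = proj j (Over.mk (π ≫ G.hom)) :=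
    (toBase_left (𝟙 (special j (Over.mk (π ≫ G.hom))))).trans (Category.id_comp _)
  have hσ : (η[Over.mk (π ≫ G.hom)] : 𝟙_ (Over S) ⟶ _) ≫
      (Over.homMk π : Over.mk (π ≫ G.hom) ⟶ G) = η[G] := IsMonHom.one_hom _
  have hσ' : (η[Over.mk (π ≫ G.hom)].left : S ⟶ G') ≫ π = (η[G].left : S ⟶ G.left) :=
    congrArg CommaMorphism.left hσ
  have hx' : (((η[Over.mk (π ≫ G.hom)].left : S ⟶ G') ≫ π).app W).hom x = 0 := by
    rw [hσ']
    exact hx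
  have hx0 : ((η[special j G].left : S₀ ⟶ _).app (proj j G ⁻¹ᵁ W)).hom
      (((proj j G).app W).hom x) = 0 := app_unit_special_eq_zero hx
  have hξ := toFunction_ofFunction _ hx0
  have hb := unitPoint_comp (j := j) (π := π) (i := η[special j G]) (e := 𝟙 S₀) rfl
    (special j (Over.mk (π ≫ G.hom)))
  have ha : (toBase (𝟙 (special j (Over.mk (π ≫ G.hom))))).left ≫ π =
      (((special j (Over.mk (π ≫ G.hom))).hom ≫ 𝟙 S₀) ≫ (η[special j G].left : S₀ ⟶ _)) ≫
        proj j G := by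
    obtain ⟨q, hq⟩ := hπ.exists_over_toCenter hj
    rw [hκe, ← left_comp_proj hq]
    have hqw : (q.left : _ ⟶ S₀) = (special j (Over.mk (π ≫ G.hom))).hom ≫ 𝟙 S₀ :=
      ((Category.comp_id _).symm.trans (Over.w q)).trans (Category.comp_id _).symm
    exact (congrArg (· ≫ (η[special j G].left : S₀ ⟶ _) ≫ proj j G) hqw).trans
      (Category.assoc _ _ _).symm
  have hO : O ≤ ((special j (Over.mk (π ≫ G.hom))).hom ≫ 𝟙 S₀) ⁻¹ᵁ U₀ := h₂
  have hO' : O ≤ (((special j (Over.mk (π ≫ G.hom))).hom ≫ 𝟙 S₀) ≫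
      (η[special j G].left : S₀ ⟶ _)) ⁻¹ᵁ (proj j G ⁻¹ᵁ W) :=
    h₂.trans ((special j (Over.mk (π ≫ G.hom))).hom.preimage_mono h')
  have hκ : O ≤ (toBase (𝟙 (special j (Over.mk (π ≫ G.hom))))).left ⁻¹ᵁ (π ⁻¹ᵁ W) := by
    rw [hκe]
    exact h₁
  have hF : Flat (𝟙_ (Over S)).hom := inferInstanceAs (Flat (𝟙 S))
  have h4 := hc.toFun_sec hj (isFaithful_cotangentModel unit_special_comp_hom)
    (hasDualGenerators_conormalFamily ((special j (Over.mk (π ≫ G.hom))).hom ≫ 𝟙 S₀)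
      (comp_unit_special _).symm unit_special_proj_hom) ha hb δ x _ hξ y O hO hO' hκ
    (fun c hc O' h' ↦ unitPoint_appLE_quot_eq_zero hπ (σ := η[Over.mk (π ≫ G.hom)]) hx'
      (special j (Over.mk (π ≫ G.hom))) c hc _ O' h')
    (fun z hz ↦ exists_chart_conormalFamily hj _ x β h δ hδ hW y hy z (hO' hz))
  rw [appLE_congr_apply hκe.symm h₁ hκ, ← h4]
  rw [← hξ] at hω
  exact (congrArg ((LinForm.ofHom u).toFun _ O le_top _) (cotangentModel_sec hω h' δ)).trans
    ((LinForm.ofHom u).toFun_res _ _ O le_top _ _ _)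

end LieMap

/-! ### Sections of smooth morphisms are regular immersions -/

section SmoothSection

open RingTheory.Sequence

variable {R A : Type*} [CommRing R] [CommRing A]

/-- The variables of a polynomial ring form a regular sequence. -/
lemma isWeaklyRegular_ofFn_X (R : Type*) [CommRing R] (n : ℕ) :
    IsWeaklyRegular (MvPolynomial (Fin n) R)
      (List.ofFn (MvPolynomial.X : Fin n → MvPolynomial (Fin n) R)) := by
  refine ⟨fun i hi ↦ ?_⟩
  have hin : i < n := by simpa using hi
  rw [smul_eq_mul, Ideal.mul_top]
  have hI : Ideal.ofList ((List.ofFn (MvPolynomial.X : Fin n → MvPolynomial (Fin n) R)).take i) =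
      Ideal.span (MvPolynomial.X '' {k : Fin n | k.1 < i}) := by
    refine congrArg Ideal.span (Set.ext fun x ↦ ?_)
    simp only [Set.mem_ofPred_eq, List.mem_take_iff_getElem, List.getElem_ofFn, List.length_ofFn,
      Set.mem_image]
    exact ⟨fun ⟨k, hk, h⟩ ↦ ⟨⟨k, by omega⟩, hk.trans_le (min_le_left _ _), h⟩,
      fun ⟨k, hk, h⟩ ↦ ⟨k.1, lt_min hk k.2, h⟩⟩
  rw [List.getElem_ofFn, hI, isSMulRegular_iff_right_eq_zero_of_smul]
  intro x
  obtain ⟨x, rfl⟩ := Ideal.Quotient.mk_surjective x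
  intro h
  have h' : MvPolynomial.X ⟨i, hin⟩ * x ∈
      Ideal.span (MvPolynomial.X '' {k : Fin n | k.1 < i}) := Ideal.Quotient.eq_zero_iff_mem.1 h
  rw [Ideal.Quotient.eq_zero_iff_mem, MvPolynomial.mem_ideal_span_X_image]
  rw [MvPolynomial.mem_ideal_span_X_image] at h'
  intro m hm
  -- Multiplication by `Xᵢ` changes only the exponent of `Xᵢ`, which is not among the earlier
  -- variables; so a monomial divisible by an earlier variable was so before.
  obtain ⟨k, hk, hmk⟩ := h' (Finsupp.single ⟨i, hin⟩ 1 + m) (by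
    rw [MvPolynomial.mem_support_iff, MvPolynomial.coeff_X_mul]
    exact MvPolynomial.mem_support_iff.1 hm)
  have hki : k ≠ ⟨i, hin⟩ := by
    rintro rfl
    exact lt_irrefl i hk
  rw [Finsupp.add_apply, Finsupp.single_eq_of_ne hki, zero_add] at hmk
  exact ⟨k, hk, hmk⟩

/-- Near a section of a standard smooth algebra, the kernel of the section is generated by a
regular sequence. -/
theorem exists_isWeaklyRegular_of_section {φ : R →+* A} (hφ : φ.IsStandardSmooth) {σ : A →+* R}
    (hσ : σ.comp φ = RingHom.id R) : ∃ (rs : List A) (s : A), IsWeaklyRegular A rs ∧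
      σ s = 1 ∧ Ideal.ofList rs ≤ RingHom.ker σ ∧
        ∀ x ∈ RingHom.ker σ, s * x ∈ Ideal.ofList rs := by
  obtain ⟨n, g, hgC, hg⟩ := hφ.exists_etale_mvPolynomial
  have hσφ : ∀ r, σ (φ r) = r := RingHom.congr_fun hσ
  have hgφ : ∀ r, g (MvPolynomial.C r) = φ r := RingHom.congr_fun hgC
  -- Étale coordinates, translated by their values along the section so as to vanish on it.
  set t : Fin n → A := fun i ↦ g (MvPolynomial.X i) - φ (σ (g (MvPolynomial.X i))) with ht
  set J := Ideal.ofList (List.ofFn t) with hJ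
  have htJ : ∀ i, t i ∈ J := fun i ↦ Ideal.subset_span (by simp)
  have hJK : J ≤ RingHom.ker σ := by
    refine Ideal.span_le.2 fun x hx ↦ ?_
    obtain ⟨i, rfl⟩ := (List.mem_ofFn' _ _).1 hx
    simp [ht, RingHom.mem_ker, hσφ]
  have hfg : (RingHom.ker σ).FG := by
    algebraize [φ]
    have := hφ.toAlgebra
    let σ' : A →ₐ[R] R := { σ with commutes' := hσφ }
    exact Algebra.FinitePresentation.ker_fG_of_surjective σ' fun r ↦ ⟨φ r, hσφ r⟩
  have hreg : IsWeaklyRegular A (List.ofFn t) := by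
    -- The translation is an automorphism of the polynomial ring. Composed with the flat map `g` it
    -- carries the regular sequence of variables to `t`.
    let τ : MvPolynomial (Fin n) R →ₐ[R] MvPolynomial (Fin n) R :=
      MvPolynomial.aeval fun i ↦ MvPolynomial.X i - MvPolynomial.C (σ (g (MvPolynomial.X i)))
    let τ' : MvPolynomial (Fin n) R →ₐ[R] MvPolynomial (Fin n) R :=
      MvPolynomial.aeval fun i ↦ MvPolynomial.X i + MvPolynomial.C (σ (g (MvPolynomial.X i)))
    have h1 : τ.comp τ' = AlgHom.id R _ := by
      ext i
      simp [τ, τ', MvPolynomial.algHom_C]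
    have h2 : τ'.comp τ = AlgHom.id R _ := by
      ext i
      simp [τ, τ', MvPolynomial.algHom_C]
    have hτ : Function.Bijective τ.toRingHom :=
      ⟨(show Function.LeftInverse τ' τ from AlgHom.congr_fun h2).injective,
        (show Function.RightInverse τ' τ from AlgHom.congr_fun h1).surjective⟩
    have hfl : (g.comp τ.toRingHom).Flat :=
      (RingHom.Flat.of_bijective hτ).comp (RingHom.Etale.iff_flat_and_formallyUnramified.1 hg).1
    algebraize [g.comp τ.toRingHom]
    have := IsWeaklyRegular.of_flat (S := A) (isWeaklyRegular_ofFn_X R n)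
    rw [List.map_ofFn] at this
    convert this using 2
    funext i
    simp [ht, RingHom.algebraMap_toAlgebra, τ, hgφ]
  have hle : RingHom.ker σ ≤ J ⊔ RingHom.ker σ • RingHom.ker σ := by
    intro x hx
    set K := J ⊔ RingHom.ker σ • RingHom.ker σ
    have hunr := hg.formallyUnramified
    algebraize [g]
    let f₁ : A →ₐ[MvPolynomial (Fin n) R] A ⧸ K := Ideal.Quotient.mkₐ _ K
    -- Modulo `K = (t) + (ker σ)²` the projection and `φ ∘ σ` agree on the coordinates, and they
    -- agree modulo the square-zero ideal `ker σ`. As `g` is unramified they coincide, so `ker σ ⊆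
    -- K`.
    have hc : ((Ideal.Quotient.mk K).comp (φ.comp σ)).comp g = (Ideal.Quotient.mk K).comp g := by
      refine MvPolynomial.ringHom_ext (fun r ↦ ?_) fun i ↦ ?_
      · simp [hgφ, hσφ]
      · refine (Ideal.Quotient.eq.2 ?_).symm
        exact le_sup_left (a := J) (htJ i)
    let f₂ : A →ₐ[MvPolynomial (Fin n) R] A ⧸ K :=
      { (Ideal.Quotient.mk K).comp (φ.comp σ) with commutes' := RingHom.congr_fun hc }
    have hf : f₁ = f₂ := by
      refine Algebra.FormallyUnramified.ext ((RingHom.ker σ).map (Ideal.Quotient.mk K))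
        ⟨2, ?_⟩ fun a ↦ ?_
      · rw [← Ideal.map_pow, Ideal.zero_eq_bot, Ideal.map_eq_bot_iff_le_ker, Ideal.mk_ker, pow_two]
        exact le_sup_right
      · rw [Ideal.Quotient.eq]
        have : f₁ a - f₂ a = Ideal.Quotient.mk K (a - φ (σ a)) := by
          rw [map_sub]
          rfl
        rw [this]
        exact Ideal.mem_map_of_mem _ (by simp [RingHom.mem_ker, hσφ])
    have h1 : Ideal.Quotient.mk K x = Ideal.Quotient.mk K (φ (σ x)) := AlgHom.congr_fun hf x
    rw [(RingHom.mem_ker).1 hx, map_zero, map_zero] at h1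
    exact Ideal.Quotient.eq_zero_iff_mem.1 h1
  -- Nakayama's lemma for the finitely generated ideal `ker σ`; the element `s` is congruent to `1`
  -- modulo `ker σ`, so `σ s = 1`.
  obtain ⟨s, hs, hsJ⟩ :=
    Submodule.exists_sub_one_mem_and_smul_le_of_fg_of_le_sup hfg le_rfl hle
  refine ⟨List.ofFn t, s, hreg, ?_, hJK, fun x hx ↦
    hsJ (Submodule.smul_mem_pointwise_smul x s _ hx)⟩
  rw [RingHom.mem_ker, map_sub, map_one, sub_eq_zero] at hs
  exact hs

end SmoothSection

/-! ### Smoothness of the morphism to the centre -/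

section SmoothToCenter

variable {S S₀ X X' H : Scheme.{u}} {j : S₀ ⟶ S} [IsClosedImmersion j] {p : X ⟶ S}
  {i : H ⟶ pullback p j} [IsClosedImmersion i] {π : X' ⟶ X} {q : pullback (π ≫ p) j ⟶ H}

theorem smooth_toCenter [Flat p] (hj : IsEffectiveCartier j) (hi : IsRegularImmersion i)
    (hπ : IsDilatation π (i ≫ pullback.fst p j).ker (j.ker.comap p))
    (hq : q ≫ i ≫ pullback.fst p j = pullback.fst (π ≫ p) j ≫ π) : Smooth q := by
  rw [HasRingHomProperty.iff_exists_appLE (P := @Smooth)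
    (RingHom.Smooth.stableUnderComposition.stableUnderCompositionWithLocalizationAway
      RingHom.Smooth.holdsForLocalizationAway).1]
  intro z
  obtain ⟨U, V, hz, e, n, f, hf, h⟩ := exists_appLE_toCenter_comp_bijective hj hi hπ hq z
  refine ⟨U, V, hz, e, ?_⟩
  rw [h]
  refine RingHom.Smooth.comp ?_ (.of_bijective hf)
  exact RingHom.smooth_algebraMap.2 ⟨inferInstance, inferInstance⟩

end SmoothToCenter

section SmoothSection

open RingTheory.Sequence

variable {B X : Scheme.{u}} {e : B ⟶ X} {g : X ⟶ B}

/-- A standard smooth chart around `e z` is shrunk over a basic open of the base whose image under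
the section stays inside the chart, so that the section restricts to a retraction of algebras. -/
lemma exists_isStandardSmooth_section [Smooth g] (he : e ≫ g = 𝟙 B) (z : B) :
    ∃ (D : B.Opens) (W : X.affineOpens) (h : W.1 ≤ g ⁻¹ᵁ D) (_ : D ≤ e ⁻¹ᵁ W.1), z ∈ D ∧
      (g.appLE D W.1 h).hom.IsStandardSmooth := by
  have hge : ∀ y : B, g (e y) = y := fun y ↦ by
    rw [← Scheme.Hom.comp_apply, he]
    rfl
  obtain ⟨U, hU, V, hV, hzV, hVU, hs⟩ := Smooth.exists_isStandardSmooth g (e z)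
  obtain ⟨r, hrV, hzr⟩ := hU.exists_basicOpen_le (V := e ⁻¹ᵁ V) ⟨z, hzV⟩ (by
    have := hVU hzV
    rwa [Scheme.Hom.mem_preimage, hge] at this)
  have hW : X.basicOpen ((g.appLE U V hVU).hom r) = V ⊓ g ⁻¹ᵁ B.basicOpen r := by
    simp [Scheme.Hom.appLE]
  refine ⟨B.basicOpen r, ⟨_, hV.basicOpen ((g.appLE U V hVU).hom r)⟩,
    hW.le.trans inf_le_right, fun y hy ↦ ?_, hzr, ?_⟩
  · change e y ∈ X.basicOpen _
    rw [hW]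
    refine ⟨hrV hy, ?_⟩
    change g (e y) ∈ B.basicOpen r
    rwa [hge]
  · have := hU.isLocalization_basicOpen r
    have := hV.isLocalization_basicOpen ((g.appLE U V hVU).hom r)
    have h := hU.appLE_eq_away_map g hV hVU r
    rw [h]
    exact RingHom.isStandardSmooth_localizationPreserves.away _ r _ _ hs

/-- A section of a smooth morphism is a regular immersion. -/
theorem isRegularImmersion_of_section [Smooth g] [IsClosedImmersion e] (he : e ≫ g = 𝟙 B) :
    IsRegularImmersion e := by
  intro z
  obtain ⟨D, W, h, h', hz, hs⟩ := exists_isStandardSmooth_section he z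
  have hD : e ⁻¹ᵁ W.1 ≤ D := fun y hy ↦ by
    have h1 : g (e y) ∈ D := h hy
    rwa [← Scheme.Hom.comp_apply, he] at h1
  have hσ : (e.appLE W.1 D h').hom.comp (g.appLE D W.1 h).hom = RingHom.id _ := by
    ext x
    have h1 : D ≤ (e ≫ g) ⁻¹ᵁ D := by rw [he]; exact le_rfl
    refine (appLE_appLE_apply e g h h' h1 x).trans ?_
    rw [appLE_congr_apply he h1 (le_id_preimage le_rfl), id_appLE_apply]
    exact resFun_self x
  have hker : e.ker.ideal W = RingHom.ker (e.appLE W.1 D h').hom := by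
    rw [Scheme.Hom.ker_apply]
    ext x
    rw [RingHom.mem_ker, RingHom.mem_ker]
    constructor
    · intro hx
      have := resFun_app e h' x
      rw [← this, hx, map_zero]
    · intro hx
      have := resFun_appLE e h' hD x
      rw [hx, map_zero, ← resFun_app, resFun_self] at this
      exact this.symm
  obtain ⟨rs, s, hrs, hs1, hle, hsx⟩ := exists_isWeaklyRegular_of_section hs hσ
  -- Since `s` is `1` along the section, inverting it keeps the point `e z` and makes the ideal of
  -- the section equal to the ideal of the sequence.
  have hzs : z ∈ e ⁻¹ᵁ X.basicOpen s := by
    have h1 := Scheme.basicOpen_appLE e D W.1 h' s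
    rw [Scheme.basicOpen_of_isUnit _ (hs1.symm ▸ isUnit_one)] at h1
    exact (h1.le hz).2
  have hloc := W.2.isLocalization_basicOpen s
  have hid : e.ker.ideal (X.affineBasicOpen s) =
      Ideal.ofList (rs.map (algebraMap Γ(X, W.1) Γ(X, X.basicOpen s))) := by
    rw [← e.ker.map_ideal_basicOpen W s, hker, ← Ideal.map_ofList]
    refine le_antisymm (Ideal.map_le_iff_le_comap.2 fun x hx ↦ ?_) (Ideal.map_mono hle)
    have h1 := Ideal.mem_map_of_mem (algebraMap Γ(X, W.1) Γ(X, X.basicOpen s)) (hsx x hx)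
    rw [map_mul] at h1
    have h2 := (Ideal.unit_mul_mem_iff_mem _
      (IsLocalization.Away.algebraMap_isUnit (S := Γ(X, X.basicOpen s)) s)).1 h1
    exact h2
  have hreg : IsWeaklyRegular Γ(X, X.basicOpen s)
      (rs.map (algebraMap Γ(X, W.1) Γ(X, X.basicOpen s))) :=
    hrs.of_isLocalization _ (Submonoid.powers s)
  refine ⟨X.affineBasicOpen s, hzs, _, ⟨hreg, fun htop ↦ ?_⟩, hid⟩
  -- If the sequence generated the unit ideal, `1` would vanish on the preimage under `e` of this
  -- open subset, which contains `z`.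
  rw [smul_eq_mul, Ideal.mul_top] at htop
  have h0 := hid.trans htop.symm
  rw [Scheme.Hom.ker_apply] at h0
  have h1 : (e.app (X.basicOpen s)).hom 1 = 0 := h0.ge (Submodule.mem_top (x := 1))
  rw [map_one] at h1
  have h2 := Scheme.basicOpen_of_isUnit B (isUnit_one (M := Γ(B, e ⁻¹ᵁ X.basicOpen s)))
  rw [h1, Scheme.basicOpen_zero] at h2
  exact h2.ge hzs

end SmoothSection

/-! ### The unit section of a smooth separated group scheme -/

section SmoothGroup

variable {S S₀ : Scheme.{u}} (j : S₀ ⟶ S) [IsClosedImmersion j] (G : Over S) [GrpObj G]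

lemma isClosedImmersion_unit_special [IsSeparated G.hom] :
    IsClosedImmersion η[special j G].left := by
  have h : IsClosedImmersion ((η[special j G].left : S₀ ⟶ _) ≫ (special j G).hom) := by
    rw [unit_special_comp_hom]
    exact inferInstanceAs (IsClosedImmersion (𝟙 S₀))
  have : IsSeparated (special j G).hom := inferInstanceAs (IsSeparated (pullback.snd G.hom j))
  exact IsClosedImmersion.of_comp (η[special j G].left : S₀ ⟶ _) (special j G).hom

lemma isRegularImmersion_unit_special [Smooth G.hom] [IsSeparated G.hom] :
    IsRegularImmersion η[special j G].left := by
  have := isClosedImmersion_unit_special j G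
  have : Smooth (special j G).hom := inferInstanceAs (Smooth (pullback.snd G.hom j))
  exact isRegularImmersion_of_section (g := (special j G).hom) unit_special_comp_hom

variable {j G}

/-- `q` is smooth and its target, the trivial group, is `S₀` itself. -/
theorem smooth_special [Flat G.hom] {G' : Scheme.{u}} {π : G' ⟶ G.left}
    [IsClosedImmersion η[special j G].left] (hj : IsEffectiveCartier j)
    (hi : IsRegularImmersion η[special j G].left) (hπ : IsNeronBlowup j η[special j G] π) :
    Smooth (special j (Over.mk (π ≫ G.hom))).hom := by
  obtain ⟨q, hq⟩ := hπ.exists_over_toCenter hj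
  have hs : Smooth q.left := smooth_toCenter hj hi hπ.isDilatation (left_comp_proj hq)
  have hw : (q.left : _ ⟶ S₀) = (special j (Over.mk (π ≫ G.hom))).hom :=
    (Category.comp_id _).symm.trans (Over.w q)
  rw [← hw]
  exact hs

end SmoothGroup

lemma comp_pushStructure_id {S : Scheme.{u}} {F : S.Modules} {V : Over S}
    (u : F ⟶ (Scheme.Modules.pushforward V.hom).obj (structureSheaf V.left)) :
    u ≫ pushStructure (𝟙 V) = u := by
  apply LinForm.ofHom_injective
  rw [ofHom_comp_pushStructure]
  ext W O hO h x
  refine (LinForm.precomp_toFun (LinForm.ofHom u) (𝟙 V.left) W (V.hom ⁻¹ᵁ W) le_rfl O h h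
    x).trans ?_
  exact (id_appLE_apply h _).trans ((LinForm.ofHom u).resFun_toFun W _ O le_top le_rfl h x)

end

end NeronBlowup

open NeronBlowup in
theorem theorem3p5 {S S₀ : Scheme.{u}} (j : S₀ ⟶ S) [IsClosedImmersion j]
    (hj : IsEffectiveCartier j) (G : Over S) [GrpObj G] :
    (∀ (H : Over S₀) [GrpObj H] (i : H ⟶ special j G) [IsMonHom i] [IsClosedImmersion i.left],
      Flat G.hom → LocallyOfFinitePresentation G.hom → Flat H.hom → IsRegularImmersion i.left →
      (∃ (G' : Scheme.{u}) (π : G' ⟶ G.left), IsNeronBlowup j i π) ∧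
      ∀ (G' : Scheme.{u}) (π : G' ⟶ G.left), IsNeronBlowup j i π →
        (∃! _ : GrpObj (Over.mk (π ≫ G.hom)),
          IsMonHom (Over.homMk π : Over.mk (π ≫ G.hom) ⟶ G)) ∧
        ∀ [GrpObj (Over.mk (π ≫ G.hom))],
          IsMonHom (Over.homMk π : Over.mk (π ≫ G.hom) ⟶ G) →
          ∃ q : special j (Over.mk (π ≫ G.hom)) ⟶ H,
            q ≫ i = (Over.pullback j).map (Over.homMk π) ∧ IsMonHom q ∧
            ∃ (V : Over S₀) (_ : GrpObj V) (u : twistedConormal j i ⟶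
                (Scheme.Modules.pushforward V.hom).obj (structureSheaf V.left)),
              IsVectorGroup (twistedConormal j i) V u ∧
              (∀ s : S₀, ∃ U : S₀.Opens, s ∈ U ∧
                ∃ f : (Over.pullback U.ι).obj V ⟶
                    (Over.pullback U.ι).obj (special j (Over.mk (π ≫ G.hom))),
                  IsShortExact f ((Over.pullback U.ι).map q)) ∧
              (∀ (H' : Over S) [GrpObj H'] (h : H' ⟶ G) [IsMonHom h] [IsImmersion h.left],
                Flat H'.hom → ∀ ε : special j H' ≅ H, ε.hom ≫ i = (Over.pullback j).map h →
                (∃ f : V ⟶ special j (Over.mk (π ≫ G.hom)),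
                  IsShortExact f q ∧ IsCanonicalInclusion j i π u f h) ∧
                ∃ σ : H' ⟶ Over.mk (π ≫ G.hom),
                  (∀ τ : H' ⟶ Over.mk (π ≫ G.hom), τ ≫ Over.homMk π = h ↔ τ = σ) ∧
                  IsMonHom σ ∧ IsMonHom (ε.inv ≫ (Over.pullback j).map σ) ∧
                  (ε.inv ≫ (Over.pullback j).map σ) ≫ q = 𝟙 H)) ∧
    (Smooth G.hom → IsSeparated G.hom →
      (∃ (G' : Scheme.{u}) (π : G' ⟶ G.left), IsNeronBlowup j η[special j G] π) ∧
      ∀ (G' : Scheme.{u}) (π : G' ⟶ G.left), IsNeronBlowup j η[special j G] π →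
        (∃! _ : GrpObj (Over.mk (π ≫ G.hom)),
          IsMonHom (Over.homMk π : Over.mk (π ≫ G.hom) ⟶ G)) ∧
        ∀ [GrpObj (Over.mk (π ≫ G.hom))],
          IsMonHom (Over.homMk π : Over.mk (π ≫ G.hom) ⟶ G) →
          ∃ (L : Over S₀) (_ : GrpObj L) (u : twistedCotangent j G ⟶
              (Scheme.Modules.pushforward L.hom).obj (structureSheaf L.left)),
            IsVectorGroup (twistedCotangent j G) L u ∧
            Smooth (special j (Over.mk (π ≫ G.hom))).hom ∧ Smooth L.hom ∧
            ∃ φ : special j (Over.mk (π ≫ G.hom)) ≅ L,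
              IsMonHom φ.hom ∧ IsCanonicalLieMap j π (u ≫ pushStructure φ.hom)) := by
  refine ⟨fun H _ i _ _ hG _ hH hi ↦ ⟨exists_isNeronBlowup hj i, fun G' π hπ ↦ ?_⟩,
    fun hG hs ↦ ⟨exists_isNeronBlowup hj _, fun G' π hπ ↦ ?_⟩⟩
  · have hF : Flat (π ≫ G.hom) := flat_neronBlowup hj hi hπ
    refine ⟨hπ.exists_grpObj hj, fun {_} _ ↦ ?_⟩
    obtain ⟨q, hq, hqm, V, hV, u, f, hu, hf, hc⟩ := exists_extension hj hi hπ
    -- The exact sequence exists over all of `S₀`, so the whole base serves as the neighbourhood of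
    -- each point. The same `f` is canonical for every lift `H'`.
    refine ⟨q, hq, hqm, V, hV, u, hu, fun s ↦ ⟨⊤, trivial, _, hf.pullback _⟩,
      fun H' _ h _ _ hH' ε hε ↦ ?_⟩
    obtain ⟨σ, hσ, h₁, h₂, h₃⟩ := exists_lift_subgroup hj hπ hq h ε hε
    exact ⟨⟨f, hf, hc H' h hH' σ ((hσ σ).2 rfl)⟩, σ, hσ, h₁, h₂, h₃⟩
  · have := isClosedImmersion_unit_special j G
    have hi := isRegularImmersion_unit_special j G
    have hF : Flat (π ≫ G.hom) := flat_neronBlowup hj hi hπ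
    refine ⟨hπ.exists_grpObj hj, fun {_} _ ↦ ?_⟩
    obtain ⟨u, hu, hc⟩ := exists_isCanonicalLieMap hj hi hπ
    have := smooth_special hj hi hπ
    -- The special fibre, with the canonical map `u`, itself represents the functor defining
    -- `Lie(G₀/S₀) ⊗ 𝒩⁻¹`; the isomorphism is the identity.
    exact ⟨special j (Over.mk (π ≫ G.hom)), inferInstance, u, hu, this, this, Iso.refl _,
      inferInstanceAs (IsMonHom (𝟙 _)), (comp_pushStructure_id u).symm ▸ hc⟩
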